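/- **Model.** Let $\gamma,\mu>0$, breakpoints $0=t_0<\dots<t_m$ (put $t_{m+1}=\infty$) and $0=b_0<\dots<b_r$, and a number $k(\infty)\le b_r$; all of these are known to the bidder. Unknown to the bidder are: - the reward function $k(\tau)=\sum_{i=1}^{m+1}a_i(t_i\wedge\tau-t_{i-1}\wedge\tau)$ with $a_1\ge\dots\ge a_m\ge a_{m+1}=0$ (concave, nondecreasing, constant on $[t_m,\infty)$), with $k(t_m)=k(\infty)$; - the win probability $q(v)=\sum_{i=1}^{r}c_i(b_i\wedge v-b_{i-1}\wedge v)$, $0\le v\le b_r$, with $c_i>0$ and $\sum_i c_i(b_i-b_{i-1})<1$. Episodes are independent. An episode has an $\mathrm{Exp}(\gamma)$ length; auctions arrive during it according to an independent Poisson process of rate $\mu$; the prices-to-beat are i.i.d. with a law whose distribution function equals $q$ on $[0,b_r]$. A policy $\pi$ bids $\pi(\tau)\ge 0$ when the time since the last win in the episode (since its start, if nothing was won yet) is $\tau$; the auction is won if the bid exceeds the price-to-beat $b^-$, and then yields the reward $k(\tau)+\varepsilon$ and costs $b^-$. The noise $\varepsilon$ is centred and sub-Gaussian with a fixed variance proxy;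 its law may depend on $\tau$, and given the ages the noises are independent. Let $V_\pi(0)$ be the expected total net payoff of an episode played with $\pi$, and $V_{\pi^\star}(0)=\sup_\pi V_\pi(0)$ over bounded measurable policies $\pi\geq 0$. For policies $\pi_1,\dots,\pi_N$ used in episodes $1,\dots,N$ put $\mathrm{Regret}(N)=\sum_{n=1}^N\big(V_{\pi^\star}(0)-V_{\pi_n}(0)\big)$. **Solver.** For functions $k,q$ put $p(v)=q(v)v-\int_0^vq(s)\,ds$ and $f(v)=q(v)v-p(v)$, let $Y$ be the bounded solution on $[0,\infty)$ of $\dot Y(t)=\gamma Y(t)-\mu f(k(t)+Y(0)-Y(t))$ with $Y(0)\ge0$, and set $\mathcal S(k,q)(\tau)=\max\big(0,\,k(\tau)+Y(0)-Y(\tau)\big)$. **Estimators.** Each episode with at least one win gives the ages $\tau^1,\dots,\tau^\ell$ of its wins and its aggregated reward $v$ (payments, which are observed, excluded); its regression vector $z$ has coordinates $z_i=\sum_j(t_i\wedge\tau^j-t_{i-1}\wedge\tau^j)$. From a data set $\mathcal D^k$ of such episodes, with design matrix $Z$ and responses $V$, $K(\mathcal D^k)$ is the function $\sum_i\hat a_i(t_i\wedge\tau-t_{i-1}\wedge\tau)$,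 where $\hat a$ is the Euclidean projection of $(Z^\top Z+\lambda_0 I)^{-1}Z^\top V$ onto $\{0=a_{m+1}\le a_m\le\dots\le a_1\}$, with a fixed $\lambda_0>0$. Each auction gives its bid, whether it was won, and the price paid if won. From a data set $\mathcal D^q$ of auctions, $Q(\mathcal D^q)$ is the function $q_{\hat c}=\sum_i\hat c_i(b_i\wedge v-b_{i-1}\wedge v)$, where $\hat c=\hat c(\mathcal D^q)$ is any measurable choice of a maximizer of the likelihood $\prod_{\text{wins}}f_c(\text{price})\prod_{\text{losses}}(1-q_c(\text{bid}))$ with $f_c=\sum_ic_i\mathbf 1_{(b_{i-1},b_i]}$, over $\{c:\ c_i\ge0,\ \sum_ic_i(b_i-b_{i-1})\le1\}$. **Algorithm.** The initial data $\mathcal D_1^k,\mathcal D_1^q$ come from $n_0\ge0$ previous independent episodes played with a fixed measurable policy $\pi_0$ with values in $[0,b_r]$ (no data if $n_0=0$). For episodes $n=1,2,\dots$, with $w_n=\sqrt{\log\log(\max(n,3))/n}$ (that is, $\sqrt{\log\log n/n}$ for $n\ge3$), play $$\pi_n=\mathcal S\Big(\min\big(K(\mathcal D^k_n)+\lambda_kw_n,\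 k(\infty)\big),\ \max\big(Q(\mathcal D^q_n)-\lambda_qw_n,\ 0\big)\Big)$$ and add the data of episode $n$ to $\mathcal D^k_n,\mathcal D^q_n$ to get $\mathcal D^k_{n+1},\mathcal D^q_{n+1}$. Thus $\pi_n$ is a deterministic function of the past data: the algorithm does not randomize. **Theorem.** For every such problem, every $n_0,\pi_0,\lambda_0$ as above and every $\delta\in(0,1)$ there are $\lambda_k,\lambda_q>0$, a constant $C$ and an integer $p\ge0$, not depending on the horizon $N$ or on the choice of the maximizers $\hat c$, such that, with probability at least $1-\delta$, $$\mathrm{Regret}(N)\ \le\ C\,\log N\,(\log\log N)^p\qquad\text{for all } N\ge3 ,$$ that is, $\mathrm{Regret}(N)\le\widetilde{\mathcal O}(\log N)$. -/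

import Mathlib

open MeasureTheory ProbabilityTheory

namespace DynBid

noncomputable section

/-! ## Piecewise linear primitives -/

/-- The `i`-th increment function `min t_{i+1} τ - min t_i τ` of the grid `t_0 < ... < t_m`, with the
convention `t_{m+1} = ∞`, so that there are `m + 1` of them and the last one is `τ - min t_m τ`. -/
def kSegment {m : ℕ} (t : Fin (m + 1) → ℝ) (i : Fin (m + 1)) (τ : ℝ) : ℝ :=
  if h : (i : ℕ) + 1 < m + 1 then min (t ⟨i + 1, h⟩) τ - min (t i) τ else τ - min (t i) τ

/-- The piecewise linear function with slopes `a` on the grid `t` (last cell unbounded). -/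
def kFun {m : ℕ} (t : Fin (m + 1) → ℝ) (a : Fin (m + 1) → ℝ) (τ : ℝ) : ℝ :=
  ∑ i, a i * kSegment t i τ

/-- The slopes of concave, nondecreasing functions that are constant on the last cell:
`0 = a_m ≤ ... ≤ a_0`. -/
def slopeCone (m : ℕ) : Set (EuclideanSpace ℝ (Fin (m + 1))) :=
  {a | (∀ i j, i ≤ j → a j ≤ a i) ∧ a (Fin.last m) = 0}

/-- The piecewise linear function with slopes `c` on the cells of the grid `b_0 < ... < b_r`. -/
def qFun {r : ℕ} (b : Fin (r + 1) → ℝ) (c : Fin r → ℝ) (v : ℝ) : ℝ :=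
  ∑ i : Fin r, c i * (min (b i.succ) v - min (b i.castSucc) v)

/-- The density of `qFun b c`. -/
def qDensity {r : ℕ} (b : Fin (r + 1) → ℝ) (c : Fin r → ℝ) (v : ℝ) : ℝ :=
  ∑ i : Fin r, if b i.castSucc < v ∧ v ≤ b i.succ then c i else 0

/-- Slope vectors for which `qFun b c` is nondecreasing with values in `[0, 1]`. -/
def densityPolytope {r : ℕ} (b : Fin (r + 1) → ℝ) : Set (Fin r → ℝ) :=
  {c | (∀ i, 0 ≤ c i) ∧ ∑ i : Fin r, c i * (b i.succ - b i.castSucc) ≤ 1}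

/-! ## What the bidder knows, and the unknown environment -/

/-- The quantities known to the bidder: the rate `gamma` of the episode length, the rate `mu` of the
auction arrivals, the breakpoints of the two primitives and the maximal value `kInf = k(∞)`. -/
structure Model (m r : ℕ) where
  gamma : ℝ
  mu : ℝ
  t : Fin (m + 1) → ℝ
  b : Fin (r + 1) → ℝ
  kInf : ℝ
  gamma_pos : 0 < gamma
  mu_pos : 0 < mu
  t_zero : t 0 = 0
  t_strictMono : StrictMono t
  b_zero : b 0 = 0
  b_strictMono : StrictMono b
  kInf_le : kInf ≤ b (Fin.last r)

/-- The unknown part: the slopes of `k` and of `q`, the law of the price-to-beat, whose distribution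
function is `q` on the range `[0, b_r]` of the bids, and the reward noise. The noise at an auction won
at age `τ` is `noise τ u` with a fresh `u` of law `noiseSeedLaw`; so its law may depend on the age.
It is sub-Gaussian with variance proxy `sigmaSq`, hence centred. -/
structure Environment {m r : ℕ} (M : Model m r) where
  a : Fin (m + 1) → ℝ
  c : Fin r → ℝ
  a_antitone : Antitone a
  a_last : a (Fin.last m) = 0
  kInf_eq : kFun M.t a (M.t (Fin.last m)) = M.kInf
  c_pos : ∀ i, 0 < c i
  c_sum : ∑ i : Fin r, c i * (M.b i.succ - M.b i.castSucc) < 1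
  priceLaw : Measure ℝ
  priceLaw_prob : IsProbabilityMeasure priceLaw
  priceLaw_cdf : ∀ v, 0 ≤ v → v ≤ M.b (Fin.last r) →
    priceLaw (Set.Iic v) = ENNReal.ofReal (qFun M.b c v)
  noiseSeedLaw : Measure ℝ
  noiseSeedLaw_prob : IsProbabilityMeasure noiseSeedLaw
  noise : ℝ → ℝ → ℝ
  noise_measurable : Measurable (Function.uncurry noise)
  sigmaSq : NNReal
  noise_subgaussian : ∀ τ, 0 ≤ τ → HasSubgaussianMGF (noise τ) sigmaSq noiseSeedLaw

/-- The expected reward as a function of the time elapsed since the last win. -/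
def Environment.k {m r : ℕ} {M : Model m r} (E : Environment M) : ℝ → ℝ := kFun M.t E.a

/-! ## One episode -/

/-- The randomness of one episode: its length, the waiting times between successive auctions, the
prices-to-beat of the successive auctions and the noise seeds. -/
abbrev Seed : Type := ℝ × (ℕ → ℝ) × (ℕ → ℝ) × (ℕ → ℝ)

/-- Exponential length with rate `gamma`, auctions arriving as a Poisson process of rate `mu`
(i.i.d. exponential waiting times), i.i.d. prices and i.i.d. noise seeds, all independent. -/
def Environment.seedLaw {m r : ℕ} {M : Model m r} (E : Environment M) : Measure Seed :=
  (expMeasure M.gamma).prod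
    ((Measure.infinitePi fun _ : ℕ => expMeasure M.mu).prod
      ((Measure.infinitePi fun _ : ℕ => E.priceLaw).prod
        (Measure.infinitePi fun _ : ℕ => E.noiseSeedLaw)))

def Seed.length (s : Seed) : ℝ := s.1
def Seed.gap (s : Seed) : ℕ → ℝ := s.2.1
def Seed.price (s : Seed) : ℕ → ℝ := s.2.2.1
def Seed.noiseSeed (s : Seed) : ℕ → ℝ := s.2.2.2

/-- Arrival time of the `i`-th auction (`i = 0, 1, ...`). -/
def Seed.arrival (s : Seed) (i : ℕ) : ℝ := ∑ j ∈ Finset.range (i + 1), s.gap j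

/-- Number of auctions that arrive before the end of the episode. -/
def Seed.numAuctions (s : Seed) : ℕ := Set.ncard {i : ℕ | s.arrival i ≤ s.length}

/-- Time of the last win before the `i`-th auction when the bid at age `τ` is `π τ`; it is `0` as long
as nothing has been won. -/
def lastWin (π : ℝ → ℝ) (s : Seed) : ℕ → ℝ
  | 0 => 0
  | i + 1 =>
    if s.price i < π (s.arrival i - lastWin π s i) then s.arrival i else lastWin π s i

/-- Time elapsed since the last win, at the `i`-th auction. -/
def age (π : ℝ → ℝ) (s : Seed) (i : ℕ) : ℝ := s.arrival i - lastWin π s i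

/-- The `i`-th auction is won: the bid exceeds the price-to-beat. -/
def Won (π : ℝ → ℝ) (s : Seed) (i : ℕ) : Prop := s.price i < π (age π s i)

open Classical in
/-- The auctions won during the episode, in order. -/
def wins (π : ℝ → ℝ) (s : Seed) : List ℕ :=
  (List.range s.numAuctions).filter fun i => decide (Won π s i)

/-- Total reward of the episode (before payments). -/
def Environment.totalReward {m r : ℕ} {M : Model m r} (E : Environment M)
    (π : ℝ → ℝ) (s : Seed) : ℝ :=
  ((wins π s).map fun i => E.k (age π s i) + E.noise (age π s i) (s.noiseSeed i)).sum

/-- Total net payoff of the episode: second-price auctions, the winner pays the price-to-beat. -/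
def Environment.payoff {m r : ℕ} {M : Model m r} (E : Environment M)
    (π : ℝ → ℝ) (s : Seed) : ℝ :=
  ((wins π s).map fun i =>
    E.k (age π s i) + E.noise (age π s i) (s.noiseSeed i) - s.price i).sum

/-- The expected payoff `V_π(0)` of an episode played with `π`. -/
def Environment.value {m r : ℕ} {M : Model m r} (E : Environment M) (π : ℝ → ℝ) : ℝ :=
  ∫ s, E.payoff π s ∂E.seedLaw

/-- Bidding policies: bounded measurable nonnegative functions of the time since the last win. -/
def IsPolicy (π : ℝ → ℝ) : Prop := Measurable π ∧ ∃ B : ℝ, ∀ τ, 0 ≤ π τ ∧ π τ ≤ B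

/-- The optimal expected payoff `V_{π⋆}(0)`. -/
def Environment.optimalValue {m r : ℕ} {M : Model m r} (E : Environment M) : ℝ :=
  sSup (E.value '' {π | IsPolicy π})

/-! ## The ODE solver -/

/-- Expected payment at bid `v` in a second-price auction. -/
def expectedPrice (q : ℝ → ℝ) (v : ℝ) : ℝ := q v * v - ∫ s in (0 : ℝ)..v, q s

def surplus (q : ℝ → ℝ) (v : ℝ) : ℝ := q v * v - expectedPrice q v

/-- `Y` is a bounded solution on `[0, ∞)` of `Y' = γ Y - μ f(k + Y(0) - Y)` with `Y(0) ≥ 0`. -/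
def IsBellman (γ μ : ℝ) (k q Y : ℝ → ℝ) : Prop :=
  0 ≤ Y 0 ∧
  (∀ t, 0 ≤ t →
    HasDerivWithinAt Y (γ * Y t - μ * surplus q (k t + Y 0 - Y t)) (Set.Ici 0) t) ∧
  ∃ B : ℝ, ∀ t, 0 ≤ t → |Y t| ≤ B

open Classical in
/-- The solver `S(k, q)`: the policy `τ ↦ max 0 (k(τ) + Y(0) - Y(τ))` where `Y` is the bounded
solution. -/
def solver (γ μ : ℝ) (k q : ℝ → ℝ) (τ : ℝ) : ℝ :=
  if h : (∃ Y, IsBellman γ μ k q Y) ∧ 0 ≤ τ then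
    max 0 (k τ + h.1.choose 0 - h.1.choose τ)
  else 0

/-! ## Data and estimators -/

/-- What an episode with at least one win contributes to the estimation of `k`: the ages at which
auctions were won, and the aggregated reward. -/
abbrev KObs : Type := List ℝ × ℝ

/-- What an auction contributes to the estimation of `q`: the bid, whether it won, and the price paid
(`0` if lost). -/
abbrev QObs : Type := ℝ × Bool × ℝ

def Environment.kData {m r : ℕ} {M : Model m r} (E : Environment M)
    (π : ℝ → ℝ) (s : Seed) : List KObs :=
  if wins π s = [] then [] else [((wins π s).map (age π s), E.totalReward π s)]

open Classical in
def qData (π : ℝ → ℝ) (s : Seed) : List QObs :=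
  (List.range s.numAuctions).map fun i =>
    (π (age π s i), decide (Won π s i), if Won π s i then s.price i else 0)

/-- The regression vector of an episode: the sum over its wins of the increments at the win's age. -/
def features {m : ℕ} (t : Fin (m + 1) → ℝ) (o : KObs) : Fin (m + 1) → ℝ :=
  fun i => (o.1.map (kSegment t i)).sum

/-- Regularized least squares `(ZᵀZ + ridge I)⁻¹ Zᵀ V`. -/
def ridgeOLS {m : ℕ} (t : Fin (m + 1) → ℝ) (ridge : ℝ) (D : List KObs) : Fin (m + 1) → ℝ :=
  ((D.map fun o => Matrix.vecMulVec (features t o) (features t o)).sum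
      + ridge • (1 : Matrix (Fin (m + 1)) (Fin (m + 1)) ℝ))⁻¹.mulVec
    (D.map fun o => o.2 • features t o).sum

open Classical in
/-- Euclidean projection onto a set (used for a nonempty closed convex set). -/
def proj {m : ℕ} (C : Set (EuclideanSpace ℝ (Fin (m + 1))))
    (x : EuclideanSpace ℝ (Fin (m + 1))) : EuclideanSpace ℝ (Fin (m + 1)) :=
  if h : ∃ y ∈ C, ∀ z ∈ C, dist x y ≤ dist x z then h.choose else 0

/-- The estimator `K(D)`. -/
def kHat {m : ℕ} (t : Fin (m + 1) → ℝ) (ridge : ℝ) (D : List KObs) : ℝ → ℝ :=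
  kFun t fun i => proj (slopeCone m) (WithLp.toLp 2 (ridgeOLS t ridge D)) i

/-- Likelihood of `c`: density at the price for a win, `1 - q_c(bid)` for a loss. -/
def likelihood {r : ℕ} (b : Fin (r + 1) → ℝ) (D : List QObs) (c : Fin r → ℝ) : ℝ :=
  (D.map fun o => if o.2.1 then qDensity b c o.2.2 else 1 - qFun b c o.1).prod

/-- `cHat` is a maximum likelihood estimator: for every data set it selects, measurably, a maximizer
of the likelihood (equivalently of the log-likelihood, with `log 0 = -∞`). -/
structure IsMLE {r : ℕ} (b : Fin (r + 1) → ℝ) (cHat : List QObs → Fin r → ℝ) : Prop where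
  mem : ∀ D, cHat D ∈ densityPolytope b
  max : ∀ D, ∀ c ∈ densityPolytope b, likelihood b D c ≤ likelihood b D (cHat D)
  measurable : ∀ n : ℕ, Measurable fun d : Fin n → QObs => cHat (List.ofFn d)

/-! ## The confidence bounds algorithm -/

/-- `√(log log n / n)`, where `log log n` is read as `log log 3` for `n < 3`. -/
def radius (n : ℕ) : ℝ := Real.sqrt (Real.log (Real.log (max (n : ℝ) 3)) / n)

/-- The policy of episode `n`: a deterministic function of the data collected before it. -/
def ucbPolicy {m r : ℕ} (M : Model m r) (ridge : ℝ) (cHat : List QObs → Fin r → ℝ)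
    (lamK lamQ : ℝ) (n : ℕ) (D : List KObs × List QObs) : ℝ → ℝ :=
  solver M.gamma M.mu
    (fun τ => min (kHat M.t ridge D.1 τ + lamK * radius n) M.kInf)
    (fun v => max (qFun M.b (cHat D.2) v - lamQ * radius n) 0)

/-- The policy of the `j`-th episode overall (`j = 0, 1, ...`): the first `n₀` episodes, played with
`π₀`, provide the initial data set (empty if `n₀ = 0`); the algorithm plays its episode `n = 1, 2, ...`
as the episode `j = n₀ + n - 1`. -/
def policyAt {m r : ℕ} (M : Model m r) (n₀ : ℕ) (π₀ : ℝ → ℝ) (ridge : ℝ)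
    (cHat : List QObs → Fin r → ℝ) (lamK lamQ : ℝ) (j : ℕ) (D : List KObs × List QObs) : ℝ → ℝ :=
  if j < n₀ then π₀ else ucbPolicy M ridge cHat lamK lamQ (j + 1 - n₀) D

/-- The data collected during the first `j` episodes, the randomness of the episodes being `ω`. -/
def Environment.data {m r : ℕ} {M : Model m r} (E : Environment M) (n₀ : ℕ) (π₀ : ℝ → ℝ)
    (ridge : ℝ) (cHat : List QObs → Fin r → ℝ) (lamK lamQ : ℝ) (ω : ℕ → Seed) :
    ℕ → List KObs × List QObs
  | 0 => ([], [])
  | j + 1 =>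
    let D := E.data n₀ π₀ ridge cHat lamK lamQ ω j
    let π := policyAt M n₀ π₀ ridge cHat lamK lamQ j D
    (D.1 ++ E.kData π (ω j), D.2 ++ qData π (ω j))

/-- Regret of the algorithm over its first `N` episodes. -/
def Environment.regret {m r : ℕ} {M : Model m r} (E : Environment M) (n₀ : ℕ) (π₀ : ℝ → ℝ)
    (ridge : ℝ) (cHat : List QObs → Fin r → ℝ) (lamK lamQ : ℝ) (ω : ℕ → Seed) (N : ℕ) : ℝ :=
  ∑ n ∈ Finset.Icc 1 N,
    (E.optimalValue
      - E.value (ucbPolicy M ridge cHat lamK lamQ n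
          (E.data n₀ π₀ ridge cHat lamK lamQ ω (n₀ + n - 1))))

/-- The law of the sequence of independent episodes. -/
def Environment.runLaw {m r : ℕ} {M : Model m r} (E : Environment M) : Measure (ℕ → Seed) :=
  Measure.infinitePi fun _ : ℕ => E.seedLaw

instance {m r : ℕ} {M : Model m r} (E : Environment M) : IsProbabilityMeasure E.seedLaw := by
  have := E.priceLaw_prob
  have := E.noiseSeedLaw_prob
  have := isProbabilityMeasure_expMeasure M.gamma_pos
  have := isProbabilityMeasure_expMeasure M.mu_pos
  unfold Environment.seedLaw
  infer_instance

instance {m r : ℕ} {M : Model m r} (E : Environment M) : IsProbabilityMeasure E.runLaw := by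
  unfold Environment.runLaw
  infer_instance

end

end DynBid

namespace DynBid
noncomputable section

/-! ## Bounded solutions of the Bellman equation -/

/-! The loss of an episode is quadratic in the error of the bids, and a bid error of order `radius
n` in episode n gives a sum of iterLog n / n, hence a logarithm up to an iterated logarithm. So p =
1 suffices, and everything reduces to bid errors of order `radius n` for all n at once.

Quadratic loss. The bounded solution Y of the Bellman equation dominates the value of every policy,
and winning at age τ is worth x = k(τ) + Y(0) - Y(τ). Bidding v instead of x costs something only if
the price falls between v and x: an event of probability O(|x - v|), with a loss of at most |x - v|
(`le_gain`). Summing over the auctions gives `optimalValue_sub_value_le`. A comparison principle for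
bounded solutions (`IsBell.abs_bid_sub_le`) bounds the bid error by the errors of the estimates of k
and q, the latter being compared only at the optimal bids, so only in the cells that these reach.

Data for k. For a subadditive reward the bid is at least γ/(γ+μ) times the reward, whatever q is
(`IsBell.le_bid`). Hence, while the estimated reward is optimistic, all policies win the only
auction of certain "cheap" episodes, which form an i.i.d. sequence of events. These alone make the
Gram matrix grow linearly (`exists_design_bound`). Against noise of order √(n log log n), projected
ridge regression is accurate to O(`radius n`), so optimism reproduces itself
(`GoodRun.reward_close`).

Data for q. In each cell, the squared error of the likelihood estimator times the number of wins in
that cell is O(log log n) (`exists_mle_bound`), so every relevant cell must be hit linearly often.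
Any policy that bids no less than the optimal bid minus a fixed η does so (`exists_hit_windows`).
During the first n₂ episodes lamQ * radius n ≥ 1, the pessimistic win probability vanishes, and the
algorithm bids its whole optimistic reward, which is at least the optimal bid (`bid_le_pol`). These
episodes provide enough hits up to a time of order K n₂; after K n₂ the bid errors are below η and
the policies produce the hits themselves. `GoodRun.abs_bid_sub_pol_le` closes this induction, and
`exists_scale` finds K before n₂ and lamQ, as is needed because the required size of lamQ depends on
K.

Concentration is uniform in time and in the policies: Ville's inequality for adapted products,
followed by a union over dyadic scales (`exists_lil_bound`). Its constants are fixed before lamK,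
lamQ and the choice of the maximizers. -/

/-- A bounded differentiable function on `[0, ∞)` cannot exceed a level above which it is repelled. -/
theorem le_of_repelling {g g' : ℝ → ℝ} {L c B t₀ : ℝ} (hc : 0 < c) (ht₀ : 0 ≤ t₀)
    (hg : ∀ t, 0 ≤ t → HasDerivWithinAt g (g' t) (Set.Ici 0) t)
    (hB : ∀ t, 0 ≤ t → g t ≤ B)
    (h : ∀ t, t₀ ≤ t → g t₀ ≤ g t → L < g t → c * (g t - L) ≤ g' t) : g t₀ ≤ L := by
  by_contra! hL
  set e := g t₀ - L with he
  have hepos : 0 < e := by linarith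
  -- The slope is c e / 2 instead of c e because the comparison theorem wants a strict inequality of
  -- the derivatives at a point of contact.
  have key : ∀ b, ∀ x ∈ Set.Icc t₀ b, (fun t => -g t) x ≤ -g t₀ - c * e / 2 * (x - t₀) := by
    intro b
    have hder : ∀ x, t₀ ≤ x → HasDerivWithinAt (fun t => -g t) (-g' x) (Set.Ici x) x := by
      intro x hx
      exact ((hg x (ht₀.trans hx)).mono (Set.Ici_subset_Ici.2 (ht₀.trans hx))).neg
    refine fun x hx => image_le_of_deriv_right_lt_deriv_boundary (f := fun t => -g t)
      (f' := fun t => -g' t) (B := fun x => -g t₀ - c * e / 2 * (x - t₀))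
      (B' := fun _ => -(c * e / 2)) ?_ ?_ ?_ ?_ ?_ hx
    · intro x hx
      exact ((hg x (ht₀.trans hx.1)).neg.continuousWithinAt).mono
        (fun y hy => ht₀.trans hy.1)
    · intro x hx
      exact hder x hx.1
    · simp
    · intro x
      have := (((hasDerivAt_id x).sub_const t₀).const_mul (c * e / 2)).const_sub (-g t₀)
      simpa using this
    · intro x hx hxe
      have h1 : g t₀ ≤ g x := by
        have : 0 ≤ c * e / 2 * (x - t₀) :=
          mul_nonneg (by positivity) (sub_nonneg.2 hx.1)
        linarith
      have h2 := h x hx.1 h1 (by linarith)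
      have h3 : c * e ≤ c * (g x - L) := mul_le_mul_of_nonneg_left (by linarith) hc.le
      have : 0 < c * e := by positivity
      linarith
  have hBt := hB t₀ ht₀
  -- At time T the linear lower bound for g equals B + 1.
  set T := t₀ + (B - g t₀ + 1) / (c * e / 2)
  have hce : 0 < c * e / 2 := by positivity
  have hT : t₀ ≤ T := le_add_of_nonneg_right (div_nonneg (by linarith) hce.le)
  have h1 := key T T ⟨hT, le_rfl⟩
  have h2 : c * e / 2 * (T - t₀) = B - g t₀ + 1 := by
    simp only [T, add_sub_cancel_left]; field_simp
  have h3 := hB T (ht₀.trans hT)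
  simp only [h2] at h1
  linarith

/-- The properties of `v ↦ ∫₀ᵛ q` for a distribution function `q` supported on `[0, ∞)`. -/
structure IsSurplus (f : ℝ → ℝ) : Prop where
  zero : ∀ x, x ≤ 0 → f x = 0
  mono : ∀ x y, x ≤ y → f x ≤ f y
  lip : ∀ x y, x ≤ y → f y - f x ≤ y - x

/-- Nonnegative, nondecreasing, subadditive continuous functions on `[0, ∞)` bounded by `K`. -/
structure IsReward (k : ℝ → ℝ) (K : ℝ) : Prop where
  cont : ContinuousOn k (Set.Ici 0)
  nonneg : ∀ t, 0 ≤ t → 0 ≤ k t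
  mono : ∀ s t, 0 ≤ s → s ≤ t → k s ≤ k t
  le : ∀ t, 0 ≤ t → k t ≤ K
  subadd : ∀ s t, 0 ≤ s → 0 ≤ t → k (s + t) ≤ k s + k t

/-- `IsBellman` in terms of the surplus function. -/
def IsBell (γ μ : ℝ) (k f Y : ℝ → ℝ) : Prop :=
  0 ≤ Y 0 ∧
  (∀ t, 0 ≤ t →
    HasDerivWithinAt Y (γ * Y t - μ * f (k t + Y 0 - Y t)) (Set.Ici 0) t) ∧
  ∃ B : ℝ, ∀ t, 0 ≤ t → |Y t| ≤ B

theorem IsSurplus.nonneg {f : ℝ → ℝ} (hf : IsSurplus f) (x : ℝ) : 0 ≤ f x := by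
  rcases le_total x 0 with h | h
  · rw [hf.zero x h]
  · rw [← hf.zero 0 le_rfl]; exact hf.mono _ _ h

theorem IsSurplus.sub_le_max {f : ℝ → ℝ} (hf : IsSurplus f) (x y : ℝ) :
    f x - f y ≤ max 0 (x - y) := by
  rcases le_total x y with h | h
  · exact (sub_nonpos.2 (hf.mono _ _ h)).trans (le_max_left _ _)
  · exact (hf.lip _ _ h).trans (le_max_right _ _)

theorem IsSurplus.abs_sub_le {f : ℝ → ℝ} (hf : IsSurplus f) (x y : ℝ) :
    |f x - f y| ≤ |x - y| := by
  have h1 := hf.sub_le_max x y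
  have h2 := hf.sub_le_max y x
  rw [abs_le]
  constructor
  · have : max 0 (y - x) ≤ |x - y| := max_le (abs_nonneg _) (by rw [abs_sub_comm]; exact le_abs_self _)
    linarith
  · exact h1.trans (max_le (abs_nonneg _) (le_abs_self _))

theorem IsSurplus.continuous {f : ℝ → ℝ} (hf : IsSurplus f) : Continuous f :=
  (LipschitzWith.of_dist_le_mul (K := 1) fun x y => by
    simpa [Real.dist_eq] using hf.abs_sub_le x y).continuous

/-! ### Shape of a bounded solution, by comparison with its translates -/

section shift

variable {γ μ : ℝ} {k f Y : ℝ → ℝ} {K : ℝ}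

theorem IsBell.continuousOn (hY : IsBell γ μ k f Y) : ContinuousOn Y (Set.Ici 0) :=
  fun t ht => (hY.2.1 t ht).continuousWithinAt

theorem IsBell.hasDerivWithinAt_shift (hY : IsBell γ μ k f Y) {τ : ℝ} (hτ : 0 ≤ τ) {t : ℝ}
    (ht : 0 ≤ t) : HasDerivWithinAt (fun s => Y (τ + s) - Y s)
      (γ * (Y (τ + t) - Y t)
        - μ * (f (k (τ + t) + Y 0 - Y (τ + t)) - f (k t + Y 0 - Y t))) (Set.Ici 0) t := by
  have h1 := hY.2.1 (τ + t) (add_nonneg hτ ht)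
  have h2 : HasDerivWithinAt (fun s => τ + s) 1 (Set.Ici 0) t :=
    ((hasDerivAt_id t).const_add τ).hasDerivWithinAt
  have h3 := h1.scomp t h2 (fun s hs => add_nonneg hτ hs)
  have h4 := h3.sub (hY.2.1 t ht)
  exact h4.congr_deriv (by simp only [one_smul]; ring)

theorem IsBell.exists_shift_bound (hY : IsBell γ μ k f Y) {τ : ℝ} (hτ : 0 ≤ τ) :
    ∃ B, ∀ t, 0 ≤ t → |Y (τ + t) - Y t| ≤ B := by
  obtain ⟨B, hB⟩ := hY.2.2
  refine ⟨B + B, fun t ht => (abs_sub _ _).trans (add_le_add (hB _ (by positivity)) (hB _ ht))⟩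

/-- Let g be Y minus its translate. Where g > 0, the translate has both a larger reward and a
smaller Y, so its surplus is larger and g' ≥ γ g: a bounded g cannot be positive. -/
theorem IsBell.monotone (hγ : 0 < γ) (hμ : 0 < μ) (hk : IsReward k K) (hf : IsSurplus f)
    (hY : IsBell γ μ k f Y) {s t : ℝ} (hs : 0 ≤ s) (hst : s ≤ t) : Y s ≤ Y t := by
  have hτ : 0 ≤ t - s := sub_nonneg.2 hst
  obtain ⟨B, hB⟩ := hY.exists_shift_bound hτ
  have := le_of_repelling (g := fun u => -(Y (t - s + u) - Y u)) (L := 0) (B := B) hγ hs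
    (fun u hu => (hY.hasDerivWithinAt_shift hτ hu).neg)
    (fun u hu => (neg_le_abs _).trans (hB u hu)) (fun u hu _ hu0 => by
      have hu' := hs.trans hu
      have h1 := hk.mono u (t - s + u) hu' (by linarith)
      have h2 := hf.mono (k u + Y 0 - Y u) (k (t - s + u) + Y 0 - Y (t - s + u)) (by linarith)
      have h3 := mul_nonneg hμ.le (sub_nonneg.2 h2)
      linarith)
  simp only [sub_add_cancel] at this
  linarith

/-- Let g be the translate by τ minus Y. Subadditivity bounds the gain in reward by k τ, and f is
1-Lipschitz, so g' ≥ γ g - μ max(0, k τ - g). The right-hand side vanishes at g = μ/(γ+μ) k τ, above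
which g is repelled. -/
theorem IsBell.sub_zero_le (hγ : 0 < γ) (hμ : 0 < μ) (hk : IsReward k K) (hf : IsSurplus f)
    (hY : IsBell γ μ k f Y) {τ : ℝ} (hτ : 0 ≤ τ) : Y τ - Y 0 ≤ μ / (γ + μ) * k τ := by
  obtain ⟨B, hB⟩ := hY.exists_shift_bound hτ
  have hν : 0 < γ + μ := by positivity
  have := le_of_repelling (g := fun u => (Y (τ + u) - Y u)) (L := μ / (γ + μ) * k τ) (B := B)
    (t₀ := 0) hγ le_rfl
    (fun u hu => (hY.hasDerivWithinAt_shift hτ hu))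
    (fun u hu => (le_abs_self _).trans (hB u hu)) (fun u hu _ hu0 => by
      have h1 := hk.subadd τ u hτ hu
      have h2 := hf.sub_le_max (k (τ + u) + Y 0 - Y (τ + u)) (k u + Y 0 - Y u)
      set g := Y (τ + u) - Y u
      have h3 : max 0 (k (τ + u) + Y 0 - Y (τ + u) - (k u + Y 0 - Y u)) ≤ max 0 (k τ - g) :=
        max_le_max le_rfl (by simp only [g]; linarith)
      have h4 := mul_le_mul_of_nonneg_left (h2.trans h3) hμ.le
      have h6 : (γ + μ) * (μ / (γ + μ) * k τ) = μ * k τ := by field_simp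
      have h5 : γ * (g - μ / (γ + μ) * k τ) ≤ γ * g - μ * max 0 (k τ - g) := by
        have hk0 : 0 ≤ μ / (γ + μ) * k τ := mul_nonneg (by positivity) (hk.nonneg τ hτ)
        rcases le_total (k τ - g) 0 with h | h
        · rw [max_eq_left h]
          have := mul_nonneg hγ.le hk0
          linarith
        · rw [max_eq_right h]
          have := mul_pos hμ (sub_pos.2 hu0)
          linarith
      linarith)
  simpa using this

theorem IsBell.bid_le (hγ : 0 < γ) (hμ : 0 < μ) (hk : IsReward k K) (hf : IsSurplus f)
    (hY : IsBell γ μ k f Y) {τ : ℝ} (hτ : 0 ≤ τ) : k τ + Y 0 - Y τ ≤ k τ := by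
  have := hY.monotone hγ hμ hk hf le_rfl hτ
  linarith

/-- This lower bound does not involve f. It is the source of exploration: an optimistic reward
forces substantial bids even with a wrong estimate of q. -/
theorem IsBell.le_bid (hγ : 0 < γ) (hμ : 0 < μ) (hk : IsReward k K) (hf : IsSurplus f)
    (hY : IsBell γ μ k f Y) {τ : ℝ} (hτ : 0 ≤ τ) : γ / (γ + μ) * k τ ≤ k τ + Y 0 - Y τ := by
  have h := hY.sub_zero_le hγ hμ hk hf hτ
  have : γ / (γ + μ) * k τ = k τ - μ / (γ + μ) * k τ := by field_simp; ring
  linarith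

theorem IsBell.bid_nonneg (hγ : 0 < γ) (hμ : 0 < μ) (hk : IsReward k K) (hf : IsSurplus f)
    (hY : IsBell γ μ k f Y) {τ : ℝ} (hτ : 0 ≤ τ) : 0 ≤ k τ + Y 0 - Y τ :=
  (mul_nonneg (by positivity) (hk.nonneg τ hτ)).trans (hY.le_bid hγ hμ hk hf hτ)

end shift

/-- The bids differ by k₁ - k₂ plus the decrease of Y₁ - Y₂ since time 0. At times where Y₁ - Y₂ is
at least its initial value they therefore differ by at most ε, and Y₁ - Y₂ is repelled from μ/γ (ε +
ε'). -/
theorem IsBell.sub_le {γ μ ε ε' : ℝ} {k₁ k₂ f₁ f₂ Y₁ Y₂ : ℝ → ℝ} (hγ : 0 < γ) (hμ : 0 < μ)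
    (hY₁ : IsBell γ μ k₁ f₁ Y₁) (hY₂ : IsBell γ μ k₂ f₂ Y₂) (hε : 0 ≤ ε)
    (hk : ∀ t, 0 ≤ t → k₁ t - k₂ t ≤ ε)
    (hf : ∀ t, 0 ≤ t → f₁ (k₁ t + Y₁ 0 - Y₁ t) - f₂ (k₂ t + Y₂ 0 - Y₂ t) ≤
      max 0 (k₁ t + Y₁ 0 - Y₁ t - (k₂ t + Y₂ 0 - Y₂ t)) + ε')
    {τ : ℝ} (hτ : 0 ≤ τ) : Y₁ τ - Y₂ τ ≤ μ / γ * (ε + ε') := by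
  obtain ⟨B₁, hB₁⟩ := hY₁.2.2
  obtain ⟨B₂, hB₂⟩ := hY₂.2.2
  have hder : ∀ t, 0 ≤ t → HasDerivWithinAt (fun t => Y₁ t - Y₂ t)
      (γ * (Y₁ t - Y₂ t) - μ * (f₁ (k₁ t + Y₁ 0 - Y₁ t) - f₂ (k₂ t + Y₂ 0 - Y₂ t)))
      (Set.Ici 0) t := by
    intro t ht
    have := (hY₁.2.1 t ht).sub (hY₂.2.1 t ht)
    rw [show γ * (Y₁ t - Y₂ t) - μ * (f₁ (k₁ t + Y₁ 0 - Y₁ t) - f₂ (k₂ t + Y₂ 0 - Y₂ t)) =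
      γ * Y₁ t - μ * f₁ (k₁ t + Y₁ 0 - Y₁ t) - (γ * Y₂ t - μ * f₂ (k₂ t + Y₂ 0 - Y₂ t)) by ring]
    exact this
  have hbd : ∀ t, 0 ≤ t → Y₁ t - Y₂ t ≤ B₁ + B₂ := fun t ht =>
    (le_abs_self _).trans ((abs_sub _ _).trans (add_le_add (hB₁ t ht) (hB₂ t ht)))
  have hkey : ∀ t, 0 ≤ t → Y₁ 0 - Y₂ 0 ≤ Y₁ t - Y₂ t →
      γ * (Y₁ t - Y₂ t - μ / γ * (ε + ε')) ≤
      γ * (Y₁ t - Y₂ t) - μ * (f₁ (k₁ t + Y₁ 0 - Y₁ t) - f₂ (k₂ t + Y₂ 0 - Y₂ t)) := by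
    intro t ht h0
    have h2 : max 0 (k₁ t + Y₁ 0 - Y₁ t - (k₂ t + Y₂ 0 - Y₂ t)) ≤ ε :=
      max_le hε (by have := hk t ht; linarith)
    have h4 := (hf t ht).trans (add_le_add_left h2 ε')
    have h5 := mul_le_mul_of_nonneg_left h4 hμ.le
    have h6 : γ * (μ / γ * (ε + ε')) = μ * (ε + ε') := by field_simp
    rw [mul_sub, h6]
    linarith
  -- Time 0 comes first: its bound makes every t with a difference above the level satisfy the
  -- condition of `hkey`, as the second application needs.
  have h0 : Y₁ 0 - Y₂ 0 ≤ μ / γ * (ε + ε') :=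
    le_of_repelling (g := fun t => Y₁ t - Y₂ t) hγ le_rfl hder hbd
      fun t ht h0 _ => hkey t ht h0
  exact le_of_repelling (g := fun t => Y₁ t - Y₂ t) hγ hτ hder hbd
      fun t ht _ h1 => hkey t (hτ.trans ht) (by linarith)

/-- Stability of the bid function; the surplus functions are only compared at the second bid. -/
theorem IsBell.abs_bid_sub_le {γ μ ε ε' : ℝ} {k₁ k₂ f₁ f₂ Y₁ Y₂ : ℝ → ℝ} (hγ : 0 < γ)
    (hμ : 0 < μ) (hf₁ : IsSurplus f₁)
    (hY₁ : IsBell γ μ k₁ f₁ Y₁) (hY₂ : IsBell γ μ k₂ f₂ Y₂)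
    (hε : 0 ≤ ε) (hε' : 0 ≤ ε')
    (hk : ∀ t, 0 ≤ t → |k₁ t - k₂ t| ≤ ε)
    (hf : ∀ t, 0 ≤ t → |f₁ (k₂ t + Y₂ 0 - Y₂ t) - f₂ (k₂ t + Y₂ 0 - Y₂ t)| ≤ ε')
    {τ : ℝ} (hτ : 0 ≤ τ) :
    |(k₁ τ + Y₁ 0 - Y₁ τ) - (k₂ τ + Y₂ 0 - Y₂ τ)| ≤ (1 + 2 * (μ / γ)) * (ε + ε') := by
  have h1 : ∀ t, 0 ≤ t → Y₁ t - Y₂ t ≤ μ / γ * (ε + ε') := fun t ht =>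
    IsBell.sub_le hγ hμ hY₁ hY₂ hε (fun t ht => (le_abs_self _).trans (hk t ht))
      (fun t ht => by
        have h1 := hf₁.sub_le_max (k₁ t + Y₁ 0 - Y₁ t) (k₂ t + Y₂ 0 - Y₂ t)
        have h2 := (le_abs_self _).trans (hf t ht)
        linarith) ht
  have h2 : ∀ t, 0 ≤ t → Y₂ t - Y₁ t ≤ μ / γ * (ε + ε') := fun t ht =>
    IsBell.sub_le hγ hμ hY₂ hY₁ hε
      (fun t ht => (le_abs_self _).trans (by rw [abs_sub_comm]; exact hk t ht))
      (fun t ht => by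
        have h1 := hf₁.sub_le_max (k₂ t + Y₂ 0 - Y₂ t) (k₁ t + Y₁ 0 - Y₁ t)
        have h2 := (neg_le_abs _).trans (hf t ht)
        linarith) ht
  have h3 := abs_le.1 (hk τ hτ)
  have a1 := h1 0 le_rfl
  have a2 := h2 0 le_rfl
  have a3 := h1 τ hτ
  have a4 := h2 τ hτ
  rw [abs_le]
  constructor <;> linarith

/-! ### Existence of a bounded solution -/

section existence

/-- The exponentially discounted future integral of a bounded continuous function. -/
theorem exists_discounted {ν M : ℝ} (hν : 0 < ν) {Φ : ℝ → ℝ} (hΦ : Continuous Φ)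
    (hM : ∀ t, |Φ t| ≤ M) :
    ∃ J : ℝ → ℝ, (∀ t, HasDerivAt J (ν * J t - Φ t) t) ∧ ∀ t, |J t| ≤ M / ν := by
  have hint : ∀ t, IntegrableOn (fun u => Real.exp (-ν * u) * Φ u) (Set.Ioi t) := by
    intro t
    refine Integrable.mono' ((integrableOn_exp_mul_Ioi (neg_lt_zero.2 hν) t).mul_const M)
      (Continuous.aestronglyMeasurable (by fun_prop)) (Filter.Eventually.of_forall fun u => ?_)
    rw [norm_mul, Real.norm_eq_abs, Real.norm_eq_abs, abs_of_pos (Real.exp_pos _)]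
    exact mul_le_mul_of_nonneg_left (hM u) (Real.exp_pos _).le
  refine ⟨fun t => Real.exp (ν * t) * ∫ u in Set.Ioi t, Real.exp (-ν * u) * Φ u, fun t => ?_,
    fun t => ?_⟩
  · have h1 : ∀ t, ∫ u in Set.Ioi t, Real.exp (-ν * u) * Φ u =
        (∫ u in Set.Ioi 0, Real.exp (-ν * u) * Φ u) - ∫ u in (0:ℝ)..t, Real.exp (-ν * u) * Φ u := by
      intro t
      rw [← intervalIntegral.integral_Ioi_sub_Ioi' (hint 0) (hint t), sub_sub_cancel]
    have hc : Continuous fun u => Real.exp (-ν * u) * Φ u := by fun_prop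
    have h2 : HasDerivAt (fun t => ∫ u in Set.Ioi t, Real.exp (-ν * u) * Φ u)
        (-(Real.exp (-ν * t) * Φ t)) t := by
      rw [funext h1]
      exact (hc.integral_hasStrictDerivAt 0 t).hasDerivAt.const_sub _
    have h3 : HasDerivAt (fun t => Real.exp (ν * t)) (Real.exp (ν * t) * ν) t := by
      have := ((hasDerivAt_id t).const_mul ν).exp
      rwa [mul_one] at this
    have h4 : Real.exp (ν * t) * Real.exp (-ν * t) = 1 := by
      rw [← Real.exp_add]; simp
    exact (h3.mul h2).congr_deriv (by linear_combination (-Φ t) * h4)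
  · rw [abs_mul, abs_of_pos (Real.exp_pos _)]
    have h1 : |∫ u in Set.Ioi t, Real.exp (-ν * u) * Φ u| ≤
        ∫ u in Set.Ioi t, Real.exp (-ν * u) * M := by
      rw [← Real.norm_eq_abs]
      refine norm_integral_le_of_norm_le
        ((integrableOn_exp_mul_Ioi (neg_lt_zero.2 hν) t).mul_const M)
        (Filter.Eventually.of_forall fun u => ?_)
      rw [norm_mul, Real.norm_eq_abs, Real.norm_eq_abs, abs_of_pos (Real.exp_pos _)]
      exact mul_le_mul_of_nonneg_left (hM u) (Real.exp_pos _).le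
    rw [integral_mul_const, integral_exp_mul_Ioi (neg_lt_zero.2 hν)] at h1
    have : Real.exp (ν * t) * Real.exp (-ν * t) = 1 := by
      rw [← Real.exp_add]; simp
    calc _ ≤ Real.exp (ν * t) * (-Real.exp (-ν * t) / -ν * M) :=
          mul_le_mul_of_nonneg_left h1 (Real.exp_pos _).le
      _ = (Real.exp (ν * t) * Real.exp (-ν * t)) * (M / ν) := by
        rw [neg_div_neg_eq]; ring
      _ = M / ν := by rw [this, one_mul]

-- With μ Y added and subtracted the equation reads Y' = (γ+μ) Y - Φ(Y), where Φ(Y) = μ (Y + f(k +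
-- Y(0) - Y)). As y ↦ y + f(c - y) is nondecreasing and f is 1-Lipschitz, Φ is μ-Lipschitz in the
-- sup norm in spite of the term Y(0). Solving the linear equation by the discounted integral gains
-- a factor 1/(γ+μ), so the resulting map is a contraction with constant μ/(γ+μ).
open BoundedContinuousFunction in
theorem exists_isBell {γ μ K : ℝ} {k f : ℝ → ℝ} (hγ : 0 < γ) (hμ : 0 < μ) (hk : IsReward k K)
    (hf : IsSurplus f) : ∃ Y, IsBell γ μ k f Y := by
  have hν : 0 < γ + μ := by positivity
  -- The reward is frozen at negative times, so that the fixed point is sought among bounded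
  -- continuous functions on the whole line.
  have hkc : Continuous fun t => k (max t 0) := by
    have := hk.cont.comp_continuous (f := fun t : ℝ => max t 0) (by fun_prop)
      (fun t => Set.mem_Ici.2 (le_max_right _ _))
    exact this
  let Φ : (ℝ →ᵇ ℝ) → ℝ → ℝ := fun Y t => μ * (Y t + f (k (max t 0) + Y 0 - Y t))
  have hΦc : ∀ Y, Continuous (Φ Y) := by
    exact fun Y => continuous_const.mul (Y.continuous.add
      (hf.continuous.comp ((hkc.add continuous_const).sub Y.continuous)))
  have hΦsub : ∀ Y Z t, |Φ Y t - Φ Z t| ≤ μ * dist Y Z := by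
    intro Y Z t
    have key : ∀ Y Z : ℝ →ᵇ ℝ, Φ Y t - Φ Z t ≤ μ * dist Y Z := by
      intro Y Z
      have h1 := abs_le.1 (Y.dist_coe_le_dist (g := Z) t)
      have h2 := abs_le.1 (Y.dist_coe_le_dist (g := Z) 0)
      have h3 := hf.sub_le_max (k (max t 0) + Y 0 - Y t) (k (max t 0) + Z 0 - Z t)
      have h4 : max 0 (k (max t 0) + Y 0 - Y t - (k (max t 0) + Z 0 - Z t)) ≤
          dist Y Z - (Y t - Z t) := max_le (by linarith) (by linarith)
      simp only [Φ, ← mul_sub]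
      exact mul_le_mul_of_nonneg_left (by linarith) hμ.le
    rw [abs_le]
    have := key Y Z
    have h2 := key Z Y
    rw [dist_comm] at h2
    constructor <;> linarith
  have hΦb : ∀ Y, ∃ M, ∀ t, |Φ Y t| ≤ M := by
    intro Y
    refine ⟨μ * dist Y 0 + μ * f K, fun t => ?_⟩
    have h1 := hΦsub Y 0 t
    have h2 : |Φ 0 t| ≤ μ * f K := by
      simp only [Φ, BoundedContinuousFunction.coe_zero, Pi.zero_apply, zero_add, sub_zero,
        add_zero]
      rw [abs_of_nonneg (mul_nonneg hμ.le (hf.nonneg _))]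
      exact mul_le_mul_of_nonneg_left (hf.mono _ _ (hk.le _ (le_max_right _ _))) hμ.le
    calc |Φ Y t| = |(Φ Y t - Φ 0 t) + Φ 0 t| := by rw [sub_add_cancel]
      _ ≤ _ := (abs_add_le _ _).trans (add_le_add h1 h2)
  choose M hM using hΦb
  choose J hJ hJb using fun Y => exists_discounted hν (hΦc Y) (hM Y)
  have hJc : ∀ Y, Continuous (J Y) := fun Y =>
    continuous_iff_continuousAt.2 fun t => (hJ Y t).continuousAt
  let T : (ℝ →ᵇ ℝ) → (ℝ →ᵇ ℝ) := fun Y =>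
    BoundedContinuousFunction.ofNormedAddCommGroup (J Y) (hJc Y) (M Y / (γ + μ))
      (fun t => by rw [Real.norm_eq_abs]; exact hJb Y t)
  have hle : ∀ Y Z t, J Y t - J Z t ≤ μ / (γ + μ) * dist Y Z := by
    intro Y Z t
    have hder' : ∀ u, HasDerivAt (fun s => J Y (t + s) - J Z (t + s)) ((γ + μ) *
        (J Y (t + u) - J Z (t + u)) - (Φ Y (t + u) - Φ Z (t + u))) u := by
      intro u
      have h1 := (hJ Y (t + u)).sub (hJ Z (t + u))
      have h2 : HasDerivAt (fun s => t + s) 1 u := (hasDerivAt_id u).const_add t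
      exact (HasDerivAt.scomp u h1 h2).congr_deriv (by simp only [one_smul]; ring)
    have := le_of_repelling (g := fun s => J Y (t + s) - J Z (t + s)) (c := γ + μ)
      (L := μ / (γ + μ) * dist Y Z) (B := M Y / (γ + μ) + M Z / (γ + μ)) (t₀ := 0) hν le_rfl
      (fun u _ => (hder' u).hasDerivWithinAt)
      (fun u _ => (le_abs_self _).trans ((abs_sub _ _).trans (add_le_add (hJb _ _) (hJb _ _))))
      (fun u _ _ _ => by
        have h1 := (abs_le.1 (hΦsub Y Z (t + u))).2
        have h2 : (γ + μ) * (μ / (γ + μ) * dist Y Z) = μ * dist Y Z := by field_simp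
        rw [mul_sub, h2]; linarith)
    simpa using this
  have hT : ContractingWith (μ / (γ + μ)).toNNReal T := by
    have h0 : 0 ≤ μ / (γ + μ) := by positivity
    refine ⟨?_, LipschitzWith.of_dist_le_mul fun Y Z => ?_⟩
    · rw [← NNReal.coe_lt_coe, Real.coe_toNNReal _ h0, NNReal.coe_one, div_lt_one hν]
      linarith
    · rw [Real.coe_toNNReal _ h0, BoundedContinuousFunction.dist_le (by positivity)]
      intro t
      rw [Real.dist_eq, abs_le]
      have h1 := hle Y Z t
      have h2 := hle Z Y t
      rw [dist_comm] at h2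
      change -_ ≤ J Y t - J Z t ∧ J Y t - J Z t ≤ _
      constructor <;> linarith
  obtain ⟨Y, hYfix, -⟩ : ∃ Y, Function.IsFixedPt T Y ∧ True :=
    ⟨hT.fixedPoint, hT.fixedPoint_isFixedPt, trivial⟩
  have hYJ : ∀ t, J Y t = Y t := fun t => by
    have : T Y t = Y t := by rw [hYfix]
    exact this
  have hd : ∀ t, 0 ≤ t →
      HasDerivWithinAt Y (γ * Y t - μ * f (k t + Y 0 - Y t)) (Set.Ici 0) t := by
    intro t ht
    have h1 := hJ Y t
    have h2 : J Y = Y := funext hYJ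
    rw [h2] at h1
    exact h1.hasDerivWithinAt.congr_deriv (by simp only [Φ, max_eq_left ht]; ring)
  have hB : ∀ t, |Y t| ≤ ‖Y‖ := fun t => Y.norm_coe_le_norm t
  refine ⟨Y, ?_, hd, ‖Y‖, fun t _ => hB t⟩
  -- Since f ≥ 0, the function -Y is repelled from the level 0.
  have := le_of_repelling (g := fun u => -Y u) (L := 0) (B := ‖Y‖) (t₀ := 0) hγ le_rfl
    (fun u hu => (hd u hu).neg) (fun u hu => (neg_le_abs _).trans (hB u)) (fun u hu _ _ => by
      have := mul_nonneg hμ.le (hf.nonneg (k u + Y 0 - Y u))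
      linarith)
  linarith

end existence


/-! ## Piecewise linear functions -/

section kFun

variable {m : ℕ} {t : Fin (m + 1) → ℝ} {a : Fin (m + 1) → ℝ}

theorem kSegment_castSucc (i : Fin m) (τ : ℝ) :
    kSegment t i.castSucc τ = min (t i.succ) τ - min (t i.castSucc) τ := by
  have h : ((i.castSucc : Fin (m + 1)) : ℕ) + 1 < m + 1 := by simp
  rw [kSegment, dif_pos h]
  rfl

theorem kSegment_last (τ : ℝ) : kSegment t (Fin.last m) τ = τ - min (t (Fin.last m)) τ := by
  rw [kSegment, dif_neg (by simp)]

theorem continuous_kSegment (i : Fin (m + 1)) : Continuous (kSegment t i) := by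
  induction i using Fin.lastCases with
  | last => simp only [funext kSegment_last]; fun_prop
  | cast i => simp only [funext (kSegment_castSucc i)]; fun_prop

theorem continuous_kFun : Continuous (kFun t a) :=
  continuous_finsetSum _ fun i _ => continuous_const.mul (continuous_kSegment i)

theorem kSegment_nonneg (ht : StrictMono t) (i : Fin (m + 1)) (τ : ℝ) : 0 ≤ kSegment t i τ := by
  induction i using Fin.lastCases with
  | last => rw [kSegment_last]; exact sub_nonneg.2 (min_le_right _ _)
  | cast i =>
    rw [kSegment_castSucc]
    exact sub_nonneg.2 (min_le_min_right _ (ht i.castSucc_lt_succ).le)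

theorem kSegment_le_self (h0 : t 0 = 0) (ht : StrictMono t) (i : Fin (m + 1)) {τ : ℝ}
    (hτ : 0 ≤ τ) : kSegment t i τ ≤ τ := by
  have h : ∀ i, 0 ≤ min (t i) τ := fun i =>
    le_min (by rw [← h0]; exact ht.monotone (Fin.zero_le _)) hτ
  induction i using Fin.lastCases with
  | last => rw [kSegment_last]; linarith [h (Fin.last m)]
  | cast i => rw [kSegment_castSucc]; linarith [h i.castSucc, min_le_right (t i.succ) τ]

/-- Summation by parts. For antitone slopes the coefficients are nonnegative, so the properties in
`IsReward` need only be checked for τ ↦ min t_i τ. -/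
theorem kFun_eq_sum_min (h0 : t 0 = 0) (ha : a (Fin.last m) = 0) {τ : ℝ} (hτ : 0 ≤ τ) :
    kFun t a τ = ∑ i : Fin m, (a i.castSucc - a i.succ) * min (t i.succ) τ := by
  have h1 : ∑ i : Fin m, a i.succ * min (t i.succ) τ =
      ∑ i : Fin m, a i.castSucc * min (t i.castSucc) τ := by
    have e1 := Fin.sum_univ_succ fun i => a i * min (t i) τ
    have e2 := Fin.sum_univ_castSucc fun i => a i * min (t i) τ
    simp only [h0, ha, min_eq_left hτ, mul_zero, zero_mul, zero_add, add_zero] at e1 e2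
    rw [← e1, e2]
  rw [kFun, Fin.sum_univ_castSucc, ha, zero_mul, add_zero]
  simp only [kSegment_castSucc, mul_sub, sub_mul, Finset.sum_sub_distrib, h1]

theorem antitone_coeff_nonneg (ha : Antitone a) (i : Fin m) : 0 ≤ a i.castSucc - a i.succ :=
  sub_nonneg.2 (ha i.castSucc_lt_succ.le)

theorem isReward_kFun (h0 : t 0 = 0) (ht : StrictMono t) (ha : Antitone a)
    (hl : a (Fin.last m) = 0) : IsReward (kFun t a) (kFun t a (t (Fin.last m))) := by
  have hpos : ∀ i, 0 ≤ t i := fun i => by rw [← h0]; exact ht.monotone (Fin.zero_le _)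
  refine ⟨continuous_kFun.continuousOn, fun s hs => ?_, fun s u hs hsu => ?_, fun s hs => ?_,
    fun s u hs hu => ?_⟩
  · rw [kFun_eq_sum_min h0 hl hs]
    exact Finset.sum_nonneg fun i _ => mul_nonneg (antitone_coeff_nonneg ha i)
      (le_min (hpos _) hs)
  · rw [kFun_eq_sum_min h0 hl hs, kFun_eq_sum_min h0 hl (hs.trans hsu)]
    exact Finset.sum_le_sum fun i _ => mul_le_mul_of_nonneg_left
      (min_le_min_left _ hsu) (antitone_coeff_nonneg ha i)
  · rw [kFun_eq_sum_min h0 hl hs, kFun_eq_sum_min h0 hl (hpos _)]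
    refine Finset.sum_le_sum fun i _ => mul_le_mul_of_nonneg_left ?_ (antitone_coeff_nonneg ha i)
    rw [min_eq_left (ht.monotone (Fin.le_last _))]
    exact min_le_left _ _
  · rw [kFun_eq_sum_min h0 hl hs, kFun_eq_sum_min h0 hl hu,
      kFun_eq_sum_min h0 hl (add_nonneg hs hu), ← Finset.sum_add_distrib]
    refine Finset.sum_le_sum fun i _ => ?_
    rw [← mul_add]
    refine mul_le_mul_of_nonneg_left ?_ (antitone_coeff_nonneg ha i)
    have := hpos i.succ
    rcases le_total (t i.succ) s with h1 | h1 <;> rcases le_total (t i.succ) u with h2 | h2 <;>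
      simp only [min_eq_left, min_eq_right, h1, h2]
    · exact (min_le_left _ _).trans (by linarith)
    · exact (min_le_left _ _).trans (by linarith)
    · exact (min_le_left _ _).trans (by linarith)
    · exact min_le_right _ _

/-- A nonnegative bonus and a cap preserve subadditivity; so the floor on the bids is available for
the optimistic reward. -/
theorem IsReward.min_add {k : ℝ → ℝ} {K x B : ℝ} (hk : IsReward k K) (hx : 0 ≤ x) (hB : 0 ≤ B) :
    IsReward (fun τ => min (k τ + x) B) B := by
  refine ⟨continuous_min.comp_continuousOn ((hk.cont.add continuousOn_const).prodMk continuousOn_const), fun s hs => ?_,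
    fun s u hs hsu => ?_, fun s hs => min_le_right _ _, fun s u hs hu => ?_⟩
  · exact le_min (add_nonneg (hk.nonneg s hs) hx) hB
  · exact min_le_min_right _ (add_le_add_left (hk.mono s u hs hsu) _)
  · have h1 := hk.subadd s u hs hu
    have h2 := hk.nonneg s hs
    have h3 := hk.nonneg u hu
    rcases le_total (k s + x) B with h | h <;> rcases le_total (k u + x) B with h' | h' <;>
      simp only [min_eq_left, min_eq_right, h, h']
    · exact (min_le_left _ _).trans (by linarith)
    · exact (min_le_right _ _).trans (by linarith)
    · exact (min_le_right _ _).trans (by linarith)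
    · exact (min_le_right _ _).trans (by linarith)

/-- Both last slopes vanish, so the unbounded cell does not contribute and the bound is uniform in
τ. -/
theorem abs_kFun_sub_le (h0 : t 0 = 0) (ht : StrictMono t) {a a' : Fin (m + 1) → ℝ}
    (ha : a (Fin.last m) = 0) (ha' : a' (Fin.last m) = 0) {τ : ℝ} (hτ : 0 ≤ τ) :
    |kFun t a τ - kFun t a' τ| ≤ t (Fin.last m) * ∑ i, |a i - a' i| := by
  have hpos : ∀ i, 0 ≤ t i := fun i => by rw [← h0]; exact ht.monotone (Fin.zero_le _)
  rw [kFun, kFun, ← Finset.sum_sub_distrib, Finset.mul_sum]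
  refine (Finset.abs_sum_le_sum_abs _ _).trans (Finset.sum_le_sum fun i _ => ?_)
  rw [← sub_mul, abs_mul, mul_comm]
  induction i using Fin.lastCases with
  | last => simp [ha, ha']
  | cast i =>
    refine mul_le_mul_of_nonneg_right ?_ (abs_nonneg _)
    rw [abs_of_nonneg (kSegment_nonneg ht _ _), kSegment_castSucc]
    have h1 : min (t i.succ) τ ≤ t (Fin.last m) :=
      (min_le_left _ _).trans (ht.monotone (Fin.le_last _))
    have h2 : 0 ≤ min (t i.castSucc) τ := le_min (hpos _) hτ
    linarith

end kFun

/-- The increment of the `i`-th cell of the grid of bids. -/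
def qSegment {r : ℕ} (b : Fin (r + 1) → ℝ) (i : Fin r) (v : ℝ) : ℝ :=
  min (b i.succ) v - min (b i.castSucc) v

section qFun

variable {r : ℕ} {b : Fin (r + 1) → ℝ} {c : Fin r → ℝ}

theorem qFun_eq (v : ℝ) : qFun b c v = ∑ i, c i * qSegment b i v := rfl

theorem continuous_qSegment (i : Fin r) : Continuous (qSegment b i) := by
  unfold qSegment; fun_prop

theorem continuous_qFun : Continuous (qFun b c) :=
  continuous_finsetSum _ fun i _ => continuous_const.mul (continuous_qSegment i)

theorem qSegment_mono (hb : StrictMono b) (i : Fin r) {v w : ℝ} (h : v ≤ w) :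
    qSegment b i v ≤ qSegment b i w := by
  have := hb i.castSucc_lt_succ
  unfold qSegment
  rcases le_total (b i.castSucc) v with h1 | h1 <;> rcases le_total (b i.succ) v with h2 | h2 <;>
  rcases le_total (b i.castSucc) w with h3 | h3 <;> rcases le_total (b i.succ) w with h4 | h4 <;>
  simp only [min_eq_left, min_eq_right, h1, h2, h3, h4] <;> linarith

theorem qSegment_of_le (hb : StrictMono b) (i : Fin r) {v : ℝ} (h : v ≤ b i.castSucc) :
    qSegment b i v = 0 := by
  rw [qSegment, min_eq_right h, min_eq_right (h.trans (hb i.castSucc_lt_succ).le), sub_self]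

theorem qSegment_of_ge (hb : StrictMono b) (i : Fin r) {v : ℝ} (h : b i.succ ≤ v) :
    qSegment b i v = b i.succ - b i.castSucc := by
  rw [qSegment, min_eq_left h, min_eq_left ((hb i.castSucc_lt_succ).le.trans h)]

theorem qSegment_nonneg (hb : StrictMono b) (i : Fin r) (v : ℝ) : 0 ≤ qSegment b i v :=
  sub_nonneg.2 (min_le_min_right _ (hb i.castSucc_lt_succ).le)

theorem qSegment_le (hb : StrictMono b) (i : Fin r) (v : ℝ) :
    qSegment b i v ≤ b i.succ - b i.castSucc := by
  rcases le_total v (b i.succ) with h | h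
  · exact (qSegment_mono hb i h).trans (qSegment_of_ge hb i le_rfl).le
  · exact (qSegment_of_ge hb i h).le

theorem sum_qSegment (hb : StrictMono b) {v w : ℝ} (hv : v ≤ w) :
    ∑ i, (qSegment b i w - qSegment b i v) ≤ w - v := by
  have h : ∀ v, ∑ i, qSegment b i v = min (b (Fin.last r)) v - min (b 0) v := by
    intro v
    have e1 := Fin.sum_univ_succ fun i => min (b i) v
    have e2 := Fin.sum_univ_castSucc fun i => min (b i) v
    simp only [qSegment, Finset.sum_sub_distrib]
    linarith
  rw [Finset.sum_sub_distrib, h, h]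
  have h1 : b 0 ≤ b (Fin.last r) := hb.monotone (Fin.zero_le _)
  rcases le_total (b 0) v with h1 | h1 <;> rcases le_total (b (Fin.last r)) v with h2 | h2 <;>
  rcases le_total (b 0) w with h3 | h3 <;> rcases le_total (b (Fin.last r)) w with h4 | h4 <;>
  simp only [min_eq_left, min_eq_right, h1, h2, h3, h4] <;> linarith

theorem qFun_of_nonpos (hb : StrictMono b) (h0 : b 0 = 0) {v : ℝ} (hv : v ≤ 0) :
    qFun b c v = 0 := by
  rw [qFun_eq]
  refine Finset.sum_eq_zero fun i _ => ?_
  rw [qSegment_of_le hb i (hv.trans (by rw [← h0]; exact hb.monotone (Fin.zero_le _))), mul_zero]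

theorem qFun_nonneg (hb : StrictMono b) (hc : ∀ i, 0 ≤ c i) (v : ℝ) : 0 ≤ qFun b c v :=
  Finset.sum_nonneg fun i _ => mul_nonneg (hc i) (qSegment_nonneg hb i v)

theorem qFun_le (hb : StrictMono b) (hc : ∀ i, 0 ≤ c i) (v : ℝ) :
    qFun b c v ≤ ∑ i : Fin r, c i * (b i.succ - b i.castSucc) :=
  Finset.sum_le_sum fun i _ => mul_le_mul_of_nonneg_left (qSegment_le hb i v) (hc i)

/-- Cells starting at or above x do not influence the values up to x. Hence cells that the optimal
bids never reach need not be estimated. -/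
theorem abs_qFun_sub_le (hb : StrictMono b) {c c' : Fin r → ℝ} {v x : ℝ} (hv : v ≤ x) :
    |qFun b c v - qFun b c' v| ≤
      ∑ i : Fin r, if b i.castSucc < x then |c i - c' i| * (b i.succ - b i.castSucc) else 0 := by
  rw [qFun_eq, qFun_eq, ← Finset.sum_sub_distrib]
  refine (Finset.abs_sum_le_sum_abs _ _).trans (Finset.sum_le_sum fun i _ => ?_)
  rw [← sub_mul, abs_mul, abs_of_nonneg (qSegment_nonneg hb i v)]
  split_ifs with h
  · exact mul_le_mul_of_nonneg_left (qSegment_le hb i v) (abs_nonneg _)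
  · rw [qSegment_of_le hb i (hv.trans (not_lt.1 h)), mul_zero]

theorem qFun_sub_le (hb : StrictMono b) (hc : ∀ i, 0 ≤ c i) {v w : ℝ} (hv : v ≤ w) :
    qFun b c w - qFun b c v ≤ (∑ i, c i) * (w - v) := by
  rw [qFun_eq, qFun_eq, ← Finset.sum_sub_distrib]
  calc _ ≤ ∑ i, (∑ j, c j) * (qSegment b i w - qSegment b i v) := by
        refine Finset.sum_le_sum fun i _ => ?_
        rw [← mul_sub]
        exact mul_le_mul_of_nonneg_right (Finset.single_le_sum (fun j _ => hc j)
          (Finset.mem_univ i)) (sub_nonneg.2 (qSegment_mono hb i hv))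
    _ ≤ _ := by
        rw [← Finset.mul_sum]
        exact mul_le_mul_of_nonneg_left (sum_qSegment hb hv) (Finset.sum_nonneg fun j _ => hc j)

end qFun

/-! ## The surplus function and the solver -/

theorem surplus_eq (q : ℝ → ℝ) (v : ℝ) : surplus q v = ∫ s in (0 : ℝ)..v, q s := by
  rw [surplus, expectedPrice, sub_sub_cancel]

theorem isSurplus_surplus {q : ℝ → ℝ} (hq : Continuous q) (h0 : ∀ v, 0 ≤ q v)
    (h1 : ∀ v, q v ≤ 1) (hz : ∀ v, v ≤ 0 → q v = 0) : IsSurplus (surplus q) := by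
  have hi : ∀ a b, IntervalIntegrable q volume a b := fun a b => hq.intervalIntegrable a b
  have hsub : ∀ x y, surplus q y - surplus q x = ∫ s in x..y, q s := fun x y => by
    rw [surplus_eq, surplus_eq, intervalIntegral.integral_interval_sub_left (hi _ _) (hi _ _)]
  refine ⟨fun x hx => ?_, fun x y h => ?_, fun x y h => ?_⟩
  · rw [surplus_eq, intervalIntegral.integral_symm, intervalIntegral.integral_of_le hx,
      setIntegral_eq_zero_of_forall_eq_zero fun s hs => hz s hs.2, neg_zero]
  · rw [← sub_nonneg, hsub]
    exact intervalIntegral.integral_nonneg h fun s _ => h0 s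
  · rw [hsub]
    refine (intervalIntegral.integral_mono h (hi _ _) (continuous_const.intervalIntegrable _ _)
      (fun s => h1 s)).trans ?_
    simp

theorem abs_surplus_sub_le {q q' : ℝ → ℝ} (hq : Continuous q) (hq' : Continuous q') {x ε : ℝ}
    (hx : 0 ≤ x) (h : ∀ v, 0 ≤ v → v ≤ x → |q v - q' v| ≤ ε) :
    |surplus q x - surplus q' x| ≤ x * ε := by
  rw [surplus_eq, surplus_eq, ← intervalIntegral.integral_sub (hq.intervalIntegrable _ _)
    (hq'.intervalIntegrable _ _)]
  have := intervalIntegral.norm_integral_le_of_norm_le_const (a := 0) (b := x) (C := ε)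
    (f := fun s => q s - q' s) (fun s hs => by
      rw [Set.uIoc_of_le hx] at hs
      exact h s hs.1.le hs.2)
  rw [sub_zero, abs_of_nonneg hx, Real.norm_eq_abs] at this
  linarith

theorem solver_of_neg {γ μ : ℝ} {k q : ℝ → ℝ} {τ : ℝ} (hτ : τ < 0) : solver γ μ k q τ = 0 := by
  rw [solver, dif_neg fun h => absurd h.2 (not_le.2 hτ)]

/-- The solution exists, and its bids are nonnegative, so neither the default value nor the
truncation at 0 in `solver` is ever active at nonnegative ages. -/
theorem exists_solver_eq {γ μ K : ℝ} {k q : ℝ → ℝ} (hγ : 0 < γ) (hμ : 0 < μ) (hk : IsReward k K)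
    (hq : IsSurplus (surplus q)) : ∃ Y, IsBell γ μ k (surplus q) Y ∧
      ∀ τ, 0 ≤ τ → solver γ μ k q τ = k τ + Y 0 - Y τ := by
  have hex : ∃ Y, IsBellman γ μ k q Y := exists_isBell hγ hμ hk hq
  have hY : IsBell γ μ k (surplus q) hex.choose := hex.choose_spec
  refine ⟨hex.choose, hY, fun τ hτ => ?_⟩
  rw [solver, dif_pos ⟨hex, hτ⟩]
  exact max_eq_right (hY.bid_nonneg hγ hμ hk hq hτ)

section solver

variable {γ μ K : ℝ} {k q : ℝ → ℝ}

theorem measurable_solver (hγ : 0 < γ) (hμ : 0 < μ) (hk : IsReward k K)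
    (hq : IsSurplus (surplus q)) : Measurable (solver γ μ k q) := by
  obtain ⟨Y, hY, h⟩ := exists_solver_eq hγ hμ hk hq
  have h1 : solver γ μ k q = fun τ => if 0 ≤ τ then (fun τ => k τ + Y 0 - Y τ) (max τ 0) else 0 := by
    ext τ
    split_ifs with hτ
    · rw [h τ hτ, max_eq_left hτ]
    · exact solver_of_neg (not_le.1 hτ)
  rw [h1]
  refine Measurable.ite measurableSet_Ici (Continuous.measurable ?_) measurable_const
  exact ((hk.cont.add continuousOn_const).sub hY.continuousOn).comp_continuous
    (f := fun τ : ℝ => max τ 0) (by fun_prop) (fun t => Set.mem_Ici.2 (le_max_right _ _))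

theorem solver_le (hγ : 0 < γ) (hμ : 0 < μ) (hk : IsReward k K)
    (hq : IsSurplus (surplus q)) {τ : ℝ} (hτ : 0 ≤ τ) : solver γ μ k q τ ≤ k τ := by
  obtain ⟨Y, hY, h⟩ := exists_solver_eq hγ hμ hk hq
  rw [h τ hτ]
  exact hY.bid_le hγ hμ hk hq hτ

theorem le_solver (hγ : 0 < γ) (hμ : 0 < μ) (hk : IsReward k K)
    (hq : IsSurplus (surplus q)) {τ : ℝ} (hτ : 0 ≤ τ) :
    γ / (γ + μ) * k τ ≤ solver γ μ k q τ := by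
  obtain ⟨Y, hY, h⟩ := exists_solver_eq hγ hμ hk hq
  rw [h τ hτ]
  exact hY.le_bid hγ hμ hk hq hτ

theorem solver_nonneg (hγ : 0 < γ) (hμ : 0 < μ) (hk : IsReward k K)
    (hq : IsSurplus (surplus q)) (τ : ℝ) : 0 ≤ solver γ μ k q τ := by
  rcases lt_or_ge τ 0 with h | h
  · exact (solver_of_neg h).ge
  · exact (mul_nonneg (by positivity) (hk.nonneg τ h)).trans (le_solver hγ hμ hk hq h)

theorem solver_le_bound (hγ : 0 < γ) (hμ : 0 < μ) (hk : IsReward k K)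
    (hq : IsSurplus (surplus q)) (τ : ℝ) : solver γ μ k q τ ≤ K := by
  rcases lt_or_ge τ 0 with h | h
  · rw [solver_of_neg h]
    exact (hk.nonneg 0 le_rfl).trans (hk.le 0 le_rfl)
  · exact (solver_le hγ hμ hk hq h).trans (hk.le τ h)

theorem abs_solver_sub_le {K' : ℝ} {k' q' : ℝ → ℝ} {ε ε' : ℝ} (hγ : 0 < γ) (hμ : 0 < μ)
    (hk : IsReward k K) (hq : IsSurplus (surplus q)) (hk' : IsReward k' K')
    (hq' : IsSurplus (surplus q')) (hε : 0 ≤ ε) (hε' : 0 ≤ ε')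
    (hkk : ∀ t, 0 ≤ t → |k t - k' t| ≤ ε)
    (hqq : ∀ t, 0 ≤ t →
      |surplus q (solver γ μ k' q' t) - surplus q' (solver γ μ k' q' t)| ≤ ε') (τ : ℝ) :
    |solver γ μ k q τ - solver γ μ k' q' τ| ≤ (1 + 2 * (μ / γ)) * (ε + ε') := by
  rcases lt_or_ge τ 0 with h | h
  · rw [solver_of_neg h, solver_of_neg h, sub_self, abs_zero]
    positivity
  · obtain ⟨Y, hY, e⟩ := exists_solver_eq hγ hμ hk hq
    obtain ⟨Y', hY', e'⟩ := exists_solver_eq hγ hμ hk' hq'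
    rw [e τ h, e' τ h]
    exact IsBell.abs_bid_sub_le hγ hμ hq hY hY' hε hε' hkk
      (fun t ht => by rw [← e' t ht]; exact hqq t ht) h

/-- With no surplus the bid is the reward. -/
theorem solver_of_surplus_eq_zero (hγ : 0 < γ) (hμ : 0 < μ) (hk : IsReward k K)
    (hq : ∀ v, surplus q v = 0) {τ : ℝ} (hτ : 0 ≤ τ) : solver γ μ k q τ = k τ := by
  have hs : IsSurplus (surplus q) :=
    ⟨fun x _ => hq x, fun x y _ => by rw [hq, hq], fun x y h => by rw [hq, hq]; linarith⟩
  obtain ⟨Y, hY, h⟩ := exists_solver_eq hγ hμ hk hs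
  have hz : IsBell γ μ k (surplus q) fun _ => 0 :=
    ⟨le_rfl, fun t _ => by simpa [hq] using hasDerivWithinAt_const t (Set.Ici (0:ℝ)) (0:ℝ),
      0, fun t _ => by simp⟩
  -- Stability without perturbation is uniqueness of the bids; the zero function is a solution.
  have h1 := IsBell.abs_bid_sub_le (ε := 0) (ε' := 0) hγ hμ hs hY hz le_rfl le_rfl
    (fun t _ => by simp) (fun t _ => by simp) hτ
  rw [h τ hτ]
  simp only [add_zero, sub_zero, mul_zero] at h1
  linarith [abs_nonpos_iff.1 h1]

end solver


/-! ## Products of independent copies -/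

section resample

variable {S : Type*} [MeasurableSpace S] {P : Measure S} [IsProbabilityMeasure P]

theorem measurable_update_prod (n : ℕ) :
    Measurable fun p : (ℕ → S) × S => Function.update p.1 n p.2 := by
  refine measurable_pi_iff.2 fun i => ?_
  by_cases h : i = n
  · subst h; simpa using measurable_snd
  · simp only [Function.update_of_ne h]
    exact (measurable_pi_apply i).comp measurable_fst

/-- Replacing one coordinate by an independent copy preserves the law. -/
theorem measurePreserving_update (n : ℕ) :
    MeasurePreserving (fun p : (ℕ → S) × S => Function.update p.1 n p.2)
      ((Measure.infinitePi fun _ : ℕ => P).prod P) (Measure.infinitePi fun _ : ℕ => P) := by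
  refine ⟨measurable_update_prod n, Measure.eq_infinitePi _ fun s t ht => ?_⟩
  rw [Measure.map_apply (measurable_update_prod n)
    (MeasurableSet.pi s.countable_toSet fun i _ => ht i)]
  by_cases hn : n ∈ s
  · have : (fun p : (ℕ → S) × S => Function.update p.1 n p.2) ⁻¹' (Set.pi s t) =
        (Set.pi (s.erase n) t) ×ˢ (t n) := by
      ext p
      simp only [Set.mem_preimage, Set.mem_pi, Set.mem_prod, Finset.mem_coe, Finset.mem_erase]
      constructor
      · intro h
        refine ⟨fun i hi => ?_, ?_⟩
        · have := h i hi.2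
          rwa [Function.update_of_ne hi.1] at this
        · have := h n hn
          rwa [Function.update_self] at this
      · intro h i hi
        by_cases hin : i = n
        · subst hin; rw [Function.update_self]; exact h.2
        · rw [Function.update_of_ne hin]; exact h.1 i ⟨hin, hi⟩
    rw [this, Measure.prod_prod, Measure.infinitePi_pi _ fun i _ => ht i,
      Finset.prod_erase_mul _ _ hn]
  · have : (fun p : (ℕ → S) × S => Function.update p.1 n p.2) ⁻¹' (Set.pi s t) =
        (Set.pi s t) ×ˢ Set.univ := by
      ext p
      simp only [Set.mem_preimage, Set.mem_pi, Set.mem_prod, Finset.mem_coe, Set.mem_univ,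
        and_true]
      refine forall₂_congr fun i hi => ?_
      rw [Function.update_of_ne (ne_of_mem_of_not_mem hi hn)]
    rw [this, Measure.prod_prod, Measure.infinitePi_pi _ fun i _ => ht i, measure_univ, mul_one]

theorem lintegral_update (n : ℕ) {F : (ℕ → S) → ENNReal} (hF : Measurable F) :
    ∫⁻ ω, F ω ∂(Measure.infinitePi fun _ : ℕ => P) =
      ∫⁻ ω, ∫⁻ s, F (Function.update ω n s) ∂P ∂(Measure.infinitePi fun _ : ℕ => P) := by
  rw [← (measurePreserving_update (P := P) n).lintegral_comp hF,
    ← lintegral_prod (fun p : (ℕ → S) × S => F (Function.update p.1 n p.2))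
      (hF.comp (measurable_update_prod n)).aemeasurable]

/-- A product of adapted factors with conditional mean at most one has mean at most one. -/
theorem lintegral_prod_le_one {g : ℕ → (ℕ → S) → ENNReal} (hg : ∀ j, Measurable (g j))
    (hdep : ∀ j ω ω', (∀ i ≤ j, ω i = ω' i) → g j ω = g j ω')
    (h : ∀ j ω, ∫⁻ s, g j (Function.update ω j s) ∂P ≤ 1) (n : ℕ) :
    ∫⁻ ω, ∏ j ∈ Finset.range n, g j ω ∂(Measure.infinitePi fun _ : ℕ => P) ≤ 1 := by
  induction n with
  | zero => simp
  | succ n ih =>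
    rw [lintegral_update n (Finset.measurable_prod _ fun j _ => hg j)]
    refine le_trans (lintegral_mono fun ω => ?_) ih
    have h1 : ∀ s, ∏ j ∈ Finset.range (n + 1), g j (Function.update ω n s) =
        (∏ j ∈ Finset.range n, g j ω) * g n (Function.update ω n s) := by
      intro s
      rw [Finset.prod_range_succ]
      congr 1
      refine Finset.prod_congr rfl fun j hj => hdep j _ _ fun i hi => ?_
      rw [Function.update_of_ne]
      have := Finset.mem_range.1 hj
      omega
    simp_rw [h1]
    rw [lintegral_const_mul (f := fun s => g n (Function.update ω n s)) _
      ((hg n).comp (measurable_update ω))]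
    exact (mul_le_mul_right (h n ω) _).trans (mul_one _).le

open Classical in
/-- Ville's maximal inequality. -/
theorem measure_exists_prod_ge_le {g : ℕ → (ℕ → S) → ENNReal} (hg : ∀ j, Measurable (g j))
    (hdep : ∀ j ω ω', (∀ i ≤ j, ω i = ω' i) → g j ω = g j ω')
    (h : ∀ j ω, ∫⁻ s, g j (Function.update ω j s) ∂P ≤ 1) {x : ENNReal} (hx : x ≠ 0)
    (hx' : x ≠ ⊤) :
    (Measure.infinitePi fun _ : ℕ => P) {ω | ∃ n, x ≤ ∏ j ∈ Finset.range n, g j ω} ≤ 1 / x := by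
  set C : ℕ → Set (ℕ → S) := fun N => {ω | ∃ n ≤ N, x ≤ ∏ j ∈ Finset.range n, g j ω} with hC
  have hCm : ∀ N, MeasurableSet (C N) := by
    intro N
    have : C N = ⋃ n ∈ Set.Iic N, {ω | x ≤ ∏ j ∈ Finset.range n, g j ω} := by
      ext ω; simp [hC]
    rw [this]
    exact MeasurableSet.biUnion (Set.to_countable _) fun n _ =>
      measurableSet_le measurable_const (Finset.measurable_prod _ fun j _ => hg j)
  have hCdep : ∀ N ω ω', (∀ i < N, ω i = ω' i) → (ω ∈ C N ↔ ω' ∈ C N) := by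
    intro N ω ω' hi
    simp only [hC, Set.mem_ofPred_eq]
    refine exists_congr fun n => and_congr_right fun hn => ?_
    rw [Finset.prod_congr rfl fun j hj => hdep j ω ω' fun i hij =>
      hi i (by have := Finset.mem_range.1 hj; omega)]
  -- The process is stopped when it crosses x: later factors are replaced by 1. Membership in `C j`
  -- depends only on the coordinates before j, so the conditional means stay at most 1, and Markov's
  -- inequality applies to the stopped product at the fixed time N.
  set g' : ℕ → (ℕ → S) → ENNReal := fun j ω => if ω ∈ C j then 1 else g j ω with hg'
  have hg'm : ∀ j, Measurable (g' j) := fun j =>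
    Measurable.ite (hCm j) measurable_const (hg j)
  have hbd := lintegral_prod_le_one (P := P) hg'm (fun j ω ω' hi => by
      simp only [hg', hCdep j ω ω' fun i hij => hi i hij.le, hdep j ω ω' hi])
    (fun j ω => by
      have h1 : ∀ s, Function.update ω j s ∈ C j ↔ ω ∈ C j := fun s =>
        hCdep j _ _ fun i hi => Function.update_of_ne hi.ne _ _
      simp only [hg', h1]
      split_ifs
      · simp
      · exact h j ω)
  have hkey : ∀ N ω, (ω ∈ C N → x ≤ ∏ j ∈ Finset.range N, g' j ω) ∧
      (ω ∉ C N → ∏ j ∈ Finset.range N, g' j ω = ∏ j ∈ Finset.range N, g j ω) := by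
    intro N ω
    induction N with
    | zero => simp [hC]
    | succ N ih =>
      rw [Finset.prod_range_succ, Finset.prod_range_succ]
      have hsub : ω ∈ C N → ω ∈ C (N + 1) := fun ⟨n, hn, hx⟩ => ⟨n, hn.trans N.le_succ, hx⟩
      by_cases hN : ω ∈ C N
      · refine ⟨fun _ => ?_, fun h => absurd (hsub hN) h⟩
        simp only [hg', if_pos hN, mul_one]
        exact ih.1 hN
      · have e : g' N ω = g N ω := by simp only [hg', if_neg hN]
        rw [e, ih.2 hN]
        refine ⟨fun ⟨n, hn, hx⟩ => ?_, fun _ => rfl⟩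
        rcases Nat.lt_or_ge n (N + 1) with h1 | h1
        · exact absurd ⟨n, by omega, hx⟩ hN
        · obtain rfl : n = N + 1 := le_antisymm hn h1
          rwa [Finset.prod_range_succ] at hx
  have hCle : ∀ N, (Measure.infinitePi fun _ : ℕ => P) (C N) ≤ 1 / x := by
    intro N
    refine (measure_mono fun ω hω => (hkey N ω).1 hω).trans ?_
    refine (meas_ge_le_lintegral_div
      (Finset.measurable_prod _ fun j _ => hg'm j).aemeasurable hx hx').trans ?_
    exact ENNReal.div_le_div_right (hbd N) _
  have hU : {ω | ∃ n, x ≤ ∏ j ∈ Finset.range n, g j ω} = ⋃ N, C N := by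
    ext ω
    simp only [hC, Set.mem_ofPred_eq, Set.mem_iUnion]
    exact ⟨fun ⟨n, hn⟩ => ⟨n, n, le_rfl, hn⟩, fun ⟨N, n, _, hn⟩ => ⟨n, hn⟩⟩
  rw [hU, Monotone.measure_iUnion]
  · exact iSup_le hCle
  · exact fun N N' hN ω ⟨n, hn, hx⟩ => ⟨n, hn.trans hN, hx⟩

end resample

/-! ## Self-normalized deviations at the scale of the iterated logarithm -/

/-- The hypothesis is Ville's inequality for exp(l X - C l² V). At scale V ≤ 2^k it is used with l =
±lam k of order √(log(k+2)/2^k) and with a threshold of order (k+2)². The failure probabilities are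
summable over k, while the logarithm of the threshold is only of order log(k+2). The scale k stays
free in the conclusion, so it may later be chosen from the random value of V. A depends on l₀, C and
δ only. -/
theorem exists_lil_bound {l₀ C δ : ℝ} (hl : 0 < l₀) (hC : 0 ≤ C) (hδ : 0 < δ) :
    ∃ A : ℝ, 0 ≤ A ∧ ∀ {Ω : Type} [MeasurableSpace Ω] (ν : Measure Ω) (X V : ℕ → Ω → ℝ),
      (∀ l x : ℝ, |l| ≤ l₀ → 0 < x →
        ν {ω | ∃ n, x ≤ Real.exp (l * X n ω - C * l ^ 2 * V n ω)} ≤ ENNReal.ofReal (1 / x)) →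
      ν {ω | ¬ ∀ n k : ℕ, V n ω ≤ 2 ^ k →
        |X n ω| ≤ A * Real.sqrt (2 ^ k * Real.log (k + 2))} ≤ ENNReal.ofReal δ := by
  have hsum : Summable fun k : ℕ => 1 / ((k : ℝ) + 2) ^ 2 := by
    have := (summable_nat_add_iff 2).2 (Real.summable_one_div_nat_pow.2 (one_lt_two))
    simpa using this
  set Z := ∑' k : ℕ, 1 / ((k : ℝ) + 2) ^ 2 with hZ
  have hZ0 : 0 ≤ Z := tsum_nonneg fun k => by positivity
  -- The events of both signs at all scales have total probability at most 2 Z / D ≤ δ.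
  set D := (2 * Z + 1) / δ with hD
  have hDpos : 0 < D := by positivity
  set β := 2 + |Real.log D| / Real.log 2 with hβ
  have hlog2 : 0 < Real.log 2 := Real.log_pos one_lt_two
  have hβ0 : 0 ≤ β := by positivity
  refine ⟨C * l₀ + β / l₀, by positivity, ?_⟩
  intro Ω _ ν X V h
  -- This choice balances C lam 2^k against log(k+2)/lam. The factor l₀ keeps it in the admissible
  -- range, because log(k+2) ≤ 2^k.
  set lam : ℕ → ℝ := fun k => l₀ * Real.sqrt (Real.log (k + 2) / 2 ^ k) with hlam
  have hlogk : ∀ k : ℕ, Real.log 2 ≤ Real.log (k + 2) := fun k =>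
    Real.log_le_log two_pos (by linarith [(Nat.cast_nonneg k : (0:ℝ) ≤ k)])
  have hlampos : ∀ k, 0 < lam k := fun k =>
    mul_pos hl (Real.sqrt_pos.2 (div_pos (hlog2.trans_le (hlogk k)) (by positivity)))
  have hlamle : ∀ k, lam k ≤ l₀ := by
    intro k
    have h1 : Real.log ((k:ℝ) + 2) ≤ 2 ^ k := by
      have h2 := Real.log_le_sub_one_of_pos (x := (k:ℝ) + 2) (by positivity)
      have h3 : k + 1 ≤ 2 ^ k := Nat.lt_two_pow_self
      have h4 : ((k:ℝ) + 1) ≤ 2 ^ k := by exact_mod_cast h3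
      linarith
    have h2 : Real.sqrt (Real.log (k + 2) / 2 ^ k) ≤ 1 := by
      rw [Real.sqrt_le_one]
      exact (div_le_one (by positivity)).2 h1
    calc lam k ≤ l₀ * 1 := mul_le_mul_of_nonneg_left h2 hl.le
      _ = l₀ := mul_one _
  set x : ℕ → ℝ := fun k => D * ((k:ℝ) + 2) ^ 2 with hx
  have hxpos : ∀ k, 0 < x k := fun k => by positivity
  have hlogx : ∀ k, Real.log (x k) ≤ β * Real.log (k + 2) := by
    intro k
    rw [hx, Real.log_mul hDpos.ne' (by positivity), Real.log_pow]
    have : |Real.log D| ≤ |Real.log D| / Real.log 2 * Real.log (k + 2) := by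
      rw [div_mul_eq_mul_div, le_div_iff₀ hlog2]
      exact mul_le_mul_of_nonneg_left (hlogk k) (abs_nonneg _)
    have := le_abs_self (Real.log D)
    rw [hβ]
    push_cast
    linarith
  set E : ℝ → ℕ → Set Ω := fun e k =>
    {ω | ∃ n, x k ≤ Real.exp (e * lam k * X n ω - C * (e * lam k) ^ 2 * V n ω)} with hE
  have hsub : {ω | ¬ ∀ n k : ℕ, V n ω ≤ 2 ^ k →
      |X n ω| ≤ (C * l₀ + β / l₀) * Real.sqrt (2 ^ k * Real.log (k + 2))} ⊆
      ⋃ k, (E 1 k ∪ E (-1) k) := by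
    intro ω hω
    by_contra hno
    apply hω
    intro n k hVk
    simp only [Set.mem_iUnion, Set.mem_union, not_exists, not_or] at hno
    have hgen : ∀ e : ℝ, e ^ 2 = 1 → ω ∉ E e k → e * X n ω ≤
        (C * l₀ + β / l₀) * Real.sqrt (2 ^ k * Real.log (k + 2)) := by
      intro e he hn
      have h1 : Real.exp (e * lam k * X n ω - C * (e * lam k) ^ 2 * V n ω) < x k := by
        by_contra! hh
        exact hn ⟨n, hh⟩
      rw [← Real.lt_log_iff_exp_lt (hxpos k)] at h1
      have h2 := h1.le.trans (hlogx k)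
      rw [mul_pow, he, one_mul] at h2
      have h3 : C * lam k ^ 2 * V n ω ≤ C * lam k ^ 2 * 2 ^ k :=
        mul_le_mul_of_nonneg_left hVk (by positivity)
      set s := Real.sqrt (2 ^ k * Real.log (k + 2)) with hs
      have hL : 0 ≤ Real.log ((k:ℝ) + 2) := hlog2.le.trans (hlogk k)
      have h2k : (0:ℝ) < 2 ^ k := by positivity
      have hs2 : s ^ 2 = 2 ^ k * Real.log (k + 2) := Real.sq_sqrt (by positivity)
      have hls : lam k * 2 ^ k = l₀ * s := by
        have : s = Real.sqrt (Real.log (k + 2) / 2 ^ k) * 2 ^ k := by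
          rw [hs, ← Real.sqrt_sq h2k.le, ← Real.sqrt_mul (by positivity), Real.sqrt_sq h2k.le]
          congr 1
          field_simp
        rw [this, hlam]
        ring
      have hls2 : lam k * s = l₀ * Real.log (k + 2) := by
        have : (lam k * s) * 2 ^ k = (l₀ * Real.log (k + 2)) * 2 ^ k := by
          calc (lam k * s) * 2 ^ k = (lam k * 2 ^ k) * s := by ring
            _ = l₀ * s ^ 2 := by rw [hls]; ring
            _ = _ := by rw [hs2]; ring
        exact mul_right_cancel₀ h2k.ne' this
      have h4 : lam k * (e * X n ω) ≤ lam k * ((C * l₀ + β / l₀) * s) := by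
        have e1 : lam k * ((C * l₀ + β / l₀) * s) = C * lam k ^ 2 * 2 ^ k +
            β * Real.log (k + 2) := by
          calc lam k * ((C * l₀ + β / l₀) * s)
              = C * lam k * (l₀ * s) + β / l₀ * (lam k * s) := by ring
            _ = C * lam k * (lam k * 2 ^ k) + β / l₀ * (l₀ * Real.log (k + 2)) := by
                rw [hls, hls2]
            _ = _ := by field_simp
        rw [e1]
        linarith
      exact le_of_mul_le_mul_left h4 (hlampos k)
    rw [abs_le]
    have h1 := hgen 1 (by norm_num) (hno k).1
    have h2 := hgen (-1) (by norm_num) (hno k).2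
    constructor <;> linarith
  refine (measure_mono hsub).trans ((measure_iUnion_le _).trans ?_)
  have hEle : ∀ e : ℝ, |e| = 1 → ∀ k, ν (E e k) ≤ ENNReal.ofReal (1 / x k) := fun e he k =>
    h (e * lam k) (x k) (by rw [abs_mul, he, one_mul, abs_of_pos (hlampos k)]; exact hlamle k)
      (hxpos k)
  calc ∑' k, ν (E 1 k ∪ E (-1) k) ≤ ∑' k : ℕ, ENNReal.ofReal (2 / D * (1 / ((k:ℝ) + 2) ^ 2)) := by
        refine ENNReal.tsum_le_tsum fun k => (measure_union_le _ _).trans ?_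
        refine (add_le_add (hEle 1 (by simp) k) (hEle (-1) (by simp) k)).trans ?_
        rw [← ENNReal.ofReal_add (by have := hxpos k; positivity) (by have := hxpos k; positivity)]
        refine ENNReal.ofReal_le_ofReal (le_of_eq ?_)
        rw [hx]; field_simp; ring
    _ = ENNReal.ofReal (2 / D * Z) := by
        rw [← ENNReal.ofReal_tsum_of_nonneg (fun k => by positivity) (hsum.mul_left _),
          tsum_mul_left]
    _ ≤ ENNReal.ofReal δ := by
        refine ENNReal.ofReal_le_ofReal ?_
        rw [hD, div_div_eq_mul_div, div_mul_eq_mul_div, div_le_iff₀ (by positivity)]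
        nlinarith

/-! ## Uniform laws of large numbers -/

/-- Continuity from above turns an almost sure, random starting time into a deterministic one
outside an event of small probability. -/
theorem exists_measure_exists_not_le {Ω : Type*} [MeasurableSpace Ω] {ν : Measure Ω}
    [IsFiniteMeasure ν] {p : ℕ → Ω → Prop} (hp : ∀ n, MeasurableSet {ω | p n ω})
    (h : ∀ᵐ ω ∂ν, ∀ᶠ n in Filter.atTop, p n ω) {δ : ENNReal} (hδ : 0 < δ) :
    ∃ N, ν {ω | ¬ ∀ n ≥ N, p n ω} ≤ δ := by
  set A : ℕ → Set Ω := fun N => {ω | ¬ ∀ n ≥ N, p n ω} with hA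
  have hAm : ∀ N, MeasurableSet (A N) := by
    intro N
    have : A N = (⋂ n ∈ Set.Ici N, {ω | p n ω})ᶜ := by
      ext ω; simp [hA]
    rw [this]
    exact (MeasurableSet.biInter (Set.to_countable _) fun n _ => hp n).compl
  have hanti : Antitone A := fun N N' hN ω hω h => hω fun n hn => h n (hN.trans hn)
  have hlim := tendsto_measure_iInter_atTop (μ := ν) (fun N => (hAm N).nullMeasurableSet) hanti
    ⟨0, measure_ne_top _ _⟩
  have h0 : ν (⋂ N, A N) = 0 := by
    refine measure_mono_null (fun ω hω => ?_) h
    simp only [Set.mem_iInter] at hω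
    change ¬ ∀ᶠ n in Filter.atTop, p n ω
    rw [Filter.eventually_atTop]
    rintro ⟨N, hN⟩
    exact hω N hN
  rw [h0] at hlim
  obtain ⟨N, hN⟩ := (hlim.eventually (gt_mem_nhds hδ)).exists
  exact ⟨N, hN.le⟩

section slln

variable {S : Type*} [MeasurableSpace S] {P : Measure S} [IsProbabilityMeasure P]

theorem measurePreserving_eval (i : ℕ) :
    MeasurePreserving (fun ω : ℕ → S => ω i) (Measure.infinitePi fun _ : ℕ => P) P :=
  ⟨measurable_pi_apply i, Measure.infinitePi_map_eval _ i⟩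

theorem ae_tendsto_average {h : S → ℝ} (hm : Measurable h) (hi : Integrable h P) (n₀ : ℕ) :
    ∀ᵐ ω ∂(Measure.infinitePi fun _ : ℕ => P), Filter.Tendsto
      (fun n : ℕ => (∑ i ∈ Finset.range n, h (ω (n₀ + i))) / n) Filter.atTop
      (nhds (∫ s, h s ∂P)) := by
  have hmp : ∀ i, MeasurePreserving (fun ω : ℕ → S => ω i)
    (Measure.infinitePi fun _ : ℕ => P) P := measurePreserving_eval
  have hind : iIndepFun (fun i (ω : ℕ → S) => h (ω i)) (Measure.infinitePi fun _ : ℕ => P) :=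
    iIndepFun_infinitePi (X := fun _ => h) fun _ => hm
  have hmap : ∀ i, (Measure.infinitePi fun _ : ℕ => P).map (fun ω => h (ω i)) = P.map h := by
    intro i
    conv_rhs => rw [← (hmp i).map_eq]
    exact (Measure.map_map hm (hmp i).measurable).symm
  have := strong_law_ae_real (μ := Measure.infinitePi fun _ : ℕ => P)
    (fun i ω => h (ω (n₀ + i))) ((hmp _).integrable_comp_of_integrable hi)
    (fun i j hij => hind.indepFun (by simpa using hij))
    (fun i => ⟨(hm.comp (hmp _).measurable).aemeasurable,
      (hm.comp (hmp _).measurable).aemeasurable, by rw [hmap, hmap]⟩)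
  have e : ∫ ω, h (ω (n₀ + 0)) ∂(Measure.infinitePi fun _ : ℕ => P) = ∫ s, h s ∂P := by
    have h2 := integral_map (μ := Measure.infinitePi fun _ : ℕ => P) (hmp (n₀ + 0)).aemeasurable
      (f := h) hm.aestronglyMeasurable
    rw [(hmp (n₀ + 0)).map_eq] at h2
    exact h2.symm
  rw [e] at this
  exact this

/-- The averages of independent copies of an integrable function converge uniformly outside an event
of small probability. -/
theorem exists_average_close {h : S → ℝ} (hm : Measurable h) (hi : Integrable h P) (n₀ : ℕ)
    {ε δ : ℝ} (hε : 0 < ε) (hδ : 0 < δ) :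
    ∃ N, (Measure.infinitePi fun _ : ℕ => P) {ω | ¬ ∀ n ≥ N,
      |∑ i ∈ Finset.range n, h (ω (n₀ + i)) - n * ∫ s, h s ∂P| ≤ ε * n} ≤ ENNReal.ofReal δ := by
  refine exists_measure_exists_not_le (fun n => ?_) ?_ (ENNReal.ofReal_pos.2 hδ)
  · refine measurableSet_le (continuous_abs.measurable.comp ?_) measurable_const
    exact (Finset.measurable_sum _ fun i _ => hm.comp (measurable_pi_apply _)).sub_const _
  · filter_upwards [ae_tendsto_average hm hi n₀] with ω hω
    have h1 := hω.eventually (Metric.closedBall_mem_nhds _ hε)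
    filter_upwards [h1, Filter.eventually_gt_atTop 0] with n hn hn0
    have hn' : (0:ℝ) < n := by exact_mod_cast hn0
    rw [Real.dist_eq] at hn
    have e : ∑ i ∈ Finset.range n, h (ω (n₀ + i)) - n * ∫ s, h s ∂P =
        ((∑ i ∈ Finset.range n, h (ω (n₀ + i))) / n - ∫ s, h s ∂P) * n := by
      field_simp
    rw [e, abs_mul, abs_of_pos hn']
    exact mul_le_mul_of_nonneg_right hn hn'.le

/-- The averages of independent copies of a nonnegative integrable function are bounded outside an
event of small probability. -/
theorem exists_average_bounded {h : S → ℝ} (hm : Measurable h) (hi : Integrable h P)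
    (h0 : ∀ s, 0 ≤ h s) {δ : ℝ} (hδ : 0 < δ) :
    ∃ C : ℝ, 0 ≤ C ∧ (Measure.infinitePi fun _ : ℕ => P) {ω | ¬ ∀ n : ℕ,
      ∑ i ∈ Finset.range n, h (ω i) ≤ C * n} ≤ ENNReal.ofReal δ := by
  obtain ⟨N, hN⟩ := exists_average_close hm hi 0 one_pos (half_pos hδ)
  -- The terms are nonnegative, so for 1 ≤ n < N the partial sum is at most the one at N, which is
  -- at most a constant K with large probability.
  obtain ⟨K, hK⟩ := exists_measure_exists_not_le (ν := Measure.infinitePi fun _ : ℕ => P)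
    (p := fun n ω => ∑ i ∈ Finset.range N, h (ω i) ≤ n)
    (fun n => measurableSet_le (Finset.measurable_sum _ fun i _ => hm.comp (measurable_pi_apply _))
      measurable_const)
    (Filter.Eventually.of_forall fun ω => by
      obtain ⟨n, hn⟩ := exists_nat_ge (∑ i ∈ Finset.range N, h (ω i))
      filter_upwards [Filter.eventually_ge_atTop n] with k hk
      exact hn.trans (by exact_mod_cast hk))
    (ENNReal.ofReal_pos.2 (half_pos hδ))
  have hE : 0 ≤ ∫ s, h s ∂P := integral_nonneg h0
  refine ⟨(∫ s, h s ∂P) + 1 + K, by positivity, ?_⟩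
  have hsub : {ω : ℕ → S | ¬ ∀ n : ℕ,
      ∑ i ∈ Finset.range n, h (ω i) ≤ ((∫ s, h s ∂P) + 1 + K) * n} ⊆
      {ω | ¬ ∀ n ≥ N, |∑ i ∈ Finset.range n, h (ω (0 + i)) - n * ∫ s, h s ∂P| ≤ 1 * n} ∪
      {ω | ¬ ∀ n ≥ K, ∑ i ∈ Finset.range N, h (ω i) ≤ n} := by
    intro ω hω
    by_contra hno
    simp only [Set.mem_union, not_or, Set.mem_ofPred_eq, not_not, zero_add] at hno
    apply hω
    intro n
    have hKn : (0:ℝ) ≤ K * n := by positivity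
    rcases le_or_gt N n with hn | hn
    · have := (abs_le.1 (hno.1 n hn)).2
      linarith
    · rcases Nat.eq_zero_or_pos n with rfl | hpos
      · simp
      · have h1 : ∑ i ∈ Finset.range n, h (ω i) ≤ ∑ i ∈ Finset.range N, h (ω i) :=
          Finset.sum_le_sum_of_subset_of_nonneg (Finset.range_mono hn.le) fun i _ _ => h0 _
        have h2 := hno.2 K le_rfl
        have h3 : (1:ℝ) ≤ n := by exact_mod_cast hpos
        have h4 : (K:ℝ) * 1 ≤ K * n := mul_le_mul_of_nonneg_left h3 (Nat.cast_nonneg K)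
        have h5 : 0 ≤ ((∫ s, h s ∂P) + 1) * n := by positivity
        linarith
  refine (measure_mono hsub).trans ((measure_union_le _ _).trans ((add_le_add hN hK).trans ?_))
  rw [← ENNReal.ofReal_add (half_pos hδ).le (half_pos hδ).le, add_halves]

end slln


/-! ## The exponential law -/

section exponential

variable {r : ℝ}

theorem lintegral_expMeasure {f : ℝ → ENNReal} (hf : Measurable f) :
    ∫⁻ x, f x ∂(expMeasure r) =
      ∫⁻ x in Set.Ici 0, ENNReal.ofReal (r * Real.exp (-(r * x))) * f x := by
  have h1 : ∫⁻ x, f x ∂(expMeasure r) = ∫⁻ x, exponentialPDF r x * f x :=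
    lintegral_withDensity_eq_lintegral_mul _
      (measurable_exponentialPDFReal r).ennreal_ofReal hf
  rw [h1, ← lintegral_indicator measurableSet_Ici]
  congr 1
  ext x
  by_cases hx : 0 ≤ x
  · rw [Set.indicator_of_mem (Set.mem_Ici.2 hx), exponentialPDF_of_nonneg hx]
  · rw [Set.indicator_of_notMem (by simpa using hx), exponentialPDF_of_neg (not_le.1 hx), zero_mul]

theorem ae_pos_expMeasure : ∀ᵐ x ∂(expMeasure r), 0 < x := by
  rw [ae_iff]
  have hm : MeasurableSet {x : ℝ | ¬ 0 < x} := (measurableSet_lt measurable_const measurable_id).compl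
  rw [← lintegral_indicator_one hm, lintegral_expMeasure (measurable_one.indicator hm),
    setLIntegral_congr (Ioi_ae_eq_Ici (a := (0:ℝ))).symm]
  rw [setLIntegral_congr_fun measurableSet_Ioi (g := fun _ => 0), lintegral_zero]
  intro x hx
  have : x ∉ {x : ℝ | ¬ 0 < x} := fun h => h hx
  simp only [Set.indicator_of_notMem this, mul_zero]

theorem integral_expMeasure (hr : 0 < r) (f : ℝ → ℝ) :
    ∫ x, f x ∂(expMeasure r) = ∫ x in Set.Ioi 0, r * Real.exp (-(r * x)) * f x := by
  have h1 : ∫ x, f x ∂(expMeasure r) = ∫ x, (exponentialPDF r x).toReal • f x :=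
    integral_withDensity_eq_integral_toReal_smul
      (measurable_exponentialPDFReal r).ennreal_ofReal
      (Filter.Eventually.of_forall fun x => ENNReal.ofReal_lt_top) _
  rw [h1, setIntegral_congr_set Ioi_ae_eq_Ici, ← integral_indicator measurableSet_Ici]
  congr 1
  ext x
  by_cases hx : 0 ≤ x
  · rw [Set.indicator_of_mem (Set.mem_Ici.2 hx), exponentialPDF_of_nonneg hx,
      ENNReal.toReal_ofReal (by positivity), smul_eq_mul]
  · rw [Set.indicator_of_notMem (by simpa using hx), exponentialPDF_of_neg (not_le.1 hx)]
    simp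

theorem lintegral_exp_neg_expMeasure {g : ℝ} (hr : 0 < r) (hg : -r < g) :
    ∫⁻ x, ENNReal.ofReal (Real.exp (-(g * x))) ∂(expMeasure r) =
      ENNReal.ofReal (r / (g + r)) := by
  rw [lintegral_expMeasure (by fun_prop), setLIntegral_congr (Ioi_ae_eq_Ici (a := (0:ℝ))).symm]
  have hν : -(g + r) < 0 := by linarith
  have h1 : ∀ x, ENNReal.ofReal (r * Real.exp (-(r * x))) * ENNReal.ofReal (Real.exp (-(g * x))) =
      ENNReal.ofReal (r * Real.exp (-(g + r) * x)) := by
    intro x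
    rw [← ENNReal.ofReal_mul (by positivity), mul_assoc, ← Real.exp_add]
    congr 3
    ring
  simp_rw [h1]
  rw [← ofReal_integral_eq_lintegral_ofReal ((integrableOn_exp_mul_Ioi hν 0).const_mul r)
    (Filter.Eventually.of_forall fun x => by positivity), integral_const_mul,
    integral_exp_mul_Ioi hν]
  congr 1
  rw [mul_zero, Real.exp_zero, neg_div_neg_eq]
  ring

theorem expMeasure_Ici (hr : 0 < r) {x : ℝ} (hx : 0 ≤ x) :
    expMeasure r (Set.Ici x) = ENNReal.ofReal (Real.exp (-(r * x))) := by
  have hν : -r < 0 := by linarith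
  rw [← lintegral_indicator_one measurableSet_Ici,
    lintegral_expMeasure (measurable_one.indicator measurableSet_Ici)]
  have h1 : ∀ y, ENNReal.ofReal (r * Real.exp (-(r * y))) * (Set.Ici x).indicator 1 y =
      (Set.Ici x).indicator (fun y => ENNReal.ofReal (r * Real.exp (-r * y))) y := by
    intro y
    by_cases hy : y ∈ Set.Ici x
    · rw [Set.indicator_of_mem hy, Set.indicator_of_mem hy]; simp
    · rw [Set.indicator_of_notMem hy, Set.indicator_of_notMem hy]; simp
  simp_rw [h1]
  rw [setLIntegral_indicator measurableSet_Ici,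
    Set.inter_eq_left.2 (Set.Ici_subset_Ici.2 hx),
    setLIntegral_congr (Ioi_ae_eq_Ici (a := x)).symm,
    ← ofReal_integral_eq_lintegral_ofReal ((integrableOn_exp_mul_Ioi hν x).const_mul r)
    (Filter.Eventually.of_forall fun x => by positivity), integral_const_mul,
    integral_exp_mul_Ioi hν]
  congr 1
  rw [neg_div_neg_eq, neg_mul]
  field_simp

theorem expMeasure_Ioo_pos (hr : 0 < r) {x y : ℝ} (hx : 0 ≤ x) (hxy : x < y) :
    0 < expMeasure r (Set.Ioo x y) := by
  rw [pos_iff_ne_zero, ← lintegral_indicator_one measurableSet_Ioo,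
    lintegral_expMeasure (measurable_one.indicator measurableSet_Ioo)]
  intro h0
  have hmeas : Measurable fun u => ENNReal.ofReal (r * Real.exp (-(r * u))) *
      (Set.Ioo x y).indicator (1 : ℝ → ENNReal) u :=
    Measurable.mul (by fun_prop) (measurable_one.indicator measurableSet_Ioo)
  rw [lintegral_eq_zero_iff hmeas] at h0
  rw [Filter.EventuallyEq, ae_restrict_iff' measurableSet_Ici] at h0
  have h1 : volume (Set.Ioo x y) = 0 := by
    refine measure_mono_null (fun u hu => ?_) h0
    change ¬ (u ∈ Set.Ici 0 → _)
    intro h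
    have h2 := h (hx.trans hu.1.le)
    simp only [Set.indicator_of_mem hu, Pi.one_apply, mul_one, Pi.zero_apply,
      ENNReal.ofReal_eq_zero] at h2
    exact absurd h2 (not_le.2 (by positivity))
  rw [Real.volume_Ioo, ENNReal.ofReal_eq_zero] at h1
  linarith

end exponential

/-! ## Resampling one ingredient of an episode -/

/-- Replacing the part of `a` selected by `Φ` by an independent draw from `ν` preserves `μ`. -/
abbrev Resamples {A X : Type*} [MeasurableSpace A] [MeasurableSpace X] (Φ : A → X → A)
    (μ : Measure A) (ν : Measure X) : Prop :=
  MeasurePreserving (fun p : A × X => Φ p.1 p.2) (μ.prod ν) μ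

section resamples

variable {A B X : Type*} [MeasurableSpace A] [MeasurableSpace B] [MeasurableSpace X]
  {μ : Measure A} {μ' : Measure B} {ν : Measure X} [IsProbabilityMeasure μ]
  [IsProbabilityMeasure μ'] [IsProbabilityMeasure ν]

theorem Resamples.self : Resamples (fun _ x => x) μ μ := measurePreserving_snd

theorem Resamples.snd {Φ : B → X → B} (h : Resamples Φ μ' ν) :
    Resamples (fun (s : A × B) x => (s.1, Φ s.2 x)) (μ.prod μ') ν :=
  ((MeasurePreserving.id μ).prod h).comp (measurePreserving_prodAssoc μ μ' ν)

theorem Resamples.fst {Φ : A → X → A} (h : Resamples Φ μ ν) :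
    Resamples (fun (s : A × B) x => (Φ s.1 x, s.2)) (μ.prod μ') ν := by
  have h1 := (Resamples.snd (μ := μ') h)
  have h2 : MeasurePreserving (fun p : (A × B) × X => ((p.1.2, p.1.1), p.2))
      ((μ.prod μ').prod ν) ((μ'.prod μ).prod ν) :=
    Measure.measurePreserving_swap.prod (MeasurePreserving.id ν)
  exact (Measure.measurePreserving_swap (μ := μ') (ν := μ)).comp (h1.comp h2)

/-- This replaces conditioning on everything but one ingredient: F is averaged over a fresh copy of
that ingredient, the rest being held fixed. -/
theorem Resamples.integral_eq {Φ : A → X → A} (h : Resamples Φ μ ν) {F H : A → ℝ}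
    (hF : Integrable F μ) (hH : ∀ᵐ s ∂μ, ∫ x, F (Φ s x) ∂ν = H s) :
    ∫ s, F s ∂μ = ∫ s, H s ∂μ := by
  have h1 := integral_map (μ := μ.prod ν) h.aemeasurable (f := F)
    (by rw [h.map_eq]; exact hF.aestronglyMeasurable)
  rw [h.map_eq] at h1
  rw [h1, integral_prod (fun p : A × X => F (Φ p.1 p.2)) (h.integrable_comp_of_integrable hF)]
  exact integral_congr_ae hH

omit [IsProbabilityMeasure μ] in
theorem Resamples.lintegral_eq {Φ : A → X → A} (h : Resamples Φ μ ν) {F : A → ENNReal}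
    (hF : Measurable F) : ∫⁻ s, F s ∂μ = ∫⁻ s, ∫⁻ x, F (Φ s x) ∂ν ∂μ := by
  rw [← h.lintegral_comp hF, ← lintegral_prod (fun p : A × X => F (Φ p.1 p.2))
    (hF.comp h.measurable).aemeasurable]

theorem resamples_update (i : ℕ) : Resamples (fun (g : ℕ → X) x => Function.update g i x)
    (Measure.infinitePi fun _ : ℕ => ν) ν := measurePreserving_update i

end resamples

def Seed.setLength (s : Seed) (x : ℝ) : Seed := (x, s.2)
def Seed.setGap (i : ℕ) (s : Seed) (x : ℝ) : Seed :=
  (s.1, Function.update s.2.1 i x, s.2.2)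
def Seed.setPrice (i : ℕ) (s : Seed) (x : ℝ) : Seed :=
  (s.1, s.2.1, Function.update s.2.2.1 i x, s.2.2.2)
def Seed.setNoise (i : ℕ) (s : Seed) (x : ℝ) : Seed :=
  (s.1, s.2.1, s.2.2.1, Function.update s.2.2.2 i x)

section law

variable {m r : ℕ} {M : Model m r} (E : Environment M)

instance : IsProbabilityMeasure E.priceLaw := E.priceLaw_prob
instance : IsProbabilityMeasure E.noiseSeedLaw := E.noiseSeedLaw_prob

theorem isProbabilityMeasure_gamma (M : Model m r) : IsProbabilityMeasure (expMeasure M.gamma) :=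
  isProbabilityMeasure_expMeasure M.gamma_pos

theorem isProbabilityMeasure_mu (M : Model m r) : IsProbabilityMeasure (expMeasure M.mu) :=
  isProbabilityMeasure_expMeasure M.mu_pos

attribute [local instance] isProbabilityMeasure_gamma isProbabilityMeasure_mu

theorem resamples_length : Resamples Seed.setLength E.seedLaw (expMeasure M.gamma) :=
  Resamples.fst Resamples.self

theorem resamples_gap (i : ℕ) : Resamples (Seed.setGap i) E.seedLaw (expMeasure M.mu) :=
  Resamples.snd (Resamples.fst (resamples_update i))

theorem resamples_price (i : ℕ) : Resamples (Seed.setPrice i) E.seedLaw E.priceLaw :=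
  Resamples.snd (Resamples.snd (Resamples.fst (resamples_update i)))

theorem resamples_noise (i : ℕ) : Resamples (Seed.setNoise i) E.seedLaw E.noiseSeedLaw :=
  Resamples.snd (Resamples.snd (Resamples.snd (resamples_update i)))

theorem measurePreserving_length :
    MeasurePreserving Seed.length E.seedLaw (expMeasure M.gamma) := measurePreserving_fst

theorem measurePreserving_gaps :
    MeasurePreserving Seed.gap E.seedLaw (Measure.infinitePi fun _ : ℕ => expMeasure M.mu) :=
  measurePreserving_fst.comp measurePreserving_snd

theorem measurePreserving_prices :
    MeasurePreserving Seed.price E.seedLaw (Measure.infinitePi fun _ : ℕ => E.priceLaw) :=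
  measurePreserving_fst.comp (measurePreserving_snd.comp measurePreserving_snd)

end law

@[fun_prop]
theorem measurable_length : Measurable Seed.length := measurable_fst
@[fun_prop]
theorem measurable_gap (i : ℕ) : Measurable fun s : Seed => s.gap i :=
  (measurable_pi_apply i).comp (measurable_fst.comp measurable_snd)
@[fun_prop]
theorem measurable_price (i : ℕ) : Measurable fun s : Seed => s.price i :=
  (measurable_pi_apply i).comp (measurable_fst.comp (measurable_snd.comp measurable_snd))
@[fun_prop]
theorem measurable_noiseSeed (i : ℕ) : Measurable fun s : Seed => s.noiseSeed i :=
  (measurable_pi_apply i).comp (measurable_snd.comp (measurable_snd.comp measurable_snd))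
@[fun_prop]
theorem measurable_arrival (i : ℕ) : Measurable fun s : Seed => s.arrival i :=
  Finset.measurable_sum _ fun j _ => measurable_gap j

/-! ## Typical episodes -/

/-- Waiting times and prices are positive and finitely many auctions arrive in the episode. -/
structure Seed.Good (s : Seed) : Prop where
  length_pos : 0 < s.length
  gap_pos : ∀ i, 0 < s.gap i
  price_pos : ∀ i, 0 < s.price i
  finite : {i | s.arrival i ≤ s.length}.Finite

section good

theorem Seed.Good.arrival_mono {s : Seed} (hs : s.Good) : Monotone s.arrival := fun i j hij =>
  Finset.sum_le_sum_of_subset_of_nonneg (Finset.range_mono (by omega)) fun k _ _ => (hs.gap_pos k).le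

theorem Seed.Good.arrival_pos {s : Seed} (hs : s.Good) (i : ℕ) : 0 < s.arrival i :=
  Finset.sum_pos (fun k _ => hs.gap_pos k) (by simp)

/-- `Set.ncard` is 0 on infinite sets; on a good seed the set is a finite initial segment, so it
counts the auctions. -/
theorem Seed.Good.arrival_le_iff {s : Seed} (hs : s.Good) {i : ℕ} :
    s.arrival i ≤ s.length ↔ i < s.numAuctions := by
  obtain ⟨n, hn⟩ : ∃ n, ∀ i, s.arrival i ≤ s.length ↔ i < n := by
    have hex : ∃ n, ¬ s.arrival n ≤ s.length := by
      by_contra! h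
      exact Set.infinite_univ (hs.finite.subset fun i _ => h i)
    obtain ⟨n, hn, hmin⟩ : ∃ n, ¬ s.arrival n ≤ s.length ∧ ∀ k < n, s.arrival k ≤ s.length :=
      ⟨_, Nat.find_spec hex, fun k hk => not_not.1 (Nat.find_min hex hk)⟩
    refine ⟨n, fun i => ⟨fun hi => ?_, hmin i⟩⟩
    by_contra! hle
    exact hn (le_trans (hs.arrival_mono hle) hi)
  have h1 : {i | s.arrival i ≤ s.length} = (Finset.range n : Set ℕ) := by
    ext i; simp [hn]
  rw [Seed.numAuctions, h1, Set.ncard_coe_finset, Finset.card_range, hn]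

variable {π : ℝ → ℝ} {s : Seed}

theorem lastWin_succ_of_won {i : ℕ} (h : Won π s i) : lastWin π s (i + 1) = s.arrival i := by
  rw [lastWin]; exact if_pos h

theorem lastWin_succ_of_not_won {i : ℕ} (h : ¬ Won π s i) :
    lastWin π s (i + 1) = lastWin π s i := by
  rw [lastWin]; exact if_neg h

theorem Seed.arrival_eq (s : Seed) (i : ℕ) :
    s.arrival i = (∑ j ∈ Finset.range i, s.gap j) + s.gap i := Finset.sum_range_succ _ _

theorem Seed.Good.lastWin_mem (hs : s.Good) (π : ℝ → ℝ) (i : ℕ) :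
    0 ≤ lastWin π s i ∧ lastWin π s i ≤ ∑ j ∈ Finset.range i, s.gap j := by
  induction i with
  | zero => simp [lastWin]
  | succ i ih =>
    by_cases h : Won π s i
    · rw [lastWin_succ_of_won h]
      exact ⟨(hs.arrival_pos i).le, le_rfl⟩
    · rw [lastWin_succ_of_not_won h, Finset.sum_range_succ]
      exact ⟨ih.1, ih.2.trans (by linarith [hs.gap_pos i])⟩

theorem Seed.Good.age_pos (hs : s.Good) (π : ℝ → ℝ) (i : ℕ) : 0 < age π s i := by
  have := (hs.lastWin_mem π i).2
  rw [age, s.arrival_eq]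
  linarith [hs.gap_pos i]

theorem Seed.Good.age_le (hs : s.Good) (π : ℝ → ℝ) (i : ℕ) : age π s i ≤ s.arrival i := by
  rw [age]
  linarith [(hs.lastWin_mem π i).1]

theorem lastWin_congr {s' : Seed} {i : ℕ} (hg : ∀ j < i, s.gap j = s'.gap j)
    (hp : ∀ j < i, s.price j = s'.price j) : lastWin π s i = lastWin π s' i := by
  induction i with
  | zero => rfl
  | succ i ih =>
    have h1 := ih (fun j hj => hg j (by omega)) (fun j hj => hp j (by omega))
    have h2 : s.arrival i = s'.arrival i :=
      Finset.sum_congr rfl fun j hj => hg j (Finset.mem_range.1 hj)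
    rw [lastWin, lastWin, h1, h2, hp i (by omega)]

/-- The prices are needed only strictly before i. The age, hence the bid, at auction i is thus
unaffected when the price of that auction is redrawn: this is the independence behind all the
one-auction computations. -/
theorem age_congr {s' : Seed} {i : ℕ} (hg : ∀ j ≤ i, s.gap j = s'.gap j)
    (hp : ∀ j < i, s.price j = s'.price j) : age π s i = age π s' i := by
  rw [age, age, lastWin_congr (fun j hj => hg j hj.le) hp]
  congr 1
  exact Finset.sum_congr rfl fun j hj => hg j (by have := Finset.mem_range.1 hj; omega)

open Classical in
theorem sum_map_wins (g : ℕ → ℝ) : ((wins π s).map g).sum =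
    ∑ i ∈ Finset.range s.numAuctions, if Won π s i then g i else 0 := by
  rw [wins]
  induction s.numAuctions with
  | zero => simp
  | succ n ih =>
    rw [List.range_succ, List.filter_append, List.map_append, List.sum_append, ih,
      Finset.sum_range_succ]
    congr 1
    by_cases h : Won π s n <;> simp [h]

end good

section measurability

variable {X : Type*} [MeasurableSpace X] {Pol : X → ℝ → ℝ} {S : X → Seed}

theorem measurable_lastWin (hPol : Measurable (Function.uncurry Pol)) (hS : Measurable S) (i : ℕ) :
    Measurable fun x => lastWin (Pol x) (S x) i := by
  induction i with
  | zero => exact measurable_const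
  | succ i ih =>
    have ha := (measurable_arrival i).comp hS
    refine Measurable.ite (measurableSet_lt ((measurable_price i).comp hS) ?_) ha ih
    exact hPol.comp (measurable_id.prodMk (ha.sub ih))

theorem measurable_age (hPol : Measurable (Function.uncurry Pol)) (hS : Measurable S) (i : ℕ) :
    Measurable fun x => age (Pol x) (S x) i :=
  ((measurable_arrival i).comp hS).sub (measurable_lastWin hPol hS i)

theorem measurable_bid (hPol : Measurable (Function.uncurry Pol)) (hS : Measurable S) (i : ℕ) :
    Measurable fun x => Pol x (age (Pol x) (S x) i) :=
  hPol.comp (measurable_id.prodMk (measurable_age hPol hS i))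

theorem measurableSet_won (hPol : Measurable (Function.uncurry Pol)) (hS : Measurable S) (i : ℕ) :
    MeasurableSet {x | Won (Pol x) (S x) i} :=
  measurableSet_lt ((measurable_price i).comp hS) (measurable_bid hPol hS i)

theorem measurableSet_arrival_le (i : ℕ) : MeasurableSet {s : Seed | s.arrival i ≤ s.length} :=
  measurableSet_le (measurable_arrival i) measurable_length

@[fun_prop]
theorem measurable_numAuctions : Measurable Seed.numAuctions := by
  -- The count is a sum of indicators, except that `Set.ncard` turns an infinite count into 0.
  have h1 : ∀ s : Seed, (s.numAuctions : ENNReal) = if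
      (∑' i, {s : Seed | s.arrival i ≤ s.length}.indicator (1 : Seed → ENNReal) s) = ⊤ then 0 else
      ∑' i, {s : Seed | s.arrival i ≤ s.length}.indicator (1 : Seed → ENNReal) s := by
    intro s
    have h2 : ∑' i, {s : Seed | s.arrival i ≤ s.length}.indicator (1 : Seed → ENNReal) s =
        ({i | s.arrival i ≤ s.length}.encard : ENNReal) := by
      rw [← ENNReal.tsum_set_one, tsum_subtype {i | s.arrival i ≤ s.length} fun _ => 1]
      rfl
    rw [h2, Seed.numAuctions]
    rcases Set.finite_or_infinite {i | s.arrival i ≤ s.length} with h | h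
    · rw [← h.cast_ncard_eq]
      simp
    · rw [h.ncard, h.encard_eq]
      simp
  have h2 : Measurable fun s : Seed => (s.numAuctions : ENNReal) := by
    simp_rw [h1]
    have h3 : Measurable fun s : Seed =>
        ∑' i, {s : Seed | s.arrival i ≤ s.length}.indicator (1 : Seed → ENNReal) s :=
      Measurable.tsum fun i => measurable_one.indicator (measurableSet_arrival_le i)
    exact Measurable.ite (h3 (measurableSet_singleton ⊤)) measurable_const h3
  refine measurable_to_countable' fun n => ?_
  have : Seed.numAuctions ⁻¹' {n} = (fun s : Seed => (s.numAuctions : ENNReal)) ⁻¹' {(n : ENNReal)} := by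
    ext s; simp
  rw [this]
  exact h2 (measurableSet_singleton _)

end measurability

/-! ### Geometric tails of the number of auctions -/

section alive

variable {m r : ℕ} {M : Model m r} (E : Environment M)

attribute [local instance] isProbabilityMeasure_gamma isProbabilityMeasure_mu

theorem price_nonpos_null : E.priceLaw (Set.Iic 0) = 0 := by
  rw [E.priceLaw_cdf 0 le_rfl (by rw [← M.b_zero]; exact M.b_strictMono.monotone (Fin.zero_le _)),
    qFun_of_nonpos M.b_strictMono M.b_zero le_rfl, ENNReal.ofReal_zero]

/-- The probability that an auction arrives before the end of the episode. -/
def Model.rho {m r : ℕ} (M : Model m r) : ℝ := M.mu / (M.gamma + M.mu)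

theorem rho_pos : 0 < M.rho := div_pos M.mu_pos (add_pos M.gamma_pos M.mu_pos)
theorem rho_lt_one : M.rho < 1 := (div_lt_one (add_pos M.gamma_pos M.mu_pos)).2 (by linarith [M.gamma_pos])

theorem ae_gap_pos : ∀ᵐ s ∂E.seedLaw, ∀ i, 0 < s.gap i := by
  rw [ae_all_iff]
  intro i
  exact ((measurePreserving_eval i).comp (measurePreserving_gaps E)).quasiMeasurePreserving.ae
    ae_pos_expMeasure

theorem ae_arrival_nonneg : ∀ᵐ s ∂E.seedLaw, ∀ i, 0 ≤ s.arrival i := by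
  filter_upwards [ae_gap_pos E] with s hs i
  exact Finset.sum_nonneg fun j _ => (hs j).le

/-- Given the waiting times, the episode outlasts the i-th arrival with probability exp(-γ ·
arrival), a product of i + 1 independent factors of mean `M.rho`. -/
theorem seedLaw_arrival_le (i : ℕ) :
    E.seedLaw {s | s.arrival i ≤ s.length} ≤ ENNReal.ofReal M.rho ^ (i + 1) := by
  rw [← lintegral_indicator_one (measurableSet_arrival_le i),
    (resamples_length E).lintegral_eq (measurable_one.indicator (measurableSet_arrival_le i))]
  have h1 : ∀ᵐ s ∂E.seedLaw, ∫⁻ x, {s : Seed | s.arrival i ≤ s.length}.indicator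
      (1 : Seed → ENNReal) (s.setLength x) ∂(expMeasure M.gamma) =
      ∏ j ∈ Finset.range (i + 1), ENNReal.ofReal (Real.exp (-(M.gamma * s.gap j))) := by
    filter_upwards [ae_arrival_nonneg E] with s hs
    have : ∀ x, {s : Seed | s.arrival i ≤ s.length}.indicator
      (1 : Seed → ENNReal) (s.setLength x) = (Set.Ici (s.arrival i)).indicator 1 x := fun x => rfl
    simp_rw [this]
    rw [lintegral_indicator_one measurableSet_Ici, expMeasure_Ici M.gamma_pos (hs i),
      ← ENNReal.ofReal_prod_of_nonneg fun _ _ => (Real.exp_pos _).le, ← Real.exp_sum,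
      Finset.sum_neg_distrib, ← Finset.mul_sum]
    rfl
  rw [lintegral_congr_ae h1]
  have hρ : ENNReal.ofReal M.rho ≠ 0 := by simpa using rho_pos
  have hρ' : ENNReal.ofReal M.rho ≠ ⊤ := ENNReal.ofReal_ne_top
  -- After division by `M.rho` the factors have mean one.
  have h2 := lintegral_prod_le_one (P := expMeasure M.mu)
    (g := fun j ω => ENNReal.ofReal (Real.exp (-(M.gamma * ω j))) / ENNReal.ofReal M.rho)
    (fun j => by fun_prop)
    (fun j ω ω' h => by simp only [h j le_rfl])
    (fun j ω => by
      simp only [Function.update_self, div_eq_mul_inv]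
      rw [lintegral_mul_const _ (by fun_prop),
        lintegral_exp_neg_expMeasure M.mu_pos (by linarith [M.gamma_pos, M.mu_pos]), ← div_eq_mul_inv]
      exact (ENNReal.div_self hρ hρ').le) (i + 1)
  rw [← (measurePreserving_gaps E).lintegral_comp (Finset.measurable_prod _ fun j _ => by fun_prop)]
    at h2
  have h3 : ∀ s : Seed, ∏ j ∈ Finset.range (i + 1), ENNReal.ofReal (Real.exp (-(M.gamma * s.gap j)))
      = ENNReal.ofReal M.rho ^ (i + 1) * ∏ j ∈ Finset.range (i + 1),
        ENNReal.ofReal (Real.exp (-(M.gamma * s.gap j))) / ENNReal.ofReal M.rho := by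
    intro s
    rw [← Finset.card_range (i + 1), ← Finset.prod_const, Finset.card_range,
      ← Finset.prod_mul_distrib]
    refine Finset.prod_congr rfl fun j _ => ?_
    rw [ENNReal.mul_div_cancel hρ hρ']
  simp_rw [h3]
  rw [lintegral_const_mul _ (Finset.measurable_prod _ fun j _ => by fun_prop)]
  exact (mul_le_mul_right h2 _).trans (mul_one _).le

/-- Finiteness of the number of arrivals is the Borel–Cantelli lemma with the geometric tails. -/
theorem ae_good : ∀ᵐ s ∂E.seedLaw, s.Good := by
  have h1 : ∀ᵐ s ∂E.seedLaw, 0 < s.length :=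
    (measurePreserving_length E).quasiMeasurePreserving.ae ae_pos_expMeasure
  have h2 : ∀ᵐ s ∂E.seedLaw, ∀ i, 0 < s.price i := by
    rw [ae_all_iff]
    intro i
    refine ((measurePreserving_eval i).comp (measurePreserving_prices E)).quasiMeasurePreserving.ae
      (p := fun x => 0 < x) ?_
    rw [ae_iff]
    have h : {a : ℝ | ¬ 0 < a} = Set.Iic 0 := by ext; simp
    rw [h]
    exact price_nonpos_null E
  have h3 : ∀ᵐ s ∂E.seedLaw, {i | s.arrival i ≤ s.length}.Finite := by
    refine ae_finite_setOfPred_mem (s := fun i => {s : Seed | s.arrival i ≤ s.length}) ?_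
    refine ne_top_of_le_ne_top ?_ (ENNReal.tsum_le_tsum (seedLaw_arrival_le E))
    simp_rw [pow_succ]
    rw [ENNReal.tsum_mul_right, ENNReal.tsum_geometric]
    refine ENNReal.mul_ne_top ?_ ENNReal.ofReal_ne_top
    rw [ENNReal.inv_ne_top, ne_eq, tsub_eq_zero_iff_le, not_le]
    exact ENNReal.ofReal_lt_one.2 rho_lt_one
  filter_upwards [h1, h2, h3, ae_gap_pos E] with s a b c d
  exact ⟨a, d, b, c⟩

end alive


/-! ## The price law and the noise -/

section env

variable {m r : ℕ} {M : Model m r} (E : Environment M)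

/-- The win probability as a function of the bid. -/
def Environment.q : ℝ → ℝ := qFun M.b E.c

theorem t_nonneg (M : Model m r) (i : Fin (m + 1)) : 0 ≤ M.t i := by
  rw [← M.t_zero]; exact M.t_strictMono.monotone (Fin.zero_le _)

theorem b_nonneg (M : Model m r) (i : Fin (r + 1)) : 0 ≤ M.b i := by
  rw [← M.b_zero]; exact M.b_strictMono.monotone (Fin.zero_le _)

theorem isReward_k : IsReward E.k M.kInf := by
  have := isReward_kFun M.t_zero M.t_strictMono E.a_antitone E.a_last
  rwa [E.kInf_eq] at this

theorem continuous_k : Continuous E.k := continuous_kFun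

theorem kInf_nonneg (E : Environment M) : 0 ≤ M.kInf := ((isReward_k E).nonneg 0 le_rfl).trans ((isReward_k E).le 0 le_rfl)

theorem isSurplus_qFun (M : Model m r) {c : Fin r → ℝ} (hc : c ∈ densityPolytope M.b) :
    IsSurplus (surplus (qFun M.b c)) :=
  isSurplus_surplus continuous_qFun (qFun_nonneg M.b_strictMono hc.1)
    (fun v => (qFun_le M.b_strictMono hc.1 v).trans hc.2)
    (fun _ hv => qFun_of_nonpos M.b_strictMono M.b_zero hv)

theorem c_mem : E.c ∈ densityPolytope M.b := ⟨fun i => (E.c_pos i).le, E.c_sum.le⟩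

theorem isSurplus_q : IsSurplus (surplus E.q) := isSurplus_qFun M (c_mem E)

theorem q_nonneg (v : ℝ) : 0 ≤ E.q v := qFun_nonneg M.b_strictMono (c_mem E).1 _

theorem priceLaw_Iic {v : ℝ} (hv : v ≤ M.b (Fin.last r)) :
    E.priceLaw (Set.Iic v) = ENNReal.ofReal (E.q v) := by
  rcases le_total 0 v with h | h
  · exact E.priceLaw_cdf v h hv
  · rw [Environment.q, qFun_of_nonpos M.b_strictMono M.b_zero h, ENNReal.ofReal_zero]
    exact measure_mono_null (Set.Iic_subset_Iic.2 h) (price_nonpos_null E)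

theorem priceLaw_Ioc {u w : ℝ} (hu : u ≤ w) (hw : w ≤ M.b (Fin.last r)) :
    E.priceLaw (Set.Ioc u w) = ENNReal.ofReal (E.q w - E.q u) := by
  have hd : Set.Ioc u w = Set.Iic w \ Set.Iic u := by
    ext x; simp [and_comm]
  rw [hd, measure_sdiff (Set.Iic_subset_Iic.2 hu) measurableSet_Iic.nullMeasurableSet
    (measure_ne_top _ _), priceLaw_Iic E hw, priceLaw_Iic E (hu.trans hw),
    ENNReal.ofReal_sub _ (q_nonneg E _)]

/-- Limit of the half-open intervals (u - ε, w]; in particular there are no atoms up to b_r. -/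
theorem priceLaw_Icc_le {u w : ℝ} (hu : u ≤ w) (hw : w ≤ M.b (Fin.last r)) :
    E.priceLaw (Set.Icc u w) ≤ ENNReal.ofReal ((∑ i, E.c i) * (w - u)) := by
  have hC : 0 ≤ ∑ i, E.c i := Finset.sum_nonneg fun i _ => (E.c_pos i).le
  refine ge_of_tendsto (x := nhdsWithin 0 (Set.Ioi 0))
    (f := fun ε : ℝ => ENNReal.ofReal ((∑ i, E.c i) * (w - (u - ε)))) ?_ ?_
  · refine (ENNReal.continuous_ofReal.tendsto _).comp ?_
    refine Filter.Tendsto.mono_left ?_ nhdsWithin_le_nhds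
    have : Continuous fun ε : ℝ => (∑ i, E.c i) * (w - (u - ε)) := by fun_prop
    simpa using this.tendsto 0
  · filter_upwards [self_mem_nhdsWithin] with ε hε
    have hε' : 0 < ε := hε
    refine (measure_mono (t := Set.Ioc (u - ε) w) fun x hx => ⟨by linarith [hx.1], hx.2⟩).trans ?_
    rw [priceLaw_Ioc E (by linarith) hw]
    exact ENNReal.ofReal_le_ofReal
      (qFun_sub_le M.b_strictMono (c_mem E).1 (by linarith))

theorem ae_price_pos : ∀ᵐ p ∂E.priceLaw, 0 < p := by
  rw [ae_iff]
  have h : {a : ℝ | ¬ 0 < a} = Set.Iic 0 := by ext; simp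
  rw [h]
  exact price_nonpos_null E

/-- Layer cake formula: the expectation of (x - p)⁺ is the integral over 0 < t ≤ x of P(p ≤ x - t) =
q(x - t). -/
theorem integral_max_sub {x : ℝ} (hx : 0 ≤ x) (hx' : x ≤ M.b (Fin.last r)) :
    Integrable (fun p => max (x - p) 0) E.priceLaw ∧
    ∫ p, max (x - p) 0 ∂E.priceLaw = surplus E.q x := by
  have hbd : ∀ᵐ p ∂E.priceLaw, max (x - p) 0 ≤ x := by
    filter_upwards [ae_price_pos E] with p hp
    exact max_le (by linarith) hx
  have hint : Integrable (fun p => max (x - p) 0) E.priceLaw := by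
    refine Integrable.mono' (integrable_const x) (by fun_prop) ?_
    filter_upwards [hbd] with p hp
    rwa [Real.norm_eq_abs, abs_of_nonneg (le_max_right _ _)]
  refine ⟨hint, ?_⟩
  rw [hint.integral_eq_integral_Ioc_meas_le (Filter.Eventually.of_forall fun p => le_max_right _ _)
    hbd, surplus_eq]
  have h1 : ∀ t ∈ Set.Ioc 0 x, E.priceLaw.real {a | t ≤ max (x - a) 0} = E.q (x - t) := by
    intro t ht
    have : {a | t ≤ max (x - a) 0} = Set.Iic (x - t) := by
      ext a
      simp only [Set.mem_ofPred_eq, Set.mem_Iic, le_max_iff]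
      constructor
      · rintro (h | h)
        · linarith
        · linarith [ht.1]
      · intro h; left; linarith
    rw [this, Measure.real, priceLaw_Iic E (by linarith [ht.1]),
      ENNReal.toReal_ofReal (q_nonneg E _)]
  rw [setIntegral_congr_fun measurableSet_Ioc h1, ← intervalIntegral.integral_of_le hx,
    intervalIntegral.integral_comp_sub_left (fun y => E.q y) x]
  simp

open Classical in
/-- Expected surplus of the bid `v` when winning is worth `x`. -/
def Environment.gain (x v : ℝ) : ℝ := ∫ p, (if p < v then x - p else 0) ∂E.priceLaw

theorem integrable_gain (x : ℝ) {v : ℝ} (hv : 0 ≤ v) :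
    Integrable (fun p => if p < v then x - p else 0) E.priceLaw := by
  refine Integrable.mono' (integrable_const (|x| + v))
    (Measurable.ite measurableSet_Iio (by fun_prop) measurable_const).aestronglyMeasurable ?_
  filter_upwards [ae_price_pos E] with p hp
  split_ifs with h
  · rw [Real.norm_eq_abs]
    exact (abs_sub _ _).trans (by rw [abs_of_pos hp]; linarith)
  · rw [norm_zero]; positivity

/-- Truthful bidding is dominant in a second-price auction, price by price. Nothing is asked of the
law at the competing bid v, which may exceed b_r; so policies with arbitrary bounded bids are
covered. -/
theorem gain_le {x v : ℝ} (hx : 0 ≤ x) (hx' : x ≤ M.b (Fin.last r)) (hv : 0 ≤ v) :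
    E.gain x v ≤ surplus E.q x := by
  obtain ⟨h1, h2⟩ := integral_max_sub E hx hx'
  rw [← h2]
  refine integral_mono (integrable_gain E x hv) h1 fun p => ?_
  dsimp only
  split_ifs
  · exact le_max_left _ _
  · exact le_max_right _ _

/-- The bids x and v give different outcomes only for prices between them. That interval has
probability at most (∑ c_i) d, and the loss there is at most d: hence the square. -/
theorem le_gain {x v d : ℝ} (hx : 0 ≤ x) (hx' : x ≤ M.b (Fin.last r)) (hv : 0 ≤ v)
    (hv' : v ≤ M.b (Fin.last r)) (hd : |x - v| ≤ d) :
    surplus E.q x - (∑ i, E.c i) * d ^ 2 ≤ E.gain x v := by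
  have hC : 0 ≤ ∑ i, E.c i := Finset.sum_nonneg fun i _ => (E.c_pos i).le
  obtain ⟨h1, h2⟩ := integral_max_sub E hx hx'
  have hd0 : 0 ≤ d := (abs_nonneg _).trans hd
  rw [sub_le_comm, ← h2, Environment.gain, ← integral_sub h1 (integrable_gain E x hv)]
  have h3 : ∫ p, (max (x - p) 0 - if p < v then x - p else 0) ∂E.priceLaw ≤
      ∫ p, (Set.Icc (min x v) (max x v)).indicator (fun _ => |x - v|) p ∂E.priceLaw := by
    refine integral_mono (h1.sub (integrable_gain E x hv))
      ((integrable_const _).indicator measurableSet_Icc) fun p => ?_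
    dsimp only
    by_cases hp : p ∈ Set.Icc (min x v) (max x v)
    · rw [Set.indicator_of_mem hp]
      rcases le_total x v with h | h
      · rw [min_eq_left h, max_eq_right h] at hp
        rw [abs_sub_comm, abs_of_nonneg (sub_nonneg.2 h), max_eq_right (by linarith [hp.1])]
        split_ifs <;> linarith [hp.1, hp.2]
      · rw [min_eq_right h, max_eq_left h] at hp
        rw [abs_of_nonneg (sub_nonneg.2 h), max_eq_left (by linarith [hp.2])]
        split_ifs <;> linarith [hp.1, hp.2]
    · rw [Set.indicator_of_notMem hp]
      simp only [Set.mem_Icc, not_and_or, not_le] at hp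
      rcases hp with hp | hp
      · rw [lt_min_iff] at hp
        rw [if_pos hp.2, max_eq_left (by linarith [hp.1]), sub_self]
      · rw [max_lt_iff] at hp
        rw [if_neg (by linarith [hp.2]), max_eq_right (by linarith [hp.1]), sub_self]
  refine h3.trans ?_
  rw [integral_indicator_const _ measurableSet_Icc, smul_eq_mul]
  have h4 : E.priceLaw.real (Set.Icc (min x v) (max x v)) ≤ (∑ i, E.c i) * |x - v| := by
    rw [Measure.real]
    refine ENNReal.toReal_le_of_le_ofReal (by positivity) ?_
    refine (priceLaw_Icc_le E min_le_max (max_le hx' hv')).trans ?_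
    rw [max_sub_min_eq_abs', abs_sub_comm]
  calc _ ≤ (∑ i, E.c i) * |x - v| * |x - v| := mul_le_mul_of_nonneg_right h4 (abs_nonneg _)
    _ = (∑ i, E.c i) * |x - v| ^ 2 := by ring
    _ ≤ _ := mul_le_mul_of_nonneg_left (pow_le_pow_left₀ (abs_nonneg _) hd 2) hC

/-- The moment generating function lies below exp(c t²/2), with equality at t = 0. Their difference
has a maximum there, so its derivative, which is the mean, vanishes. -/
theorem integral_eq_zero_of_hasSubgaussianMGF {Ω : Type*} [MeasurableSpace Ω] {ν : Measure Ω}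
    [IsProbabilityMeasure ν] {X : Ω → ℝ} {c : NNReal} (h : HasSubgaussianMGF X c ν) :
    ∫ ω, X ω ∂ν = 0 := by
  have h0 : (0:ℝ) ∈ interior (integrableExpSet X ν) := by simp [h.integrableExpSet_eq_univ]
  have h1 := hasDerivAt_mgf h0
  have h2 : HasDerivAt (fun t : ℝ => Real.exp (c * t ^ 2 / 2)) 0 0 := by
    have := (((hasDerivAt_pow 2 (0:ℝ)).const_mul (c:ℝ)).div_const 2).exp
    exact this.congr_deriv (by simp)
  have h3 := h1.sub h2
  have hmax : IsLocalMax (fun t => mgf X ν t - Real.exp (c * t ^ 2 / 2)) 0 := by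
    refine Filter.Eventually.of_forall fun t => ?_
    have := h.mgf_le t
    simp only [mgf_zero]
    simpa using this
  have h4 := hmax.hasDerivAt_eq_zero h3
  simpa using h4

/-- A bound for the mean absolute value of the noise. -/
def Environment.noiseBound : ℝ := 2 * Real.exp (E.sigmaSq / 2)

theorem lintegral_noise_le {τ : ℝ} (hτ : 0 ≤ τ) :
    ∫⁻ u, ‖E.noise τ u‖ₑ ∂E.noiseSeedLaw ≤ ENNReal.ofReal E.noiseBound := by
  have h := E.noise_subgaussian τ hτ
  have hi : Integrable (fun u => Real.exp (1 * E.noise τ u) + Real.exp (-1 * E.noise τ u))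
      E.noiseSeedLaw := (h.integrable_exp_mul 1).add (h.integrable_exp_mul (-1))
  have h1 : ∫⁻ u, ‖E.noise τ u‖ₑ ∂E.noiseSeedLaw ≤ ∫⁻ u, ENNReal.ofReal
      (Real.exp (1 * E.noise τ u) + Real.exp (-1 * E.noise τ u)) ∂E.noiseSeedLaw := by
    refine lintegral_mono fun u => ?_
    rw [← ofReal_norm]
    refine ENNReal.ofReal_le_ofReal ?_
    rw [Real.norm_eq_abs]
    have e1 := Real.add_one_le_exp (1 * E.noise τ u)
    have e2 := Real.add_one_le_exp (-1 * E.noise τ u)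
    have e3 := Real.exp_pos (1 * E.noise τ u)
    have e4 := Real.exp_pos (-1 * E.noise τ u)
    rw [abs_le]
    constructor <;> linarith
  refine h1.trans ?_
  rw [← ofReal_integral_eq_lintegral_ofReal hi (Filter.Eventually.of_forall fun u => by
    positivity)]
  refine ENNReal.ofReal_le_ofReal ?_
  rw [integral_add (h.integrable_exp_mul 1) (h.integrable_exp_mul (-1))]
  have e1 := h.mgf_le 1
  have e2 := h.mgf_le (-1)
  simp only [mgf] at e1 e2
  norm_num at e1 e2
  rw [Environment.noiseBound]
  simp only [one_mul, neg_mul]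
  linarith

end env

/-- The equation says nothing about negative times; a version frozen there is measurable on the
whole line. -/
theorem IsBell.exists_continuous {γ μ : ℝ} {k f Y : ℝ → ℝ} (hY : IsBell γ μ k f Y) :
    ∃ Z, Continuous Z ∧ IsBell γ μ k f Z ∧ ∀ t, 0 ≤ t → Z t = Y t := by
  have he : ∀ t, 0 ≤ t → Y (max t 0) = Y t := fun t ht => by rw [max_eq_left ht]
  refine ⟨fun t => Y (max t 0), hY.continuousOn.comp_continuous (by fun_prop)
    (fun t => Set.mem_Ici.2 (le_max_right _ _)), ⟨?_, fun t ht => ?_, ?_⟩, he⟩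
  · simpa using hY.1
  · simp only [he t ht, he 0 le_rfl]
    exact (hY.2.1 t ht).congr (fun x hx => he x hx) (he t ht)
  · obtain ⟨B, hB⟩ := hY.2.2
    exact ⟨B, fun t ht => by simpa only [he t ht] using hB t ht⟩

/-- The Bellman equation in integrated form. -/
theorem IsBell.integral_eq {γ μ K : ℝ} {k f Y : ℝ → ℝ} (hγ : 0 < γ) (hμ : 0 < μ)
    (hk : IsReward k K) (hf : IsSurplus f) (hY : IsBell γ μ k f Y) {x : ℝ} (hx : 0 ≤ x) :
    ∫ g, Real.exp (-(γ * g)) * (Y (x + g) + f (k (x + g) + Y 0 - Y (x + g))) ∂(expMeasure μ)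
      = Y x := by
  obtain ⟨B, hB⟩ := hY.2.2
  have hν : 0 < γ + μ := by positivity
  rw [integral_expMeasure hμ]
  -- The integrand has the antiderivative -exp(-(γ+μ) g) Y(x + g), which is -Y x at 0 and tends to 0
  -- at infinity because Y is bounded.
  have hder : ∀ g, 0 ≤ g → HasDerivWithinAt (fun g => -(Real.exp (-(γ + μ) * g) * Y (x + g)))
      (μ * Real.exp (-(μ * g)) * (Real.exp (-(γ * g)) *
        (Y (x + g) + f (k (x + g) + Y 0 - Y (x + g))))) (Set.Ici 0) g := by
    intro g hg
    have h1 := hY.2.1 (x + g) (add_nonneg hx hg)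
    have h2 : HasDerivWithinAt (fun s => x + s) 1 (Set.Ici 0) g :=
      ((hasDerivAt_id g).const_add x).hasDerivWithinAt
    have h3 := h1.scomp g h2 (fun s hs => add_nonneg hx hs)
    have h4 : HasDerivAt (fun g => Real.exp (-(γ + μ) * g))
        (Real.exp (-(γ + μ) * g) * -(γ + μ)) g := by
      have := ((hasDerivAt_id g).const_mul (-(γ + μ))).exp
      rwa [mul_one] at this
    have h5 : Real.exp (-(μ * g)) * Real.exp (-(γ * g)) = Real.exp (-(γ + μ) * g) := by
      rw [← Real.exp_add]; congr 1; ring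
    refine (h4.hasDerivWithinAt.mul h3).neg.congr_deriv ?_
    simp only [Function.comp_apply, one_smul]
    linear_combination (-(μ * (Y (x + g) + f (k (x + g) + Y 0 - Y (x + g))))) * h5
  have hbd : ∀ g, 0 ≤ g → |Y (x + g) + f (k (x + g) + Y 0 - Y (x + g))| ≤ B + f K := by
    intro g hg
    have h0 := add_nonneg hx hg
    refine (abs_add_le _ _).trans (add_le_add (hB _ h0) ?_)
    rw [abs_of_nonneg (hf.nonneg _)]
    exact hf.mono _ _ ((hY.bid_le hγ hμ hk hf h0).trans (hk.le _ h0))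
  have hcont : ContinuousOn (fun g => μ * Real.exp (-(μ * g)) * (Real.exp (-(γ * g)) *
        (Y (x + g) + f (k (x + g) + Y 0 - Y (x + g))))) (Set.Ici 0) := by
    have hs : Set.MapsTo (fun g => x + g) (Set.Ici (0:ℝ)) (Set.Ici 0) :=
      fun g hg => add_nonneg hx hg
    have hY' : ContinuousOn (fun g => Y (x + g)) (Set.Ici 0) :=
      hY.continuousOn.comp (by fun_prop) hs
    have hk' : ContinuousOn (fun g => k (x + g)) (Set.Ici 0) := hk.cont.comp (by fun_prop) hs
    exact ContinuousOn.mul (by fun_prop) (ContinuousOn.mul (by fun_prop)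
      (hY'.add (hf.continuous.comp_continuousOn ((hk'.add continuousOn_const).sub hY'))))
  have hint : IntegrableOn (fun g => μ * Real.exp (-(μ * g)) * (Real.exp (-(γ * g)) *
        (Y (x + g) + f (k (x + g) + Y 0 - Y (x + g))))) (Set.Ioi 0) := by
    refine Integrable.mono' ((integrableOn_exp_mul_Ioi (neg_lt_zero.2 hμ) 0).const_mul
      (μ * (B + f K))) ((hcont.mono Set.Ioi_subset_Ici_self).aestronglyMeasurable
      measurableSet_Ioi) ?_
    rw [ae_restrict_iff' measurableSet_Ioi]
    refine Filter.Eventually.of_forall fun g hg => ?_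
    have hg0 : 0 ≤ g := le_of_lt hg
    rw [norm_mul, norm_mul, Real.norm_eq_abs, Real.norm_eq_abs, Real.norm_eq_abs, abs_mul,
      abs_of_pos hμ, abs_of_pos (Real.exp_pos _), abs_of_pos (Real.exp_pos _)]
    have h1 : Real.exp (-(γ * g)) ≤ 1 := Real.exp_le_one_iff.2 (by nlinarith)
    have h2 := hbd g hg0
    have h3 : Real.exp (-(γ * g)) * |Y (x + g) + f (k (x + g) + Y 0 - Y (x + g))| ≤
        1 * (B + f K) := mul_le_mul h1 h2 (abs_nonneg _) zero_le_one
    calc _ ≤ μ * Real.exp (-(μ * g)) * (1 * (B + f K)) :=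
          mul_le_mul_of_nonneg_left h3 (by positivity)
      _ = _ := by rw [neg_mul]; ring
  have hlim : Filter.Tendsto (fun g => -(Real.exp (-(γ + μ) * g) * Y (x + g))) Filter.atTop
      (nhds 0) := by
    rw [← neg_zero]
    refine Filter.Tendsto.neg ?_
    have he : Filter.Tendsto (fun g => Real.exp (-(γ + μ) * g) * B) Filter.atTop (nhds 0) := by
      rw [← zero_mul B]
      refine Filter.Tendsto.mul_const B (Real.tendsto_exp_atBot.comp ?_)
      exact Filter.tendsto_id.const_mul_atTop_of_neg (neg_lt_zero.2 hν)
    refine squeeze_zero_norm' ?_ he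
    filter_upwards [Filter.eventually_ge_atTop 0] with g hg
    rw [norm_mul, Real.norm_eq_abs, Real.norm_eq_abs, abs_of_pos (Real.exp_pos _)]
    exact mul_le_mul_of_nonneg_left (hB _ (add_nonneg hx hg)) (Real.exp_pos _).le
  rw [integral_Ioi_of_hasDerivAt_of_tendsto (hder 0 le_rfl).continuousWithinAt
    (fun g hg => (hder g (le_of_lt hg)).hasDerivAt (Ici_mem_nhds hg)) hint hlim]
  simp


/-! ## The value of a policy -/

theorem Resamples.integrable_integral {A X : Type*} [MeasurableSpace A] [MeasurableSpace X]
    {μ : Measure A} {ν : Measure X} [IsProbabilityMeasure μ] [IsProbabilityMeasure ν]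
    {Φ : A → X → A} (h : Resamples Φ μ ν) {F H : A → ℝ}
    (hF : Integrable F μ) (hH : ∀ᵐ s ∂μ, ∫ x, F (Φ s x) ∂ν = H s) : Integrable H μ :=
  (h.integrable_comp_of_integrable hF).integral_prod_left.congr hH

section value

variable {m r : ℕ} {M : Model m r} (E : Environment M)

attribute [local instance] isProbabilityMeasure_gamma isProbabilityMeasure_mu

/-- The auctions that arrive before the end of the episode. -/
def alive (i : ℕ) : Set Seed := {s | s.arrival i ≤ s.length}

theorem measurableSet_alive (i : ℕ) : MeasurableSet (alive i) := measurableSet_arrival_le i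

/-- Time of the arrival preceding the `i`-th one. -/
def Seed.prevArrival (s : Seed) (i : ℕ) : ℝ := ∑ j ∈ Finset.range i, s.gap j

def prevAlive (i : ℕ) : Set Seed := {s | s.prevArrival i ≤ s.length}

theorem measurable_prevArrival (i : ℕ) : Measurable fun s : Seed => s.prevArrival i :=
  Finset.measurable_sum _ fun j _ => measurable_gap j

theorem measurableSet_prevAlive (i : ℕ) : MeasurableSet (prevAlive i) :=
  measurableSet_le (measurable_prevArrival i) measurable_length

/-- Time since the last win just after the `i`-th renewal time. -/
def restAge (π : ℝ → ℝ) (s : Seed) (i : ℕ) : ℝ := s.prevArrival i - lastWin π s i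

theorem age_eq (π : ℝ → ℝ) (s : Seed) (i : ℕ) : age π s i = restAge π s i + s.gap i := by
  rw [age, restAge, s.arrival_eq, Seed.prevArrival]; ring

theorem restAge_succ (π : ℝ → ℝ) (s : Seed) (i : ℕ) [Decidable (Won π s i)] :
    restAge π s (i + 1) = if Won π s i then 0 else age π s i := by
  split_ifs with h
  · rw [restAge, lastWin_succ_of_won h]; exact sub_self _
  · rw [restAge, lastWin_succ_of_not_won h]; rfl

theorem Seed.Good.restAge_nonneg {s : Seed} (hs : s.Good) (π : ℝ → ℝ) (i : ℕ) :
    0 ≤ restAge π s i := sub_nonneg.2 (hs.lastWin_mem π i).2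

section meas

variable {π : ℝ → ℝ} (hπ : Measurable π)
include hπ

theorem measurable_lastWin' (i : ℕ) : Measurable fun s => lastWin π s i :=
  measurable_lastWin (Pol := fun _ => π) (hπ.comp measurable_snd) measurable_id i

theorem measurable_age' (i : ℕ) : Measurable fun s => age π s i :=
  (measurable_arrival i).sub (measurable_lastWin' hπ i)

theorem measurable_restAge (i : ℕ) : Measurable fun s => restAge π s i :=
  (measurable_prevArrival i).sub (measurable_lastWin' hπ i)

theorem measurableSet_won' (i : ℕ) : MeasurableSet {s | Won π s i} :=
  measurableSet_won (Pol := fun _ => π) (hπ.comp measurable_snd) measurable_id i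

end meas

theorem seedLaw_alive_le (i : ℕ) : E.seedLaw.real (alive i) ≤ M.rho ^ (i + 1) := by
  refine ENNReal.toReal_le_of_le_ofReal (pow_nonneg rho_pos.le _) ?_
  rw [ENNReal.ofReal_pow rho_pos.le]
  exact seedLaw_arrival_le E i

theorem integrable_of_bound {F : Seed → ℝ} (hF : Measurable F) {C : ℝ}
    (h : ∀ s : Seed, s.Good → |F s| ≤ C) : Integrable F E.seedLaw := by
  refine Integrable.mono' (integrable_const C) hF.aestronglyMeasurable ?_
  filter_upwards [ae_good E] with s hs
  exact h s hs

theorem integral_exp_indicator {x : ℝ} (hx : 0 ≤ x) (z : ℝ) :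
    ∫ l, (Set.Ici x).indicator (fun _ => z) l ∂(expMeasure M.gamma) =
      Real.exp (-(M.gamma * x)) * z := by
  rw [integral_indicator_const _ measurableSet_Ici, Measure.real, expMeasure_Ici M.gamma_pos hx,
    ENNReal.toReal_ofReal (Real.exp_pos _).le, smul_eq_mul]

open Classical in
/-- Expected contribution of the `i`-th auction, without the noise. -/
def Environment.meanTerm (π : ℝ → ℝ) (i : ℕ) (s : Seed) : ℝ :=
  (alive i).indicator (fun s => if Won π s i then E.k (age π s i) - s.price i else 0) s

open Classical in
def Environment.noiseTerm (π : ℝ → ℝ) (i : ℕ) (s : Seed) : ℝ :=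
  (alive i).indicator
    (fun s => if Won π s i then E.noise (age π s i) (s.noiseSeed i) else 0) s

section step

variable {π Y : ℝ → ℝ} (hπ : Measurable π) {B : ℝ} (hB : ∀ τ, 0 ≤ π τ ∧ π τ ≤ B)
  (hYc : Continuous Y) (hY : IsBell M.gamma M.mu E.k (surplus E.q) Y)

include hB in
theorem abs_meanTerm_le (i : ℕ) {s : Seed} (hs : s.Good) :
    |E.meanTerm π i s| ≤ M.kInf + B := by
  classical
  have hB0 := (hB 0).1.trans (hB 0).2
  have hK := kInf_nonneg E
  rw [Environment.meanTerm]
  by_cases h : s ∈ alive i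
  · rw [Set.indicator_of_mem h]
    split_ifs with hw
    · have h1 := (isReward_k E).nonneg _ (hs.age_pos π i).le
      have h2 := (isReward_k E).le _ (hs.age_pos π i).le
      have h3 := hs.price_pos i
      have h4 : s.price i ≤ B := hw.le.trans (hB _).2
      rw [abs_le]; constructor <;> linarith
    · rw [abs_zero]; positivity
  · rw [Set.indicator_of_notMem h, abs_zero]; positivity

include hπ in
theorem measurable_meanTerm (i : ℕ) : Measurable (E.meanTerm π i) := by
  classical
  refine Measurable.indicator ?_ (measurableSet_alive i)
  exact Measurable.ite (measurableSet_won' hπ i)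
    (((continuous_k E).measurable.comp (measurable_age' hπ i)).sub (measurable_price i))
    measurable_const

include hπ hB in
theorem integrable_meanTerm (i : ℕ) : Integrable (E.meanTerm π i) E.seedLaw :=
  integrable_of_bound E (measurable_meanTerm E hπ i) fun _ hs => abs_meanTerm_le E hB i hs

/-- The worth of an auction at age `τ`, before the price-to-beat is known. -/
def Environment.worth (Y : ℝ → ℝ) (τ : ℝ) : ℝ := Y τ + surplus E.q (E.k τ + Y 0 - Y τ)

/-- Expected value of the game from the `i`-th renewal time on. -/
def Environment.cont (π Y : ℝ → ℝ) (i : ℕ) : ℝ :=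
  ∫ s, (prevAlive i).indicator (fun s => Y (restAge π s i)) s ∂E.seedLaw

include hY in
theorem abs_worth_le {BY : ℝ} (hBY : ∀ t, 0 ≤ t → |Y t| ≤ BY) {τ : ℝ} (hτ : 0 ≤ τ) :
    |E.worth Y τ| ≤ BY + surplus E.q M.kInf := by
  refine (abs_add_le _ _).trans (add_le_add (hBY τ hτ) ?_)
  rw [abs_of_nonneg ((isSurplus_q E).nonneg _)]
  exact (isSurplus_q E).mono _ _ ((hY.bid_le M.gamma_pos M.mu_pos (isReward_k E) (isSurplus_q E)
    hτ).trans ((isReward_k E).le _ hτ))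

include hYc in
theorem continuous_worth : Continuous (E.worth Y) := by
  have := (isSurplus_q E).continuous
  have := continuous_k E
  unfold Environment.worth
  exact hYc.add ((isSurplus_q E).continuous.comp ((continuous_k E |>.add continuous_const).sub hYc))

include hπ hYc hY in
theorem integrable_alive_worth (i : ℕ) :
    Integrable ((alive i).indicator fun s => E.worth Y (age π s i)) E.seedLaw := by
  obtain ⟨BY, hBY⟩ := hY.2.2
  refine integrable_of_bound E (C := BY + surplus E.q M.kInf)
    (((continuous_worth E hYc).measurable.comp (measurable_age' hπ i)).indicator
      (measurableSet_alive i)) fun s hs => ?_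
  have h1 := abs_worth_le E hY hBY (hs.age_pos π i).le
  by_cases h : s ∈ alive i
  · rw [Set.indicator_of_mem h]; exact h1
  · rw [Set.indicator_of_notMem h, abs_zero]; exact (abs_nonneg _).trans h1

include hπ hYc hY in
theorem integrable_cont (i : ℕ) :
    Integrable ((prevAlive i).indicator fun s => Y (restAge π s i)) E.seedLaw := by
  obtain ⟨BY, hBY⟩ := hY.2.2
  refine integrable_of_bound E (C := BY)
    ((hYc.measurable.comp (measurable_restAge hπ i)).indicator
      (measurableSet_prevAlive i)) fun s hs => ?_
  have h1 := hBY _ (hs.restAge_nonneg π i)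
  by_cases h : s ∈ prevAlive i
  · rw [Set.indicator_of_mem h]; exact h1
  · rw [Set.indicator_of_notMem h, abs_zero]; exact (abs_nonneg _).trans h1

include hπ hYc hY in
/-- Waiting for the next arrival. -/
theorem integral_alive_worth (i : ℕ) :
    ∫ s, (alive i).indicator (fun s => E.worth Y (age π s i)) s ∂E.seedLaw = E.cont π Y i := by
  obtain ⟨BY, hBY⟩ := hY.2.2
  have hage : ∀ (s : Seed) x, age π (s.setLength x) i = age π s i := fun s x =>
    age_congr (fun _ _ => rfl) (fun _ _ => rfl)
  have hrest : ∀ (s : Seed) x, restAge π (s.setLength x) i = restAge π s i := fun s x => by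
    have h1 : lastWin π (s.setLength x) i = lastWin π s i :=
      lastWin_congr (fun _ _ => rfl) (fun _ _ => rfl)
    simp only [restAge, h1]; rfl
  -- Averaging over the length replaces the survival indicator by exp(-γ · arrival); ages do not
  -- depend on the length.
  have e1 : ∫ s, (alive i).indicator (fun s => E.worth Y (age π s i)) s ∂E.seedLaw =
      ∫ s, Real.exp (-(M.gamma * s.arrival i)) * E.worth Y (age π s i) ∂E.seedLaw := by
    refine (resamples_length E).integral_eq (integrable_alive_worth E hπ hYc hY i) ?_
    filter_upwards [ae_good E] with s hs
    rw [← integral_exp_indicator (hs.arrival_pos i).le]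
    congr 1
    ext x
    simp only [Set.indicator, hage]
    rfl
  have e2 : E.cont π Y i =
      ∫ s, Real.exp (-(M.gamma * s.prevArrival i)) * Y (restAge π s i) ∂E.seedLaw := by
    refine (resamples_length E).integral_eq (integrable_cont E hπ hYc hY i) ?_
    filter_upwards [ae_good E] with s hs
    have hp : 0 ≤ s.prevArrival i := Finset.sum_nonneg fun j _ => (hs.gap_pos j).le
    rw [← integral_exp_indicator hp]
    congr 1
    ext x
    simp only [Set.indicator, hrest]
    rfl
  rw [e1, e2]
  have hint : Integrable (fun s => Real.exp (-(M.gamma * s.arrival i)) * E.worth Y (age π s i))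
      E.seedLaw := by
    refine integrable_of_bound E (C := 1 * (BY + surplus E.q M.kInf)) (Measurable.mul (by fun_prop)
      ((continuous_worth E hYc).measurable.comp (measurable_age' hπ i))) fun s hs => ?_
    rw [abs_mul, abs_of_pos (Real.exp_pos _)]
    refine mul_le_mul (Real.exp_le_one_iff.2 ?_) (abs_worth_le E hY hBY (hs.age_pos π i).le)
      (abs_nonneg _) zero_le_one
    have := mul_nonneg M.gamma_pos.le (hs.arrival_pos i).le
    linarith
  refine (resamples_gap E i).integral_eq hint ?_
  filter_upwards [ae_good E] with s hs
  have hr : ∀ x, restAge π (s.setGap i x) i = restAge π s i := fun x => by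
    have h1 : ∀ j < i, (s.setGap i x).gap j = s.gap j := fun j hj =>
      Function.update_of_ne hj.ne _ _
    rw [restAge, restAge, lastWin_congr (s' := s) h1 (fun _ _ => rfl), Seed.prevArrival,
      Finset.sum_congr rfl fun j hj => h1 j (Finset.mem_range.1 hj)]
    rfl
  have hp : ∀ x, (s.setGap i x).prevArrival i = s.prevArrival i := fun x =>
    Finset.sum_congr rfl fun j hj => Function.update_of_ne (Finset.mem_range.1 hj).ne _ _
  have hg : ∀ x, (s.setGap i x).gap i = x := fun x => Function.update_self _ _ _
  have ha : ∀ x, (s.setGap i x).arrival i = s.prevArrival i + x := fun x => by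
    rw [Seed.arrival_eq, hg, ← hp x]; rfl
  -- With the past fixed only the i-th waiting time is averaged: exp(-γ · prevArrival) factors out,
  -- and what remains is the integrated Bellman equation at the age `restAge`.
  simp only [age_eq, hr, hg, ha]
  rw [← hY.integral_eq M.gamma_pos M.mu_pos (isReward_k E) (isSurplus_q E)
    (hs.restAge_nonneg π i), ← integral_const_mul]
  congr 1
  ext x
  rw [mul_add, neg_add, Real.exp_add, mul_assoc]
  rfl

include hπ hB hYc hY in
/-- One auction: the loss against the worth is the loss of surplus. -/
theorem integral_meanTerm_add_cont (i : ℕ) :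
    ∫ s, E.meanTerm π i s ∂E.seedLaw + E.cont π Y (i + 1) =
      ∫ s, (alive i).indicator (fun s => Y (age π s i) +
        E.gain (E.k (age π s i) + Y 0 - Y (age π s i)) (π (age π s i))) s ∂E.seedLaw ∧
    Integrable ((alive i).indicator (fun s => Y (age π s i) +
        E.gain (E.k (age π s i) + Y 0 - Y (age π s i)) (π (age π s i)))) E.seedLaw := by
  classical
  have hi := (integrable_meanTerm E hπ hB i).add (integrable_cont E hπ hYc hY (i + 1))
  have hage : ∀ (s : Seed) x, age π (s.setPrice i x) i = age π s i := fun s x =>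
    age_congr (fun _ _ => rfl) (fun j hj => Function.update_of_ne hj.ne _ _)
  have hwon : ∀ (s : Seed) x, Won π (s.setPrice i x) i ↔ x < π (age π s i) := fun s x => by
    rw [Won, hage]
    have : (s.setPrice i x).price i = x := Function.update_self _ _ _
    rw [this]
  have hkey : ∀ᵐ s ∂E.seedLaw, ∫ x, (E.meanTerm π i + (prevAlive (i + 1)).indicator
      fun s => Y (restAge π s (i + 1))) (s.setPrice i x) ∂E.priceLaw =
      (alive i).indicator (fun s => Y (age π s i) +
        E.gain (E.k (age π s i) + Y 0 - Y (age π s i)) (π (age π s i))) s := by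
    refine Filter.Eventually.of_forall fun s => ?_
    have h1 : ∀ x, (E.meanTerm π i + (prevAlive (i + 1)).indicator
      fun s => Y (restAge π s (i + 1))) (s.setPrice i x) = (alive i).indicator (fun s =>
        Y (age π s i) + if x < π (age π s i) then
          E.k (age π s i) + Y 0 - Y (age π s i) - x else 0) s := by
      intro x
      have hp : (s.setPrice i x).price i = x := Function.update_self _ _ _
      rw [Pi.add_apply, Environment.meanTerm]
      -- `alive i` and `prevAlive (i + 1)` are the same event. After a win the age restarts at 0, so
      -- winning changes the continuation from Y(age) to Y 0; this is why the auction is worth k + Y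
      -- 0 - Y.
      by_cases hs : s ∈ alive i
      · have h2 : s.setPrice i x ∈ alive i := hs
        have h3 : s.setPrice i x ∈ prevAlive (i + 1) := hs
        rw [Set.indicator_of_mem hs, Set.indicator_of_mem h2, Set.indicator_of_mem h3,
          restAge_succ]
        simp only [hwon, hage, hp]
        split_ifs <;> ring
      · have h2 : s.setPrice i x ∉ alive i := hs
        have h3 : s.setPrice i x ∉ prevAlive (i + 1) := hs
        rw [Set.indicator_of_notMem hs, Set.indicator_of_notMem h2, Set.indicator_of_notMem h3,
          add_zero]
    simp_rw [h1]
    by_cases hs : s ∈ alive i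
    · simp only [Set.indicator_of_mem hs]
      rw [integral_add (integrable_const _) (integrable_gain E _ (hB _).1)]
      simp [Environment.gain]
    · simp only [Set.indicator_of_notMem hs, integral_zero]
  constructor
  · rw [Environment.cont, ← integral_add (integrable_meanTerm E hπ hB i)
      (integrable_cont E hπ hYc hY (i + 1))]
    exact (resamples_price E i).integral_eq hi hkey
  · exact (resamples_price E i).integrable_integral hi hkey

theorem bid_mem (hY : IsBell M.gamma M.mu E.k (surplus E.q) Y) {τ : ℝ} (hτ : 0 ≤ τ) :
    0 ≤ E.k τ + Y 0 - Y τ ∧ E.k τ + Y 0 - Y τ ≤ M.b (Fin.last r) :=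
  ⟨hY.bid_nonneg M.gamma_pos M.mu_pos (isReward_k E) (isSurplus_q E) hτ,
    (hY.bid_le M.gamma_pos M.mu_pos (isReward_k E) (isSurplus_q E) hτ).trans
      (((isReward_k E).le _ hτ).trans M.kInf_le)⟩

include hπ hB hYc hY in
theorem meanTerm_add_cont_le (i : ℕ) :
    ∫ s, E.meanTerm π i s ∂E.seedLaw + E.cont π Y (i + 1) ≤ E.cont π Y i := by
  obtain ⟨h1, h2⟩ := integral_meanTerm_add_cont E hπ hB hYc hY i
  rw [h1, ← integral_alive_worth E hπ hYc hY i]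
  refine integral_mono_ae h2 (integrable_alive_worth E hπ hYc hY i) ?_
  filter_upwards [ae_good E] with s hs
  obtain ⟨h3, h4⟩ := bid_mem E hY (hs.age_pos π i).le
  exact Set.indicator_le_indicator (add_le_add_right (gain_le E h3 h4 (hB _).1) _)

-- A bid within d of the worth loses at most (∑ c_i) d² of surplus, and only if the i-th auction
-- takes place.
include hπ hB hYc hY in
theorem le_meanTerm_add_cont (hb : ∀ τ, π τ ≤ M.b (Fin.last r)) {d : ℝ}
    (hd : ∀ τ, 0 ≤ τ → |E.k τ + Y 0 - Y τ - π τ| ≤ d) (i : ℕ) :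
    E.cont π Y i - (∑ i, E.c i) * d ^ 2 * M.rho ^ (i + 1) ≤
      ∫ s, E.meanTerm π i s ∂E.seedLaw + E.cont π Y (i + 1) := by
  have hC : 0 ≤ ∑ i, E.c i := Finset.sum_nonneg fun i _ => (E.c_pos i).le
  obtain ⟨h1, h2⟩ := integral_meanTerm_add_cont E hπ hB hYc hY i
  rw [h1, ← integral_alive_worth E hπ hYc hY i]
  have h3 : Integrable ((alive i).indicator fun _ => (∑ i, E.c i) * d ^ 2) E.seedLaw :=
    (integrable_const _).indicator (measurableSet_alive i)
  have h4 : ∫ s, (alive i).indicator (fun _ => (∑ i, E.c i) * d ^ 2) s ∂E.seedLaw ≤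
      (∑ i, E.c i) * d ^ 2 * M.rho ^ (i + 1) := by
    rw [integral_indicator_const _ (measurableSet_alive i), smul_eq_mul, mul_comm]
    exact mul_le_mul_of_nonneg_left (seedLaw_alive_le E i) (by positivity)
  have h5 : ∫ s, (alive i).indicator (fun s => E.worth Y (age π s i)) s ∂E.seedLaw ≤
      ∫ s, ((alive i).indicator (fun s => Y (age π s i) +
        E.gain (E.k (age π s i) + Y 0 - Y (age π s i)) (π (age π s i))) s +
        (alive i).indicator (fun _ => (∑ i, E.c i) * d ^ 2) s) ∂E.seedLaw := by
    refine integral_mono_ae (integrable_alive_worth E hπ hYc hY i) (h2.add h3) ?_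
    filter_upwards [ae_good E] with s hs
    have ha := (hs.age_pos π i).le
    obtain ⟨h3, h4⟩ := bid_mem E hY ha
    have h6 := le_gain E h3 h4 (hB (age π s i)).1 (hb _) (hd _ ha)
    by_cases h : s ∈ alive i
    · simp only [Set.indicator_of_mem h, Environment.worth]
      linarith
    · simp only [Set.indicator_of_notMem h]
      linarith
  rw [integral_add h2 h3] at h5
  linarith

theorem seedLaw_prevAlive_le (i : ℕ) : E.seedLaw.real (prevAlive i) ≤ M.rho ^ i := by
  cases i with
  | zero => rw [pow_zero]; exact measureReal_le_one
  | succ i => exact seedLaw_alive_le E i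

include hY in
theorem cont_bounds (hπ : Measurable π) (hYc : Continuous Y) {BY : ℝ}
    (hBY : ∀ t, 0 ≤ t → |Y t| ≤ BY) (i : ℕ) :
    0 ≤ E.cont π Y i ∧ E.cont π Y i ≤ BY * M.rho ^ i := by
  have hBY0 : 0 ≤ BY := (abs_nonneg _).trans (hBY 0 le_rfl)
  constructor
  · refine integral_nonneg_of_ae ?_
    filter_upwards [ae_good E] with s hs
    have h1 := hs.restAge_nonneg π i
    have h2 : 0 ≤ Y (restAge π s i) := hY.1.trans (hY.monotone M.gamma_pos M.mu_pos
      (isReward_k E) (isSurplus_q E) le_rfl h1)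
    by_cases h : s ∈ prevAlive i
    · simp only [Set.indicator_of_mem h]; exact h2
    · simp only [Set.indicator_of_notMem h]; exact le_rfl
  · have h1 : E.cont π Y i ≤ ∫ s, (prevAlive i).indicator (fun _ => BY) s ∂E.seedLaw := by
      refine integral_mono_ae (integrable_cont E hπ hYc hY i)
        ((integrable_const _).indicator (measurableSet_prevAlive i)) ?_
      filter_upwards [ae_good E] with s hs
      exact Set.indicator_le_indicator (le_of_abs_le (hBY _ (hs.restAge_nonneg π i)))
    rw [integral_indicator_const _ (measurableSet_prevAlive i), smul_eq_mul, mul_comm] at h1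
    exact h1.trans (mul_le_mul_of_nonneg_left (seedLaw_prevAlive_le E i) hBY0)

theorem cont_zero : E.cont π Y 0 = Y 0 := by
  have : E.cont π Y 0 = ∫ _, Y 0 ∂E.seedLaw := by
    refine integral_congr_ae ?_
    filter_upwards [ae_good E] with s hs
    have h : s ∈ prevAlive 0 := by
      simp only [prevAlive, Set.mem_ofPred_eq, Seed.prevArrival, Finset.range_zero,
        Finset.sum_empty]
      exact hs.length_pos.le
    rw [Set.indicator_of_mem h]
    simp [restAge, Seed.prevArrival, lastWin]
  simpa using this

end step

/-! ### Noise of the rewards and summation over the auctions -/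

section noise

variable {π : ℝ → ℝ} (hπ : Measurable π)

include hπ in
theorem measurable_noiseTerm (i : ℕ) : Measurable (E.noiseTerm π i) := by
  classical
  refine Measurable.indicator ?_ (measurableSet_alive i)
  exact Measurable.ite (measurableSet_won' hπ i)
    (E.noise_measurable.comp ((measurable_age' hπ i).prodMk (measurable_noiseSeed i)))
    measurable_const

-- Neither the age nor the outcome of an auction involves its own noise seed, so redrawing that seed
-- averages a centred variable.
include hπ in
theorem integrable_noiseTerm (i : ℕ) : Integrable (E.noiseTerm π i) E.seedLaw ∧
    ∫ s, E.noiseTerm π i s ∂E.seedLaw = 0 ∧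
    ∫ s, ‖E.noiseTerm π i s‖ ∂E.seedLaw ≤ E.noiseBound * M.rho ^ (i + 1) := by
  classical
  have hterm : ∀ (s : Seed) x, E.noiseTerm π i (s.setNoise i x) =
      (alive i).indicator (fun s => if Won π s i then E.noise (age π s i) x else 0) s := by
    intro s x
    have h1 : age π (s.setNoise i x) i = age π s i := age_congr (fun _ _ => rfl) (fun _ _ => rfl)
    have h2 : Won π (s.setNoise i x) i ↔ Won π s i := by rw [Won, Won, h1]; rfl
    have h3 : (s.setNoise i x).noiseSeed i = x := Function.update_self _ _ _
    simp only [Environment.noiseTerm, Set.indicator, h1, h2, h3]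
    rfl
  have hB : 0 ≤ E.noiseBound := by unfold Environment.noiseBound; positivity
  have hle : ∫⁻ s, ‖E.noiseTerm π i s‖ₑ ∂E.seedLaw ≤
      ENNReal.ofReal (E.noiseBound * M.rho ^ (i + 1)) := by
    rw [(resamples_noise E i).lintegral_eq (measurable_noiseTerm E hπ i).enorm]
    calc ∫⁻ s, ∫⁻ x, ‖E.noiseTerm π i (s.setNoise i x)‖ₑ ∂E.noiseSeedLaw ∂E.seedLaw
        ≤ ∫⁻ s, (alive i).indicator (fun _ => ENNReal.ofReal E.noiseBound) s ∂E.seedLaw := by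
          refine lintegral_mono_ae ?_
          filter_upwards [ae_good E] with s hs
          simp only [hterm]
          by_cases h : s ∈ alive i
          · simp only [Set.indicator_of_mem h]
            by_cases hw : Won π s i
            · simp only [if_pos hw]
              exact lintegral_noise_le E (hs.age_pos π i).le
            · simp [hw]
          · simp [Set.indicator_of_notMem h]
      _ = ENNReal.ofReal E.noiseBound * E.seedLaw (alive i) := by
          rw [lintegral_indicator_const (measurableSet_alive i)]
      _ ≤ _ := by
          rw [ENNReal.ofReal_mul hB, ENNReal.ofReal_pow rho_pos.le]
          gcongr
          exact seedLaw_arrival_le E i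
  have hi : Integrable (E.noiseTerm π i) E.seedLaw :=
    ⟨(measurable_noiseTerm E hπ i).aestronglyMeasurable, hle.trans_lt ENNReal.ofReal_lt_top⟩
  refine ⟨hi, ?_, ?_⟩
  · have := (resamples_noise E i).integral_eq (H := fun _ => 0) hi (by
      filter_upwards [ae_good E] with s hs
      simp only [hterm]
      by_cases h : s ∈ alive i
      · simp only [Set.indicator_of_mem h]
        by_cases hw : Won π s i
        · simp only [if_pos hw]
          exact integral_eq_zero_of_hasSubgaussianMGF (E.noise_subgaussian _ (hs.age_pos π i).le)
        · simp [hw]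
      · simp [Set.indicator_of_notMem h])
    simpa using this
  · rw [integral_norm_eq_lintegral_enorm hi.1]
    exact ENNReal.toReal_le_of_le_ofReal (mul_nonneg hB (pow_nonneg rho_pos.le _)) hle

theorem Seed.Good.hasSum_payoff {s : Seed} (hs : s.Good) :
    HasSum (fun i => E.meanTerm π i s + E.noiseTerm π i s) (E.payoff π s) := by
  classical
  have h : E.payoff π s = ∑ i ∈ Finset.range s.numAuctions,
      (E.meanTerm π i s + E.noiseTerm π i s) := by
    rw [Environment.payoff, sum_map_wins]
    refine Finset.sum_congr rfl fun i hi => ?_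
    have h : s ∈ alive i := hs.arrival_le_iff.2 (Finset.mem_range.1 hi)
    rw [Environment.meanTerm, Environment.noiseTerm, Set.indicator_of_mem h, Set.indicator_of_mem h]
    split_ifs <;> ring
  rw [h]
  refine hasSum_sum_of_ne_finset_zero fun i hi => ?_
  have h : s ∉ alive i := fun h => hi (Finset.mem_range.2 (hs.arrival_le_iff.1 h))
  rw [Environment.meanTerm, Environment.noiseTerm, Set.indicator_of_notMem h,
    Set.indicator_of_notMem h, add_zero]

variable {B : ℝ} (hB : ∀ τ, 0 ≤ π τ ∧ π τ ≤ B)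

include hB in
theorem integral_norm_meanTerm_le (i : ℕ) :
    ∫ s, ‖E.meanTerm π i s‖ ∂E.seedLaw ≤ (M.kInf + B) * M.rho ^ (i + 1) := by
  have hB0 := (hB 0).1.trans (hB 0).2
  have hK := kInf_nonneg E
  have h1 : ∫ s, ‖E.meanTerm π i s‖ ∂E.seedLaw ≤
      ∫ s, (alive i).indicator (fun _ => M.kInf + B) s ∂E.seedLaw := by
    refine integral_mono_of_nonneg (Filter.Eventually.of_forall fun _ => norm_nonneg _)
      ((integrable_const _).indicator (measurableSet_alive i)) ?_
    filter_upwards [ae_good E] with s hs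
    by_cases h : s ∈ alive i
    · rw [Set.indicator_of_mem h]
      exact abs_meanTerm_le E hB i hs
    · rw [Set.indicator_of_notMem h, Environment.meanTerm, Set.indicator_of_notMem h, norm_zero]
  rw [integral_indicator_const _ (measurableSet_alive i), smul_eq_mul, mul_comm] at h1
  exact h1.trans (mul_le_mul_of_nonneg_left (seedLaw_alive_le E i) (by positivity))

/-- The sum is ρ/(1 - ρ), which bounds the expected number of auctions of an episode. -/
theorem hasSum_rho : HasSum (fun i => M.rho ^ (i + 1)) (M.mu / M.gamma) := by
  have h := (hasSum_geometric_of_lt_one (rho_pos (M := M)).le rho_lt_one).mul_left M.rho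
  simp only [← pow_succ'] at h
  have : M.rho * (1 - M.rho)⁻¹ = M.mu / M.gamma := by
    have h1 := M.gamma_pos
    have h2 := M.mu_pos
    have h3 : 1 - M.rho = M.gamma / (M.gamma + M.mu) := by
      unfold Model.rho; field_simp; ring
    rw [h3]; unfold Model.rho; field_simp
  rwa [this] at h

-- Each auction contributes at most a constant times the probability that it takes place, so
-- geometric tails allow summation and expectation to be exchanged; the noise averages out.
include hπ hB in
theorem hasSum_value : HasSum (fun i => ∫ s, E.meanTerm π i s ∂E.seedLaw) (E.value π) := by
  have h := hasSum_integral_of_summable_integral_norm (μ := E.seedLaw)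
    (F := fun i s => E.meanTerm π i s + E.noiseTerm π i s)
    (fun i => (integrable_meanTerm E hπ hB i).add (integrable_noiseTerm E hπ i).1) (by
      refine Summable.of_nonneg_of_le (fun i => integral_nonneg fun _ => norm_nonneg _)
        (fun i => ?_) ((hasSum_rho (M := M)).summable.mul_left (M.kInf + B + E.noiseBound))
      have h1 := integral_norm_meanTerm_le E hB i
      have h2 := (integrable_noiseTerm E hπ i).2.2
      have h3 := (integrable_meanTerm E hπ hB i).norm
      have h4 := (integrable_noiseTerm E hπ i).1.norm
      have h5 := integral_mono ((integrable_meanTerm E hπ hB i).add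
        (integrable_noiseTerm E hπ i).1).norm (h3.add h4) (fun s => norm_add_le _ _)
      simp only [Pi.add_apply] at h5
      rw [integral_add h3 h4] at h5
      linarith)
  have e1 : ∫ s, ∑' i, (E.meanTerm π i s + E.noiseTerm π i s) ∂E.seedLaw = E.value π := by
    refine integral_congr_ae ?_
    filter_upwards [ae_good E] with s hs
    exact (hs.hasSum_payoff E).tsum_eq
  rw [e1] at h
  refine h.congr_fun fun i => ?_
  rw [integral_add (integrable_meanTerm E hπ hB i) (integrable_noiseTerm E hπ i).1,
    (integrable_noiseTerm E hπ i).2.1, add_zero]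

end noise

/-- Verification argument: the one-auction inequalities telescope from Y 0 and the remaining
continuation value is nonnegative. -/
theorem value_le {Y : ℝ → ℝ} (hY : IsBell M.gamma M.mu E.k (surplus E.q) Y) {π : ℝ → ℝ}
    (hπ : IsPolicy π) : E.value π ≤ Y 0 := by
  obtain ⟨Z, hZc, hZ, hZY⟩ := hY.exists_continuous
  obtain ⟨hm, B, hB⟩ := hπ
  obtain ⟨BZ, hBZ⟩ := hZ.2.2
  rw [← hZY 0 le_rfl]
  refine le_of_tendsto' (hasSum_value E hm hB).tendsto_sum_nat fun n => ?_
  have h : ∀ n, ∑ i ∈ Finset.range n, ∫ s, E.meanTerm π i s ∂E.seedLaw ≤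
      Z 0 - E.cont π Z n := by
    intro n
    induction n with
    | zero => simp [cont_zero]
    | succ n ih =>
      rw [Finset.sum_range_succ]
      have := meanTerm_add_cont_le E hm hB hZc hZ n
      linarith
  have := (cont_bounds E hZ hm hZc hBZ n).1
  linarith [h n]

/-- The same telescoping in the other direction: the losses of the auctions add up with the weights
ρ^(i+1), and the remaining continuation value tends to 0. -/
theorem le_value {Y : ℝ → ℝ} (hY : IsBell M.gamma M.mu E.k (surplus E.q) Y) {π : ℝ → ℝ}
    (hm : Measurable π) (hb : ∀ τ, 0 ≤ π τ ∧ π τ ≤ M.b (Fin.last r)) {d : ℝ}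
    (hd : ∀ τ, 0 ≤ τ → |E.k τ + Y 0 - Y τ - π τ| ≤ d) :
    Y 0 - M.mu / M.gamma * (∑ i, E.c i) * d ^ 2 ≤ E.value π := by
  obtain ⟨Z, hZc, hZ, hZY⟩ := hY.exists_continuous
  obtain ⟨BZ, hBZ⟩ := hZ.2.2
  rw [← hZY 0 le_rfl]
  have hd' : ∀ τ, 0 ≤ τ → |E.k τ + Z 0 - Z τ - π τ| ≤ d := fun τ hτ => by
    rw [hZY 0 le_rfl, hZY τ hτ]; exact hd τ hτ
  have h : ∀ n, Z 0 - (∑ i, E.c i) * d ^ 2 * ∑ i ∈ Finset.range n, M.rho ^ (i + 1)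
      - BZ * M.rho ^ n ≤ ∑ i ∈ Finset.range n, ∫ s, E.meanTerm π i s ∂E.seedLaw := by
    intro n
    have h : ∀ n, Z 0 - (∑ i, E.c i) * d ^ 2 * ∑ i ∈ Finset.range n, M.rho ^ (i + 1)
      - E.cont π Z n ≤ ∑ i ∈ Finset.range n, ∫ s, E.meanTerm π i s ∂E.seedLaw := by
      intro n
      induction n with
      | zero => simp [cont_zero]
      | succ n ih =>
        rw [Finset.sum_range_succ, Finset.sum_range_succ]
        have := le_meanTerm_add_cont E hm hb hZc hZ (fun τ => (hb τ).2) hd' n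
        linarith
    linarith [h n, (cont_bounds E hZ hm hZc hBZ n).2]
  have h1 := (hasSum_rho (M := M)).tendsto_sum_nat
  have h2 := (hasSum_value E hm hb).tendsto_sum_nat
  have h3 := tendsto_pow_atTop_nhds_zero_of_lt_one (rho_pos (M := M)).le rho_lt_one
  have h4 := le_of_tendsto_of_tendsto' (((h1.const_mul ((∑ i, E.c i) * d ^ 2)).const_sub (Z 0)).sub
    (h3.const_mul BZ)) h2 h
  linarith

theorem optimalValue_le {Y : ℝ → ℝ} (hY : IsBell M.gamma M.mu E.k (surplus E.q) Y) :
    E.optimalValue ≤ Y 0 := by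
  refine Real.sSup_le ?_ hY.1
  rintro _ ⟨π, hπ, rfl⟩
  exact value_le E hY hπ

/-- The loss of a policy is quadratic in its distance to the optimal bids. -/
theorem optimalValue_sub_value_le {Y : ℝ → ℝ} (hY : IsBell M.gamma M.mu E.k (surplus E.q) Y)
    {π : ℝ → ℝ} (hm : Measurable π) (hb : ∀ τ, 0 ≤ π τ ∧ π τ ≤ M.b (Fin.last r)) {d : ℝ}
    (hd : ∀ τ, 0 ≤ τ → |E.k τ + Y 0 - Y τ - π τ| ≤ d) :
    E.optimalValue - E.value π ≤ M.mu / M.gamma * (∑ i, E.c i) * d ^ 2 := by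
  linarith [optimalValue_le E hY, le_value E hY hm hb hd]

end value


/-! ## Projection onto the cone of concave slopes -/

section proj

variable {m : ℕ}

theorem convex_slopeCone : Convex ℝ (slopeCone m) := by
  rintro x ⟨hx, hx'⟩ y ⟨hy, hy'⟩ a b ha hb _
  refine ⟨fun i j hij => ?_, ?_⟩
  · simp only [PiLp.add_apply, PiLp.smul_apply, smul_eq_mul]
    exact add_le_add (mul_le_mul_of_nonneg_left (hx i j hij) ha)
      (mul_le_mul_of_nonneg_left (hy i j hij) hb)
  · simp [hx', hy']

theorem isClosed_slopeCone : IsClosed (slopeCone m) := by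
  have h : slopeCone m = (⋂ i, ⋂ j, ⋂ (_ : i ≤ j), {a | a j ≤ a i}) ∩ {a | a (Fin.last m) = 0} := by
    ext a; simp [slopeCone]
  rw [h]
  refine IsClosed.inter ?_ (isClosed_eq (by fun_prop) continuous_const)
  exact isClosed_iInter fun i => isClosed_iInter fun j => isClosed_iInter fun _ =>
    isClosed_le (by fun_prop) (by fun_prop)

theorem zero_mem_slopeCone : (0 : EuclideanSpace ℝ (Fin (m + 1))) ∈ slopeCone m :=
  ⟨fun _ _ _ => le_rfl, rfl⟩

/-- The cone is closed and convex, so the minimizer exists and satisfies the variational inequality;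
the default value in `proj` is never used. -/
theorem proj_spec (x : EuclideanSpace ℝ (Fin (m + 1))) : proj (slopeCone m) x ∈ slopeCone m ∧
    ∀ z ∈ slopeCone m, inner ℝ (x - proj (slopeCone m) x) (z - proj (slopeCone m) x) ≤ 0 := by
  have hex : ∃ y ∈ slopeCone m, ∀ z ∈ slopeCone m, dist x y ≤ dist x z := by
    obtain ⟨v, hv, h⟩ := exists_norm_eq_iInf_of_complete_convex ⟨_, zero_mem_slopeCone⟩
      isClosed_slopeCone.isComplete convex_slopeCone x
    refine ⟨v, hv, fun z hz => ?_⟩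
    rw [dist_eq_norm, dist_eq_norm, h]
    exact ciInf_le (f := fun w : slopeCone m => ‖x - w‖)
      ⟨0, Set.forall_mem_range.2 fun _ => norm_nonneg _⟩ ⟨z, hz⟩
  have he : proj (slopeCone m) x = hex.choose := by
    rw [proj, dif_pos hex]
  rw [he]
  obtain ⟨h1, h2⟩ := hex.choose_spec
  refine ⟨h1, (norm_eq_iInf_iff_real_inner_le_zero convex_slopeCone h1).1 ?_⟩
  have : Nonempty (slopeCone m) := ⟨⟨_, h1⟩⟩
  refine le_antisymm (le_ciInf fun w => ?_) ?_
  · have := h2 w w.2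
    rwa [dist_eq_norm, dist_eq_norm] at this
  · exact ciInf_le (f := fun w : slopeCone m => ‖x - w‖)
      ⟨0, Set.forall_mem_range.2 fun _ => norm_nonneg _⟩ ⟨_, h1⟩

theorem proj_mem (x : EuclideanSpace ℝ (Fin (m + 1))) : proj (slopeCone m) x ∈ slopeCone m :=
  (proj_spec x).1

theorem dist_proj_proj_le (x y : EuclideanSpace ℝ (Fin (m + 1))) :
    dist (proj (slopeCone m) x) (proj (slopeCone m) y) ≤ dist x y := by
  obtain ⟨hx, hx'⟩ := proj_spec x
  obtain ⟨hy, hy'⟩ := proj_spec y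
  set p := proj (slopeCone m) x
  set q := proj (slopeCone m) y
  have h1 := hx' q hy
  have h2 := hy' p hx
  have h3 : inner ℝ (p - q) (p - q) ≤ inner ℝ (x - y) (p - q) := by
    have e : inner ℝ (x - y) (p - q) - inner ℝ (p - q) (p - q) =
        -(inner ℝ (x - p) (q - p) + inner ℝ (y - q) (p - q)) := by
      simp only [inner_sub_left, inner_sub_right]
      ring
    linarith
  rw [real_inner_self_eq_norm_sq] at h3
  have h4 := h3.trans (real_inner_le_norm _ _)
  rw [dist_eq_norm, dist_eq_norm]
  by_contra! h
  nlinarith [norm_nonneg (x - y)]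

theorem dist_proj_le {y : EuclideanSpace ℝ (Fin (m + 1))} (hy : y ∈ slopeCone m)
    (x : EuclideanSpace ℝ (Fin (m + 1))) : dist (proj (slopeCone m) x) y ≤ dist x y := by
  have h : proj (slopeCone m) y = y := by
    have h1 := (proj_spec y).2 y hy
    rw [real_inner_self_eq_norm_sq] at h1
    have h2 : ‖y - proj (slopeCone m) y‖ = 0 := by
      have := sq_nonneg ‖y - proj (slopeCone m) y‖
      exact pow_eq_zero_iff two_ne_zero |>.1 (le_antisymm h1 this)
    exact (sub_eq_zero.1 (norm_eq_zero.1 h2)).symm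
  simpa only [h] using dist_proj_proj_le x y

theorem measurable_proj : Measurable (proj (slopeCone m)) :=
  (LipschitzWith.mk_one dist_proj_proj_le).continuous.measurable

end proj

/-! ## Optimistic bids as a function of the estimated slopes -/

section bids

variable {m r : ℕ} (M : Model m r)

def optReward (x : ℝ) (a : Fin (m + 1) → ℝ) : ℝ → ℝ := fun τ => min (kFun M.t a τ + x) M.kInf

def pesWin (y : ℝ) (c : Fin r → ℝ) : ℝ → ℝ := fun v => max (qFun M.b c v - y) 0

def optBid (x y : ℝ) (a : Fin (m + 1) → ℝ) (c : Fin r → ℝ) : ℝ → ℝ :=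
  solver M.gamma M.mu (optReward M x a) (pesWin M y c)

variable {M} {x y : ℝ} {a : EuclideanSpace ℝ (Fin (m + 1))} {c : Fin r → ℝ}

theorem isReward_optReward (hx : 0 ≤ x) (hK : 0 ≤ M.kInf) (ha : a ∈ slopeCone m) :
    IsReward (optReward M x a) M.kInf :=
  (isReward_kFun M.t_zero M.t_strictMono (fun i j h => ha.1 i j h) ha.2).min_add hx hK

theorem abs_optReward_sub_le {a' : EuclideanSpace ℝ (Fin (m + 1))} (ha : a ∈ slopeCone m)
    (ha' : a' ∈ slopeCone m) {τ : ℝ} (hτ : 0 ≤ τ) :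
    |optReward M x a τ - optReward M x a' τ| ≤ M.t (Fin.last m) * ∑ i, |a i - a' i| := by
  have h := abs_kFun_sub_le M.t_zero M.t_strictMono ha.2 ha'.2 hτ
  refine le_trans ?_ h
  refine (abs_min_sub_min_le_max _ _ _ _).trans (max_le ?_ ?_)
  · rw [add_sub_add_right_eq_sub]
  · rw [sub_self, abs_zero]; exact abs_nonneg _

theorem continuous_pesWin : Continuous (pesWin M y c) :=
  (continuous_qFun.sub continuous_const).max continuous_const

theorem pesWin_of_nonpos (hy : 0 ≤ y) {v : ℝ} (hv : v ≤ 0) : pesWin M y c v = 0 := by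
  rw [pesWin, qFun_of_nonpos M.b_strictMono M.b_zero hv]
  exact max_eq_right (by linarith)

theorem isSurplus_pesWin (hy : 0 ≤ y) (hc : c ∈ densityPolytope M.b) :
    IsSurplus (surplus (pesWin M y c)) := by
  refine isSurplus_surplus continuous_pesWin (fun v => le_max_right _ _) (fun v => ?_)
    fun v hv => pesWin_of_nonpos hy hv
  refine max_le ?_ zero_le_one
  linarith [(qFun_le M.b_strictMono hc.1 v).trans hc.2]

theorem measurable_optBid (hx : 0 ≤ x) (hy : 0 ≤ y) (hK : 0 ≤ M.kInf) (ha : a ∈ slopeCone m)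
    (hc : c ∈ densityPolytope M.b) : Measurable (optBid M x y a c) :=
  measurable_solver M.gamma_pos M.mu_pos (isReward_optReward hx hK ha) (isSurplus_pesWin hy hc)

theorem optBid_mem (hx : 0 ≤ x) (hy : 0 ≤ y) (hK : 0 ≤ M.kInf) (ha : a ∈ slopeCone m)
    (hc : c ∈ densityPolytope M.b) (τ : ℝ) :
    0 ≤ optBid M x y a c τ ∧ optBid M x y a c τ ≤ M.b (Fin.last r) :=
  ⟨solver_nonneg M.gamma_pos M.mu_pos (isReward_optReward hx hK ha) (isSurplus_pesWin hy hc) τ,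
    (solver_le_bound M.gamma_pos M.mu_pos (isReward_optReward hx hK ha) (isSurplus_pesWin hy hc)
      τ).trans M.kInf_le⟩

/-- Lipschitz dependence on the estimated slopes, needed only for measurability: `solver` picks its
solution by choice, so joint measurability has to come from stability. -/
theorem abs_optBid_sub_le (hx : 0 ≤ x) (hy : 0 ≤ y) (hK : 0 ≤ M.kInf) (ha : a ∈ slopeCone m)
    (hc : c ∈ densityPolytope M.b) {a' : EuclideanSpace ℝ (Fin (m + 1))} {c' : Fin r → ℝ}
    (ha' : a' ∈ slopeCone m) (hc' : c' ∈ densityPolytope M.b) (τ : ℝ) :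
    |optBid M x y a c τ - optBid M x y a' c' τ| ≤ (1 + 2 * (M.mu / M.gamma)) *
      (M.t (Fin.last m) * ∑ i, |a i - a' i| +
        M.kInf * ∑ i, |c i - c' i| * (M.b i.succ - M.b i.castSucc)) := by
  have hΔ : ∀ i : Fin r, 0 ≤ M.b i.succ - M.b i.castSucc := fun i =>
    sub_nonneg.2 (M.b_strictMono i.castSucc_lt_succ).le
  have hS : 0 ≤ ∑ i, |c i - c' i| * (M.b i.succ - M.b i.castSucc) :=
    Finset.sum_nonneg fun i _ => mul_nonneg (abs_nonneg _) (hΔ i)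
  refine abs_solver_sub_le M.gamma_pos M.mu_pos (isReward_optReward hx hK ha)
    (isSurplus_pesWin hy hc) (isReward_optReward hx hK ha') (isSurplus_pesWin hy hc')
    (mul_nonneg (t_nonneg M _) (Finset.sum_nonneg fun _ _ => abs_nonneg _)) (mul_nonneg hK hS)
    (fun t ht => abs_optReward_sub_le ha ha' ht) (fun t _ => ?_) τ
  have h1 := solver_nonneg M.gamma_pos M.mu_pos (isReward_optReward hx hK ha')
    (isSurplus_pesWin hy hc') t
  have h2 := solver_le_bound M.gamma_pos M.mu_pos (isReward_optReward hx hK ha')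
    (isSurplus_pesWin hy hc') t
  refine (abs_surplus_sub_le continuous_pesWin continuous_pesWin h1 fun v _ _ => ?_).trans
    (mul_le_mul_of_nonneg_right h2 hS)
  refine (abs_max_sub_max_le_abs _ _ _).trans ?_
  rw [sub_sub_sub_cancel_right]
  refine (abs_qFun_sub_le M.b_strictMono le_rfl).trans (Finset.sum_le_sum fun i _ => ?_)
  split_ifs
  · exact le_rfl
  · exact mul_nonneg (abs_nonneg _) (hΔ i)

/-- Continuity in the slopes for each age, and measurability in the age for fixed slopes, give joint
measurability (a Carathéodory function). -/
theorem measurable_uncurry_optBid (hx : 0 ≤ x) (hy : 0 ≤ y) (hK : 0 ≤ M.kInf) :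
    Measurable (Function.uncurry
      fun (θ : slopeCone m × densityPolytope M.b) => optBid M x y θ.1.1 θ.2.1) := by
  refine measurable_uncurry_of_continuous_of_measurable (fun τ => ?_) fun θ =>
    measurable_optBid hx hy hK θ.1.2 θ.2.2
  refine continuous_iff_continuousAt.2 fun θ₀ => ?_
  refine tendsto_iff_dist_tendsto_zero.2 ?_
  have hle : ∀ θ : slopeCone m × densityPolytope M.b, _ := fun θ =>
    abs_optBid_sub_le hx hy hK θ.1.2 θ.2.2 θ₀.1.2 θ₀.2.2 τ
  refine squeeze_zero (fun _ => dist_nonneg) hle ?_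
  have hc : Continuous fun θ : slopeCone m × densityPolytope M.b =>
      (1 + 2 * (M.mu / M.gamma)) *
      (M.t (Fin.last m) * ∑ i, |θ.1.1 i - θ₀.1.1 i| +
        M.kInf * ∑ i, |θ.2.1 i - θ₀.2.1 i| * (M.b i.succ - M.b i.castSucc)) := by
    have h1 : ∀ i, Continuous fun θ : slopeCone m × densityPolytope M.b => θ.1.1 i := fun i =>
      (EuclideanSpace.proj (𝕜 := ℝ) i).continuous.comp (continuous_subtype_val.comp continuous_fst)
    have h2 : ∀ i, Continuous fun θ : slopeCone m × densityPolytope M.b => θ.2.1 i := fun i =>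
      (continuous_apply i).comp (continuous_subtype_val.comp continuous_snd)
    fun_prop
  simpa using hc.tendsto θ₀

end bids

/-! ## Measurability of lists and of least squares -/

section measurableList

variable {X α : Type*} [MeasurableSpace X] [MeasurableSpace α]

theorem Measurable.comp_nat {F : X → ℕ → α} (hF : ∀ n, Measurable fun x => F x n) {N : X → ℕ}
    (hN : Measurable N) : Measurable fun x => F x (N x) :=
  (measurable_from_prod_countable_left (f := fun p : X × ℕ => F p.1 p.2) hF).comp
    (measurable_id.prodMk hN)

variable [Inhabited α]

/-- Measurability of the length and of each padded entry; this matches `IsMLE.measurable`, which is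
stated for each length separately. -/
structure MeasurableList (L : X → List α) : Prop where
  length : Measurable fun x => (L x).length
  getD : ∀ i, Measurable fun x => (L x).getD i default

theorem MeasurableList.append {L₁ L₂ : X → List α} (h₁ : MeasurableList L₁)
    (h₂ : MeasurableList L₂) : MeasurableList fun x => L₁ x ++ L₂ x := by
  refine ⟨?_, fun i => ?_⟩
  · simp only [List.length_append]
    exact h₁.length.add h₂.length
  · have : ∀ x, (L₁ x ++ L₂ x).getD i default = if i < (L₁ x).length then (L₁ x).getD i default
        else (L₂ x).getD (i - (L₁ x).length) default := by
      intro x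
      split_ifs with h
      · exact List.getD_append _ _ _ _ h
      · exact List.getD_append_right _ _ _ _ (not_lt.1 h)
    simp only [this]
    refine Measurable.ite (measurableSet_lt measurable_const h₁.length) (h₁.getD i) ?_
    exact Measurable.comp_nat (F := fun x n => (L₂ x).getD n default) h₂.getD
      ((measurable_from_nat (f := fun n => i - n)).comp h₁.length)

theorem MeasurableList.map_range {N : X → ℕ} (hN : Measurable N) {f : X → ℕ → α}
    (hf : ∀ i, Measurable fun x => f x i) :
    MeasurableList fun x => (List.range (N x)).map (f x) := by
  refine ⟨by simpa using hN, fun i => ?_⟩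
  have : ∀ x, ((List.range (N x)).map (f x)).getD i default =
      if i < N x then f x i else default := by
    intro x
    split_ifs with h <;> simp [List.getD, h]
  simp only [this]
  exact Measurable.ite (measurableSet_lt measurable_const hN) (hf i) measurable_const

theorem MeasurableList.comp {β : Type*} [MeasurableSpace β] {F : List α → β}
    (hF : ∀ n : ℕ, Measurable fun d : Fin n → α => F (List.ofFn d)) {L : X → List α}
    (hL : MeasurableList L) : Measurable fun x => F (L x) := by
  have h := Measurable.comp_nat
    (F := fun x n => F (List.ofFn fun i : Fin n => (L x).getD i default))
    (fun n => (hF n).comp (measurable_pi_iff.2 fun i => hL.getD i)) hL.length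
  have he : ∀ x, (List.ofFn fun i : Fin (L x).length => (L x).getD i default) = L x := by
    intro x; simp
  simpa only [he] using h

end measurableList

section measurableMatrix

variable {X ι : Type*} [MeasurableSpace X] [Fintype ι] [DecidableEq ι]

theorem measurable_det {A : X → Matrix ι ι ℝ} (hA : ∀ i j, Measurable fun x => A x i j) :
    Measurable fun x => (A x).det := by
  simp only [Matrix.det_apply']
  exact Finset.measurable_sum _ fun σ _ => measurable_const.mul
    (Finset.measurable_prod _ fun i _ => hA _ _)

theorem measurable_inv {A : X → Matrix ι ι ℝ} (hA : ∀ i j, Measurable fun x => A x i j) (i j : ι) :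
    Measurable fun x => (A x)⁻¹ i j := by
  simp only [Matrix.inv_def, Matrix.smul_apply, smul_eq_mul, Ring.inverse_eq_inv',
    Matrix.adjugate_apply]
  refine (measurable_det hA).inv.mul (measurable_det fun k l => ?_)
  simp only [Matrix.updateRow_apply]
  split_ifs
  · exact measurable_const
  · exact hA k l

end measurableMatrix

/-! ## The data of one episode -/

section episode

variable {m r : ℕ} {M : Model m r} (E : Environment M)

/-- The regression vector of an episode. -/
def regressor (M : Model m r) (π : ℝ → ℝ) (s : Seed) (i : Fin (m + 1)) : ℝ :=
  ((wins π s).map fun j => kSegment M.t i (age π s j)).sum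

/-- An episode without a win leaves no datum, but its regressor is zero; so the sums may run over
all episodes. -/
theorem sum_kData_gram (π : ℝ → ℝ) (s : Seed) :
    ((E.kData π s).map fun o => Matrix.vecMulVec (features M.t o) (features M.t o)).sum =
      Matrix.vecMulVec (regressor M π s) (regressor M π s) := by
  unfold Environment.kData
  split_ifs with h
  · have : regressor M π s = 0 := by ext i; simp [regressor, h]
    simp [this]
  · have : features M.t ((wins π s).map (age π s), E.totalReward π s) = regressor M π s := by
      ext i; simp [features, regressor, Function.comp_def]
    simp [this]

theorem sum_kData_moment (π : ℝ → ℝ) (s : Seed) :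
    ((E.kData π s).map fun o => o.2 • features M.t o).sum =
      E.totalReward π s • regressor M π s := by
  unfold Environment.kData
  split_ifs with h
  · have : regressor M π s = 0 := by ext i; simp [regressor, h]
    simp [this]
  · have : features M.t ((wins π s).map (age π s), E.totalReward π s) = regressor M π s := by
      ext i; simp [features, regressor, Function.comp_def]
    simp [this]

variable {X : Type*} [MeasurableSpace X] {Pol : X → ℝ → ℝ} {S : X → Seed}
  (hPol : Measurable (Function.uncurry Pol)) (hS : Measurable S)

include hPol hS

theorem measurable_sum_wins {g : X → ℕ → ℝ} (hg : ∀ i, Measurable fun x => g x i) :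
    Measurable fun x => ((wins (Pol x) (S x)).map (g x)).sum := by
  classical
  simp only [sum_map_wins]
  refine Measurable.comp_nat (F := fun x n => ∑ i ∈ Finset.range n,
    if Won (Pol x) (S x) i then g x i else 0) (fun n => ?_) (measurable_numAuctions.comp hS)
  exact Finset.measurable_sum _ fun i _ =>
    Measurable.ite (measurableSet_won hPol hS i) (hg i) measurable_const

theorem measurable_regressor (i : Fin (m + 1)) :
    Measurable fun x => regressor M (Pol x) (S x) i :=
  measurable_sum_wins hPol hS fun j =>
    (continuous_kSegment i).measurable.comp (measurable_age hPol hS j)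

theorem measurable_totalReward : Measurable fun x => E.totalReward (Pol x) (S x) :=
  measurable_sum_wins hPol hS fun j =>
    ((continuous_k E).measurable.comp (measurable_age hPol hS j)).add
      (E.noise_measurable.comp ((measurable_age hPol hS j).prodMk
        ((measurable_noiseSeed j).comp hS)))

theorem measurableList_qData : MeasurableList fun x => qData (Pol x) (S x) := by
  classical
  refine MeasurableList.map_range (measurable_numAuctions.comp hS) fun i => ?_
  refine (measurable_bid hPol hS i).prodMk (Measurable.prodMk ?_ ?_)
  · have h2 : (fun x => @decide (Won (Pol x) (S x) i) (Classical.propDecidable _)) =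
        fun x => if Won (Pol x) (S x) i then true else false := by
      ext x; by_cases h : Won (Pol x) (S x) i <;> simp [h]
    rw [h2]
    exact Measurable.ite (measurableSet_won hPol hS i) measurable_const measurable_const
  · exact Measurable.ite (measurableSet_won hPol hS i) ((measurable_price i).comp hS)
      measurable_const

end episode

/-! ## The run of the algorithm -/

/-- The parameters of the algorithm. -/
structure Learner {m r : ℕ} (M : Model m r) where
  n₀ : ℕ
  π₀ : ℝ → ℝ
  measurable_π₀ : Measurable π₀
  π₀_mem : ∀ τ, π₀ τ ∈ Set.Icc 0 (M.b (Fin.last r))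
  ridge : ℝ
  ridge_pos : 0 < ridge
  cHat : List QObs → Fin r → ℝ
  isMLE : IsMLE M.b cHat
  lamK : ℝ
  lamK_pos : 0 < lamK
  lamQ : ℝ
  lamQ_pos : 0 < lamQ

section run

variable {m r : ℕ} {M : Model m r} (E : Environment M) (L : Learner M)

def Learner.slopes (D : List KObs) : EuclideanSpace ℝ (Fin (m + 1)) :=
  proj (slopeCone m) (WithLp.toLp 2 (ridgeOLS M.t L.ridge D))

def Environment.history (ω : ℕ → Seed) (j : ℕ) : List KObs × List QObs :=
  E.data L.n₀ L.π₀ L.ridge L.cHat L.lamK L.lamQ ω j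

def Environment.pol (j : ℕ) (ω : ℕ → Seed) : ℝ → ℝ :=
  policyAt M L.n₀ L.π₀ L.ridge L.cHat L.lamK L.lamQ j (E.history L ω j)

theorem radius_nonneg (n : ℕ) : 0 ≤ radius n := Real.sqrt_nonneg _

theorem pol_of_lt {j : ℕ} (h : j < L.n₀) (ω : ℕ → Seed) : E.pol L j ω = L.π₀ := if_pos h

theorem pol_of_ge {j : ℕ} (h : L.n₀ ≤ j) (ω : ℕ → Seed) : E.pol L j ω =
    optBid M (L.lamK * radius (j + 1 - L.n₀)) (L.lamQ * radius (j + 1 - L.n₀))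
      (L.slopes (E.history L ω j).1) (L.cHat (E.history L ω j).2) := if_neg (not_lt.2 h)

theorem history_succ (ω : ℕ → Seed) (j : ℕ) : E.history L ω (j + 1) =
    ((E.history L ω j).1 ++ E.kData (E.pol L j ω) (ω j),
      (E.history L ω j).2 ++ qData (E.pol L j ω) (ω j)) := rfl

theorem history_congr {ω ω' : ℕ → Seed} {j : ℕ} (h : ∀ i < j, ω i = ω' i) :
    E.history L ω j = E.history L ω' j := by
  induction j with
  | zero => rfl
  | succ j ih =>
    have h1 := ih fun i hi => h i (by omega)
    rw [history_succ, history_succ, Environment.pol, Environment.pol, h1, h j (by omega)]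

theorem history_gram (ω : ℕ → Seed) (n : ℕ) :
    ((E.history L ω n).1.map fun o =>
      Matrix.vecMulVec (features M.t o) (features M.t o)).sum =
      ∑ j ∈ Finset.range n, Matrix.vecMulVec (regressor M (E.pol L j ω) (ω j))
        (regressor M (E.pol L j ω) (ω j)) := by
  induction n with
  | zero => rfl
  | succ n ih =>
    rw [history_succ, Finset.sum_range_succ, ← ih, List.map_append, List.sum_append,
      sum_kData_gram]

theorem history_moment (ω : ℕ → Seed) (n : ℕ) :
    ((E.history L ω n).1.map fun o => o.2 • features M.t o).sum =
      ∑ j ∈ Finset.range n, E.totalReward (E.pol L j ω) (ω j) •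
        regressor M (E.pol L j ω) (ω j) := by
  induction n with
  | zero => rfl
  | succ n ih =>
    rw [history_succ, Finset.sum_range_succ, ← ih, List.map_append, List.sum_append,
      sum_kData_moment]

/-- Policies that depend measurably on the past, with bids in `[0, b_r]`. -/
structure AdaptedPolicy (M : Model m r) (P : ℕ → (ℕ → Seed) → ℝ → ℝ) : Prop where
  measurable : ∀ j, Measurable (Function.uncurry (P j))
  congr : ∀ j ω ω', (∀ i < j, ω i = ω' i) → P j ω = P j ω'
  mem : ∀ j ω τ, 0 ≤ P j ω τ ∧ P j ω τ ≤ M.b (Fin.last r)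

/-- The policy depends on the past through the Gram matrix, the moment vector and the likelihood
estimator. The first two are finite sums over earlier episodes, which allows the induction in
`measurable_pol`. -/
theorem measurable_pol_of_data {j : ℕ}
    (h1 : ∀ i < j, Measurable (Function.uncurry (E.pol L i)))
    (h2 : MeasurableList fun ω => (E.history L ω j).2) :
    Measurable (Function.uncurry (E.pol L j)) := by
  rcases lt_or_ge j L.n₀ with h | h
  · have : E.pol L j = fun _ => L.π₀ := funext fun ω => pol_of_lt E L h ω
    rw [this]
    exact L.measurable_π₀.comp measurable_snd
  · have hc : Measurable fun ω => L.cHat (E.history L ω j).2 := h2.comp L.isMLE.measurable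
    have hreg : ∀ i ∈ Finset.range j, ∀ k,
        Measurable fun ω => regressor M (E.pol L i ω) (ω i) k := fun i hi k =>
      measurable_regressor (h1 i (Finset.mem_range.1 hi)) (measurable_pi_apply i) k
    have hrew : ∀ i ∈ Finset.range j,
        Measurable fun ω => E.totalReward (E.pol L i ω) (ω i) := fun i hi =>
      measurable_totalReward E (h1 i (Finset.mem_range.1 hi)) (measurable_pi_apply i)
    have ha : Measurable fun ω => L.slopes (E.history L ω j).1 := by
      unfold Learner.slopes ridgeOLS
      simp only [history_gram, history_moment]
      refine measurable_proj.comp ((PiLp.continuous_toLp 2 _).measurable.comp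
        (measurable_pi_iff.2 fun k => ?_))
      simp only [Matrix.mulVec, dotProduct]
      refine Finset.measurable_sum _ fun l _ => Measurable.mul (measurable_inv (fun a b => ?_) _ _) ?_
      · simp only [Matrix.add_apply, Matrix.sum_apply, Matrix.vecMulVec_apply]
        exact (Finset.measurable_sum _ fun i hi => (hreg i hi a).mul (hreg i hi b)).add_const _
      · simp only [Finset.sum_apply, Pi.smul_apply, smul_eq_mul]
        exact Finset.measurable_sum _ fun i hi => (hrew i hi).mul (hreg i hi l)
    have hθ := (Measurable.prodMk
      (Measurable.subtype_mk (h := fun ω => proj_mem _) ha :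
        Measurable fun ω => (⟨L.slopes (E.history L ω j).1, proj_mem _⟩ : slopeCone m))
      (Measurable.subtype_mk (h := fun ω => L.isMLE.mem _) hc :
        Measurable fun ω => (⟨L.cHat (E.history L ω j).2, L.isMLE.mem _⟩ : densityPolytope M.b)))
    have h3 := (measurable_uncurry_optBid (M := M)
      (x := L.lamK * radius (j + 1 - L.n₀)) (y := L.lamQ * radius (j + 1 - L.n₀))
      (mul_nonneg L.lamK_pos.le (radius_nonneg _)) (mul_nonneg L.lamQ_pos.le (radius_nonneg _))
      (kInf_nonneg E)).comp ((hθ.comp measurable_fst).prodMk measurable_snd)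
    have : Function.uncurry (E.pol L j) = fun p : (ℕ → Seed) × ℝ => optBid M
        (L.lamK * radius (j + 1 - L.n₀)) (L.lamQ * radius (j + 1 - L.n₀))
        (L.slopes (E.history L p.1 j).1) (L.cHat (E.history L p.1 j).2) p.2 := by
      ext p
      rw [Function.uncurry, pol_of_ge E L h]
    rw [this]
    exact h3

theorem measurable_pol (j : ℕ) : Measurable (Function.uncurry (E.pol L j)) := by
  have h : ∀ n, (∀ i < n, Measurable (Function.uncurry (E.pol L i))) ∧
      MeasurableList fun ω => (E.history L ω n).2 := by
    intro n
    induction n with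
    | zero => exact ⟨fun i hi => absurd hi (by omega), ⟨measurable_const, fun i => measurable_const⟩⟩
    | succ n ih =>
      have hn := measurable_pol_of_data E L ih.1 ih.2
      refine ⟨fun i hi => ?_, ?_⟩
      · rcases Nat.lt_succ_iff_lt_or_eq.1 hi with h | rfl
        · exact ih.1 i h
        · exact hn
      · simp only [history_succ]
        exact ih.2.append (measurableList_qData hn (measurable_pi_apply n))
  exact (h (j + 1)).1 j (by omega)

theorem adaptedPolicy_pol : AdaptedPolicy M (E.pol L) := by
  refine ⟨measurable_pol E L, fun j ω ω' h => ?_, fun j ω τ => ?_⟩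
  · rw [Environment.pol, Environment.pol, history_congr E L h]
  · rcases lt_or_ge j L.n₀ with h | h
    · rw [pol_of_lt E L h]; exact L.π₀_mem τ
    · rw [pol_of_ge E L h]
      exact optBid_mem (mul_nonneg L.lamK_pos.le (radius_nonneg _))
        (mul_nonneg L.lamQ_pos.le (radius_nonneg _)) (kInf_nonneg E) (proj_mem _)
        (L.isMLE.mem _) τ

end run


/-! ## Iterated logarithms -/

/-- `log log n`, frozen below `3`. -/
def iterLog (n : ℕ) : ℝ := Real.log (Real.log (max (n : ℝ) 3))

theorem one_lt_log_three : 1 < Real.log 3 := by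
  rw [Real.lt_log_iff_exp_lt (by norm_num)]
  exact Real.exp_one_lt_d9.trans (by norm_num)

theorem one_lt_log_max (n : ℕ) : 1 < Real.log (max (n : ℝ) 3) :=
  one_lt_log_three.trans_le (Real.log_le_log (by norm_num) (le_max_right _ _))

theorem iterLog_pos (n : ℕ) : 0 < iterLog n := Real.log_pos (one_lt_log_max n)

theorem iterLog_mono : Monotone iterLog := fun a b h => by
  have h1 : max (a : ℝ) 3 ≤ max (b : ℝ) 3 := max_le_max (Nat.cast_le.2 h) le_rfl
  exact Real.log_le_log (zero_lt_one.trans (one_lt_log_max a))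
    (Real.log_le_log (by positivity) h1)

theorem radius_sq {n : ℕ} : radius n ^ 2 = iterLog n / n :=
  Real.sq_sqrt (div_nonneg (iterLog_pos n).le n.cast_nonneg)

theorem radius_sq_mul {n : ℕ} (hn : 0 < n) : radius n ^ 2 * n = iterLog n := by
  rw [radius_sq]; field_simp

theorem radius_pos {n : ℕ} (hn : 0 < n) : 0 < radius n :=
  Real.sqrt_pos.2 (div_pos (iterLog_pos n) (by positivity))

/-- A dyadic scale for a quantity that grows at most linearly. -/
theorem exists_dyadic {C : ℝ} (hC : 0 ≤ C) : ∃ C' : ℝ, 0 ≤ C' ∧ ∀ (n : ℕ) (V : ℝ), V ≤ C * n →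
    0 ≤ V → ∃ k : ℕ, V ≤ 2 ^ k ∧ (2 : ℝ) ^ k ≤ 2 * V + 1 ∧
      Real.log (k + 2) ≤ C' * iterLog (n + 1) := by
  have hl2 : 0 < Real.log 2 := Real.log_pos one_lt_two
  have hlC : 0 ≤ Real.log (C + 1) := Real.log_nonneg (by linarith)
  -- The constant is chosen so that k + 2 ≤ D log n for the least admissible k; taking one more
  -- logarithm gives the iterated one.
  set D : ℝ := 3 + (Real.log (C + 1) + 1) / Real.log 2 with hD
  have hDpos : 3 ≤ D := by rw [hD]; have := div_nonneg (add_nonneg hlC zero_le_one) hl2.le; linarith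
  have hlogD : 0 ≤ Real.log D := Real.log_nonneg (by linarith)
  have h00 := iterLog_pos 0
  refine ⟨Real.log D / iterLog 0 + 1, by positivity, fun n V hV hV0 => ?_⟩
  have hex : ∃ k : ℕ, V ≤ 2 ^ k := by
    obtain ⟨k, hk⟩ := pow_unbounded_of_one_lt V one_lt_two
    exact ⟨k, hk.le⟩
  classical
  refine ⟨Nat.find hex, Nat.find_spec hex, ?_, ?_⟩
  · rcases Nat.eq_zero_or_pos (Nat.find hex) with h | h
    · rw [h]; norm_num; exact hV0
    · have h1 := Nat.find_min hex (Nat.sub_lt h one_pos)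
      have h2 : (2:ℝ) ^ Nat.find hex = 2 * 2 ^ (Nat.find hex - 1) := by
        rw [← pow_succ', Nat.sub_add_cancel h]
      rw [h2]; linarith
  · set X := Real.log (max ((n + 1 : ℕ) : ℝ) 3) with hX
    have hX1 : 1 < X := one_lt_log_max _
    have hk : (Nat.find hex : ℝ) + 2 ≤ D * X := by
      rcases Nat.eq_zero_or_pos (Nat.find hex) with h | h
      · rw [h]; push_cast; nlinarith
      · have h1 := not_le.1 (Nat.find_min hex (Nat.sub_lt h one_pos))
        have h2 : (2:ℝ) ^ (Nat.find hex - 1) ≤ (C + 1) * max ((n + 1 : ℕ) : ℝ) 3 := by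
          refine h1.le.trans (hV.trans (mul_le_mul (by linarith) ?_ n.cast_nonneg (by linarith)))
          refine le_trans ?_ (le_max_left _ _)
          push_cast; linarith
        have h3 := Real.log_le_log (by positivity) h2
        rw [Real.log_pow, Real.log_mul (by linarith) (by positivity), ← hX,
          Nat.cast_sub h, Nat.cast_one] at h3
        have h4 : (Nat.find hex : ℝ) - 1 ≤ (Real.log (C + 1) + X) / Real.log 2 :=
          (le_div_iff₀ hl2).2 h3
        have h5 : (Real.log (C + 1) + X) / Real.log 2 ≤
            (Real.log (C + 1) + 1) / Real.log 2 * X := by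
          rw [div_mul_eq_mul_div]
          refine div_le_div_of_nonneg_right ?_ hl2.le
          nlinarith
        rw [hD]
        nlinarith
    have h1 := Real.log_le_log (by positivity) hk
    rw [Real.log_mul (by linarith) (by linarith)] at h1
    have h2 : Real.log X = iterLog (n + 1) := rfl
    rw [h2] at h1
    have h3 : Real.log D ≤ Real.log D / iterLog 0 * iterLog (n + 1) := by
      rw [div_mul_eq_mul_div, le_div_iff₀ h00]
      exact mul_le_mul_of_nonneg_left (iterLog_mono (Nat.zero_le _)) hlogD
    linarith

/-! ## Concentration along adapted policies -/

section adapted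

variable {m r : ℕ} {M : Model m r} (E : Environment M)

theorem ae_run_good : ∀ᵐ ω ∂E.runLaw, ∀ j, (ω j).Good := by
  refine ae_all_iff.2 fun j => ?_
  exact (measurePreserving_eval (P := E.seedLaw) j).quasiMeasurePreserving.ae (ae_good E)

/-- Given the past, the policy of an episode is a fixed function. A mean-one bound for one episode
that holds for every fixed policy therefore makes the exponential a supermartingale along the run.
-/
theorem AdaptedPolicy.measure_exists_exp_ge_le {P : ℕ → (ℕ → Seed) → ℝ → ℝ}
    (hP : AdaptedPolicy M P) {x v : (ℝ → ℝ) → Seed → ℝ}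
    (hx : ∀ j, Measurable fun ω => x (P j ω) (ω j)) (hv : ∀ j, Measurable fun ω => v (P j ω) (ω j))
    {C l : ℝ} (h : ∀ π, Measurable π → (∀ τ, 0 ≤ π τ ∧ π τ ≤ M.b (Fin.last r)) →
      ∫⁻ s, ENNReal.ofReal (Real.exp (l * x π s - C * l ^ 2 * v π s)) ∂E.seedLaw ≤ 1)
    {y : ℝ} (hy : 0 < y) :
    E.runLaw {ω | ∃ n, y ≤ Real.exp (l * ∑ j ∈ Finset.range n, x (P j ω) (ω j) -
      C * l ^ 2 * ∑ j ∈ Finset.range n, v (P j ω) (ω j))} ≤ ENNReal.ofReal (1 / y) := by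
  have hmeas : ∀ j, Measurable fun ω =>
      ENNReal.ofReal (Real.exp (l * x (P j ω) (ω j) - C * l ^ 2 * v (P j ω) (ω j))) := fun j => by
    have h1 := hx j
    have h2 := hv j
    have h3 := (h1.const_mul l).sub (h2.const_mul (C * l ^ 2))
    exact h3.exp.ennreal_ofReal
  have h1 := measure_exists_prod_ge_le (P := E.seedLaw)
    (g := fun j ω => ENNReal.ofReal (Real.exp (l * x (P j ω) (ω j) - C * l ^ 2 * v (P j ω) (ω j))))
    hmeas
    (fun j ω ω' hω => by rw [hP.congr j ω ω' fun i hi => hω i hi.le, hω j le_rfl])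
    (fun j ω => by
      have h2 : ∀ s, P j (Function.update ω j s) = P j ω := fun s =>
        hP.congr j _ _ fun i hi => Function.update_of_ne hi.ne _ _
      simp only [h2, Function.update_self]
      exact h _ ((hP.measurable j).comp (measurable_prodMk_left (x := ω))) (hP.mem j ω))
    (x := ENNReal.ofReal y) (by simpa using hy) ENNReal.ofReal_ne_top
  rw [ENNReal.ofReal_div_of_pos hy, ENNReal.ofReal_one]
  refine (measure_mono ?_).trans h1
  rintro ω ⟨n, hn⟩
  refine ⟨n, ?_⟩
  rw [← ENNReal.ofReal_prod_of_nonneg fun _ _ => (Real.exp_pos _).le, ← Real.exp_sum]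
  refine ENNReal.ofReal_le_ofReal (hn.trans_eq ?_)
  rw [Finset.sum_sub_distrib, Finset.mul_sum, Finset.mul_sum]

/-- Law of the iterated logarithm, with a constant that depends neither on the policies nor on the
environment. -/
theorem exists_adapted_lil_bound {l₀ C δ : ℝ} (hl : 0 < l₀) (hC : 0 ≤ C) (hδ : 0 < δ) :
    ∃ A : ℝ, 0 ≤ A ∧ ∀ (P : ℕ → (ℕ → Seed) → ℝ → ℝ) (x v : (ℝ → ℝ) → Seed → ℝ),
      AdaptedPolicy M P →
      (∀ j, Measurable fun ω => x (P j ω) (ω j)) → (∀ j, Measurable fun ω => v (P j ω) (ω j)) →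
      (∀ l, |l| ≤ l₀ → ∀ π, Measurable π → (∀ τ, 0 ≤ π τ ∧ π τ ≤ M.b (Fin.last r)) →
        ∫⁻ s, ENNReal.ofReal (Real.exp (l * x π s - C * l ^ 2 * v π s)) ∂E.seedLaw ≤ 1) →
      E.runLaw {ω | ¬ ∀ n k : ℕ, ∑ j ∈ Finset.range n, v (P j ω) (ω j) ≤ 2 ^ k →
        |∑ j ∈ Finset.range n, x (P j ω) (ω j)| ≤ A * Real.sqrt (2 ^ k * Real.log (k + 2))} ≤
        ENNReal.ofReal δ := by
  obtain ⟨A, hA, h⟩ := exists_lil_bound hl hC hδ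
  refine ⟨A, hA, fun P x v hP hx hv hm => ?_⟩
  exact h E.runLaw _ _ fun l y hl hy => hP.measure_exists_exp_ge_le E hx hv (hm l hl) hy

end adapted

/-! ## Noise in the regression -/

section noise

variable {m r : ℕ} {M : Model m r} (E : Environment M)

/-- Accumulated noise of an episode. -/
def Environment.regNoise (π : ℝ → ℝ) (s : Seed) : ℝ :=
  ((wins π s).map fun j => E.noise (age π s j) (s.noiseSeed j)).sum

theorem totalReward_eq (π : ℝ → ℝ) (s : Seed) :
    E.totalReward π s = ∑ i, E.a i * regressor M π s i + E.regNoise π s := by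
  classical
  simp only [Environment.totalReward, Environment.regNoise, regressor, sum_map_wins,
    Environment.k, kFun, Finset.mul_sum]
  rw [Finset.sum_comm, ← Finset.sum_add_distrib]
  refine Finset.sum_congr rfl fun j _ => ?_
  split_ifs
  · rfl
  · simp

def Seed.setNoises (s : Seed) (u : ℕ → ℝ) : Seed := (s.1, s.2.1, s.2.2.1, u)

attribute [local instance] isProbabilityMeasure_gamma isProbabilityMeasure_mu

theorem resamples_noises : Resamples Seed.setNoises E.seedLaw
    (Measure.infinitePi fun _ : ℕ => E.noiseSeedLaw) :=
  Resamples.snd (Resamples.snd (Resamples.snd Resamples.self))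

/-- During an episode the policy does not react to the rewards: with lengths, waiting times and
prices fixed, wins and regressor are constants and the noises are independent. Each win contributes
a variance proxy of `sigmaSq` times the squared coordinate. -/
theorem lintegral_exp_regNoise_le {π : ℝ → ℝ} (hπ : Measurable π) (i : Fin (m + 1)) (l : ℝ) :
    ∫⁻ s, ENNReal.ofReal (Real.exp (l * (regressor M π s i * E.regNoise π s) -
      (E.sigmaSq / 2 : ℝ) * l ^ 2 * ((wins π s).length * regressor M π s i ^ 2))) ∂E.seedLaw ≤ 1 := by
  classical
  have hPol : Measurable (Function.uncurry fun _ : Seed => π) := hπ.comp measurable_snd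
  have hz : Measurable fun s => regressor M π s i :=
    measurable_regressor (Pol := fun _ => π) hPol measurable_id i
  have hε : Measurable fun s => E.regNoise π s :=
    measurable_sum_wins (Pol := fun _ => π) hPol measurable_id fun j =>
      E.noise_measurable.comp ((measurable_age' hπ j).prodMk (measurable_noiseSeed j))
  have hlen : ∀ s : Seed, ((wins π s).length : ℝ) = ((wins π s).map fun _ => (1:ℝ)).sum := by
    intro s; simp
  have hn : Measurable fun s => ((wins π s).length : ℝ) := by
    simp only [hlen]
    exact measurable_sum_wins (Pol := fun _ => π) hPol measurable_id fun j => measurable_const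
  have hm : Measurable fun s => ENNReal.ofReal (Real.exp (l * (regressor M π s i * E.regNoise π s) -
      (E.sigmaSq / 2 : ℝ) * l ^ 2 * ((wins π s).length * regressor M π s i ^ 2))) :=
    (Real.measurable_exp.comp (((hz.mul hε).const_mul l).sub
      ((hn.mul (hz.pow_const 2)).const_mul _))).ennreal_ofReal
  rw [(resamples_noises E).lintegral_eq hm]
  calc _ ≤ ∫⁻ _, 1 ∂E.seedLaw := lintegral_mono_ae ?_
    _ = 1 := by simp
  filter_upwards [ae_good E] with s hs
  have hage : ∀ u j, age π (s.setNoises u) j = age π s j := fun u j =>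
    age_congr (fun _ _ => rfl) (fun _ _ => rfl)
  have hwon : ∀ u j, Won π (s.setNoises u) j ↔ Won π s j := fun u j => by
    rw [Won, Won, hage]; rfl
  set z := regressor M π s i with hz'
  have key : ∀ u, ENNReal.ofReal (Real.exp (l * (regressor M π (s.setNoises u) i *
      E.regNoise π (s.setNoises u)) - (E.sigmaSq / 2 : ℝ) * l ^ 2 *
        ((wins π (s.setNoises u)).length * regressor M π (s.setNoises u) i ^ 2))) =
      ∏ j ∈ Finset.range s.numAuctions, ENNReal.ofReal (Real.exp
        (if Won π s j then l * z * E.noise (age π s j) (u j) - E.sigmaSq * (l * z) ^ 2 / 2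
          else 0)) := by
    intro u
    have e1 : regressor M π (s.setNoises u) i = z := by
      rw [hz', regressor, regressor, sum_map_wins, sum_map_wins]
      simp only [hwon, hage]
      rfl
    rw [e1, hlen, Environment.regNoise, sum_map_wins, sum_map_wins,
      ← ENNReal.ofReal_prod_of_nonneg fun _ _ => (Real.exp_pos _).le, ← Real.exp_sum]
    simp only [hwon, hage, Finset.mul_sum, Finset.sum_mul]
    rw [← Finset.sum_sub_distrib]
    congr 2
    refine Finset.sum_congr rfl fun j _ => ?_
    split_ifs
    · have : (s.setNoises u).noiseSeed j = u j := rfl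
      rw [this]; ring
    · ring
  simp only [key]
  refine lintegral_prod_le_one (fun j => ?_) (fun j u u' h => ?_) (fun j u => ?_) _
  · refine (Real.measurable_exp.comp ?_).ennreal_ofReal
    split_ifs
    · exact ((E.noise_measurable.comp (measurable_const.prodMk
        (measurable_pi_apply j))).const_mul _).sub_const _
    · exact measurable_const
  · rw [h j le_rfl]
  · simp only [Function.update_self]
    by_cases hw : Won π s j
    · simp only [if_pos hw]
      have h1 := (E.noise_subgaussian _ (hs.age_pos π j).le).mgf_le (l * z)
      have h2 := (E.noise_subgaussian _ (hs.age_pos π j).le).integrable_exp_mul (l * z)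
      rw [mgf] at h1
      simp only [Real.exp_sub, div_eq_mul_inv]
      rw [← ofReal_integral_eq_lintegral_ofReal (h2.mul_const _)
        (Filter.Eventually.of_forall fun x => by positivity), integral_mul_const]
      rw [← ENNReal.ofReal_one]
      refine ENNReal.ofReal_le_ofReal ?_
      rw [← div_eq_mul_inv]
      exact div_le_one_of_le₀ h1 (Real.exp_pos _).le
    · simp [hw]

theorem regressor_nonneg (M : Model m r) (s : Seed) (π : ℝ → ℝ) (i : Fin (m + 1)) :
    0 ≤ regressor M π s i := by
  refine List.sum_nonneg fun x hx => ?_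
  obtain ⟨j, _, rfl⟩ := List.mem_map.1 hx
  exact kSegment_nonneg M.t_strictMono _ _

theorem length_wins_le (π : ℝ → ℝ) (s : Seed) : (wins π s).length ≤ s.numAuctions := by
  rw [wins]
  exact (List.length_filter_le _ _).trans (by simp)

theorem Seed.Good.regressor_le {s : Seed} (hs : s.Good) (π : ℝ → ℝ) (i : Fin (m + 1)) :
    regressor M π s i ≤ s.numAuctions * s.length := by
  have h : ∀ x ∈ (wins π s).map fun j => kSegment M.t i (age π s j), x ≤ s.length := by
    intro x hx
    obtain ⟨j, hj, rfl⟩ := List.mem_map.1 hx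
    have hj' : j < s.numAuctions := by
      rw [wins] at hj
      exact List.mem_range.1 (List.mem_filter.1 hj).1
    exact (kSegment_le_self M.t_zero M.t_strictMono i (hs.age_pos π j).le).trans
      ((hs.age_le π j).trans (hs.arrival_le_iff.2 hj'))
  have h1 := List.sum_le_card_nsmul _ _ h
  rw [List.length_map, nsmul_eq_mul] at h1
  exact h1.trans (mul_le_mul_of_nonneg_right (Nat.cast_le.2 (length_wins_le π s)) hs.length_pos.le)

/-- If n ≥ 1 auctions arrive then n^p is the single term i = n - 1 of the sum of (i+1)^p over the
auctions that take place; geometric tails make that sum integrable. -/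
theorem lintegral_numAuctions_pow_lt_top (p : ℕ) :
    ∫⁻ s, (s.numAuctions : ENNReal) ^ p ∂E.seedLaw < ⊤ := by
  have h1 : ∀ᵐ s ∂E.seedLaw, (s.numAuctions : ENNReal) ^ p ≤
      1 + ∑' i : ℕ, ((i + 1 : ℕ) : ENNReal) ^ p * (alive i).indicator 1 s := by
    filter_upwards [ae_good E] with s hs
    rcases Nat.eq_zero_or_pos s.numAuctions with h | h
    · rw [h]
      refine le_trans ?_ (le_self_add)
      simp only [Nat.cast_zero]
      exact pow_le_one₀ zero_le zero_le_one
    · have ha : s ∈ alive (s.numAuctions - 1) := hs.arrival_le_iff.2 (by omega)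
      refine le_trans ?_ le_add_self
      refine le_trans ?_ (ENNReal.le_tsum (s.numAuctions - 1))
      rw [Set.indicator_of_mem ha, Nat.sub_add_cancel h]
      simp
  refine (lintegral_mono_ae h1).trans_lt ?_
  rw [lintegral_add_left measurable_const, lintegral_tsum fun i =>
    ((measurable_one.indicator (measurableSet_alive i)).const_mul _).aemeasurable]
  refine ENNReal.add_lt_top.2 ⟨by simp, ?_⟩
  have h2 : Summable fun i : ℕ => ((i + 1 : ℕ) : ℝ) ^ p * M.rho ^ (i + 1) := by
    have := summable_pow_mul_geometric_of_norm_lt_one p (r := M.rho)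
      (by rw [Real.norm_eq_abs, abs_of_pos rho_pos]; exact rho_lt_one)
    exact (summable_nat_add_iff 1).2 this
  refine lt_of_le_of_lt (ENNReal.tsum_le_tsum fun i => ?_) h2.tsum_ofReal_lt_top
  rw [lintegral_const_mul _ (measurable_one.indicator (measurableSet_alive i)),
    lintegral_indicator_one (measurableSet_alive i), ENNReal.ofReal_mul (by positivity),
    ENNReal.ofReal_pow rho_pos.le, ENNReal.ofReal_pow (by positivity), ENNReal.ofReal_natCast]
  gcongr
  exact seedLaw_arrival_le E i

theorem integrable_numAuctions_pow (p : ℕ) :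
    Integrable (fun s => (s.numAuctions : ℝ) ^ p) E.seedLaw := by
  have hm : Measurable fun s : Seed => (s.numAuctions : ℝ) ^ p :=
    (measurable_from_nat.comp measurable_numAuctions).pow_const p
  refine ⟨hm.aestronglyMeasurable, ?_⟩
  refine lt_of_le_of_lt (le_of_eq ?_) (lintegral_numAuctions_pow_lt_top E p)
  refine lintegral_congr fun s => ?_
  rw [enorm_pow, Real.enorm_natCast]

theorem integrable_length_pow (p : ℕ) : Integrable (fun s => s.length ^ p) E.seedLaw := by
  refine (measurePreserving_length E).integrable_comp_of_integrable (g := fun x : ℝ => x ^ p) ?_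
  have hγ := M.gamma_pos
  have h1 : Integrable (fun x => Real.exp (-(-(M.gamma / 2) * x))) (expMeasure M.gamma) := by
    refine ⟨(by fun_prop : Measurable _).aestronglyMeasurable, ?_⟩
    rw [hasFiniteIntegral_iff_ofReal (Filter.Eventually.of_forall fun x => (Real.exp_pos _).le),
      lintegral_exp_neg_expMeasure hγ (by linarith)]
    exact ENNReal.ofReal_lt_top
  refine Integrable.mono' (h1.const_mul (p.factorial * (2 / M.gamma) ^ p))
    (by fun_prop : Measurable _).aestronglyMeasurable ?_
  filter_upwards [ae_pos_expMeasure] with x hx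
  rw [Real.norm_eq_abs, abs_of_pos (pow_pos hx p)]
  have h2 := Real.pow_div_factorial_le_exp (M.gamma / 2 * x) (by positivity) p
  rw [div_le_iff₀ (by positivity), mul_pow] at h2
  have h3 : x ^ p = (2 / M.gamma) ^ p * ((M.gamma / 2) ^ p * x ^ p) := by
    rw [← mul_assoc, ← mul_pow]
    have : 2 / M.gamma * (M.gamma / 2) = 1 := by field_simp
    rw [this, one_pow, one_mul]
  rw [h3, neg_mul, neg_neg]
  calc _ ≤ (2 / M.gamma) ^ p * (Real.exp (M.gamma / 2 * x) * p.factorial) :=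
        mul_le_mul_of_nonneg_left h2 (by positivity)
    _ = _ := by ring

/-- The variance of an episode is dominated by a function of its seed alone, with a finite mean, so
the accumulated variance is at most linear for all adapted policies at once. -/
theorem exists_regNoise_bound {δ : ℝ} (hδ : 0 < δ) : ∃ A : ℝ, 0 ≤ A ∧
    ∀ P : ℕ → (ℕ → Seed) → ℝ → ℝ, AdaptedPolicy M P →
      E.runLaw {ω | ¬ ∀ (n : ℕ) (i : Fin (m + 1)),
        |∑ j ∈ Finset.range n, regressor M (P j ω) (ω j) i * E.regNoise (P j ω) (ω j)| ≤
          A * Real.sqrt ((n + 1 : ℕ) * iterLog (n + 1))} ≤ ENNReal.ofReal δ := by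
  have hm : (0:ℝ) < m + 1 := by positivity
  have hδ' : 0 < δ / 2 / (m + 1) := by positivity
  obtain ⟨A, hA, hlil⟩ := exists_adapted_lil_bound E one_pos
    (by positivity : (0:ℝ) ≤ E.sigmaSq / 2) hδ'
  -- With A auctions and length T, the variance is at most A (A T)² = A³ T² ≤ A⁶ + T⁴.
  set h : Seed → ℝ := fun s => (s.numAuctions : ℝ) ^ 6 + s.length ^ 4 with hh
  have hhm : Measurable h := ((measurable_from_nat.comp measurable_numAuctions).pow_const 6).add
    (measurable_length.pow_const 4)
  obtain ⟨C, hC, hCb⟩ := exists_average_bounded (P := E.seedLaw) hhm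
    ((integrable_numAuctions_pow E 6).add (integrable_length_pow E 4))
    (fun s => by rw [hh]; positivity) (half_pos hδ)
  obtain ⟨C', hC', hdy⟩ := exists_dyadic hC
  refine ⟨A * Real.sqrt ((2 * C + 1) * C'), by positivity, fun P hP => ?_⟩
  have hPol : ∀ j, Measurable (Function.uncurry (P j)) := hP.measurable
  have hz : ∀ i j, Measurable fun ω => regressor M (P j ω) (ω j) i := fun i j =>
    measurable_regressor (hPol j) (measurable_pi_apply j) i
  have hε : ∀ j, Measurable fun ω => E.regNoise (P j ω) (ω j) := fun j =>
    measurable_sum_wins (hPol j) (measurable_pi_apply j) fun l =>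
      E.noise_measurable.comp ((measurable_age (hPol j) (measurable_pi_apply j) l).prodMk
        ((measurable_noiseSeed l).comp (measurable_pi_apply j)))
  have hn : ∀ j, Measurable fun ω => ((wins (P j ω) (ω j)).length : ℝ) := fun j => by
    have : ∀ ω, ((wins (P j ω) (ω j)).length : ℝ) = ((wins (P j ω) (ω j)).map fun _ => (1:ℝ)).sum := by
      intro s; simp
    simp only [this]
    exact measurable_sum_wins (hPol j) (measurable_pi_apply j) fun _ => measurable_const
  have h1 : ∀ i : Fin (m + 1), _ := fun i => hlil P
    (fun π s => regressor M π s i * E.regNoise π s)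
    (fun π s => (wins π s).length * regressor M π s i ^ 2) hP
    (fun j => (hz i j).mul (hε j)) (fun j => (hn j).mul ((hz i j).pow_const 2))
    (fun l _ π hπ _ => lintegral_exp_regNoise_le E hπ i l)
  have hgood := ae_iff.1 (ae_run_good E)
  refine (measure_mono (t := (⋃ i : Fin (m + 1), {ω | ¬ ∀ n k : ℕ,
    ∑ j ∈ Finset.range n, ((wins (P j ω) (ω j)).length : ℝ) * regressor M (P j ω) (ω j) i ^ 2 ≤ 2 ^ k →
        |∑ j ∈ Finset.range n, regressor M (P j ω) (ω j) i * E.regNoise (P j ω) (ω j)| ≤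
          A * Real.sqrt (2 ^ k * Real.log (k + 2))}) ∪ ({ω | ¬ ∀ n : ℕ,
      ∑ i ∈ Finset.range n, h (ω i) ≤ C * n} ∪ {ω | ¬ ∀ j, (ω j).Good})) ?_).trans ?_
  · intro ω hω
    by_contra hcon
    simp only [Set.mem_union, Set.mem_iUnion, Set.mem_ofPred_eq, not_or, not_exists, not_not] at hcon
    obtain ⟨hc1, hc2, hc3⟩ := hcon
    refine hω fun n i => ?_
    obtain ⟨k, hk1, hk2, hk3⟩ := hdy n (C * n) le_rfl (by positivity)
    have hV : ∑ j ∈ Finset.range n, ((wins (P j ω) (ω j)).length : ℝ) *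
        regressor M (P j ω) (ω j) i ^ 2 ≤ 2 ^ k := by
      refine le_trans (Finset.sum_le_sum fun j _ => ?_) ((hc2 n).trans hk1)
      have g1 := (hc3 j).regressor_le (M := M) (P j ω) i
      have g2 := regressor_nonneg M (ω j) (P j ω) i
      have g3 : ((wins (P j ω) (ω j)).length : ℝ) ≤ (ω j).numAuctions :=
        Nat.cast_le.2 (length_wins_le _ _)
      calc _ ≤ ((ω j).numAuctions : ℝ) * ((ω j).numAuctions * (ω j).length) ^ 2 :=
            mul_le_mul g3 (pow_le_pow_left₀ g2 g1 2) (by positivity) (by positivity)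
        _ ≤ _ := by
          rw [hh]
          nlinarith [sq_nonneg (((ω j).numAuctions : ℝ) ^ 3 - (ω j).length ^ 2),
            sq_nonneg (((ω j).numAuctions : ℝ) ^ 3), sq_nonneg ((ω j).length ^ 2)]
    refine (hc1 i n k hV).trans ?_
    rw [mul_assoc, ← Real.sqrt_mul (by positivity)]
    refine mul_le_mul_of_nonneg_left (Real.sqrt_le_sqrt ?_) hA
    have h3 : (2:ℝ) ^ k ≤ (2 * C + 1) * (n + 1 : ℕ) := by push_cast; nlinarith
    calc (2:ℝ) ^ k * Real.log (k + 2) ≤ ((2 * C + 1) * (n + 1 : ℕ)) * (C' * iterLog (n + 1)) :=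
          mul_le_mul h3 hk3 (Real.log_nonneg (by linarith [k.cast_nonneg (α := ℝ)]))
            (by positivity)
      _ = _ := by ring
  · refine (measure_union_le _ _).trans ?_
    have e1 : ENNReal.ofReal δ = ENNReal.ofReal (δ / 2) + ENNReal.ofReal (δ / 2) := by
      rw [← ENNReal.ofReal_add (by positivity) (by positivity), add_halves]
    rw [e1]
    refine add_le_add ((measure_iUnion_fintype_le _ _).trans ?_) ?_
    · refine (Finset.sum_le_sum fun i _ => h1 i).trans ?_
      rw [Finset.sum_const, Finset.card_univ, Fintype.card_fin, nsmul_eq_mul,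
        ← ENNReal.ofReal_natCast, ← ENNReal.ofReal_mul (by positivity)]
      refine ENNReal.ofReal_le_ofReal (le_of_eq ?_)
      push_cast
      field_simp
    · refine (measure_union_le _ _).trans ?_
      rw [hgood, add_zero]
      exact hCb

end noise


/-! ## Error of ridge regression -/

section ols

variable {ι : Type*} [Fintype ι] [DecidableEq ι]

theorem mulVec_gram (s : Finset ℕ) (z : ℕ → ι → ℝ) (ridge : ℝ) (u : ι → ℝ) :
    ((∑ j ∈ s, Matrix.vecMulVec (z j) (z j)) + ridge • (1 : Matrix ι ι ℝ)).mulVec u =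
      (∑ j ∈ s, (z j ⬝ᵥ u) • z j) + ridge • u := by
  rw [Matrix.add_mulVec, Matrix.smul_mulVec, Matrix.one_mulVec, Matrix.sum_mulVec]
  congr 1
  refine Finset.sum_congr rfl fun j _ => ?_
  ext i
  simp [Matrix.vecMulVec_mulVec, mul_comm]

/-- The regularized Gram matrix maps the error to ∑ e_j z_j - ridge • a, and its quadratic form is
at least κ; Cauchy–Schwarz then divides by κ. -/
theorem norm_ridge_sub_le (s : Finset ℕ) (z : ℕ → ι → ℝ) (e : ℕ → ℝ) {ridge κ : ℝ} (a : ι → ℝ)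
    (hr : 0 ≤ ridge) (hκ : 0 < κ)
    (h : ∀ u : EuclideanSpace ℝ ι, κ * ‖u‖ ^ 2 ≤ ∑ j ∈ s, (z j ⬝ᵥ u.ofLp) ^ 2) :
    ‖(WithLp.toLp 2 (((∑ j ∈ s, Matrix.vecMulVec (z j) (z j)) +
        ridge • (1 : Matrix ι ι ℝ))⁻¹.mulVec (∑ j ∈ s, (a ⬝ᵥ z j + e j) • z j)) -
      WithLp.toLp 2 a : EuclideanSpace ℝ ι)‖ ≤
      ‖(WithLp.toLp 2 ((∑ j ∈ s, e j • z j) - ridge • a) : EuclideanSpace ℝ ι)‖ / κ := by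
  set A := (∑ j ∈ s, Matrix.vecMulVec (z j) (z j)) + ridge • (1 : Matrix ι ι ℝ) with hA
  have hquad : ∀ u : EuclideanSpace ℝ ι, κ * ‖u‖ ^ 2 ≤ u.ofLp ⬝ᵥ A.mulVec u.ofLp := by
    intro u
    have hn : 0 ≤ u.ofLp ⬝ᵥ u.ofLp := by
      rw [dotProduct]; exact Finset.sum_nonneg fun i _ => mul_self_nonneg _
    rw [hA, mulVec_gram, dotProduct_add, dotProduct_smul, dotProduct_sum, smul_eq_mul]
    have e1 : ∑ j ∈ s, u.ofLp ⬝ᵥ ((z j ⬝ᵥ u.ofLp) • z j) = ∑ j ∈ s, (z j ⬝ᵥ u.ofLp) ^ 2 :=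
      Finset.sum_congr rfl fun j _ => by
        rw [dotProduct_smul, smul_eq_mul, dotProduct_comm u.ofLp (z j), sq]
    rw [e1]
    have := mul_nonneg hr hn
    linarith [h u]
  have hinj : Function.Injective A.mulVec := by
    refine (injective_iff_map_eq_zero (Matrix.mulVecLin A)).2 fun u hu => ?_
    have h1 := hquad (WithLp.toLp 2 u)
    have hu' : A.mulVec u = 0 := hu
    simp only [hu', dotProduct_zero] at h1
    have h2 : ‖(WithLp.toLp 2 u : EuclideanSpace ℝ ι)‖ ^ 2 = 0 := by
      have := sq_nonneg ‖(WithLp.toLp 2 u : EuclideanSpace ℝ ι)‖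
      nlinarith
    have h3 := norm_eq_zero.1 (pow_eq_zero_iff two_ne_zero |>.1 h2)
    simpa using h3
  have hunit : IsUnit A.det := (Matrix.isUnit_iff_isUnit_det A).1
    (Matrix.mulVec_injective_iff_isUnit.1 hinj)
  set x := A⁻¹.mulVec (∑ j ∈ s, (a ⬝ᵥ z j + e j) • z j) with hx
  have hAx : A.mulVec (x - a) = (∑ j ∈ s, e j • z j) - ridge • a := by
    rw [Matrix.mulVec_sub, hx, Matrix.mulVec_mulVec, Matrix.mul_nonsing_inv _ hunit,
      Matrix.one_mulVec, hA, mulVec_gram]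
    simp only [add_smul, Finset.sum_add_distrib]
    have e1 : ∑ j ∈ s, (a ⬝ᵥ z j) • z j = ∑ j ∈ s, (z j ⬝ᵥ a) • z j :=
      Finset.sum_congr rfl fun j _ => by rw [dotProduct_comm]
    rw [e1]; abel
  have h1 := hquad (WithLp.toLp 2 x - WithLp.toLp 2 a)
  set u : EuclideanSpace ℝ ι := WithLp.toLp 2 x - WithLp.toLp 2 a with hu
  have hu' : u.ofLp = x - a := rfl
  rw [hu', hAx] at h1
  set w : EuclideanSpace ℝ ι := WithLp.toLp 2 ((∑ j ∈ s, e j • z j) - ridge • a) with hw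
  have h2 : (x - a) ⬝ᵥ ((∑ j ∈ s, e j • z j) - ridge • a) = inner ℝ w u := by
    rw [EuclideanSpace.inner_eq_star_dotProduct]; simp [hu', hw]
  rw [h2] at h1
  have h3 := h1.trans (real_inner_le_norm _ _)
  rw [le_div_iff₀ hκ]
  by_contra! hlt
  nlinarith [norm_nonneg w, norm_nonneg u]

end ols

section slopes

variable {m r : ℕ} {M : Model m r} (E : Environment M) (L : Learner M)

theorem a_mem : (WithLp.toLp 2 E.a : EuclideanSpace ℝ (Fin (m + 1))) ∈ slopeCone m :=
  ⟨fun _ _ h => E.a_antitone h, E.a_last⟩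

theorem sum_abs_slopes_sub_le {ω : ℕ → Seed} {n : ℕ} {κ W : ℝ} (hκ : 0 < κ)
    (h : ∀ u : EuclideanSpace ℝ (Fin (m + 1)), κ * ‖u‖ ^ 2 ≤
      ∑ j ∈ Finset.range n, (regressor M (E.pol L j ω) (ω j) ⬝ᵥ u.ofLp) ^ 2)
    (hW : ∀ i, |∑ j ∈ Finset.range n, regressor M (E.pol L j ω) (ω j) i *
      E.regNoise (E.pol L j ω) (ω j)| ≤ W) :
    ∑ i, |L.slopes (E.history L ω n).1 i - E.a i| ≤
      (m + 1) * (((m + 1) * W + L.ridge * ∑ i, |E.a i|) / κ) := by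
  have h1 := norm_ridge_sub_le (Finset.range n) (fun j => regressor M (E.pol L j ω) (ω j))
    (fun j => E.regNoise (E.pol L j ω) (ω j)) E.a L.ridge_pos.le hκ h
  have e1 : ∀ j, E.a ⬝ᵥ regressor M (E.pol L j ω) (ω j) + E.regNoise (E.pol L j ω) (ω j) =
      E.totalReward (E.pol L j ω) (ω j) := fun j => (totalReward_eq E _ _).symm
  simp only [e1] at h1
  rw [← history_gram, ← history_moment] at h1
  -- The true slopes lie in the cone, so projecting does not move the estimate away from them.
  have h2 := (dist_proj_le (a_mem E) (WithLp.toLp 2 (ridgeOLS M.t L.ridge (E.history L ω n).1)))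
  rw [dist_eq_norm, dist_eq_norm] at h2
  have h3 := h2.trans h1
  set w : EuclideanSpace ℝ (Fin (m + 1)) := WithLp.toLp 2 ((∑ j ∈ Finset.range n,
    E.regNoise (E.pol L j ω) (ω j) • regressor M (E.pol L j ω) (ω j)) - L.ridge • E.a) with hw
  have h4 : ‖w‖ ≤ (m + 1) * W + L.ridge * ∑ i, |E.a i| := by
    have : ‖w‖ ≤ ∑ i, |w i| := by
      rw [EuclideanSpace.norm_eq]
      refine Real.sqrt_le_iff.2 ⟨Finset.sum_nonneg fun _ _ => abs_nonneg _, ?_⟩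
      exact Finset.sum_sq_le_sq_sum_of_nonneg fun _ _ => abs_nonneg _
    refine this.trans ?_
    have h5 : ∀ i, |w i| ≤ W + L.ridge * |E.a i| := fun i => by
      have : w i = ∑ j ∈ Finset.range n, regressor M (E.pol L j ω) (ω j) i *
          E.regNoise (E.pol L j ω) (ω j) - L.ridge * E.a i := by
        simp [hw, mul_comm]
      rw [this]
      refine (abs_sub _ _).trans (add_le_add (hW i) ?_)
      rw [abs_mul, abs_of_pos L.ridge_pos]
    refine (Finset.sum_le_sum fun i _ => h5 i).trans ?_
    rw [Finset.sum_add_distrib, ← Finset.mul_sum]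
    simp
  have h6 : ∀ i, |L.slopes (E.history L ω n).1 i - E.a i| ≤
      ((m + 1) * W + L.ridge * ∑ i, |E.a i|) / κ := fun i =>
    (PiLp.norm_apply_le (L.slopes (E.history L ω n).1 - WithLp.toLp 2 E.a) i).trans
      (h3.trans (div_le_div_of_nonneg_right h4 hκ.le))
  refine (Finset.sum_le_sum fun i _ => h6 i).trans ?_
  simp

end slopes

/-! ## Episodes that are informative under every policy that bids enough -/

section design

variable {m r : ℕ} {M : Model m r} (E : Environment M)

attribute [local instance] isProbabilityMeasure_gamma isProbabilityMeasure_mu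

/-- If k τ ≤ 0 then k(n τ) ≤ 0 for all n by subadditivity, which contradicts k(t_m) > 0. -/
theorem k_pos (hK : 0 < M.kInf) {τ : ℝ} (hτ : 0 < τ) : 0 < E.k τ := by
  have hk := isReward_k E
  by_contra! hle
  have h0 : ∀ n : ℕ, E.k (n * τ) ≤ 0 := by
    intro n
    induction n with
    | zero =>
      have := hk.mono 0 τ le_rfl hτ.le
      simp only [Nat.cast_zero, zero_mul]; linarith
    | succ n ih =>
      have h1 := hk.subadd (n * τ) τ (by positivity) hτ.le
      have e : ((n + 1 : ℕ) : ℝ) * τ = n * τ + τ := by push_cast; ring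
      rw [e]
      linarith
  obtain ⟨n, hn⟩ := exists_nat_ge (M.t (Fin.last m) / τ)
  have h1 : M.t (Fin.last m) ≤ n * τ := (div_le_iff₀ hτ).1 hn
  have h2 := hk.mono _ _ (t_nonneg M _) h1
  have h3 : E.k (M.t (Fin.last m)) = M.kInf := E.kInf_eq
  linarith [h0 n]

theorem q_lt {u v : ℝ} (hu : 0 ≤ u) (huv : u < v) (hv : v ≤ M.b (Fin.last r)) :
    E.q u < E.q v := by
  have hmono : ∀ i, qSegment M.b i u ≤ qSegment M.b i v := fun i =>
    qSegment_mono M.b_strictMono i huv.le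
  rw [Environment.q, qFun_eq, qFun_eq]
  by_contra! hle
  have h1 : ∀ i, E.c i * qSegment M.b i u = E.c i * qSegment M.b i v := by
    have h2 := Finset.sum_eq_sum_iff_of_le (s := Finset.univ)
      (f := fun i => E.c i * qSegment M.b i u) (g := fun i => E.c i * qSegment M.b i v)
      (fun i _ => mul_le_mul_of_nonneg_left (hmono i) (E.c_pos i).le)
    intro i
    exact h2.1 (le_antisymm (Finset.sum_le_sum fun i _ =>
      mul_le_mul_of_nonneg_left (hmono i) (E.c_pos i).le) hle) i (Finset.mem_univ i)
  have h2 : ∀ i, qSegment M.b i u = qSegment M.b i v := fun i =>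
    mul_left_cancel₀ (E.c_pos i).ne' (h1 i)
  have h3 : ∀ v, ∑ i, qSegment M.b i v = min (M.b (Fin.last r)) v - min (M.b 0) v := by
    intro v
    have e1 := Fin.sum_univ_succ fun i => min (M.b i) v
    have e2 := Fin.sum_univ_castSucc fun i => min (M.b i) v
    simp only [qSegment, Finset.sum_sub_distrib]
    linarith
  have h4 := Finset.sum_congr (rfl : (Finset.univ : Finset (Fin r)) = Finset.univ) fun i _ => h2 i
  rw [h3, h3, M.b_zero, min_eq_right (huv.le.trans hv), min_eq_right hv, min_eq_left hu,
    min_eq_left (hu.trans huv.le)] at h4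
  linarith

theorem priceLaw_Ioo_pos {u v : ℝ} (hu : 0 ≤ u) (huv : u < v) (hu' : u < M.b (Fin.last r)) :
    0 < E.priceLaw (Set.Ioo u v) := by
  obtain ⟨w, hw1, hw2⟩ := exists_between (lt_min huv hu')
  rw [lt_min_iff] at hw2
  have h := priceLaw_Ioc E hw1.le hw2.2.le
  have h1 : 0 < E.priceLaw (Set.Ioc u w) := by
    rw [h, ENNReal.ofReal_pos, sub_pos]
    exact q_lt E hu hw1 hw2.2.le
  exact h1.trans_le (measure_mono fun x hx => ⟨hx.1, hx.2.trans_lt hw2.1⟩)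

/-- Exactly one auction arrives, at a time in `(x, y)` with `y ≤ T`, and its price lies in `S`. -/
def window (x y T : ℝ) (S : Set ℝ) : Set Seed :=
  {s | s.gap 0 ∈ Set.Ioo x y ∧ s.length ∈ Set.Ioo T (T + 1) ∧
    s.gap 1 ∈ Set.Ioo (T + 1) (T + 2) ∧ s.price 0 ∈ S}

theorem measurableSet_window {x y T : ℝ} {S : Set ℝ} (hS : MeasurableSet S) :
    MeasurableSet (window x y T S) :=
  (measurable_gap 0 measurableSet_Ioo).inter ((measurable_length measurableSet_Ioo).inter
    ((measurable_gap 1 measurableSet_Ioo).inter (measurable_price 0 hS)))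

theorem seedLaw_window_pos {x y T : ℝ} (hx : 0 ≤ x) (hxy : x < y) (hyT : y ≤ T) {S : Set ℝ}
    (hS : MeasurableSet S) (hS' : 0 < E.priceLaw S) : 0 < E.seedLaw (window x y T S) := by
  set G : ℕ → Set ℝ := fun i => if i = 0 then Set.Ioo x y else Set.Ioo (T + 1) (T + 2) with hG
  have hGm : ∀ i, MeasurableSet (G i) := fun i => by
    simp only [hG]; split_ifs <;> exact measurableSet_Ioo
  have he : window x y T S = Set.Ioo T (T + 1) ×ˢ ((Set.pi (Finset.range 2) G) ×ˢ
      ((Set.pi (Finset.range 1) fun _ => S) ×ˢ (Set.univ : Set (ℕ → ℝ)))) := by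
    ext s
    simp only [window, Set.mem_ofPred_eq, Set.mem_prod, Set.mem_pi, Finset.coe_range, Set.mem_Iio,
      Set.mem_univ, and_true, hG]
    constructor
    · rintro ⟨h1, h2, h3, h4⟩
      refine ⟨h2, fun i hi => ?_, fun i hi => ?_⟩
      · interval_cases i
        · simpa [Seed.gap] using h1
        · simpa [Seed.gap] using h3
      · interval_cases i
        exact h4
    · rintro ⟨h2, h3, h4⟩
      exact ⟨by simpa [Seed.gap] using h3 0 (by norm_num), h2,
        by simpa [Seed.gap] using h3 1 (by norm_num), h4 0 (by norm_num)⟩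
  rw [he, Environment.seedLaw, Measure.prod_prod, Measure.prod_prod, Measure.prod_prod,
    Measure.infinitePi_pi _ fun i _ => hGm i, Measure.infinitePi_pi _ fun i _ => hS]
  have hT : 0 ≤ T := hx.trans (hxy.le.trans hyT)
  have h1 := expMeasure_Ioo_pos M.gamma_pos hT (lt_add_one T)
  have h2 := expMeasure_Ioo_pos M.mu_pos hx hxy
  have h3 := expMeasure_Ioo_pos M.mu_pos (x := T + 1) (y := T + 2) (by linarith) (by linarith)
  simp only [Finset.prod_range_succ, Finset.prod_range_zero, hG, one_mul, measure_univ, mul_one,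
    if_true, one_ne_zero, if_false]
  exact ENNReal.mul_pos h1.ne' (ENNReal.mul_pos (ENNReal.mul_pos h2.ne' h3.ne').ne' hS'.ne').ne'

/-- The second waiting time exceeds T + 1 while the episode is shorter than T + 1, so only the first
auction arrives. -/
theorem window_spec {x y T : ℝ} (hyT : y ≤ T) {S : Set ℝ} {s : Seed} (hs : s.Good)
    (h : s ∈ window x y T S) : s.numAuctions = 1 ∧ s.arrival 0 = s.gap 0 := by
  obtain ⟨h1, h2, h3, -⟩ := h
  have e0 : s.arrival 0 = s.gap 0 := by simp [Seed.arrival]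
  have e1 : s.arrival 1 = s.gap 0 + s.gap 1 := by simp [Seed.arrival, Finset.sum_range_succ]
  refine ⟨?_, e0⟩
  have g0 : 0 < s.numAuctions := hs.arrival_le_iff.1 (by rw [e0]; linarith [h1.2, h2.1])
  have g1 : ¬ 1 < s.numAuctions := fun h => by
    have := hs.arrival_le_iff.2 h
    rw [e1] at this
    linarith [hs.gap_pos 0, h3.1, h2.2]
  omega

theorem age_zero (π : ℝ → ℝ) (s : Seed) : age π s 0 = s.arrival 0 := by
  simp [age, lastWin]

/-- Lower bound on optimistic bids, relative to the reward. -/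
def Model.floor (M : Model m r) : ℝ := M.gamma / (M.gamma + M.mu)

theorem floor_pos : 0 < M.floor := div_pos M.gamma_pos (add_pos M.gamma_pos M.mu_pos)

/-- Episodes with exactly one auction, which is won by every policy that bids at least
`M.floor * k`. -/
def Environment.cheap : Set Seed :=
  {s | s ∈ window 0 (M.t (Fin.last m) + 1) (M.t (Fin.last m) + 1) Set.univ ∧
    s.price 0 < M.floor * E.k (s.gap 0)}

theorem measurableSet_cheap : MeasurableSet E.cheap :=
  (measurableSet_window MeasurableSet.univ).inter (measurableSet_lt (measurable_price 0)
    (((continuous_k E).measurable.comp (measurable_gap 0)).const_mul _))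

/-- On cheap episodes the regressor is the same for all policies above the floor. The Gram matrix of
an adaptive run is thus bounded below by a sum of independent terms. -/
theorem regressor_dotProduct_of_cheap {π : ℝ → ℝ} (hπ : ∀ τ, 0 ≤ τ → M.floor * E.k τ ≤ π τ)
    {s : Seed} (hs : s.Good) (h : s ∈ E.cheap) (u : Fin (m + 1) → ℝ) :
    regressor M π s ⬝ᵥ u = kFun M.t u (s.gap 0) := by
  classical
  obtain ⟨h1, h2⟩ := window_spec le_rfl hs h.1
  have hw : Won π s 0 := by
    rw [Won, age_zero, h2]
    exact h.2.trans_le (hπ _ (hs.gap_pos 0).le)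
  have h3 : ∀ i, regressor M π s i = kSegment M.t i (s.gap 0) := fun i => by
    rw [regressor, sum_map_wins, h1]
    simp [hw, age_zero, h2]
  simp only [dotProduct, h3, kFun]
  exact Finset.sum_congr rfl fun i _ => mul_comm _ _

theorem kSegment_of_le {i : Fin (m + 1)} {τ : ℝ} (h : τ ≤ M.t i) : kSegment M.t i τ = 0 := by
  induction i using Fin.lastCases with
  | last => rw [kSegment_last, min_eq_right h, sub_self]
  | cast i =>
    rw [kSegment_castSucc, min_eq_right h,
      min_eq_right (h.trans (M.t_strictMono i.castSucc_lt_succ).le), sub_self]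

theorem kSegment_pos {i : Fin (m + 1)} {τ : ℝ} (h : M.t i < τ) : 0 < kSegment M.t i τ := by
  induction i using Fin.lastCases with
  | last => rw [kSegment_last, min_eq_left h.le]; linarith
  | cast i =>
    rw [kSegment_castSucc, min_eq_left h.le, sub_pos]
    exact lt_min (M.t_strictMono i.castSucc_lt_succ) h

/-- Induction on the cells: just inside the i-th cell only slopes up to i matter, and the earlier
ones are already zero. -/
theorem eq_zero_of_kFun_eq_zero {u : Fin (m + 1) → ℝ}
    (h : ∀ τ, 0 < τ → τ < M.t (Fin.last m) + 1 → kFun M.t u τ = 0) : u = 0 := by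
  ext i
  induction i using WellFoundedLT.induction with
  | ind i ih =>
    obtain ⟨τ, h1, h2, h3⟩ : ∃ τ, M.t i < τ ∧ τ < M.t (Fin.last m) + 1 ∧
        ∀ j, i < j → τ ≤ M.t j := by
      induction i using Fin.lastCases with
      | last => exact ⟨M.t (Fin.last m) + 1 / 2, by linarith, by linarith,
          fun j hj => absurd hj (not_lt.2 (Fin.le_last j))⟩
      | cast i =>
        have := M.t_strictMono.monotone (Fin.le_last i.succ)
        exact ⟨M.t i.succ, M.t_strictMono i.castSucc_lt_succ, by linarith,
          fun j hj => M.t_strictMono.monotone (Fin.castSucc_lt_iff_succ_le.1 hj)⟩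
    have h4 := h τ ((t_nonneg M i).trans_lt h1) h2
    have h5 : kFun M.t u τ = u i * kSegment M.t i τ := by
      rw [kFun]
      refine Finset.sum_eq_single i (fun j _ hj => ?_) (by simp)
      rcases lt_or_gt_of_ne hj with hj | hj
      · rw [ih j hj]; simp
      · rw [kSegment_of_le (h3 j hj), mul_zero]
    rw [h5] at h4
    exact (mul_eq_zero.1 h4).resolve_right (kSegment_pos h1).ne'

/-- The minimum over the unit sphere is attained; on the trivial space the sphere is empty and any
constant works. -/
theorem exists_pos_le_of_homogeneous {V : Type*} [NormedAddCommGroup V] [NormedSpace ℝ V]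
    [FiniteDimensional ℝ V] {F : V → ℝ} (hF : Continuous F)
    (hom : ∀ (x : ℝ) u, F (x • u) = x ^ 2 * F u) (hpos : ∀ u, u ≠ 0 → 0 < F u) :
    ∃ c : ℝ, 0 < c ∧ ∀ u, c * ‖u‖ ^ 2 ≤ F u := by
  have hcomp : IsCompact (Metric.sphere (0 : V) 1) := isCompact_sphere _ _
  have h0 : F 0 = 0 := by simpa using hom 0 0
  rcases (Metric.sphere (0 : V) 1).eq_empty_or_nonempty with he | hne
  · refine ⟨1, one_pos, fun u => ?_⟩
    have : u = 0 := by
      by_contra hu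
      have : (‖u‖⁻¹ • u) ∈ Metric.sphere (0 : V) 1 := by
        simp [norm_smul, norm_ne_zero_iff.2 hu]
      rw [he] at this
      exact this
    simp [this, h0]
  · obtain ⟨v, hv, hmin⟩ := hcomp.exists_isMinOn hne hF.continuousOn
    refine ⟨F v, hpos v fun h => by simp [h] at hv, fun u => ?_⟩
    by_cases hu : u = 0
    · simp [hu, h0]
    · have hn : ‖u‖ ≠ 0 := norm_ne_zero_iff.2 hu
      have h1 : (‖u‖⁻¹ • u) ∈ Metric.sphere (0 : V) 1 := by simp [norm_smul, hn]
      have h2 := isMinOn_iff.1 hmin _ h1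
      rw [hom] at h2
      have h3 : ‖u‖ ^ 2 * (‖u‖⁻¹ ^ 2 * F u) = F u := by field_simp
      calc F v * ‖u‖ ^ 2 = ‖u‖ ^ 2 * F v := mul_comm _ _
        _ ≤ ‖u‖ ^ 2 * (‖u‖⁻¹ ^ 2 * F u) := mul_le_mul_of_nonneg_left h2 (sq_nonneg _)
        _ = F u := h3

/-- Entries of the design matrix of one cheap episode. -/
def Environment.design (a b : Fin (m + 1)) : Seed → ℝ :=
  E.cheap.indicator fun s => kSegment M.t a (s.gap 0) * kSegment M.t b (s.gap 0)

theorem measurable_design (a b : Fin (m + 1)) : Measurable (E.design a b) :=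
  (((continuous_kSegment a).measurable.comp (measurable_gap 0)).mul
    ((continuous_kSegment b).measurable.comp (measurable_gap 0))).indicator (measurableSet_cheap E)

theorem integrable_design (a b : Fin (m + 1)) : Integrable (E.design a b) E.seedLaw := by
  refine integrable_of_bound E (C := (M.t (Fin.last m) + 1) * (M.t (Fin.last m) + 1))
    (measurable_design E a b) fun s hs => ?_
  have hT : 0 ≤ M.t (Fin.last m) + 1 := by linarith [t_nonneg M (Fin.last m)]
  by_cases h : s ∈ E.cheap
  · rw [Environment.design, Set.indicator_of_mem h, abs_mul]
    have h1 : ∀ a, |kSegment M.t a (s.gap 0)| ≤ M.t (Fin.last m) + 1 := fun a => by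
      rw [abs_of_nonneg (kSegment_nonneg M.t_strictMono _ _)]
      exact (kSegment_le_self M.t_zero M.t_strictMono a (hs.gap_pos 0).le).trans h.1.1.2.le
    exact mul_le_mul (h1 a) (h1 b) (abs_nonneg _) hT
  · rw [Environment.design, Set.indicator_of_notMem h, abs_zero]
    positivity

theorem sum_design (u : Fin (m + 1) → ℝ) (s : Seed) :
    ∑ a, ∑ b, u a * u b * E.design a b s =
      E.cheap.indicator (fun s => kFun M.t u (s.gap 0) ^ 2) s := by
  by_cases h : s ∈ E.cheap
  · simp only [Environment.design, Set.indicator_of_mem h]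
    rw [kFun, sq, Finset.sum_mul_sum]
    exact Finset.sum_congr rfl fun a _ => Finset.sum_congr rfl fun b _ => by ring
  · simp [Environment.design, Set.indicator_of_notMem h]

/-- If the form vanishes at u then kFun u vanishes at the arrival time of almost every cheap
episode. Such arrivals fall into every open subinterval with positive probability, so kFun u = 0 on
(0, t_m + 1) and u = 0. -/
theorem exists_design_pos (hK : 0 < M.kInf) : ∃ c : ℝ, 0 < c ∧
    ∀ u : EuclideanSpace ℝ (Fin (m + 1)),
      c * ‖u‖ ^ 2 ≤ ∑ a, ∑ b, u a * u b * ∫ s, E.design a b s ∂E.seedLaw := by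
  refine exists_pos_le_of_homogeneous (by fun_prop) (fun x u => ?_) fun u hu => ?_
  · simp only [PiLp.smul_apply, smul_eq_mul, Finset.mul_sum]
    exact Finset.sum_congr rfl fun a _ => Finset.sum_congr rfl fun b _ => by ring
  · have hint : ∀ a b, Integrable (fun s => u a * u b * E.design a b s) E.seedLaw := fun a b =>
      (integrable_design E a b).const_mul _
    have e1 : ∑ a, ∑ b, u a * u b * ∫ s, E.design a b s ∂E.seedLaw =
        ∫ s, E.cheap.indicator (fun s => kFun M.t u (s.gap 0) ^ 2) s ∂E.seedLaw := by
      simp only [← sum_design, ← integral_const_mul]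
      rw [integral_finsetSum _ fun a _ => integrable_finsetSum _ fun b _ => hint a b]
      exact Finset.sum_congr rfl fun a _ => (integral_finsetSum _ fun b _ => hint a b).symm
    have hi : Integrable (E.cheap.indicator fun s => kFun M.t u (s.gap 0) ^ 2) E.seedLaw := by
      have := integrable_finsetSum (μ := E.seedLaw) Finset.univ fun a _ =>
        integrable_finsetSum Finset.univ fun b _ => hint a b
      refine this.congr (Filter.Eventually.of_forall fun s => ?_)
      simpa using sum_design E u s
    have hn : 0 ≤ E.cheap.indicator fun s => kFun M.t u (s.gap 0) ^ 2 := fun s =>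
      Set.indicator_nonneg (fun _ _ => sq_nonneg _) s
    rw [e1]
    refine lt_of_le_of_ne (integral_nonneg hn) fun h0 => hu ?_
    have h1 := (integral_eq_zero_iff_of_nonneg hn hi).1 h0.symm
    have h2 : u.ofLp = 0 := by
      refine eq_zero_of_kFun_eq_zero (M := M) fun τ hτ hτT => ?_
      by_contra hne
      have hcont : Continuous (kFun M.t u.ofLp) := continuous_kFun
      have h3 : {x | kFun M.t u.ofLp x ≠ 0} ∩ Set.Ioo 0 (M.t (Fin.last m) + 1) ∈ nhds τ :=
        Filter.inter_mem (hcont.continuousAt.eventually_ne hne) (Ioo_mem_nhds hτ hτT)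
      obtain ⟨l, v, ⟨hl, hv⟩, hsub⟩ := mem_nhds_iff_exists_Ioo_subset.1 h3
      have hτ2 : τ < v := hv
      obtain ⟨x, hx1, hx2⟩ := exists_between hτ2
      have hmem : ∀ z, τ < z → z < x → z ∈ {x | kFun M.t u.ofLp x ≠ 0} ∩
        Set.Ioo 0 (M.t (Fin.last m) + 1) := fun z hz hz' => hsub ⟨by linarith, by linarith⟩
      have hxT : x ≤ M.t (Fin.last m) + 1 := by
        exact (hsub ⟨by linarith, hx2⟩).2.2.le
      -- Here kInf > 0 matters: prices below the floor have positive probability at every positive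
      -- age.
      have hkτ := k_pos E hK hτ
      have hp := priceLaw_Ioo_pos E le_rfl (mul_pos (floor_pos (M := M)) hkτ)
        (hK.trans_le M.kInf_le)
      have hpos := seedLaw_window_pos E hτ.le hx1 hxT measurableSet_Ioo hp
      refine hpos.ne' (measure_mono_null ?_ (ae_iff.1 h1))
      intro s hs
      have hs1 := hmem _ hs.1.1 hs.1.2
      have hc : s ∈ E.cheap := by
        refine ⟨⟨hs1.2, hs.2.1, hs.2.2.1, Set.mem_univ _⟩, hs.2.2.2.2.trans_le ?_⟩
        exact mul_le_mul_of_nonneg_left ((isReward_k E).mono _ _ hτ.le hs.1.1.le) floor_pos.le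
      simp only [Set.mem_ofPred_eq, Set.indicator_of_mem hc, Pi.zero_apply]
      exact pow_ne_zero 2 hs1.1
    exact PiLp.ext fun i => congrFun h2 i

theorem exists_design_bound (hK : 0 < M.kInf) (n₀ : ℕ) {δ : ℝ} (hδ : 0 < δ) :
    ∃ c : ℝ, 0 < c ∧ ∃ N : ℕ, E.runLaw {ω | ¬ ∀ n ≥ N, ∀ u : EuclideanSpace ℝ (Fin (m + 1)),
      c * n * ‖u‖ ^ 2 ≤ ∑ j ∈ Finset.range n,
        E.cheap.indicator (fun s => kFun M.t u (s.gap 0) ^ 2) (ω (n₀ + j))} ≤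
      ENNReal.ofReal δ := by
  obtain ⟨c, hc, hcu⟩ := exists_design_pos E hK
  have hm : (0:ℝ) < m + 1 := by positivity
  -- With this tolerance in each entry the form changes by at most half of c n ‖u‖², since (∑
  -- |u_a|)² ≤ (m + 1) ‖u‖².
  have hε : 0 < c / (2 * (m + 1)) := by positivity
  have hδ' : 0 < δ / ((m + 1) * (m + 1)) := by positivity
  choose N hN using fun p : Fin (m + 1) × Fin (m + 1) => exists_average_close (P := E.seedLaw)
    (measurable_design E p.1 p.2) (integrable_design E p.1 p.2) n₀ hε hδ'
  refine ⟨c / 2, half_pos hc, ∑ p, N p, (measure_mono (t := ⋃ p, {ω | ¬ ∀ n ≥ N p,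
    |∑ i ∈ Finset.range n, E.design p.1 p.2 (ω (n₀ + i)) - n * ∫ s, E.design p.1 p.2 s ∂E.seedLaw| ≤
      c / (2 * (m + 1)) * n}) ?_).trans ((measure_iUnion_fintype_le _ _).trans ?_)⟩
  · intro ω hω
    by_contra hcon
    simp only [Set.mem_iUnion, Set.mem_ofPred_eq, not_exists, not_not] at hcon
    refine hω fun n hn u => ?_
    have hNp : ∀ p, N p ≤ n := fun p =>
      (Finset.single_le_sum (fun _ _ => Nat.zero_le _) (Finset.mem_univ p)).trans hn
    simp only [← sum_design]
    rw [Finset.sum_comm]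
    have e1 : ∀ a, ∑ j ∈ Finset.range n, ∑ b, u a * u b * E.design a b (ω (n₀ + j)) =
        ∑ b, u a * u b * ∑ j ∈ Finset.range n, E.design a b (ω (n₀ + j)) := fun a => by
      rw [Finset.sum_comm]
      exact Finset.sum_congr rfl fun b _ => (Finset.mul_sum _ _ _).symm
    simp only [e1]
    have h1 : ∀ a b, u a * u b * (n * ∫ s, E.design a b s ∂E.seedLaw) -
        |u a| * |u b| * (c / (2 * (m + 1)) * n) ≤
        u a * u b * ∑ j ∈ Finset.range n, E.design a b (ω (n₀ + j)) := fun a b => by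
      have h2 := hcon (a, b) n (hNp _)
      have h3 := mul_le_mul_of_nonneg_left h2 (abs_nonneg (u a * u b))
      rw [← abs_mul, abs_mul (u a)] at h3
      have h4 := neg_abs_le (u a * u b * (∑ i ∈ Finset.range n, E.design a b (ω (n₀ + i)) -
        n * ∫ s, E.design a b s ∂E.seedLaw))
      linarith
    have h2 := Finset.sum_le_sum fun a (_ : a ∈ Finset.univ) =>
      Finset.sum_le_sum fun b (_ : b ∈ Finset.univ) => h1 a b
    refine le_trans ?_ h2
    simp only [Finset.sum_sub_distrib]
    have e2 : ∑ a, ∑ b, u a * u b * (n * ∫ s, E.design a b s ∂E.seedLaw) =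
        n * ∑ a, ∑ b, u a * u b * ∫ s, E.design a b s ∂E.seedLaw := by
      simp only [Finset.mul_sum]
      exact Finset.sum_congr rfl fun a _ => Finset.sum_congr rfl fun b _ => by ring
    have e3 : ∑ a, ∑ b, |u a| * |u b| * (c / (2 * (m + 1)) * n) =
        (∑ a, |u a|) ^ 2 * (c / (2 * (m + 1)) * n) := by
      rw [sq, Finset.sum_mul_sum, Finset.sum_mul]
      simp only [Finset.sum_mul]
    have h3 : (∑ a, |u a|) ^ 2 ≤ (m + 1) * ‖u‖ ^ 2 := by
      have := sq_sum_le_card_mul_sum_sq (s := Finset.univ) (f := fun a => |u a|)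
      rw [EuclideanSpace.norm_sq_eq]
      simpa using this
    rw [e2, e3]
    have h4 := mul_le_mul_of_nonneg_left (hcu u) (n.cast_nonneg (α := ℝ))
    have h5 := mul_le_mul_of_nonneg_right h3 (by positivity : 0 ≤ c / (2 * (m + 1)) * (n:ℝ))
    have e4 : (m + 1) * ‖u‖ ^ 2 * (c / (2 * (m + 1)) * (n:ℝ)) = c / 2 * n * ‖u‖ ^ 2 := by
      field_simp
    rw [e4] at h5
    linarith
  · refine (Finset.sum_le_sum fun p _ => hN p).trans ?_
    rw [Finset.sum_const, Finset.card_univ, Fintype.card_prod, Fintype.card_fin, nsmul_eq_mul,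
      ← ENNReal.ofReal_natCast, ← ENNReal.ofReal_mul (by positivity)]
    refine ENNReal.ofReal_le_ofReal (le_of_eq ?_)
    push_cast
    field_simp

end design


/-! ## Maximum likelihood: the deterministic part -/

section mle

variable {m r : ℕ} {M : Model m r} (E : Environment M)

/-- Score of an observation in the direction of the slope `i`, at the true slopes. -/
def Environment.obsScore (i : Fin r) (o : QObs) : ℝ :=
  if o.2.1 then (if M.b i.castSucc < o.2.2 ∧ o.2.2 ≤ M.b i.succ then (E.c i)⁻¹ else 0)
  else -(qSegment M.b i o.1 / (1 - E.q o.1))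

/-- The observation is a win at a price in the cell `i`. -/
def obsHit (M : Model m r) (i : Fin r) (o : QObs) : ℝ :=
  if o.2.1 then (if M.b i.castSucc < o.2.2 ∧ o.2.2 ≤ M.b i.succ then 1 else 0) else 0

/-- The factor of an observation in the likelihood. -/
def obsFactor (M : Model m r) (c : Fin r → ℝ) (o : QObs) : ℝ :=
  if o.2.1 then qDensity M.b c o.2.2 else 1 - qFun M.b c o.1

/-- Probability that a bid of at most `b_r` loses, bounded below. -/
def Environment.slack : ℝ := 1 - ∑ i : Fin r, E.c i * (M.b i.succ - M.b i.castSucc)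

theorem slack_pos : 0 < E.slack := sub_pos.2 E.c_sum

theorem slack_le (v : ℝ) : E.slack ≤ 1 - E.q v :=
  sub_le_sub_left (qFun_le M.b_strictMono (c_mem E).1 v) _

theorem cell_pos (M : Model m r) (i : Fin r) : 0 < M.b i.succ - M.b i.castSucc :=
  sub_pos.2 (M.b_strictMono i.castSucc_lt_succ)

theorem le_inv_cell {c : Fin r → ℝ} (hc : c ∈ densityPolytope M.b) (i : Fin r) :
    c i ≤ (M.b i.succ - M.b i.castSucc)⁻¹ := by
  have h1 := Finset.single_le_sum (f := fun i : Fin r => c i * (M.b i.succ - M.b i.castSucc))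
    (fun j _ => mul_nonneg (hc.1 j) (cell_pos M j).le) (Finset.mem_univ i)
  rw [← one_div, le_div_iff₀ (cell_pos M i)]
  exact h1.trans hc.2

theorem exists_cell {p : ℝ} (hp : 0 < p) (hp' : p ≤ M.b (Fin.last r)) :
    ∃ i : Fin r, M.b i.castSucc < p ∧ p ≤ M.b i.succ := by
  by_contra! h
  have h1 : ∀ i : Fin (r + 1), M.b i < p := by
    intro i
    induction i using Fin.induction with
    | zero => rw [M.b_zero]; exact hp
    | succ i ih => exact h i ih
  exact absurd (h1 (Fin.last r)) (not_lt.2 hp')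

theorem cell_unique {p : ℝ} {i j : Fin r} (hi : M.b i.castSucc < p ∧ p ≤ M.b i.succ)
    (hj : M.b j.castSucc < p ∧ p ≤ M.b j.succ) : i = j := by
  by_contra hne
  rcases lt_or_gt_of_ne hne with h | h
  · have := M.b_strictMono.monotone (Fin.succ_le_castSucc_iff.2 h)
    linarith [hi.2, hj.1]
  · have := M.b_strictMono.monotone (Fin.succ_le_castSucc_iff.2 h)
    linarith [hj.2, hi.1]

theorem sum_cell (f : Fin r → ℝ) {p : ℝ} {i : Fin r} (hi : M.b i.castSucc < p ∧ p ≤ M.b i.succ) :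
    (∑ j : Fin r, if M.b j.castSucc < p ∧ p ≤ M.b j.succ then f j else 0) = f i := by
  rw [Finset.sum_eq_single i (fun j _ hj => if_neg fun h => hj (cell_unique h hi)) (by simp),
    if_pos hi]

/-- The wins of the list have prices in `(0, b_r]`. -/
def ValidObs (M : Model m r) (o : QObs) : Prop := o.2.1 = true → 0 < o.2.2 ∧ o.2.2 ≤ M.b (Fin.last r)

theorem obsFactor_pos {o : QObs} (ho : ValidObs M o) : 0 < obsFactor M E.c o := by
  rw [obsFactor]
  split_ifs with h
  · obtain ⟨i, hi⟩ := exists_cell (ho h).1 (ho h).2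
    rw [qDensity, sum_cell _ hi]
    exact E.c_pos i
  · exact (slack_pos E).trans_le (slack_le E _)

theorem obsFactor_nonneg {c : Fin r → ℝ} (hc : c ∈ densityPolytope M.b) (o : QObs) :
    0 ≤ obsFactor M c o := by
  rw [obsFactor]
  split_ifs with h
  · refine Finset.sum_nonneg fun i _ => ?_
    split_ifs
    · exact hc.1 i
    · exact le_rfl
  · exact sub_nonneg.2 ((qFun_le M.b_strictMono hc.1 _).trans hc.2)

/-- Both kinds of factor are affine in c, so the likelihood ratio at the truth is exactly 1 plus the
score in the direction c - E.c. -/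
theorem obsFactor_eq {o : QObs} (ho : ValidObs M o) (c : Fin r → ℝ) :
    obsFactor M c o = obsFactor M E.c o * (1 + ∑ i, (c i - E.c i) * E.obsScore i o) := by
  by_cases h : o.2.1 = true
  · obtain ⟨i, hi⟩ := exists_cell (ho h).1 (ho h).2
    have h1 : ∑ j, (c j - E.c j) * E.obsScore j o = (c i - E.c i) * (E.c i)⁻¹ := by
      rw [← sum_cell (fun j => (c j - E.c j) * (E.c j)⁻¹) hi]
      exact Finset.sum_congr rfl fun j _ => by rw [Environment.obsScore, if_pos h]; split_ifs <;> simp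
    have hci := (E.c_pos i).ne'
    rw [obsFactor, obsFactor, if_pos h, if_pos h, qDensity, qDensity, sum_cell _ hi,
      sum_cell _ hi, h1]
    field_simp
    ring
  · have hd : 1 - E.q o.1 ≠ 0 := ((slack_pos E).trans_le (slack_le E _)).ne'
    have h1 : ∑ j, (c j - E.c j) * E.obsScore j o =
        -((qFun M.b c o.1 - E.q o.1) / (1 - E.q o.1)) := by
      rw [Environment.q, qFun_eq, qFun_eq, ← Finset.sum_sub_distrib, Finset.sum_div,
        ← Finset.sum_neg_distrib]
      exact Finset.sum_congr rfl fun j _ => by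
        rw [Environment.obsScore, if_neg h, Environment.q, qFun_eq]; ring
    rw [h1, obsFactor, obsFactor, if_neg h, if_neg h]
    change _ = (1 - E.q o.1) * _
    field_simp
    ring

/-- Bound on likelihood ratios. -/
def Environment.ratioBound : ℝ :=
  ∑ i : Fin r, (M.b i.succ - M.b i.castSucc)⁻¹ * (E.c i)⁻¹ + E.slack⁻¹

theorem obsFactor_le {c : Fin r → ℝ} (hc : c ∈ densityPolytope M.b) {o : QObs}
    (ho : ValidObs M o) : obsFactor M c o ≤ E.ratioBound * obsFactor M E.c o := by
  have hn : ∀ i : Fin r, 0 ≤ (M.b i.succ - M.b i.castSucc)⁻¹ * (E.c i)⁻¹ := fun i =>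
    mul_nonneg (inv_nonneg.2 (cell_pos M i).le) (inv_nonneg.2 (E.c_pos i).le)
  have hs := slack_pos E
  by_cases h : o.2.1 = true
  · obtain ⟨i, hi⟩ := exists_cell (ho h).1 (ho h).2
    rw [obsFactor, obsFactor, if_pos h, if_pos h, qDensity, qDensity, sum_cell _ hi, sum_cell _ hi]
    have h1 := Finset.single_le_sum (fun j _ => hn j) (Finset.mem_univ i)
    have h2 : (M.b i.succ - M.b i.castSucc)⁻¹ * (E.c i)⁻¹ ≤ E.ratioBound :=
      h1.trans (le_add_of_nonneg_right (inv_nonneg.2 hs.le))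
    calc c i ≤ (M.b i.succ - M.b i.castSucc)⁻¹ := le_inv_cell hc i
      _ = (M.b i.succ - M.b i.castSucc)⁻¹ * (E.c i)⁻¹ * E.c i := by
        rw [mul_assoc, inv_mul_cancel₀ (E.c_pos i).ne', mul_one]
      _ ≤ _ := mul_le_mul_of_nonneg_right h2 (E.c_pos i).le
  · rw [obsFactor, obsFactor, if_neg h, if_neg h]
    have h2 : E.slack⁻¹ ≤ E.ratioBound := le_add_of_nonneg_left (Finset.sum_nonneg fun j _ => hn j)
    have h3 := slack_le E o.1
    calc 1 - qFun M.b c o.1 ≤ 1 := by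
          linarith [qFun_nonneg M.b_strictMono hc.1 o.1]
      _ = E.slack⁻¹ * E.slack := (inv_mul_cancel₀ hs.ne').symm
      _ ≤ E.ratioBound * (1 - E.q o.1) := mul_le_mul h2 h3 hs.le ((inv_nonneg.2 hs.le).trans h2)

/-- Put y = √(1+x). Then 1 + x = y² ≤ exp(2(y - 1)), and x - 2(y - 1) = (y - 1)² = x²/(1 + y)²,
where y ≤ √R. This is a global form of the curvature of the logarithm on bounded ratios. -/
theorem one_add_le_exp_sub {x R : ℝ} (hx : -1 ≤ x) (hR : 1 + x ≤ R) :
    1 + x ≤ Real.exp (x - ((1 + Real.sqrt R) ^ 2)⁻¹ * x ^ 2) := by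
  set y := Real.sqrt (1 + x) with hy
  have hy0 : 0 ≤ y := Real.sqrt_nonneg _
  have hyx : y ^ 2 = 1 + x := Real.sq_sqrt (by linarith)
  have hyR : y ≤ Real.sqrt R := Real.sqrt_le_sqrt hR
  have h1 : y ≤ Real.exp (y - 1) := by linarith [Real.add_one_le_exp (y - 1)]
  have h2 : 1 + x ≤ Real.exp (2 * (y - 1)) := by
    rw [← hyx, two_mul, Real.exp_add, sq]
    exact mul_le_mul h1 h1 hy0 (Real.exp_pos _).le
  refine h2.trans (Real.exp_le_exp.2 ?_)
  have h3 : x = (y - 1) * (y + 1) := by linear_combination -hyx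
  have h4 : ((1 + Real.sqrt R) ^ 2)⁻¹ * x ^ 2 ≤ (y - 1) ^ 2 := by
    rw [inv_mul_le_iff₀ (by positivity), h3, mul_pow, mul_comm]
    refine mul_le_mul_of_nonneg_right (pow_le_pow_left₀ (by linarith) (by linarith) 2) (sq_nonneg _)
  have h5 : x - 2 * (y - 1) = (y - 1) ^ 2 := by linear_combination -hyx
  linarith

theorem likelihood_eq (c : Fin r → ℝ) (D : List QObs) :
    likelihood M.b D c = (D.map (obsFactor M c)).prod := rfl

/-- Likelihood ratios are bounded by `ratioBound` on the whole polytope, so the quadratic penalty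
holds there without first localizing the estimator near the truth. -/
theorem likelihood_le {c : Fin r → ℝ} (hc : c ∈ densityPolytope M.b) {D : List QObs}
    (hD : ∀ o ∈ D, ValidObs M o) : likelihood M.b D c ≤ likelihood M.b D E.c *
      Real.exp (D.map fun o => (∑ i, (c i - E.c i) * E.obsScore i o) -
        ((1 + Real.sqrt E.ratioBound) ^ 2)⁻¹ *
          (∑ i, (c i - E.c i) * E.obsScore i o) ^ 2).sum := by
  simp only [likelihood_eq]
  induction D with
  | nil => simp
  | cons o D ih =>
    have ho := hD o (by simp)
    have ih := ih fun o' ho' => hD o' (by simp [ho'])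
    simp only [List.map_cons, List.prod_cons, List.sum_cons, Real.exp_add]
    have h1 := obsFactor_eq E ho c
    have h2 := obsFactor_pos E ho
    have h3 := obsFactor_nonneg hc o
    have h4 := obsFactor_le E hc ho
    set x := ∑ i, (c i - E.c i) * E.obsScore i o
    have h5 : -1 ≤ x := by
      rw [h1] at h3
      have := nonneg_of_mul_nonneg_right h3 h2
      linarith
    have h6 : 1 + x ≤ E.ratioBound := by
      rw [h1, mul_comm] at h4
      exact le_of_mul_le_mul_right h4 h2
    have h7 := one_add_le_exp_sub h5 h6
    have h8 : obsFactor M c o ≤ obsFactor M E.c o * Real.exp (x -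
        ((1 + Real.sqrt E.ratioBound) ^ 2)⁻¹ * x ^ 2) := by
      rw [h1]; exact mul_le_mul_of_nonneg_left h7 h2.le
    have h9 : 0 ≤ (D.map (obsFactor M c)).prod := List.prod_nonneg fun y hy => by
      obtain ⟨o', _, rfl⟩ := List.mem_map.1 hy
      exact obsFactor_nonneg hc o'
    calc _ ≤ _ := mul_le_mul h8 ih h9 (mul_nonneg h2.le (Real.exp_pos _).le)
      _ = _ := by ring

/-- Curvature of the log-likelihood. -/
def Environment.curvature : ℝ :=
  ((1 + Real.sqrt E.ratioBound) ^ 2)⁻¹ * ((∑ i, E.c i + 1) ^ 2)⁻¹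

theorem curvature_pos : 0 < E.curvature := by
  have : 0 ≤ ∑ i, E.c i := Finset.sum_nonneg fun i _ => (E.c_pos i).le
  unfold Environment.curvature
  positivity

/-- A win has a score in the direction of its own cell only, so keeping just the wins makes the
information diagonal: each cell is charged with its own hits. -/
theorem sum_sq_hit_le {o : QObs} (ho : ValidObs M o) (u : Fin r → ℝ) :
    ((∑ i, E.c i + 1) ^ 2)⁻¹ * ∑ i, u i ^ 2 * obsHit M i o ≤
      (∑ i, u i * E.obsScore i o) ^ 2 := by
  by_cases h : o.2.1 = true
  · obtain ⟨i, hi⟩ := exists_cell (ho h).1 (ho h).2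
    have h1 : ∑ j, u j * E.obsScore j o = u i * (E.c i)⁻¹ := by
      rw [← sum_cell (fun j => u j * (E.c j)⁻¹) hi]
      exact Finset.sum_congr rfl fun j _ => by
        rw [Environment.obsScore, if_pos h]; split_ifs <;> simp
    have h2 : ∑ j, u j ^ 2 * obsHit M j o = u i ^ 2 := by
      rw [← sum_cell (fun j => u j ^ 2) hi]
      exact Finset.sum_congr rfl fun j _ => by rw [obsHit, if_pos h]; split_ifs <;> simp
    have h3 : E.c i ≤ ∑ i, E.c i + 1 :=
      (Finset.single_le_sum (fun j _ => (E.c_pos j).le) (Finset.mem_univ i)).trans (by linarith)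
    rw [h1, h2, mul_pow, mul_comm, inv_pow]
    exact mul_le_mul_of_nonneg_left (inv_anti₀ (pow_pos (E.c_pos i) 2)
      (pow_le_pow_left₀ (E.c_pos i).le h3 2)) (sq_nonneg _)
  · have h2 : ∑ j, u j ^ 2 * obsHit M j o = 0 :=
      Finset.sum_eq_zero fun j _ => by rw [obsHit, if_neg h, mul_zero]
    rw [h2, mul_zero]
    exact sq_nonneg _

/-- The estimation error is controlled by the score. -/
theorem curvature_mul_le {c : Fin r → ℝ} (hc : c ∈ densityPolytope M.b) {D : List QObs}
    (hD : ∀ o ∈ D, ValidObs M o) (hmax : likelihood M.b D E.c ≤ likelihood M.b D c) :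
    E.curvature * ∑ i, (c i - E.c i) ^ 2 * (D.map (obsHit M i)).sum ≤
      ∑ i, (c i - E.c i) * (D.map (E.obsScore i)).sum := by
  have hpos : 0 < likelihood M.b D E.c := by
    rw [likelihood_eq]
    refine List.prod_pos fun y hy => ?_
    obtain ⟨o, ho, rfl⟩ := List.mem_map.1 hy
    exact obsFactor_pos E (hD o ho)
  have h1 := hmax.trans (likelihood_le E hc hD)
  have h2 := (le_mul_iff_one_le_right hpos).1 h1
  have h3 := Real.one_le_exp_iff.1 h2
  have h4 : (D.map fun o => (∑ i, (c i - E.c i) * E.obsScore i o) -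
        ((1 + Real.sqrt E.ratioBound) ^ 2)⁻¹ *
          (∑ i, (c i - E.c i) * E.obsScore i o) ^ 2).sum ≤
      ∑ i, (c i - E.c i) * (D.map (E.obsScore i)).sum -
        E.curvature * ∑ i, (c i - E.c i) ^ 2 * (D.map (obsHit M i)).sum := by
    clear h3 h2 h1 hpos hmax
    induction D with
    | nil => simp
    | cons o D ih =>
      have ih := ih fun o' ho' => hD o' (by simp [ho'])
      have h5 := sum_sq_hit_le E (hD o (by simp)) (fun i => c i - E.c i)
      have h6 : 0 ≤ ((1 + Real.sqrt E.ratioBound) ^ 2)⁻¹ := by positivity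
      have h7 := mul_le_mul_of_nonneg_left h5 h6
      rw [← mul_assoc] at h7
      simp only [List.map_cons, List.sum_cons, mul_add, Finset.sum_add_distrib]
      rw [Environment.curvature] at ih ⊢
      linarith
  linarith

end mle

/-! ## Maximum likelihood: concentration of the score -/

section score

variable {m r : ℕ} {M : Model m r} (E : Environment M)

/-- Mean-one bound behind the concentration of the score. -/
theorem exp_score_inequality {c seg d d₀ Δ l C : ℝ} (hc : 0 < c) (hseg : 0 ≤ seg)
    (hsegΔ : seg ≤ Δ) (hd₀ : 0 < d₀) (hd : d₀ ≤ d) (hC : C = (4 / c + Δ / d₀) / c)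
    (h1 : |l| ≤ c / 2) (h2 : |l| * Δ ≤ d₀) (h3 : C * |l| ≤ 1 / c) :
    c * seg * (Real.exp (l * c⁻¹ - C * l ^ 2) - 1) +
      d * (Real.exp (l * -(seg / d)) - 1) ≤ 0 := by
  have hΔ : 0 ≤ Δ := hseg.trans hsegΔ
  have hd' : 0 < d := hd₀.trans_le hd
  have hC0 : 0 ≤ C := by rw [hC]; positivity
  have hl := abs_nonneg l
  have e1 : |l| * c⁻¹ ≤ 1 / 2 := by
    rw [← div_eq_mul_inv, div_le_iff₀ hc]; linarith
  have e2 : C * |l| ^ 2 ≤ 1 / 2 := by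
    calc C * |l| ^ 2 = C * |l| * |l| := by ring
      _ ≤ 1 / c * (c / 2) := mul_le_mul h3 h1 hl (by positivity)
      _ = 1 / 2 := by field_simp
  have e3 : |l * c⁻¹ - C * l ^ 2| ≤ |l| * c⁻¹ + C * |l| ^ 2 := by
    refine (abs_sub _ _).trans (le_of_eq ?_)
    rw [abs_mul, abs_mul, abs_of_pos (inv_pos.2 hc), abs_of_nonneg hC0, abs_pow]
  have e4 : |l * -(seg / d)| ≤ 1 := by
    rw [abs_mul, abs_neg, abs_div, abs_of_nonneg hseg, abs_of_pos hd', ← mul_div_assoc,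
      div_le_one hd']
    exact (mul_le_mul_of_nonneg_left hsegΔ hl).trans (h2.trans hd)
  have b1 := (abs_le.1 (Real.abs_exp_sub_one_sub_id_le (e3.trans (by linarith)))).2
  have b2 := (abs_le.1 (Real.abs_exp_sub_one_sub_id_le e4)).2
  have e5 : (l * c⁻¹ - C * l ^ 2) ^ 2 ≤ 4 / c ^ 2 * l ^ 2 := by
    rw [← sq_abs]
    calc |l * c⁻¹ - C * l ^ 2| ^ 2 ≤ (|l| * c⁻¹ + C * |l| ^ 2) ^ 2 :=
          pow_le_pow_left₀ (abs_nonneg _) e3 2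
      _ ≤ (|l| * (2 / c)) ^ 2 := by
          refine pow_le_pow_left₀ (by positivity) ?_ 2
          have := mul_le_mul_of_nonneg_left h3 hl
          calc |l| * c⁻¹ + C * |l| ^ 2 = |l| * c⁻¹ + |l| * (C * |l|) := by ring
            _ ≤ |l| * c⁻¹ + |l| * (1 / c) := by linarith
            _ = _ := by ring
      _ = 4 / c ^ 2 * l ^ 2 := by rw [mul_pow, sq_abs]; ring
  have e6 : c * seg * (Real.exp (l * c⁻¹ - C * l ^ 2) - 1) ≤
      c * seg * ((l * c⁻¹ - C * l ^ 2) + 4 / c ^ 2 * l ^ 2) :=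
    mul_le_mul_of_nonneg_left (by linarith) (by positivity)
  have e7 : d * (Real.exp (l * -(seg / d)) - 1) ≤ d * (l * -(seg / d) + (l * -(seg / d)) ^ 2) :=
    mul_le_mul_of_nonneg_left (by linarith) hd'.le
  have e8 : d * (l * -(seg / d) + (l * -(seg / d)) ^ 2) = -(l * seg) + l ^ 2 * seg * (seg / d) := by
    field_simp
  have e9 : seg / d ≤ Δ / d₀ := div_le_div₀ hΔ hsegΔ hd₀ hd
  have e10 : l ^ 2 * seg * (seg / d) ≤ l ^ 2 * seg * (Δ / d₀) :=
    mul_le_mul_of_nonneg_left e9 (by positivity)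
  -- The value of C is fixed here. A hit has probability c seg; the penalty C l² on hits compensates
  -- both the second-order term of the hits and that of the losses. This allows normalization by
  -- hits alone.
  have e11 : c * seg * ((l * c⁻¹ - C * l ^ 2) + 4 / c ^ 2 * l ^ 2) =
      l * seg - l ^ 2 * seg * (Δ / d₀) := by
    rw [hC]; field_simp; ring
  linarith

theorem priceLaw_Iio {v : ℝ} (hv : v ≤ M.b (Fin.last r)) :
    E.priceLaw (Set.Iio v) = ENNReal.ofReal (E.q v) := by
  rw [← priceLaw_Iic E hv]
  refine le_antisymm (measure_mono Set.Iio_subset_Iic_self) ?_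
  have h0 : E.priceLaw {v} = 0 := by
    have := priceLaw_Icc_le E (le_refl v) hv
    rw [Set.Icc_self, sub_self, mul_zero, ENNReal.ofReal_zero] at this
    exact le_antisymm this bot_le
  calc E.priceLaw (Set.Iic v) ≤ E.priceLaw (Set.Iio v ∪ {v}) := measure_mono fun x hx => by
        rcases lt_or_eq_of_le (show x ≤ v from hx) with h | h
        · exact Or.inl h
        · exact Or.inr h
    _ ≤ _ := (measure_union_le _ _).trans (by rw [h0, add_zero])

theorem priceLaw_hit (i : Fin r) {x : ℝ} (hx : x ≤ M.b (Fin.last r)) :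
    E.priceLaw.real {p | p < x ∧ M.b i.castSucc < p ∧ p ≤ M.b i.succ} =
      E.c i * qSegment M.b i x := by
  have hle : M.b i.castSucc ≤ M.b i.succ := (cell_pos M i).le |> sub_nonneg.1
  rcases le_total x (M.b i.castSucc) with h | h
  · have : {p | p < x ∧ M.b i.castSucc < p ∧ p ≤ M.b i.succ} = ∅ := by
      ext p; simp only [Set.mem_ofPred_eq, Set.mem_empty_iff_false, iff_false]
      rintro ⟨h1, h2, -⟩; linarith
    rw [this, qSegment_of_le M.b_strictMono i h]; simp
  · have hqd : ∀ w, M.b i.castSucc ≤ w → w ≤ M.b i.succ → E.q w - E.q (M.b i.castSucc) =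
        E.c i * (w - M.b i.castSucc) := by
      intro w h1 h2
      rw [Environment.q, qFun_eq, qFun_eq, ← Finset.sum_sub_distrib,
        Finset.sum_eq_single i (fun j _ hj => ?_) (by simp)]
      · rw [qSegment, qSegment, min_eq_right h2, min_eq_left h1, min_eq_right hle, min_self]; ring
      · rcases lt_or_gt_of_ne hj with hj | hj
        · have := M.b_strictMono.monotone (Fin.succ_le_castSucc_iff.2 hj)
          rw [qSegment_of_ge M.b_strictMono j (this.trans h1),
            qSegment_of_ge M.b_strictMono j this, sub_self]
        · have := M.b_strictMono.monotone (Fin.succ_le_castSucc_iff.2 hj)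
          rw [qSegment_of_le M.b_strictMono j (h2.trans this),
            qSegment_of_le M.b_strictMono j (hle.trans this), sub_self]
    rcases le_total x (M.b i.succ) with h' | h'
    · have hs : {p | p < x ∧ M.b i.castSucc < p ∧ p ≤ M.b i.succ} =
          Set.Iio x \ Set.Iic (M.b i.castSucc) := by
        ext p
        simp only [Set.mem_ofPred_eq, Set.mem_sdiff, Set.mem_Iio, Set.mem_Iic, not_le]
        exact ⟨fun ⟨a, b, _⟩ => ⟨a, b⟩, fun ⟨a, b⟩ => ⟨a, b, (a.le.trans h')⟩⟩
      rcases eq_or_lt_of_le h with rfl | hlt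
      · rw [qSegment_of_le M.b_strictMono i le_rfl, mul_zero, hs]
        have : Set.Iio (M.b i.castSucc) \ Set.Iic (M.b i.castSucc) = ∅ := by
          ext p; simp only [Set.mem_sdiff, Set.mem_Iio, Set.mem_Iic, Set.mem_empty_iff_false, iff_false]
          rintro ⟨a, b⟩; exact b a.le
        rw [this]; simp
      · rw [hs, Measure.real, measure_sdiff (Set.Iic_subset_Iio.2 hlt)
          measurableSet_Iic.nullMeasurableSet (measure_ne_top _ _), priceLaw_Iio E hx,
          priceLaw_Iic E (h.trans hx), ← ENNReal.ofReal_sub _ (q_nonneg E _), hqd x h h',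
          qSegment, min_eq_right h', min_eq_left h]
        exact ENNReal.toReal_ofReal (mul_nonneg (E.c_pos i).le (by linarith))
    · rw [qSegment_of_ge M.b_strictMono i h', ← hqd _ hle le_rfl]
      refine le_antisymm ?_ ?_
      · have h1 : E.priceLaw.real {p | p < x ∧ M.b i.castSucc < p ∧ p ≤ M.b i.succ} ≤
          E.priceLaw.real (Set.Ioc (M.b i.castSucc) (M.b i.succ)) := measureReal_mono fun p hp => hp.2
        refine h1.trans (le_of_eq ?_)
        rw [Measure.real, priceLaw_Ioc E hle (h'.trans hx), ENNReal.toReal_ofReal]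
        rw [hqd _ hle le_rfl]; exact mul_nonneg (E.c_pos i).le (by linarith)
      · have h2 : Set.Iio (M.b i.succ) \ Set.Iic (M.b i.castSucc) ⊆
          {p | p < x ∧ M.b i.castSucc < p ∧ p ≤ M.b i.succ} := by
          rintro p ⟨a, b⟩
          exact ⟨lt_of_lt_of_le a h', not_le.1 b, le_of_lt a⟩
        refine le_trans (le_of_eq ?_) (measureReal_mono h2)
        rw [Measure.real, measure_sdiff (Set.Iic_subset_Iio.2 (sub_pos.1 (cell_pos M i)))
          measurableSet_Iic.nullMeasurableSet (measure_ne_top _ _), priceLaw_Iio E (h'.trans hx),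
          priceLaw_Iic E (h.trans hx), ← ENNReal.ofReal_sub _ (q_nonneg E _),
          ENNReal.toReal_ofReal]
        rw [hqd _ hle le_rfl]; exact mul_nonneg (E.c_pos i).le (by linarith)

open Classical in
/-- The observation made when bidding `x` against the price `p`. -/
def obsOf (x p : ℝ) : QObs := (x, decide (p < x), if p < x then p else 0)

theorem obsScore_obsOf (i : Fin r) (x p : ℝ) [Decidable (p < x)]
    [Decidable (M.b i.castSucc < p ∧ p ≤ M.b i.succ)] : E.obsScore i (obsOf x p) =
    if p < x then (if M.b i.castSucc < p ∧ p ≤ M.b i.succ then (E.c i)⁻¹ else 0)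
      else -(qSegment M.b i x / (1 - E.q x)) := by
  by_cases h : p < x <;> simp [Environment.obsScore, obsOf, h]

theorem obsHit_obsOf (i : Fin r) (x p : ℝ) [Decidable (p < x)]
    [Decidable (M.b i.castSucc < p ∧ p ≤ M.b i.succ)] : obsHit M i (obsOf x p) =
    if p < x then (if M.b i.castSucc < p ∧ p ≤ M.b i.succ then 1 else 0) else 0 := by
  by_cases h : p < x <;> simp [obsHit, obsOf, h]

/-- The exponential takes three values: A on wins in the cell i, B on losses, and 1 otherwise. Its
mean is computed from the probabilities c_i qSegment and 1 - q. -/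
theorem lintegral_exp_obsScore_le (i : Fin r) {l C x : ℝ}
    (hC : C = (4 / E.c i + (M.b i.succ - M.b i.castSucc) / E.slack) / E.c i)
    (h1 : |l| ≤ E.c i / 2) (h2 : |l| * (M.b i.succ - M.b i.castSucc) ≤ E.slack)
    (h3 : C * |l| ≤ 1 / E.c i) (hx : x ≤ M.b (Fin.last r)) :
    ∫⁻ p, ENNReal.ofReal (Real.exp (l * E.obsScore i (obsOf x p) -
      C * l ^ 2 * obsHit M i (obsOf x p))) ∂E.priceLaw ≤ 1 := by
  classical
  set A := Real.exp (l * (E.c i)⁻¹ - C * l ^ 2)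
  set B := Real.exp (l * -(qSegment M.b i x / (1 - E.q x)))
  set H : Set ℝ := {p | p < x ∧ M.b i.castSucc < p ∧ p ≤ M.b i.succ}
  have hH : MeasurableSet H := measurableSet_Iio.inter measurableSet_Ioc
  have hf : ∀ p, Real.exp (l * E.obsScore i (obsOf x p) - C * l ^ 2 * obsHit M i (obsOf x p)) =
      1 + H.indicator (fun _ => A - 1) p + (Set.Ici x).indicator (fun _ => B - 1) p := by
    intro p
    rw [obsScore_obsOf, obsHit_obsOf]
    by_cases hp : p < x
    · have h4 : p ∉ Set.Ici x := by simpa using hp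
      by_cases hc : M.b i.castSucc < p ∧ p ≤ M.b i.succ
      · have h5 : p ∈ H := ⟨hp, hc⟩
        simp [hp, hc, h5, A]
      · have h5 : p ∉ H := fun h => hc h.2
        simp [hp, hc, h5]
    · have h4 : p ∈ Set.Ici x := not_lt.1 hp
      have h5 : p ∉ H := fun h => hp h.1
      rw [if_neg hp, if_neg hp, Set.indicator_of_mem h4, Set.indicator_of_notMem h5, mul_zero,
        sub_zero]
      ring
  have i1 : Integrable (H.indicator fun _ => A - 1) E.priceLaw :=
    (integrable_const _).indicator hH
  have i2 : Integrable ((Set.Ici x).indicator fun _ => B - 1) E.priceLaw :=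
    (integrable_const _).indicator measurableSet_Ici
  have i3 : Integrable (fun p => 1 + H.indicator (fun _ => A - 1) p +
      (Set.Ici x).indicator (fun _ => B - 1) p) E.priceLaw := ((integrable_const _).add i1).add i2
  have hloss : E.priceLaw.real (Set.Ici x) = 1 - E.q x := by
    have : Set.Ici x = (Set.Iio x)ᶜ := by ext; simp
    rw [this, probReal_compl_eq_one_sub measurableSet_Iio, Measure.real, priceLaw_Iio E hx,
      ENNReal.toReal_ofReal (q_nonneg E _)]
  simp only [hf]
  rw [← ofReal_integral_eq_lintegral_ofReal i3 (Filter.Eventually.of_forall fun p => by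
    simp only [Pi.zero_apply]; rw [← hf]; exact (Real.exp_pos _).le)]
  have i4 : Integrable (fun p => 1 + H.indicator (fun _ => A - 1) p) E.priceLaw :=
    (integrable_const _).add i1
  rw [integral_add i4 i2, integral_add (integrable_const _) i1,
    integral_indicator_const _ hH, integral_indicator_const _ measurableSet_Ici, hloss,
    priceLaw_hit E i hx]
  simp only [integral_const, probReal_univ, smul_eq_mul, one_mul]
  rw [← ENNReal.ofReal_one]
  refine ENNReal.ofReal_le_ofReal ?_
  have := exp_score_inequality (E.c_pos i) (qSegment_nonneg M.b_strictMono i x)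
    (qSegment_le M.b_strictMono i x) (slack_pos E) (slack_le E x) hC h1 h2 h3
  linarith

/-- Accumulated score of an episode. -/
def Environment.score (i : Fin r) (π : ℝ → ℝ) (s : Seed) : ℝ :=
  ((qData π s).map (E.obsScore i)).sum

/-- Number of wins of an episode at prices in the cell `i`. -/
def hits (M : Model m r) (i : Fin r) (π : ℝ → ℝ) (s : Seed) : ℝ := ((qData π s).map (obsHit M i)).sum

theorem qData_eq (π : ℝ → ℝ) (s : Seed) : qData π s =
    (List.range s.numAuctions).map fun j => obsOf (π (age π s j)) (s.price j) := by
  refine List.map_congr_left fun j _ => ?_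
  by_cases h : s.price j < π (age π s j)
  · have hw : Won π s j := h
    simp [obsOf, h, hw]
  · have hw : ¬ Won π s j := h
    simp [obsOf, h, hw]

theorem sum_map_qData (f : QObs → ℝ) (π : ℝ → ℝ) (s : Seed) : ((qData π s).map f).sum =
    ∑ j ∈ Finset.range s.numAuctions, f (obsOf (π (age π s j)) (s.price j)) := by
  rw [qData_eq, List.map_map]
  rfl

theorem measurable_obsScore (i : Fin r) :
    Measurable fun z : ℝ × ℝ => E.obsScore i (obsOf z.1 z.2) := by
  classical
  simp only [obsScore_obsOf]
  have hq : Measurable E.q := (continuous_qFun (b := M.b) (c := E.c)).measurable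
  refine Measurable.ite (measurableSet_lt measurable_snd measurable_fst) (Measurable.ite
    (measurable_snd measurableSet_Ioc) measurable_const measurable_const) ?_
  exact ((((continuous_qSegment i).measurable.comp measurable_fst).div
    ((hq.comp measurable_fst).const_sub 1))).neg

theorem measurable_obsHit (i : Fin r) :
    Measurable fun z : ℝ × ℝ => obsHit M i (obsOf z.1 z.2) := by
  classical
  simp only [obsHit_obsOf]
  exact Measurable.ite (measurableSet_lt measurable_snd measurable_fst) (Measurable.ite
    (measurable_snd measurableSet_Ioc) measurable_const measurable_const) measurable_const

section joint

variable {X : Type*} [MeasurableSpace X] {Pol : X → ℝ → ℝ} {S : X → Seed}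

theorem measurable_sum_qData {f : QObs → ℝ} (hf : Measurable fun z : ℝ × ℝ => f (obsOf z.1 z.2))
    (hPol : Measurable (Function.uncurry Pol)) (hS : Measurable S) :
    Measurable fun x => ((qData (Pol x) (S x)).map f).sum := by
  simp only [sum_map_qData]
  refine Measurable.comp_nat (F := fun x n => ∑ j ∈ Finset.range n,
    f (obsOf (Pol x (age (Pol x) (S x) j)) ((S x).price j))) (fun n => ?_)
    (measurable_numAuctions.comp hS)
  exact Finset.measurable_sum _ fun j _ => hf.comp ((measurable_bid hPol hS j).prodMk
    ((measurable_price j).comp hS))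

end joint

def Seed.setPrices (s : Seed) (u : ℕ → ℝ) : Seed := (s.1, s.2.1, u, s.2.2.2)

attribute [local instance] isProbabilityMeasure_gamma isProbabilityMeasure_mu

theorem resamples_prices : Resamples Seed.setPrices E.seedLaw
    (Measure.infinitePi fun _ : ℕ => E.priceLaw) :=
  Resamples.snd (Resamples.snd (Resamples.fst Resamples.self))

/-- The prices are integrated with the rest of the seed fixed. Each bid depends on earlier prices
only, so the factors are adapted and the one-auction bound applies to each of them. -/
theorem lintegral_exp_score_le (i : Fin r) {l C : ℝ}
    (hC : C = (4 / E.c i + (M.b i.succ - M.b i.castSucc) / E.slack) / E.c i)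
    (h1 : |l| ≤ E.c i / 2) (h2 : |l| * (M.b i.succ - M.b i.castSucc) ≤ E.slack)
    (h3 : C * |l| ≤ 1 / E.c i) {π : ℝ → ℝ} (hπ : Measurable π)
    (hb : ∀ τ, π τ ≤ M.b (Fin.last r)) :
    ∫⁻ s, ENNReal.ofReal (Real.exp (l * E.score i π s - C * l ^ 2 * hits M i π s)) ∂E.seedLaw ≤ 1 := by
  have hPol : Measurable (Function.uncurry fun _ : Seed => π) := hπ.comp measurable_snd
  have m1 : Measurable fun s => E.score i π s :=
    measurable_sum_qData (Pol := fun _ => π) (measurable_obsScore E i) hPol measurable_id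
  have m2 : Measurable fun s => hits M i π s :=
    measurable_sum_qData (Pol := fun _ => π) (measurable_obsHit i) hPol measurable_id
  have m3 : Measurable fun s => l * E.score i π s - C * l ^ 2 * hits M i π s :=
    (m1.const_mul l).sub (m2.const_mul (C * l ^ 2))
  rw [(resamples_prices E).lintegral_eq m3.exp.ennreal_ofReal]
  calc _ ≤ ∫⁻ _, 1 ∂E.seedLaw := lintegral_mono fun s => ?_
    _ = 1 := by simp
  have key : ∀ u, ENNReal.ofReal (Real.exp (l * E.score i π (s.setPrices u) -
      C * l ^ 2 * hits M i π (s.setPrices u))) =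
      ∏ j ∈ Finset.range s.numAuctions, ENNReal.ofReal (Real.exp
        (l * E.obsScore i (obsOf (π (age π (s.setPrices u) j)) (u j)) -
          C * l ^ 2 * obsHit M i (obsOf (π (age π (s.setPrices u) j)) (u j)))) := by
    intro u
    rw [Environment.score, hits, sum_map_qData, sum_map_qData,
      ← ENNReal.ofReal_prod_of_nonneg fun _ _ => (Real.exp_pos _).le, ← Real.exp_sum,
      Finset.sum_sub_distrib, ← Finset.mul_sum, ← Finset.mul_sum]
    rfl
  have hset : Measurable fun u => s.setPrices u :=
    (measurable_const.prodMk (measurable_const.prodMk (measurable_id.prodMk measurable_const)))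
  have hage : ∀ u u' : ℕ → ℝ, ∀ j, (∀ k < j, u k = u' k) →
      age π (s.setPrices u) j = age π (s.setPrices u') j := fun u u' j h =>
    age_congr (fun _ _ => rfl) h
  have goal : ∫⁻ u, ∏ j ∈ Finset.range s.numAuctions, ENNReal.ofReal (Real.exp
        (l * E.obsScore i (obsOf (π (age π (s.setPrices u) j)) (u j)) -
          C * l ^ 2 * obsHit M i (obsOf (π (age π (s.setPrices u) j)) (u j))))
      ∂(Measure.infinitePi fun _ : ℕ => E.priceLaw) ≤ 1 := by
    refine lintegral_prod_le_one (fun j => ?_) (fun j u u' h => ?_) (fun j u => ?_) _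
    · have hb : Measurable fun u : ℕ → ℝ => (π (age π (s.setPrices u) j), u j) :=
        (measurable_bid (Pol := fun _ : ℕ → ℝ => π) (hπ.comp measurable_snd) hset j).prodMk
          (measurable_pi_apply j)
      have m4 := (measurable_obsScore E i).comp hb
      have m5 := (measurable_obsHit (M := M) i).comp hb
      have m6 := (m4.const_mul l).sub (m5.const_mul (C * l ^ 2))
      exact m6.exp.ennreal_ofReal
    · rw [h j le_rfl, hage u u' j fun k hk => h k hk.le]
    · have : ∀ p, age π (s.setPrices (Function.update u j p)) j = age π (s.setPrices u) j :=
        fun p => hage _ _ j fun k hk => Function.update_of_ne hk.ne _ _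
      simp only [Function.update_self, this]
      exact lintegral_exp_obsScore_le E i hC h1 h2 h3 (hb _)
  simpa only [key] using goal

theorem hits_nonneg (i : Fin r) (π : ℝ → ℝ) (s : Seed) : 0 ≤ hits M i π s := by
  refine List.sum_nonneg fun x hx => ?_
  obtain ⟨o, _, rfl⟩ := List.mem_map.1 hx
  unfold obsHit
  split_ifs <;> norm_num

theorem hits_le (i : Fin r) (π : ℝ → ℝ) (s : Seed) : hits M i π s ≤ s.numAuctions := by
  rw [hits, sum_map_qData]
  refine (Finset.sum_le_sum (g := fun _ => (1:ℝ)) fun j _ => ?_).trans (by simp)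
  unfold obsHit
  split_ifs <;> norm_num

/-- Scores obey a law of the iterated logarithm, normalized by the number of hits. -/
theorem exists_score_bound (i : Fin r) {δ : ℝ} (hδ : 0 < δ) : ∃ A : ℝ, 0 ≤ A ∧
    ∀ P : ℕ → (ℕ → Seed) → ℝ → ℝ, AdaptedPolicy M P → E.runLaw {ω | ¬ ∀ n : ℕ,
      (∑ j ∈ Finset.range n, E.score i (P j ω) (ω j)) ^ 2 ≤
        A * (2 * ∑ j ∈ Finset.range n, hits M i (P j ω) (ω j) + 1) * iterLog (n + 1)} ≤
      ENNReal.ofReal δ := by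
  set Δ := M.b i.succ - M.b i.castSucc
  have hΔ : 0 < Δ := cell_pos M i
  have hc := E.c_pos i
  have hs := slack_pos E
  obtain ⟨C, hC⟩ : ∃ C, C = (4 / E.c i + Δ / E.slack) / E.c i := ⟨_, rfl⟩
  have hC0 : 0 < C := by rw [hC]; positivity
  -- The three terms of the minimum are the three smallness conditions on |l| in
  -- `lintegral_exp_obsScore_le`.
  obtain ⟨A, hA, hlil⟩ := exists_adapted_lil_bound (M := M) E
    (l₀ := min (E.c i / 2) (min (E.slack / Δ) (1 / E.c i / C)))
    (by positivity) hC0.le (half_pos hδ)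
  obtain ⟨B, hB, hBb⟩ := exists_average_bounded (P := E.seedLaw)
    (h := fun s => (s.numAuctions : ℝ) ^ 1)
    ((measurable_from_nat.comp measurable_numAuctions).pow_const 1) (integrable_numAuctions_pow E 1)
    (fun s => by positivity) (half_pos hδ)
  obtain ⟨C', hC', hdy⟩ := exists_dyadic hB
  refine ⟨A ^ 2 * C', by positivity, fun P hP => ?_⟩
  have h1 := hlil P (E.score i) (hits M i) hP
    (fun j => measurable_sum_qData (measurable_obsScore E i) (hP.measurable j) (measurable_pi_apply j))
    (fun j => measurable_sum_qData (measurable_obsHit i) (hP.measurable j) (measurable_pi_apply j))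
    (fun l hl π hπ hb => by
      rw [le_min_iff, le_min_iff] at hl
      exact lintegral_exp_score_le E i hC hl.1 ((le_div_iff₀ hΔ).1 hl.2.1)
        (by rw [mul_comm]; exact (le_div_iff₀ hC0).1 hl.2.2) hπ fun τ => (hb τ).2)
  refine (measure_mono (t := {ω | ¬ ∀ n k : ℕ, ∑ j ∈ Finset.range n, hits M i (P j ω) (ω j) ≤ 2 ^ k →
        |∑ j ∈ Finset.range n, E.score i (P j ω) (ω j)| ≤
          A * Real.sqrt (2 ^ k * Real.log (k + 2))} ∪ {ω | ¬ ∀ n : ℕ,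
      ∑ i ∈ Finset.range n, ((ω i).numAuctions : ℝ) ^ 1 ≤ B * n}) ?_).trans
    ((measure_union_le _ _).trans ((add_le_add h1 hBb).trans (le_of_eq ?_)))
  · intro ω hω
    by_contra hcon
    simp only [Set.mem_union, Set.mem_ofPred_eq, not_or, not_not] at hcon
    refine hω fun n => ?_
    have hV0 : 0 ≤ ∑ j ∈ Finset.range n, hits M i (P j ω) (ω j) :=
      Finset.sum_nonneg fun j _ => hits_nonneg i _ _
    -- The scale is that of the random number of hits itself, not of its linear upper bound: the
    -- result is self-normalized.
    obtain ⟨k, hk1, hk2, hk3⟩ := hdy n (∑ j ∈ Finset.range n, hits M i (P j ω) (ω j))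
      ((Finset.sum_le_sum fun j _ => by rw [pow_one]; exact hits_le i _ _).trans (hcon.2 n)) hV0
    have h2 := hcon.1 n k hk1
    have hlog : 0 ≤ Real.log ((k:ℝ) + 2) := Real.log_nonneg (by linarith [k.cast_nonneg (α := ℝ)])
    rw [← sq_abs]
    calc _ ≤ (A * Real.sqrt (2 ^ k * Real.log (k + 2))) ^ 2 := pow_le_pow_left₀ (abs_nonneg _) h2 2
      _ = A ^ 2 * (2 ^ k * Real.log (k + 2)) := by
        rw [mul_pow, Real.sq_sqrt (mul_nonneg (by positivity) hlog)]
      _ ≤ A ^ 2 * ((2 * ∑ j ∈ Finset.range n, hits M i (P j ω) (ω j) + 1) *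
          (C' * iterLog (n + 1))) := by
        refine mul_le_mul_of_nonneg_left ?_ (sq_nonneg _)
        exact mul_le_mul hk2 hk3 hlog (by positivity)
      _ = _ := by ring
  · rw [← ENNReal.ofReal_add (by positivity) (by positivity), add_halves]

theorem history_sum (L : Learner M) (f : QObs → ℝ) (ω : ℕ → Seed) (n : ℕ) :
    ((E.history L ω n).2.map f).sum =
      ∑ j ∈ Finset.range n, ((qData (E.pol L j ω) (ω j)).map f).sum := by
  induction n with
  | zero => rfl
  | succ n ih => rw [history_succ, Finset.sum_range_succ, ← ih, List.map_append, List.sum_append]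

theorem history_valid (L : Learner M) {ω : ℕ → Seed} (hω : ∀ j, (ω j).Good) (n : ℕ) :
    ∀ o ∈ (E.history L ω n).2, ValidObs M o := by
  induction n with
  | zero => intro o ho; exact absurd ho List.not_mem_nil
  | succ n ih =>
    intro o ho
    rw [history_succ] at ho
    rcases List.mem_append.1 ho with h | h
    · exact ih o h
    · rw [qData_eq] at h
      obtain ⟨j, _, rfl⟩ := List.mem_map.1 h
      intro hw
      have hlt : (ω n).price j < E.pol L n ω (age (E.pol L n ω) (ω n) j) := by
        simpa [obsOf] using hw
      have h1 : (obsOf (E.pol L n ω (age (E.pol L n ω) (ω n) j)) ((ω n).price j)).2.2 =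
        (ω n).price j := by simp [obsOf, hlt]
      rw [h1]
      exact ⟨(hω n).price_pos j, hlt.le.trans ((adaptedPolicy_pol E L).mem n ω _).2⟩

/-- The maximum likelihood estimator, cell by cell. -/
theorem exists_mle_bound {δ : ℝ} (hδ : 0 < δ) : ∃ A : ℝ, 0 ≤ A ∧ ∀ L : Learner M,
    E.runLaw {ω | ¬ ∀ (n : ℕ) (i : Fin r), (L.cHat (E.history L ω n).2 i - E.c i) ^ 2 *
      ∑ j ∈ Finset.range n, hits M i (E.pol L j ω) (ω j) ≤ A * iterLog (n + 1)} ≤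
      ENNReal.ofReal δ := by
  have hr : (0:ℝ) < r + 1 := by positivity
  have hδ' : 0 < δ / (r + 1) := by positivity
  choose A hA hAb using fun i => exists_score_bound E i hδ'
  have hκ := curvature_pos E
  have hl0 := iterLog_pos 0
  set κ := E.curvature
  set U : ℝ := ∑ i : Fin r, ((M.b i.succ - M.b i.castSucc)⁻¹) ^ 2
  have hU : 0 ≤ U := Finset.sum_nonneg fun _ _ => sq_nonneg _
  refine ⟨2 / κ * (κ / 4 * U / iterLog 0 + (∑ i, A i) / κ), ?_, fun L => ?_⟩
  · have : 0 ≤ ∑ i, A i := Finset.sum_nonneg fun i _ => hA i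
    positivity
  have hgood := ae_iff.1 (ae_run_good E)
  refine (measure_mono (t := (⋃ i, {ω | ¬ ∀ n : ℕ,
      (∑ j ∈ Finset.range n, E.score i (E.pol L j ω) (ω j)) ^ 2 ≤
        A i * (2 * ∑ j ∈ Finset.range n, hits M i (E.pol L j ω) (ω j) + 1) * iterLog (n + 1)}) ∪
      {ω | ¬ ∀ j, (ω j).Good}) ?_).trans ((measure_union_le _ _).trans ?_)
  · intro ω hω
    by_contra hcon
    simp only [Set.mem_union, Set.mem_iUnion, Set.mem_ofPred_eq, not_or, not_exists, not_not] at hcon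
    obtain ⟨hc1, hc2⟩ := hcon
    refine hω fun n i => ?_
    set N : Fin r → ℝ := fun i => ∑ j ∈ Finset.range n, hits M i (E.pol L j ω) (ω j)
    have hN : ∀ i, 0 ≤ N i := fun i => Finset.sum_nonneg fun j _ => hits_nonneg i _ _
    set S : Fin r → ℝ := fun i => ∑ j ∈ Finset.range n, E.score i (E.pol L j ω) (ω j)
    set u : Fin r → ℝ := fun i => L.cHat (E.history L ω n).2 i - E.c i
    have hmem := L.isMLE.mem (E.history L ω n).2
    have h1 := curvature_mul_le E hmem (history_valid E L hc2 n)
      (L.isMLE.max _ _ (c_mem E))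
    simp only [history_sum] at h1
    have h1' : κ * ∑ i, u i ^ 2 * N i ≤ ∑ i, u i * S i := h1
    set ll := iterLog (n + 1)
    have hll : iterLog 0 ≤ ll := iterLog_mono (Nat.zero_le _)
    -- Young's inequality with weight 2 N + 1: half of the curvature term absorbs the part with u²
    -- N, and S² is at most of order (2 N + 1) times the iterated logarithm, so N cancels. The
    -- remaining u² is bounded because both vectors lie in the polytope.
    have h2 : ∀ i, u i * S i ≤ κ / 2 * (u i ^ 2 * N i) + κ / 4 * u i ^ 2 + A i / κ * ll := by
      intro i
      have h3 : S i ^ 2 ≤ A i * (2 * N i + 1) * ll := hc1 i n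
      have hw : 0 < 2 * N i + 1 := by linarith [hN i]
      have h4 : u i * S i ≤ κ / 4 * u i ^ 2 * (2 * N i + 1) + S i ^ 2 / (κ * (2 * N i + 1)) := by
        have h5 : 0 ≤ (κ / 2 * u i * (2 * N i + 1) - S i) ^ 2 / (κ * (2 * N i + 1)) := by positivity
        have h6 : (κ / 2 * u i * (2 * N i + 1) - S i) ^ 2 / (κ * (2 * N i + 1)) =
          κ / 4 * u i ^ 2 * (2 * N i + 1) - u i * S i + S i ^ 2 / (κ * (2 * N i + 1)) := by
          field_simp; ring
        linarith
      have h7 : S i ^ 2 / (κ * (2 * N i + 1)) ≤ A i / κ * ll := by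
        rw [div_le_iff₀ (by positivity)]
        refine h3.trans (le_of_eq ?_)
        field_simp
      linarith
    have h3 := Finset.sum_le_sum fun i (_ : i ∈ Finset.univ) => h2 i
    rw [Finset.sum_add_distrib, Finset.sum_add_distrib, ← Finset.mul_sum, ← Finset.mul_sum,
      ← Finset.sum_mul, ← Finset.sum_div] at h3
    have h4 : ∑ i, u i ^ 2 ≤ U := Finset.sum_le_sum fun i _ => by
      rw [← sq_abs]
      refine pow_le_pow_left₀ (abs_nonneg _) ?_ 2
      rw [abs_le]
      have e1 := le_inv_cell hmem i
      have e2 := le_inv_cell (c_mem E) i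
      have e3 := hmem.1 i
      have e4 := (c_mem E).1 i
      constructor <;> simp only [u] <;> linarith
    have h5 : U ≤ U / iterLog 0 * ll := by
      rw [div_mul_eq_mul_div, le_div_iff₀ hl0]
      exact mul_le_mul_of_nonneg_left hll hU
    have h6 : u i ^ 2 * N i ≤ ∑ i, u i ^ 2 * N i :=
      Finset.single_le_sum (f := fun i => u i ^ 2 * N i)
        (fun j _ => mul_nonneg (sq_nonneg _) (hN j)) (Finset.mem_univ i)
    have h7 : κ / 2 * ∑ i, u i ^ 2 * N i ≤ (κ / 4 * U / iterLog 0 + (∑ i, A i) / κ) * ll := by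
      have h8 := mul_le_mul_of_nonneg_left (h4.trans h5) (by positivity : 0 ≤ κ / 4)
      have h9 : κ / 4 * (U / iterLog 0 * ll) = κ / 4 * U / iterLog 0 * ll := by ring
      linarith
    have h8 : u i ^ 2 * N i ≤ 2 / κ * (κ / 4 * U / iterLog 0 + (∑ i, A i) / κ) * ll := by
      calc u i ^ 2 * N i ≤ ∑ i, u i ^ 2 * N i := h6
        _ = 2 / κ * (κ / 2 * ∑ i, u i ^ 2 * N i) := by field_simp
        _ ≤ 2 / κ * ((κ / 4 * U / iterLog 0 + (∑ i, A i) / κ) * ll) :=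
          mul_le_mul_of_nonneg_left h7 (by positivity)
        _ = _ := by ring
    exact h8
  · rw [hgood, add_zero]
    refine (measure_iUnion_fintype_le _ _).trans
      ((Finset.sum_le_sum fun i _ => hAb i _ (adaptedPolicy_pol E L)).trans ?_)
    rw [Finset.sum_const, Finset.card_univ, Fintype.card_fin, nsmul_eq_mul,
      ← ENNReal.ofReal_natCast, ← ENNReal.ofReal_mul (by positivity)]
    refine ENNReal.ofReal_le_ofReal ?_
    rw [mul_div_assoc', div_le_iff₀ hr]
    nlinarith

end score


/-! ## Slow variation of the iterated logarithm -/

def slowConst : ℝ := 1 + 2 / iterLog 0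

theorem one_le_slowConst : 1 ≤ slowConst :=
  le_add_of_nonneg_right (div_nonneg zero_le_two (iterLog_pos 0).le)

/-- With ρ = n/n', log log n exceeds log log n' by at most log ρ ≤ 2 √ρ. This is crude, but any
growth slower than ρ is enough for the radii to decay. -/
theorem iterLog_le {n n' : ℕ} (hn' : 0 < n') (h : n' ≤ n) :
    iterLog n ≤ slowConst * iterLog n' * Real.sqrt (n / n') := by
  have hn0 : (0:ℝ) < n' := by exact_mod_cast hn'
  have hnn : (n' : ℝ) ≤ n := by exact_mod_cast h
  set ρ : ℝ := n / n'
  have hρ : 1 ≤ ρ := (one_le_div hn0).2 hnn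
  have hsρ : 1 ≤ Real.sqrt ρ := Real.one_le_sqrt.2 hρ
  have h1 : max (n : ℝ) 3 ≤ max (n' : ℝ) 3 * ρ := by
    refine max_le ?_ ?_
    · calc (n : ℝ) = n' * ρ := by simp only [ρ]; field_simp
        _ ≤ _ := mul_le_mul_of_nonneg_right (le_max_left _ _) (by linarith)
    · calc (3:ℝ) ≤ max (n' : ℝ) 3 := le_max_right _ _
        _ ≤ _ := le_mul_of_one_le_right (by positivity) hρ
  have h2 := Real.log_le_log (by positivity) h1
  rw [Real.log_mul (by positivity) (by positivity)] at h2
  set X' := Real.log (max (n' : ℝ) 3)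
  have hX' : 1 < X' := one_lt_log_max n'
  have hlρ : 0 ≤ Real.log ρ := Real.log_nonneg hρ
  have h3 : X' + Real.log ρ ≤ X' * (1 + Real.log ρ) := by nlinarith
  have h4 := Real.log_le_log (zero_lt_one.trans (one_lt_log_max n)) (h2.trans h3)
  rw [Real.log_mul (by linarith) (by linarith)] at h4
  have h5 : Real.log (1 + Real.log ρ) ≤ Real.log ρ := by
    have := Real.log_le_sub_one_of_pos (by linarith : 0 < 1 + Real.log ρ); linarith
  have h6 : Real.log ρ ≤ 2 * Real.sqrt ρ := by
    have e : Real.log ρ = 2 * Real.log (Real.sqrt ρ) := by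
      rw [Real.log_sqrt (by linarith)]; ring
    have := Real.log_le_sub_one_of_pos (by linarith : 0 < Real.sqrt ρ)
    rw [e]; linarith
  have h7 : iterLog n ≤ iterLog n' + 2 * Real.sqrt ρ := by
    have e1 : iterLog n = Real.log (Real.log (max (n : ℝ) 3)) := rfl
    have e2 : iterLog n' = Real.log X' := rfl
    rw [e1, e2]; linarith
  have h0 := iterLog_pos 0
  have h8 : 1 ≤ iterLog n' / iterLog 0 := (one_le_div h0).2 (iterLog_mono (Nat.zero_le _))
  have h9 := iterLog_pos n'
  calc iterLog n ≤ iterLog n' * Real.sqrt ρ + 2 * Real.sqrt ρ * (iterLog n' / iterLog 0) :=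
        h7.trans (add_le_add (le_mul_of_one_le_right h9.le hsρ)
          (le_mul_of_one_le_right (by positivity) h8))
    _ = _ := by rw [slowConst]; ring

theorem iterLog_shift_le (n₀ : ℕ) {n : ℕ} (hn : 0 < n) :
    iterLog (n₀ + n) ≤ slowConst * (n₀ + 1) * iterLog n := by
  have hn' : (0:ℝ) < n := by exact_mod_cast hn
  have hn1 : (1:ℝ) ≤ n := by exact_mod_cast hn
  have h0 := iterLog_pos n
  have hs := one_le_slowConst
  refine (iterLog_le hn (Nat.le_add_left _ _)).trans ?_
  have h1 : Real.sqrt (((n₀ + n : ℕ) : ℝ) / n) ≤ n₀ + 1 := by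
    refine Real.sqrt_le_iff.2 ⟨by positivity, ?_⟩
    rw [div_le_iff₀ hn']
    push_cast
    nlinarith [mul_nonneg (n₀.cast_nonneg (α := ℝ)) hn'.le,
      mul_nonneg (n₀.cast_nonneg (α := ℝ)) (sub_nonneg.2 hn1),
      mul_nonneg (mul_nonneg (n₀.cast_nonneg (α := ℝ)) (n₀.cast_nonneg (α := ℝ))) hn'.le]
  calc _ ≤ slowConst * iterLog n * (n₀ + 1) := mul_le_mul_of_nonneg_left h1 (by positivity)
    _ = _ := by ring

theorem sqrt_shift_le (n₀ : ℕ) {n : ℕ} (hn : 0 < n) :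
    Real.sqrt ((n₀ + n : ℕ) * iterLog (n₀ + n)) ≤ slowConst * (n₀ + 1) * (n * radius n) := by
  have hn' : (0:ℝ) < n := by exact_mod_cast hn
  have hn1 : (1:ℝ) ≤ n := by exact_mod_cast hn
  have h0 := iterLog_pos n
  have hs := one_le_slowConst
  refine Real.sqrt_le_iff.2 ⟨mul_nonneg (by positivity) (mul_nonneg hn'.le (radius_nonneg n)), ?_⟩
  have e : (slowConst * (n₀ + 1) * (n * radius n)) ^ 2 =
      slowConst ^ 2 * (n₀ + 1) ^ 2 * n * (radius n ^ 2 * n) := by ring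
  rw [e, radius_sq_mul hn]
  have h1 := iterLog_shift_le n₀ hn
  have h2 : ((n₀ + n : ℕ) : ℝ) ≤ (n₀ + 1) * n := by
    push_cast; nlinarith [mul_nonneg (n₀.cast_nonneg (α := ℝ)) (sub_nonneg.2 hn1)]
  calc _ ≤ ((n₀ + 1) * n) * (slowConst * (n₀ + 1) * iterLog n) :=
        mul_le_mul h2 h1 (iterLog_pos _).le (by positivity)
    _ = slowConst * ((n₀ + 1) ^ 2 * n * iterLog n) := by ring
    _ ≤ slowConst ^ 2 * ((n₀ + 1) ^ 2 * n * iterLog n) := by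
        refine mul_le_mul_of_nonneg_right ?_ (by positivity)
        nlinarith
    _ = _ := by ring

/-- The radius decays at least like (n'/n)^(1/4), with a constant that does not depend on n'. This
uniformity lets the ratio K be chosen before n₂. -/
theorem radius_le {n n' : ℕ} (hn' : 0 < n') (h : n' ≤ n) :
    radius n ^ 2 ≤ slowConst * radius n' ^ 2 * Real.sqrt (n' / n) := by
  have hn0 : (0:ℝ) < n' := by exact_mod_cast hn'
  have hn : (0:ℝ) < n := by exact_mod_cast hn'.trans_le h
  rw [radius_sq, radius_sq, div_le_iff₀ hn]
  refine (iterLog_le hn' h).trans (le_of_eq ?_)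
  have e : Real.sqrt (n / n') = Real.sqrt (n' / n) * (n / n') := by
    rw [Real.sqrt_div hn.le, Real.sqrt_div hn0.le]
    have h1 := Real.sqrt_pos.2 hn
    have h2 := Real.sqrt_pos.2 hn0
    have h3 := Real.sq_sqrt hn.le
    have h4 := Real.sq_sqrt hn0.le
    field_simp
    rw [h3, h4]; ring
  rw [e]; field_simp

theorem radius_le_of_le {n n' : ℕ} (hn' : 0 < n') (h : n' ≤ n) :
    radius n ≤ Real.sqrt slowConst * radius n' := by
  have hs := one_le_slowConst
  have hn0 : (0:ℝ) < n := by exact_mod_cast hn'.trans_le h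
  refine abs_le_of_sq_le_sq' ?_ (mul_nonneg (Real.sqrt_nonneg _) (radius_nonneg _)) |>.2
  rw [mul_pow, Real.sq_sqrt (by linarith)]
  refine (radius_le hn' h).trans (mul_le_of_le_one_right (by positivity) ?_)
  refine Real.sqrt_le_iff.2 ⟨zero_le_one, ?_⟩
  rw [one_pow]
  exact (div_le_one hn0).2 (by exact_mod_cast h)

theorem exists_radius_le (N : ℕ) {ε : ℝ} (hε : 0 < ε) : ∃ n, N ≤ n ∧ 0 < n ∧ radius n ≤ ε := by
  have hs := one_le_slowConst
  obtain ⟨n, hn⟩ := exists_nat_ge ((slowConst * radius 1 ^ 2 / ε ^ 2) ^ 2)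
  refine ⟨N + n + 1, by omega, by omega, ?_⟩
  refine abs_le_of_sq_le_sq' ?_ hε.le |>.2
  refine (radius_le one_pos (by omega)).trans ?_
  have h1 : Real.sqrt (((1:ℕ):ℝ) / ((N + n + 1 : ℕ) : ℝ)) ≤ ε ^ 2 / (slowConst * radius 1 ^ 2) := by
    have hr := radius_pos one_pos
    refine Real.sqrt_le_iff.2 ⟨by positivity, ?_⟩
    rw [div_le_iff₀ (by positivity)]
    have h2 : (slowConst * radius 1 ^ 2 / ε ^ 2) ^ 2 ≤ ((N + n + 1 : ℕ) : ℝ) := by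
      push_cast; linarith [N.cast_nonneg (α := ℝ)]
    calc ((1:ℕ):ℝ) = (ε ^ 2 / (slowConst * radius 1 ^ 2)) ^ 2 * (slowConst * radius 1 ^ 2 / ε ^ 2) ^ 2 := by
          rw [← mul_pow]; push_cast; field_simp
      _ ≤ _ := mul_le_mul_of_nonneg_left h2 (sq_nonneg _)
  have hr := radius_pos one_pos
  calc _ ≤ slowConst * radius 1 ^ 2 * (ε ^ 2 / (slowConst * radius 1 ^ 2)) :=
        mul_le_mul_of_nonneg_left h1 (by positivity)
    _ = ε ^ 2 := by field_simp

theorem sum_radius_sq_le {N : ℕ} (hN : 3 ≤ N) : ∑ n ∈ Finset.Icc 1 N, radius n ^ 2 ≤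
    2 * Real.log N * Real.log (Real.log N) := by
  have h3 : (3:ℝ) ≤ N := by exact_mod_cast hN
  have hll : iterLog N = Real.log (Real.log N) := by rw [iterLog, max_eq_left h3]
  have h1 : ∑ n ∈ Finset.Icc 1 N, radius n ^ 2 ≤ ∑ n ∈ Finset.Icc 1 N, iterLog N * (n:ℝ)⁻¹ := by
    refine Finset.sum_le_sum fun n hn => ?_
    rw [radius_sq, div_eq_mul_inv]
    exact mul_le_mul_of_nonneg_right (iterLog_mono (Finset.mem_Icc.1 hn).2) (by positivity)
  refine h1.trans ?_
  rw [← Finset.mul_sum, ← hll]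
  have h2 : ∑ n ∈ Finset.Icc 1 N, (n:ℝ)⁻¹ ≤ 1 + Real.log N := by
    have := harmonic_le_one_add_log N
    rw [harmonic_eq_sum_Icc] at this
    push_cast at this
    exact this
  have h4 : 1 ≤ Real.log N := one_lt_log_three.le.trans (Real.log_le_log (by norm_num) h3)
  have h5 := iterLog_pos N
  nlinarith

/-! ## Episodes that are informative about a relevant cell -/

section window

variable {m r : ℕ} {M : Model m r} (E : Environment M)

theorem k_zero : E.k 0 = 0 := by
  rw [Environment.k, kFun_eq_sum_min M.t_zero E.a_last le_rfl]
  refine Finset.sum_eq_zero fun i _ => ?_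
  rw [min_eq_right (t_nonneg M _), mul_zero]

/-- If the optimal bid exceeds the left end of the cell at some age, it does so with a margin at
nearby ages. A single auction there, with a price just above the left end, is then won by every
policy that is not much lower than the optimal one. For cells never reached the witnesses are
arbitrary. -/
theorem exists_hit_window {Y : ℝ → ℝ} (hYc : Continuous Y) (i : Fin r) :
    ∃ W : Set Seed, MeasurableSet W ∧ 0 < E.seedLaw.real W ∧ ∃ η : ℝ, 0 < η ∧
      ((∃ τ, 0 ≤ τ ∧ M.b i.castSucc < E.k τ + Y 0 - Y τ) → ∀ s : Seed, s.Good → s ∈ W →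
        ∀ π : ℝ → ℝ, (∀ τ, 0 ≤ τ → E.k τ + Y 0 - Y τ - η ≤ π τ) → 1 ≤ hits M i π s) := by
  by_cases hrel : ∃ τ, 0 ≤ τ ∧ M.b i.castSucc < E.k τ + Y 0 - Y τ
  · obtain ⟨τ, hτ, hb⟩ := hrel
    have hb0 := b_nonneg M i.castSucc
    have hτ0 : 0 < τ := by
      refine lt_of_le_of_ne hτ fun h => ?_
      rw [← h, k_zero] at hb
      linarith
    set β : ℝ → ℝ := fun τ => E.k τ + Y 0 - Y τ
    have hβ : Continuous β := ((continuous_k E).add continuous_const).sub hYc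
    -- The margin 3η at τ leaves 2η nearby; one η is for the bid error, the other bounds the price
    -- above the left end.
    set η := (β τ - M.b i.castSucc) / 3
    have hη : 0 < η := div_pos (sub_pos.2 hb) three_pos
    have h3 : {x | M.b i.castSucc + 2 * η < β x} ∩ Set.Ioi 0 ∈ nhds τ := by
      refine Filter.inter_mem ?_ (Ioi_mem_nhds hτ0)
      refine hβ.continuousAt.eventually_const_lt ?_
      have : β τ = M.b i.castSucc + 3 * η := by simp only [η]; ring
      rw [this]; linarith
    obtain ⟨l, v, ⟨hl, hv⟩, hsub⟩ := mem_nhds_iff_exists_Ioo_subset.1 h3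
    obtain ⟨x, hx1, hx2⟩ := exists_between hv
    set p := min (M.b i.succ) (M.b i.castSucc + η)
    have hp : M.b i.castSucc < p := lt_min (M.b_strictMono i.castSucc_lt_succ) (by linarith)
    have hpl : M.b i.castSucc < M.b (Fin.last r) :=
      M.b_strictMono (Fin.castSucc_lt_last i)
    have hpos := seedLaw_window_pos E hτ hx1 le_rfl measurableSet_Ioo (priceLaw_Ioo_pos E hb0 hp hpl)
    refine ⟨window τ x x (Set.Ioo (M.b i.castSucc) p), measurableSet_window measurableSet_Ioo,
      ENNReal.toReal_pos hpos.ne' (measure_ne_top _ _), η, hη, fun _ s hs hW π hπ => ?_⟩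
    obtain ⟨h1, h2⟩ := window_spec le_rfl hs hW
    have h4 := (hsub ⟨hl.trans hW.1.1, hW.1.2.trans hx2⟩).1
    have h4' : M.b i.castSucc + 2 * η < β (s.gap 0) := h4
    have h5 : β (s.gap 0) - η ≤ π (s.gap 0) := hπ _ (hs.gap_pos 0).le
    have h6 := hW.2.2.2
    have h7 := lt_min_iff.1 h6.2
    have h8 : s.price 0 < π (s.gap 0) := by linarith [h7.2]
    rw [hits, sum_map_qData, h1, Finset.sum_range_one, age_zero, h2]
    classical
    rw [obsHit_obsOf, if_pos h8, if_pos ⟨h6.1, h7.1.le⟩]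
  · exact ⟨Set.univ, MeasurableSet.univ, by simp, 1, one_pos, fun h => absurd h hrel⟩

/-- The optimal bids. -/
def Environment.bid : ℝ → ℝ := solver M.gamma M.mu E.k E.q

theorem exists_bell_bid : ∃ Y, Continuous Y ∧ IsBell M.gamma M.mu E.k (surplus E.q) Y ∧
    ∀ τ, 0 ≤ τ → E.bid τ = E.k τ + Y 0 - Y τ := by
  obtain ⟨Y, hY, h⟩ := exists_solver_eq M.gamma_pos M.mu_pos (isReward_k E) (isSurplus_q E)
  obtain ⟨Z, hZc, hZ, hZY⟩ := hY.exists_continuous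
  exact ⟨Z, hZc, hZ, fun τ hτ => by rw [hZY 0 le_rfl, hZY τ hτ]; exact h τ hτ⟩

/-- The cells that the optimal bids reach. -/
def Environment.Relevant (i : Fin r) : Prop := ∃ τ, 0 ≤ τ ∧ M.b i.castSucc < E.bid τ

theorem exists_hit_windows : ∃ (W : Fin r → Set Seed) (η : ℝ), 0 < η ∧
    (∀ i, MeasurableSet (W i)) ∧ (∀ i, 0 < E.seedLaw.real (W i)) ∧
    ∀ i, E.Relevant i → ∀ s : Seed, s.Good → s ∈ W i →
      ∀ π : ℝ → ℝ, (∀ τ, 0 ≤ τ → E.bid τ - η ≤ π τ) → 1 ≤ hits M i π s := by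
  obtain ⟨Y, hYc, -, hY⟩ := exists_bell_bid E
  choose W hWm hWp η hη h using exists_hit_window E hYc
  have hS : 0 ≤ ∑ i, (η i)⁻¹ := Finset.sum_nonneg fun i _ => inv_nonneg.2 (hη i).le
  -- This is a positive lower bound for all the margins that also makes sense when there are no
  -- cells.
  have hle : ∀ i, (∑ i, (η i)⁻¹ + 1)⁻¹ ≤ η i := fun i => by
    refine inv_le_of_inv_le₀ (hη i) ?_
    have := Finset.single_le_sum (f := fun i => (η i)⁻¹) (fun j _ => inv_nonneg.2 (hη j).le)
      (Finset.mem_univ i)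
    linarith
  refine ⟨W, (∑ i, (η i)⁻¹ + 1)⁻¹, by positivity, hWm, hWp, fun i hi s hs hsW π hπ => ?_⟩
  obtain ⟨τ, hτ, hb⟩ := hi
  refine h i ⟨τ, hτ, by rw [← hY τ hτ]; exact hb⟩ s hs hsW π fun τ hτ => ?_
  rw [← hY τ hτ]
  linarith [hπ τ hτ, hle i]

end window


/-! ## Runs on which the estimators concentrate -/

section final

variable {m r : ℕ} {M : Model m r} (E : Environment M) (L : Learner M)

/-- The first four constants of concentration and the frequencies are tied to no tuning parameter.
The tolerance 1/6 in `freq` is what the count of hits between two times tolerates. -/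
structure GoodRun (A₁ c₂ A₃ : ℝ) (N₂ N₄ : ℕ) (W : Fin r → Set Seed) (ω : ℕ → Seed) : Prop where
  good : ∀ j, (ω j).Good
  noise : ∀ (n : ℕ) (i : Fin (m + 1)), |∑ j ∈ Finset.range n,
    regressor M (E.pol L j ω) (ω j) i * E.regNoise (E.pol L j ω) (ω j)| ≤
      A₁ * Real.sqrt ((n + 1 : ℕ) * iterLog (n + 1))
  design : ∀ n ≥ N₂, ∀ u : EuclideanSpace ℝ (Fin (m + 1)), c₂ * n * ‖u‖ ^ 2 ≤
    ∑ j ∈ Finset.range n, E.cheap.indicator (fun s => kFun M.t u (s.gap 0) ^ 2) (ω (L.n₀ + j))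
  mle : ∀ (n : ℕ) (i : Fin r), (L.cHat (E.history L ω n).2 i - E.c i) ^ 2 *
    ∑ j ∈ Finset.range n, hits M i (E.pol L j ω) (ω j) ≤ A₃ * iterLog (n + 1)
  freq : ∀ i, ∀ n ≥ N₄, |∑ j ∈ Finset.range n, (W i).indicator (fun _ => (1:ℝ)) (ω (L.n₀ + j)) -
    n * E.seedLaw.real (W i)| ≤ E.seedLaw.real (W i) / 6 * n

/-- The order of the quantifiers matters: the constants depend on n₀ but come before the learner, so
lamK and lamQ may be chosen from them and the maximizers stay arbitrary. -/
theorem exists_goodRun (hK : 0 < M.kInf) (n₀ : ℕ) {W : Fin r → Set Seed}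
    (hWm : ∀ i, MeasurableSet (W i)) (hWp : ∀ i, 0 < E.seedLaw.real (W i)) {δ : ℝ} (hδ : 0 < δ) :
    ∃ (A₁ c₂ A₃ : ℝ) (N₂ N₄ : ℕ), 0 ≤ A₁ ∧ 0 < c₂ ∧ 0 ≤ A₃ ∧ ∀ L : Learner M, L.n₀ = n₀ →
      ∃ A : Set (ℕ → Seed), MeasurableSet A ∧ ENNReal.ofReal (1 - δ) ≤ E.runLaw A ∧
        ∀ ω ∈ A, GoodRun E L A₁ c₂ A₃ N₂ N₄ W ω := by
  have hδ4 : 0 < δ / 4 := by positivity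
  obtain ⟨A₁, hA₁, h1⟩ := exists_regNoise_bound E hδ4
  obtain ⟨c₂, hc₂, N₂, h2⟩ := exists_design_bound E hK n₀ hδ4
  obtain ⟨A₃, hA₃, h3⟩ := exists_mle_bound E hδ4
  have hr : (0:ℝ) < r + 1 := by positivity
  choose N hN using fun i => exists_average_close (P := E.seedLaw)
    (h := (W i).indicator fun _ => (1:ℝ)) (measurable_const.indicator (hWm i))
    ((integrable_const _).indicator (hWm i)) n₀
    (div_pos (hWp i) (by norm_num : (0:ℝ) < 6)) (div_pos hδ4 hr)
  refine ⟨A₁, c₂, A₃, N₂, ∑ i, N i, hA₁, hc₂, hA₃, fun L hL => ?_⟩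
  subst hL
  have hgood := ae_iff.1 (ae_run_good E)
  set B : Set (ℕ → Seed) := {ω | ¬ GoodRun E L A₁ c₂ A₃ N₂ (∑ i, N i) W ω} with hB
  have hBle : E.runLaw B ≤ ENNReal.ofReal δ := by
    set B₁ : Set (ℕ → Seed) := {ω | ¬ ∀ (n : ℕ) (i : Fin (m + 1)), |∑ j ∈ Finset.range n,
      regressor M (E.pol L j ω) (ω j) i * E.regNoise (E.pol L j ω) (ω j)| ≤
      A₁ * Real.sqrt ((n + 1 : ℕ) * iterLog (n + 1))}
    set B₂ : Set (ℕ → Seed) := {ω | ¬ ∀ n ≥ N₂, ∀ u : EuclideanSpace ℝ (Fin (m + 1)),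
      c₂ * n * ‖u‖ ^ 2 ≤ ∑ j ∈ Finset.range n,
        E.cheap.indicator (fun s => kFun M.t u (s.gap 0) ^ 2) (ω (L.n₀ + j))}
    set B₃ : Set (ℕ → Seed) := {ω | ¬ ∀ (n : ℕ) (i : Fin r),
      (L.cHat (E.history L ω n).2 i - E.c i) ^ 2 *
      ∑ j ∈ Finset.range n, hits M i (E.pol L j ω) (ω j) ≤ A₃ * iterLog (n + 1)}
    set B₄ : Fin r → Set (ℕ → Seed) := fun i => {ω | ¬ ∀ n ≥ N i,
      |∑ j ∈ Finset.range n, (W i).indicator (fun _ => (1:ℝ)) (ω (L.n₀ + j)) -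
        n * ∫ s, (W i).indicator (fun _ => (1:ℝ)) s ∂E.seedLaw| ≤ E.seedLaw.real (W i) / 6 * n}
    have hsub : B ⊆ (B₁ ∪ B₂) ∪ (B₃ ∪ ((⋃ i, B₄ i) ∪ {ω | ¬ ∀ j, (ω j).Good})) := by
      intro ω hω
      by_contra hcon
      simp only [Set.mem_union, Set.mem_iUnion, not_or, not_exists] at hcon
      obtain ⟨⟨g1, g2⟩, g3, g4, g5⟩ := hcon
      refine hω ⟨not_not.1 g5, not_not.1 g1, not_not.1 g2, not_not.1 g3, fun i n hn => ?_⟩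
      have := not_not.1 (g4 i) n
        ((Finset.single_le_sum (fun _ _ => Nat.zero_le _) (Finset.mem_univ i)).trans hn)
      rwa [integral_indicator_const _ (hWm i), smul_eq_mul, mul_one] at this
    have h4 : E.runLaw (⋃ i, B₄ i) ≤ ENNReal.ofReal (δ / 4) := by
      refine (measure_iUnion_fintype_le _ _).trans
        ((Finset.sum_le_sum fun i _ => hN i).trans ?_)
      rw [Finset.sum_const, Finset.card_univ, Fintype.card_fin, nsmul_eq_mul,
        ← ENNReal.ofReal_natCast, ← ENNReal.ofReal_mul (by positivity)]
      refine ENNReal.ofReal_le_ofReal ?_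
      rw [mul_div_assoc', div_le_iff₀ hr]
      nlinarith
    have e : ENNReal.ofReal δ = (ENNReal.ofReal (δ / 4) + ENNReal.ofReal (δ / 4)) +
        (ENNReal.ofReal (δ / 4) + (ENNReal.ofReal (δ / 4) + 0)) := by
      rw [add_zero, ← ENNReal.ofReal_add (by positivity) (by positivity),
        ← ENNReal.ofReal_add (by positivity) (by positivity)]
      congr 1; ring
    rw [e]
    refine (measure_mono hsub).trans ((measure_union_le _ _).trans (add_le_add
      ((measure_union_le _ _).trans (add_le_add (h1 _ (adaptedPolicy_pol E L)) h2))
      ((measure_union_le _ _).trans (add_le_add (h3 L) ((measure_union_le _ _).trans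
        (add_le_add h4 hgood.le))))))
  -- A measurable hull of the bad event avoids proving that event measurable.
  refine ⟨(toMeasurable E.runLaw B)ᶜ, (measurableSet_toMeasurable _ _).compl, ?_, fun ω hω => ?_⟩
  · rw [prob_compl_eq_one_sub (measurableSet_toMeasurable _ _), measure_toMeasurable,
      ENNReal.ofReal_sub _ hδ.le, ENNReal.ofReal_one]
    exact tsub_le_tsub_left hBle 1
  · by_contra h
    exact hω (subset_toMeasurable _ _ h)

variable {E L} {A₁ c₂ A₃ : ℝ} {N₂ N₄ : ℕ} {W : Fin r → Set Seed} {ω : ℕ → Seed}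

/-- The optimistic reward of the `l`-th episode (`l = 0, 1, ...`) of the algorithm. -/
def Learner.reward (E : Environment M) (L : Learner M) (ω : ℕ → Seed) (l : ℕ) : ℝ → ℝ :=
  optReward M (L.lamK * radius (l + 1)) (L.slopes (E.history L ω (L.n₀ + l)).1)

/-- The pessimistic win probability of the `l`-th episode of the algorithm. -/
def Learner.winProb (E : Environment M) (L : Learner M) (ω : ℕ → Seed) (l : ℕ) : ℝ → ℝ :=
  pesWin M (L.lamQ * radius (l + 1)) (L.cHat (E.history L ω (L.n₀ + l)).2)

theorem pol_eq_solver (l : ℕ) : E.pol L (L.n₀ + l) ω =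
    solver M.gamma M.mu (L.reward E ω l) (L.winProb E ω l) := by
  rw [pol_of_ge E L (Nat.le_add_right _ _)]
  have : L.n₀ + l + 1 - L.n₀ = l + 1 := by omega
  rw [this]
  rfl

theorem isReward_reward (l : ℕ) : IsReward (L.reward E ω l) M.kInf :=
  isReward_optReward (mul_nonneg L.lamK_pos.le (radius_nonneg _)) (kInf_nonneg E) (proj_mem _)

theorem isSurplus_winProb (l : ℕ) : IsSurplus (surplus (L.winProb E ω l)) :=
  isSurplus_pesWin (mul_nonneg L.lamQ_pos.le (radius_nonneg _)) (L.isMLE.mem _)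

/-- Constant of the regression error. -/
def Environment.slopeConst (E : Environment M) (n₀ : ℕ) (ridge A₁ c₂ : ℝ) : ℝ :=
  (m + 1) * (((m + 1) * (A₁ * (slowConst * (n₀ + 1))) +
    ridge * (∑ i, |E.a i|) / Real.sqrt (iterLog 0)) / (c₂ / 2))

/-- If all earlier policies respected the floor, the Gram matrix is at least c₂ l. Noise of order
√(l log log l), divided by l, is of the order of the radius. -/
theorem GoodRun.sum_abs_slopes_le (hG : GoodRun E L A₁ c₂ A₃ N₂ N₄ W ω) (hA₁ : 0 ≤ A₁)
    (hc₂ : 0 < c₂) {l : ℕ} (hl : N₂ < l)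
    (hpast : ∀ l' < l, ∀ τ, 0 ≤ τ → M.floor * E.k τ ≤ E.pol L (L.n₀ + l') ω τ) :
    ∑ i, |L.slopes (E.history L ω (L.n₀ + l)).1 i - E.a i| ≤
      E.slopeConst L.n₀ L.ridge A₁ c₂ * radius (l + 1) := by
  have hl1 : (1:ℝ) ≤ l := by exact_mod_cast (show 1 ≤ l by omega)
  have hκ : 0 < c₂ * (l:ℝ) := by positivity
  have hS : 0 ≤ ∑ i, |E.a i| := Finset.sum_nonneg fun _ _ => abs_nonneg _
  have h1 := sum_abs_slopes_sub_le E L (ω := ω) (n := L.n₀ + l) (κ := c₂ * l)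
    (W := A₁ * Real.sqrt ((L.n₀ + l + 1 : ℕ) * iterLog (L.n₀ + l + 1))) hκ (fun u => by
      rw [Finset.sum_range_add]
      refine (hG.design l hl.le u).trans (le_add_of_nonneg_of_le
        (Finset.sum_nonneg fun _ _ => sq_nonneg _) (Finset.sum_le_sum fun j hj => ?_))
      by_cases hc : ω (L.n₀ + j) ∈ E.cheap
      · rw [Set.indicator_of_mem hc, regressor_dotProduct_of_cheap E
          (hpast j (Finset.mem_range.1 hj)) (hG.good _) hc]
      · rw [Set.indicator_of_notMem hc]
        exact sq_nonneg _) (hG.noise _)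
  refine h1.trans ?_
  have h2 := sqrt_shift_le L.n₀ (n := l + 1) (by omega)
  rw [← add_assoc] at h2
  set x : ℝ := ((l + 1 : ℕ) : ℝ) * radius (l + 1) with hx
  have hll := iterLog_pos 0
  -- The fixed bias caused by the regularization is absorbed into the growing quantity x.
  have hx2 : 1 ≤ x / Real.sqrt (iterLog 0) := by
    rw [one_le_div (Real.sqrt_pos.2 hll)]
    refine Real.sqrt_le_iff.2 ⟨mul_nonneg (Nat.cast_nonneg _) (radius_nonneg _), ?_⟩
    have e : x ^ 2 = ((l + 1 : ℕ) : ℝ) * (radius (l + 1) ^ 2 * ((l + 1 : ℕ) : ℝ)) := by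
      rw [hx]; ring
    rw [e, radius_sq_mul (by omega)]
    have h3 : iterLog 0 ≤ iterLog (l + 1) := iterLog_mono (Nat.zero_le _)
    refine h3.trans (le_mul_of_one_le_left (iterLog_pos _).le ?_)
    push_cast; linarith
  have h3 : (m + 1) * (A₁ * Real.sqrt ((L.n₀ + l + 1 : ℕ) * iterLog (L.n₀ + l + 1))) +
      L.ridge * ∑ i, |E.a i| ≤ ((m + 1) * (A₁ * (slowConst * (L.n₀ + 1))) +
        L.ridge * (∑ i, |E.a i|) / Real.sqrt (iterLog 0)) * x := by
    have h4 := mul_le_mul_of_nonneg_left h2 hA₁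
    have h5 : L.ridge * ∑ i, |E.a i| ≤ L.ridge * (∑ i, |E.a i|) * (x / Real.sqrt (iterLog 0)) :=
      le_mul_of_one_le_right (mul_nonneg L.ridge_pos.le hS) hx2
    have h6 := mul_le_mul_of_nonneg_left h4 (by positivity : (0:ℝ) ≤ m + 1)
    calc _ ≤ _ := add_le_add h6 h5
      _ = _ := by ring
  have hs := one_le_slowConst
  set Bc := (m + 1) * (A₁ * (slowConst * (L.n₀ + 1))) +
    L.ridge * (∑ i, |E.a i|) / Real.sqrt (iterLog 0) with hBc
  have hBc0 : 0 ≤ Bc := by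
    have := L.ridge_pos
    rw [hBc]; positivity
  rw [Environment.slopeConst, mul_assoc]
  refine mul_le_mul_of_nonneg_left ?_ (by positivity)
  rw [← hBc]
  refine (div_le_div_of_nonneg_right h3 hκ.le).trans ?_
  rw [hx, div_le_iff₀ hκ]
  have hr := radius_nonneg (l + 1)
  have h7 : ((l + 1 : ℕ) : ℝ) ≤ 2 * l := by push_cast; linarith
  calc Bc * (((l + 1 : ℕ) : ℝ) * radius (l + 1)) ≤ Bc * ((2 * l) * radius (l + 1)) :=
        mul_le_mul_of_nonneg_left (mul_le_mul_of_nonneg_right h7 hr) hBc0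
    _ = _ := by field_simp

/-- The estimated rewards are optimistic and accurate. -/
theorem GoodRun.reward_close (hG : GoodRun E L A₁ c₂ A₃ N₂ N₄ W ω) (hA₁ : 0 ≤ A₁)
    (hc₂ : 0 < c₂) (h1 : M.t (Fin.last m) * E.slopeConst L.n₀ L.ridge A₁ c₂ ≤ L.lamK)
    (h2 : ∀ l ≤ N₂, M.kInf ≤ L.lamK * radius (l + 1)) (l : ℕ) :
    ∀ τ, 0 ≤ τ → E.k τ ≤ L.reward E ω l τ ∧
      |L.reward E ω l τ - E.k τ| ≤ 2 * L.lamK * radius (l + 1) := by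
  -- Optimism in earlier episodes keeps their bids above the floor, which makes the present estimate
  -- accurate, so the bonus makes it optimistic again.
  induction l using Nat.strong_induction_on with
  | _ l ih =>
  intro τ hτ
  have hk := isReward_k E
  have hk0 := hk.nonneg τ hτ
  have hk1 := hk.le τ hτ
  have hw := radius_nonneg (l + 1)
  have hlw := mul_nonneg L.lamK_pos.le hw
  rcases Nat.lt_or_ge N₂ l with hl | hl
  · have hpast : ∀ l' < l, ∀ τ, 0 ≤ τ → M.floor * E.k τ ≤ E.pol L (L.n₀ + l') ω τ := by
      intro l' hl' τ hτ
      rw [pol_eq_solver]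
      exact (mul_le_mul_of_nonneg_left (ih l' hl' τ hτ).1 floor_pos.le).trans
        (le_solver M.gamma_pos M.mu_pos (isReward_reward l') (isSurplus_winProb l') hτ)
    have h3 := hG.sum_abs_slopes_le hA₁ hc₂ hl hpast
    have h4 := abs_kFun_sub_le M.t_zero M.t_strictMono
      (proj_mem (WithLp.toLp 2 (ridgeOLS M.t L.ridge (E.history L ω (L.n₀ + l)).1))).2 E.a_last hτ
    have h5 : |kFun M.t (L.slopes (E.history L ω (L.n₀ + l)).1) τ - E.k τ| ≤
        L.lamK * radius (l + 1) := by
      refine h4.trans ((mul_le_mul_of_nonneg_left h3 (t_nonneg M _)).trans ?_)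
      rw [← mul_assoc]
      exact mul_le_mul_of_nonneg_right h1 hw
    rw [abs_le] at h5
    have h6 : E.k τ ≤ L.reward E ω l τ := le_min (by linarith [h5.1]) hk1
    refine ⟨h6, ?_⟩
    rw [abs_of_nonneg (sub_nonneg.2 h6)]
    have h7 : L.reward E ω l τ ≤ kFun M.t (L.slopes (E.history L ω (L.n₀ + l)).1) τ +
      L.lamK * radius (l + 1) := min_le_left _ _
    linarith [h5.2]
  -- Before the law of large numbers takes effect, the bonus alone reaches the cap kInf.
  · have h3 := h2 l hl
    have h5 := (isReward_kFun M.t_zero M.t_strictMono (fun i j h => (proj_mem (WithLp.toLp 2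
      (ridgeOLS M.t L.ridge (E.history L ω (L.n₀ + l)).1))).1 i j h)
      (proj_mem (WithLp.toLp 2 (ridgeOLS M.t L.ridge (E.history L ω (L.n₀ + l)).1))).2).nonneg τ hτ
    have h5' : 0 ≤ kFun M.t (L.slopes (E.history L ω (L.n₀ + l)).1) τ := h5
    have h6 : L.reward E ω l τ = M.kInf := min_eq_right (by linarith)
    rw [h6]
    refine ⟨hk1, ?_⟩
    rw [abs_of_nonneg (by linarith)]
    linarith

theorem bid_bounds {τ : ℝ} (hτ : 0 ≤ τ) : 0 ≤ E.bid τ ∧ E.bid τ ≤ E.k τ ∧ E.bid τ ≤ M.kInf :=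
  ⟨solver_nonneg M.gamma_pos M.mu_pos (isReward_k E) (isSurplus_q E) τ,
    solver_le M.gamma_pos M.mu_pos (isReward_k E) (isSurplus_q E) hτ,
    solver_le_bound M.gamma_pos M.mu_pos (isReward_k E) (isSurplus_q E) τ⟩

/-- While the estimated win probability vanishes, the algorithm bids the optimistic reward. -/
theorem bid_le_pol {l : ℕ} (h : ∀ τ, 0 ≤ τ → E.k τ ≤ L.reward E ω l τ)
    (hq : 1 ≤ L.lamQ * radius (l + 1)) {τ : ℝ} (hτ : 0 ≤ τ) :
    E.bid τ ≤ E.pol L (L.n₀ + l) ω τ := by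
  have hz : ∀ v, surplus (L.winProb E ω l) v = 0 := by
    -- Estimated win probabilities are at most 1, hence below the penalty.
    have : L.winProb E ω l = fun _ => 0 := by
      ext v
      refine max_eq_right ?_
      have := (qFun_le M.b_strictMono (L.isMLE.mem (E.history L ω (L.n₀ + l)).2).1 v).trans
        (L.isMLE.mem (E.history L ω (L.n₀ + l)).2).2
      linarith
    intro v
    rw [this, surplus_eq]
    simp
  rw [pol_eq_solver, solver_of_surplus_eq_zero M.gamma_pos M.mu_pos (isReward_reward l) hz hτ]
  exact (bid_bounds hτ).2.1.trans (h τ hτ)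

/-- Error of the bids in terms of the errors of the estimators. -/
theorem abs_bid_sub_pol_le {l : ℕ}
    (h : ∀ τ, 0 ≤ τ → |L.reward E ω l τ - E.k τ| ≤ 2 * L.lamK * radius (l + 1)) {Cq : ℝ}
    (hCq : 0 ≤ Cq) (hq : ∀ τ, 0 ≤ τ → (∑ i : Fin r, if M.b i.castSucc < E.bid τ then
      |L.cHat (E.history L ω (L.n₀ + l)).2 i - E.c i| * (M.b i.succ - M.b i.castSucc) else 0) ≤
        Cq * radius (l + 1)) (τ : ℝ) :
    |E.bid τ - E.pol L (L.n₀ + l) ω τ| ≤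
      (1 + 2 * (M.mu / M.gamma)) * (2 * L.lamK + M.kInf * (Cq + L.lamQ)) * radius (l + 1) := by
  have hw := radius_nonneg (l + 1)
  have hK := kInf_nonneg E
  have hlk := L.lamK_pos.le
  have hlq := L.lamQ_pos.le
  rw [abs_sub_comm, pol_eq_solver]
  -- The true problem is placed second, so the win probabilities are compared at optimal bids only.
  have h1 := abs_solver_sub_le M.gamma_pos M.mu_pos (isReward_reward (E := E) (L := L) (ω := ω) l)
    (isSurplus_winProb (E := E) (L := L) (ω := ω) l) (isReward_k E) (isSurplus_q E)
    (ε := 2 * L.lamK * radius (l + 1)) (ε' := M.kInf * ((Cq + L.lamQ) * radius (l + 1)))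
    (by positivity) (by positivity) h (fun t ht => ?_) τ
  · refine h1.trans (le_of_eq ?_)
    ring
  · obtain ⟨b1, -, b3⟩ := bid_bounds (E := E) ht
    change |surplus (L.winProb E ω l) (E.bid t) - surplus E.q (E.bid t)| ≤ _
    refine (abs_surplus_sub_le continuous_pesWin continuous_qFun b1 fun v _ hv => ?_).trans
      (mul_le_mul_of_nonneg_right b3 (by positivity))
    have h2 := (abs_qFun_sub_le M.b_strictMono hv
      (c := L.cHat (E.history L ω (L.n₀ + l)).2) (c' := E.c)).trans (hq t ht)
    have h3 : 0 ≤ qFun M.b E.c v := q_nonneg E v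
    have h4 : 0 ≤ L.lamQ * radius (l + 1) := by positivity
    change |L.winProb E ω l v - qFun M.b E.c v| ≤ _
    rw [abs_le] at h2 ⊢
    rw [add_mul]
    have h5 : qFun M.b (L.cHat (E.history L ω (L.n₀ + l)).2) v - L.lamQ * radius (l + 1) ≤
      L.winProb E ω l v := le_max_left _ _
    constructor
    · linarith [h2.1]
    · have : L.winProb E ω l v ≤ qFun M.b E.c v + Cq * radius (l + 1) :=
        max_le (by linarith [h2.2]) (by positivity)
      linarith

end final


/-! ## Accuracy of the bids on good runs -/

section accuracy

variable {m r : ℕ} {M : Model m r} {E : Environment M} {L : Learner M}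
  {A₁ c₂ A₃ : ℝ} {N₂ N₄ : ℕ} {W : Fin r → Set Seed} {ω : ℕ → Seed}

/-- The number of informative auctions grows linearly. -/
theorem GoodRun.le_sum_hits (hG : GoodRun E L A₁ c₂ A₃ N₂ N₄ W ω) {i : Fin r} {η : ℝ}
    (hhit : ∀ s : Seed, s.Good → s ∈ W i → ∀ π : ℝ → ℝ,
      (∀ τ, 0 ≤ τ → E.bid τ - η ≤ π τ) → 1 ≤ hits M i π s)
    {n₂ K l : ℕ} (hn₂ : 0 < n₂) (hN : N₄ ≤ n₂) (hK : 1 ≤ K) (hl : n₂ ≤ l)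
    (hearly : ∀ j < n₂, ∀ τ, 0 ≤ τ → E.bid τ - η ≤ E.pol L (L.n₀ + j) ω τ)
    (hlate : ∀ j < l, K * n₂ ≤ j → ∀ τ, 0 ≤ τ → E.bid τ - η ≤ E.pol L (L.n₀ + j) ω τ) :
    E.seedLaw.real (W i) * (l + 1) / (8 * K) ≤
      ∑ j ∈ Finset.range (L.n₀ + l), hits M i (E.pol L j ω) (ω j) := by
  set p := E.seedLaw.real (W i) with hp
  have hp0 : 0 ≤ p := measureReal_nonneg
  set x : ℕ → ℝ := fun j => (W i).indicator (fun _ => (1:ℝ)) (ω (L.n₀ + j))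
  have hkey : ∀ S ⊆ Finset.range l,
      (∀ j ∈ S, ∀ τ, 0 ≤ τ → E.bid τ - η ≤ E.pol L (L.n₀ + j) ω τ) →
      ∑ j ∈ S, x j ≤ ∑ j ∈ Finset.range (L.n₀ + l), hits M i (E.pol L j ω) (ω j) := by
    intro S hS h
    rw [Finset.sum_range_add]
    refine le_add_of_nonneg_of_le (Finset.sum_nonneg fun _ _ => hits_nonneg _ _ _) ?_
    refine le_trans (Finset.sum_le_sum fun j hj => ?_)
      (Finset.sum_le_sum_of_subset_of_nonneg hS fun _ _ _ => hits_nonneg _ _ _)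
    by_cases hc : ω (L.n₀ + j) ∈ W i
    · simp only [x, Set.indicator_of_mem hc]
      exact hhit _ (hG.good _) hc _ (h j hj)
    · simp only [x, Set.indicator_of_notMem hc]
      exact hits_nonneg _ _ _
  have hfreq : ∀ n ≥ n₂, 5 / 6 * p * n ≤ ∑ j ∈ Finset.range n, x j ∧
      ∑ j ∈ Finset.range n, x j ≤ 7 / 6 * p * n := by
    intro n hn
    have := abs_le.1 (hG.freq i n (hN.trans hn))
    constructor <;> linarith [this.1, this.2]
  have hK1 : (1:ℝ) ≤ K := by exact_mod_cast hK
  have hn1 : (1:ℝ) ≤ n₂ := by exact_mod_cast hn₂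
  have hln : (n₂:ℝ) ≤ l := by exact_mod_cast hl
  have hK0 : (0:ℝ) < 8 * K := by positivity
  -- Up to 2 K n₂ the first n₂ episodes are a sufficient fraction of l. Later the episodes from K n₂
  -- to l suffice: they contain at least (5/6 - 7/12) p l = p l / 4 windows.
  rcases le_or_gt l (2 * (K * n₂)) with h | h
  · refine le_trans ?_ (hkey (Finset.range n₂) (Finset.range_subset_range.2 hl)
      fun j hj => hearly j (Finset.mem_range.1 hj))
    refine le_trans ?_ (hfreq n₂ le_rfl).1
    have h' : (l:ℝ) ≤ 2 * (K * n₂) := by exact_mod_cast h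
    rw [div_le_iff₀ hK0]
    have h1 : (1:ℝ) ≤ K * n₂ := one_le_mul_of_one_le_of_one_le hK1 hn1
    calc p * (l + 1) ≤ p * (20 / 3 * (K * n₂)) := mul_le_mul_of_nonneg_left (by linarith) hp0
      _ = _ := by ring
  · have hKn : n₂ ≤ K * n₂ := Nat.le_mul_of_pos_left _ hK
    have hKl : K * n₂ ≤ l := by omega
    refine le_trans ?_ (hkey (Finset.Ico (K * n₂) l) (fun j hj => Finset.mem_range.2
      (Finset.mem_Ico.1 hj).2) fun j hj =>
      hlate j (Finset.mem_Ico.1 hj).2 (Finset.mem_Ico.1 hj).1)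
    rw [Finset.sum_Ico_eq_sub _ hKl]
    have h1 := (hfreq l hl).1
    have h2 := (hfreq (K * n₂) hKn).2
    have h' : 2 * ((K * n₂ : ℕ) : ℝ) ≤ l := by exact_mod_cast h.le
    have h3 : p * (2 * ((K * n₂ : ℕ) : ℝ)) ≤ p * l := mul_le_mul_of_nonneg_left h' hp0
    have h4 : p * (l + 1) / (8 * K) ≤ p * (2 * l) / 8 := by
      refine div_le_div₀ (by positivity) (mul_le_mul_of_nonneg_left ?_ hp0) (by norm_num) ?_ <;>
        linarith
    linarith

/-- Accuracy of the maximum likelihood estimator once the informative auctions are frequent. -/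
theorem GoodRun.abs_cHat_sub_le (hG : GoodRun E L A₁ c₂ A₃ N₂ N₄ W ω) (hA₃ : 0 ≤ A₃) {i : Fin r}
    {κ : ℝ} (hκ : 0 < κ) {l : ℕ}
    (h : κ * (l + 1) ≤ ∑ j ∈ Finset.range (L.n₀ + l), hits M i (E.pol L j ω) (ω j)) :
    |L.cHat (E.history L ω (L.n₀ + l)).2 i - E.c i| ≤
      Real.sqrt (A₃ * (slowConst * (L.n₀ + 1)) / κ) * radius (l + 1) := by
  have hs := one_le_slowConst
  have h1 := hG.mle (L.n₀ + l) i
  have h2 := iterLog_shift_le L.n₀ (n := l + 1) (by omega)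
  rw [← add_assoc] at h2
  have hl : (0:ℝ) < l + 1 := by positivity
  have h3 := mul_le_mul_of_nonneg_left h
    (sq_nonneg (L.cHat (E.history L ω (L.n₀ + l)).2 i - E.c i))
  have h4 := h3.trans (h1.trans (mul_le_mul_of_nonneg_left h2 hA₃))
  have h5 := radius_sq_mul (n := l + 1) (by omega)
  push_cast at h5
  rw [← h5] at h4
  refine (Real.abs_le_sqrt (y := A₃ * (slowConst * (L.n₀ + 1)) / κ * radius (l + 1) ^ 2)
    ?_).trans (le_of_eq ?_)
  · rw [div_mul_eq_mul_div, le_div_iff₀ hκ]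
    refine le_of_mul_le_mul_right ?_ hl
    calc _ = (L.cHat (E.history L ω (L.n₀ + l)).2 i - E.c i) ^ 2 * (κ * (l + 1)) := by ring
      _ ≤ _ := h4
      _ = _ := by ring
  · rw [Real.sqrt_mul (by positivity), Real.sqrt_sq (radius_nonneg _)]

/-- Constant of the bidding error. -/
def bidConst (M : Model m r) (lamQ : ℝ) : ℝ :=
  (1 + 2 * (M.mu / M.gamma)) * ((2 + 2 * M.kInf) * lamQ)

/-- Strong induction in three phases. Up to n₂ the claim is trivial and the bids are high, hence
informative. Between n₂ and K n₂ the policies need not be informative, but the early hits suffice,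
at the price of the factor K. Beyond K n₂ the claim for earlier episodes puts their bids within η of
the optimal ones. -/
theorem GoodRun.abs_bid_sub_pol_le (hG : GoodRun E L A₁ c₂ A₃ N₂ N₄ W ω) (hA₃ : 0 ≤ A₃)
    (hWp : ∀ i, 0 < E.seedLaw.real (W i)) {η : ℝ} (hη : 0 < η)
    (hhit : ∀ i, E.Relevant i → ∀ s : Seed, s.Good → s ∈ W i → ∀ π : ℝ → ℝ,
      (∀ τ, 0 ≤ τ → E.bid τ - η ≤ π τ) → 1 ≤ hits M i π s)
    (hR : ∀ l τ, 0 ≤ τ → E.k τ ≤ L.reward E ω l τ ∧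
      |L.reward E ω l τ - E.k τ| ≤ 2 * L.lamK * radius (l + 1))
    {n₂ K : ℕ} (hn₂ : 0 < n₂) (hN : N₄ ≤ n₂) (hK : 1 ≤ K)
    (hlow : ∀ n, 0 < n → n ≤ n₂ → 1 ≤ L.lamQ * radius n) (hlam : L.lamK ≤ L.lamQ)
    (hCq : ∑ i, Real.sqrt (A₃ * (slowConst * (L.n₀ + 1)) / (E.seedLaw.real (W i) / (8 * K))) *
      (M.b i.succ - M.b i.castSucc) ≤ L.lamQ)
    (hhigh : ∀ n, K * n₂ ≤ n → bidConst M L.lamQ * radius n ≤ η) (l : ℕ) :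
    ∀ τ, 0 ≤ τ → |E.bid τ - E.pol L (L.n₀ + l) ω τ| ≤ bidConst M L.lamQ * radius (l + 1) := by
  have hk := kInf_nonneg E
  have hlq := L.lamQ_pos
  have hρ : 0 ≤ M.mu / M.gamma := (div_pos M.mu_pos M.gamma_pos).le
  induction l using Nat.strong_induction_on with
  | _ l ih =>
  have hw := radius_nonneg (l + 1)
  -- In the early phase lamQ * radius ≥ 1, so the bound exceeds kInf, the range of both bids.
  rcases Nat.lt_or_ge l n₂ with hl | hl
  · intro τ hτ
    have h1 := hlow (l + 1) (by omega) hl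
    obtain ⟨b1, -, b3⟩ := bid_bounds (E := E) hτ
    have p1 : 0 ≤ E.pol L (L.n₀ + l) ω τ := ((adaptedPolicy_pol E L).mem _ ω τ).1
    have p2 : E.pol L (L.n₀ + l) ω τ ≤ M.kInf := by
      rw [pol_eq_solver]
      exact solver_le_bound M.gamma_pos M.mu_pos (isReward_reward l) (isSurplus_winProb l) τ
    have h2 : |E.bid τ - E.pol L (L.n₀ + l) ω τ| ≤ M.kInf := by
      rw [abs_le]; constructor <;> linarith
    refine h2.trans ?_
    rw [bidConst]
    have h3 : M.kInf * 1 ≤ M.kInf * (L.lamQ * radius (l + 1)) := mul_le_mul_of_nonneg_left h1 hk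
    have h4 : 0 ≤ L.lamQ * radius (l + 1) := by positivity
    calc M.kInf ≤ 1 * ((2 + 2 * M.kInf) * (L.lamQ * radius (l + 1))) := by nlinarith
      _ ≤ (1 + 2 * (M.mu / M.gamma)) * ((2 + 2 * M.kInf) * (L.lamQ * radius (l + 1))) :=
          mul_le_mul_of_nonneg_right (by linarith) (by positivity)
      _ = _ := by ring
  · intro τ _
    have hK0 : (0:ℝ) < K := by exact_mod_cast hK
    set Cq := ∑ i, Real.sqrt (A₃ * (slowConst * (L.n₀ + 1)) /
      (E.seedLaw.real (W i) / (8 * K))) * (M.b i.succ - M.b i.castSucc)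
    have hCq0 : 0 ≤ Cq := Finset.sum_nonneg fun i _ =>
      mul_nonneg (Real.sqrt_nonneg _) (cell_pos M i).le
    refine (DynBid.abs_bid_sub_pol_le (fun τ hτ => (hR l τ hτ).2) hCq0 (fun σ hσ => ?_) τ).trans ?_
    · rw [Finset.sum_mul]
      refine Finset.sum_le_sum fun i _ => ?_
      have hc := (cell_pos M i).le
      split_ifs with hb
      · have h1 := hG.le_sum_hits (hhit i ⟨σ, hσ, hb⟩) hn₂ hN hK hl
          (fun j hj τ hτ => by
            have := bid_le_pol (fun τ hτ => (hR j τ hτ).1) (hlow (j + 1) (by omega) hj) hτ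
            linarith)
          -- The induction hypothesis enters here: a past bid after K n₂ falls short of the optimal
          -- one by at most η.
          (fun j hj hKj τ hτ => by
            have := (abs_le.1 ((ih j hj τ hτ).trans (hhigh (j + 1) (by omega)))).2
            linarith)
        rw [mul_div_right_comm] at h1
        have h2 := hG.abs_cHat_sub_le hA₃ (div_pos (hWp i) (by positivity)) h1
        rw [mul_right_comm]
        exact mul_le_mul_of_nonneg_right h2 hc
      · exact mul_nonneg (mul_nonneg (Real.sqrt_nonneg _) hc) hw
    · refine mul_le_mul_of_nonneg_right ?_ hw
      -- Since lamQ dominates lamK and Cq, the three error sources merge into (2 + 2 kInf) lamQ.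
      rw [bidConst]
      refine mul_le_mul_of_nonneg_left ?_ (by positivity)
      nlinarith

/-- The regret of the algorithm when its bids are accurate. -/
theorem regret_le_of_close {D : ℝ} (h : ∀ l τ, 0 ≤ τ →
    |E.bid τ - E.pol L (L.n₀ + l) ω τ| ≤ D * radius (l + 1)) {N : ℕ} (hN : 3 ≤ N) :
    E.regret L.n₀ L.π₀ L.ridge L.cHat L.lamK L.lamQ ω N ≤
      2 * (M.mu / M.gamma * (∑ i, E.c i) * D ^ 2) * Real.log N * Real.log (Real.log N) ^ 1 := by
  obtain ⟨Y, -, hY, hYb⟩ := exists_bell_bid E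
  have hc : 0 ≤ ∑ i, E.c i := Finset.sum_nonneg fun i _ => (E.c_pos i).le
  have hρ : 0 ≤ M.mu / M.gamma := (div_pos M.mu_pos M.gamma_pos).le
  have h1 : E.regret L.n₀ L.π₀ L.ridge L.cHat L.lamK L.lamQ ω N ≤
      ∑ n ∈ Finset.Icc 1 N, M.mu / M.gamma * (∑ i, E.c i) * D ^ 2 * radius n ^ 2 := by
    refine Finset.sum_le_sum fun n hn => ?_
    obtain ⟨l, rfl⟩ : ∃ l, n = l + 1 := ⟨n - 1, by have := (Finset.mem_Icc.1 hn).1; omega⟩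
    have e : ucbPolicy M L.ridge L.cHat L.lamK L.lamQ (l + 1)
        (E.data L.n₀ L.π₀ L.ridge L.cHat L.lamK L.lamQ ω (L.n₀ + (l + 1) - 1)) =
        E.pol L (L.n₀ + l) ω := by
      rw [pol_of_ge E L (Nat.le_add_right _ _), show L.n₀ + l + 1 - L.n₀ = l + 1 by omega,
        show L.n₀ + (l + 1) - 1 = L.n₀ + l by omega]
      rfl
    rw [e]
    have hP := adaptedPolicy_pol E L
    have hm : Measurable (E.pol L (L.n₀ + l) ω) := (hP.measurable (L.n₀ + l)).of_uncurry_left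
    refine (optimalValue_sub_value_le E hY (π := E.pol L (L.n₀ + l) ω)
      (d := D * radius (l + 1)) hm (fun τ => hP.mem _ ω τ) fun τ hτ => ?_).trans (le_of_eq ?_)
    · rw [← hYb τ hτ]; exact h l τ hτ
    · ring
  refine h1.trans ?_
  rw [← Finset.mul_sum]
  refine (mul_le_mul_of_nonneg_left (sum_radius_sq_le hN) (by positivity)).trans (le_of_eq ?_)
  ring

end accuracy

/-! ## Choice of the constants -/

/-- Parameters for which the radii are large up to a time `n₂` and small after `K n₂`. -/
theorem exists_scale {x η : ℝ} (hη : 0 < η) (N : ℕ) (hx : 0 ≤ x) :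
    ∃ K : ℕ, 1 ≤ K ∧ ∀ B : ℝ, ∃ (n₂ : ℕ) (lamQ : ℝ), 0 < n₂ ∧ N ≤ n₂ ∧ 0 < lamQ ∧ B ≤ lamQ ∧
      (∀ n, 0 < n → n ≤ n₂ → 1 ≤ lamQ * radius n) ∧
      ∀ n, K * n₂ ≤ n → x * lamQ * radius n ≤ η := by
  have hs := one_le_slowConst
  -- The fourth power inverts the decay of the radius with exponent 1/4. K does not see B, because B
  -- will depend on K.
  obtain ⟨K, hK⟩ := exists_nat_ge ((x * slowConst / η) ^ 4)
  refine ⟨K + 1, by omega, fun B => ?_⟩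
  obtain ⟨n₂, hN, hn₂, hr⟩ := exists_radius_le N (ε := (|B| + 1)⁻¹) (by positivity)
  have hr0 := radius_pos hn₂
  have hss : 1 ≤ Real.sqrt slowConst := Real.one_le_sqrt.2 hs
  -- The factor √slowConst makes up for the radius being only almost decreasing; lamQ is made large
  -- by taking n₂ large.
  refine ⟨n₂, Real.sqrt slowConst / radius n₂, hn₂, hN, by positivity, ?_, fun n hn hle => ?_,
    fun n hn => ?_⟩
  · rw [le_div_iff₀ hr0]
    have h1 : (|B| + 1) * radius n₂ ≤ 1 := by
      calc _ ≤ (|B| + 1) * (|B| + 1)⁻¹ := mul_le_mul_of_nonneg_left hr (by positivity)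
        _ = 1 := mul_inv_cancel₀ (by positivity)
    nlinarith [le_abs_self B]
  · rw [div_mul_eq_mul_div, one_le_div hr0]
    exact radius_le_of_le hn hle
  · have hKn : n₂ ≤ (K + 1) * n₂ := Nat.le_mul_of_pos_left _ (by omega)
    have h1 := radius_le hn₂ (hKn.trans hn)
    have hn0 : (0:ℝ) < n := by exact_mod_cast hn₂.trans_le (hKn.trans hn)
    have hn2 : (0:ℝ) < n₂ := by exact_mod_cast hn₂
    set y := x * (Real.sqrt slowConst / radius n₂) * radius n
    refine abs_le_of_sq_le_sq' (a := y) ?_ hη.le |>.2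
    set z := x * slowConst / η with hz
    have hz0 : 0 ≤ z := by positivity
    have h2 : Real.sqrt (n₂ / n) * z ^ 2 ≤ 1 := by
      have h3 : z ^ 2 ≤ Real.sqrt (n / n₂) := by
        refine Real.le_sqrt_of_sq_le ?_
        rw [← pow_mul, le_div_iff₀ hn2, show 2 * 2 = 4 from rfl]
        have : ((K + 1 : ℕ) : ℝ) * n₂ ≤ n := by exact_mod_cast hn
        push_cast at this
        refine le_trans (mul_le_mul_of_nonneg_right ?_ hn2.le) this
        linarith
      calc _ ≤ Real.sqrt (n₂ / n) * Real.sqrt (n / n₂) :=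
            mul_le_mul_of_nonneg_left h3 (Real.sqrt_nonneg _)
        _ = 1 := by
            rw [← Real.sqrt_mul (by positivity), div_mul_div_cancel₀ hn0.ne', div_self hn2.ne',
              Real.sqrt_one]
    calc y ^ 2 = x ^ 2 * (Real.sqrt slowConst ^ 2 / radius n₂ ^ 2) * radius n ^ 2 := by
          simp only [y]; ring
      _ ≤ x ^ 2 * (slowConst / radius n₂ ^ 2) *
          (slowConst * radius n₂ ^ 2 * Real.sqrt (n₂ / n)) := by
          rw [Real.sq_sqrt (by linarith)]
          exact mul_le_mul_of_nonneg_left h1 (by positivity)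
      _ = η ^ 2 * (Real.sqrt (n₂ / n) * z ^ 2) := by
          rw [hz]; field_simp
      _ ≤ η ^ 2 := mul_le_of_le_one_right (sq_nonneg _) h2

theorem exists_lamK {m r : ℕ} {M : Model m r} (hk : 0 ≤ M.kInf) (x : ℝ) (N : ℕ) :
    ∃ lamK : ℝ, 0 < lamK ∧ x ≤ lamK ∧ ∀ l ≤ N, M.kInf ≤ lamK * radius (l + 1) := by
  have hS : ∀ l ∈ Finset.range (N + 1), 0 ≤ M.kInf / radius (l + 1) := fun l _ =>
    div_nonneg hk (radius_nonneg _)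
  have h0 := Finset.sum_nonneg hS
  refine ⟨|x| + ∑ l ∈ Finset.range (N + 1), M.kInf / radius (l + 1) + 1, by positivity,
    by linarith [le_abs_self x], fun l hl => ?_⟩
  rw [← div_le_iff₀ (radius_pos (by omega))]
  have := Finset.single_le_sum hS (Finset.mem_range.2 (Nat.lt_succ_of_le hl))
  linarith [abs_nonneg x]

end
end DynBid

theorem mainTheorem1 {m r : ℕ} (M : DynBid.Model m r) (E : DynBid.Environment M)
    (n₀ : ℕ) (π₀ : ℝ → ℝ) (hπ₀ : Measurable π₀)
    (hπ₀_mem : ∀ τ, π₀ τ ∈ Set.Icc 0 (M.b (Fin.last r)))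
    (ridge : ℝ) (hridge : 0 < ridge) (δ : ℝ) (hδ : δ ∈ Set.Ioo (0 : ℝ) 1) :
    ∃ lamK : ℝ, 0 < lamK ∧ ∃ lamQ : ℝ, 0 < lamQ ∧ ∃ (C : ℝ) (p : ℕ),
      ∀ cHat : List DynBid.QObs → Fin r → ℝ, DynBid.IsMLE M.b cHat →
        ∃ A : Set (ℕ → DynBid.Seed), MeasurableSet A ∧
          ENNReal.ofReal (1 - δ) ≤ E.runLaw A ∧
          ∀ ω ∈ A, ∀ N : ℕ, 3 ≤ N →
            E.regret n₀ π₀ ridge cHat lamK lamQ ω N ≤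
              C * Real.log N * Real.log (Real.log N) ^ p := by
  open DynBid in
  -- If kInf = 0 all bids vanish, the optimal ones included, and the regret bound holds with D = 0
  -- on every run.
  rcases (kInf_nonneg E).eq_or_lt with hK0 | hK0
  · refine ⟨1, one_pos, 1, one_pos, 2 * (M.mu / M.gamma * (∑ i, E.c i) * 0 ^ 2), 1,
      fun cHat hc => ⟨Set.univ, MeasurableSet.univ, ?_,
      fun ω _ N hN => ?_⟩⟩
    · rw [measure_univ, ← ENNReal.ofReal_one]
      exact ENNReal.ofReal_le_ofReal (by linarith [hδ.1])
    · let L : Learner M := ⟨n₀, π₀, hπ₀, hπ₀_mem, ridge, hridge, cHat, hc, 1, one_pos, 1, one_pos⟩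
      refine regret_le_of_close (L := L) (D := 0) (fun l τ hτ => ?_) hN
      obtain ⟨b1, -, b3⟩ := bid_bounds (E := E) hτ
      have p1 : 0 ≤ E.pol L (L.n₀ + l) ω τ := ((adaptedPolicy_pol E L).mem _ ω τ).1
      have p2 : E.pol L (L.n₀ + l) ω τ ≤ M.kInf := by
        rw [pol_eq_solver]
        exact solver_le_bound M.gamma_pos M.mu_pos (isReward_reward l) (isSurplus_winProb l) τ
      rw [abs_le]
      constructor <;> linarith
  · obtain ⟨W, η, hη, hWm, hWp, hhit⟩ := exists_hit_windows E
    obtain ⟨A₁, c₂, A₃, N₂, N₄, hA₁, hc₂, hA₃, hgood⟩ := exists_goodRun E hK0 n₀ hWm hWp hδ.1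
    obtain ⟨lamK, hlamK, hlamK1, hlamK2⟩ := exists_lamK hK0.le
      (M.t (Fin.last m) * E.slopeConst n₀ ridge A₁ c₂) N₂
    have hρ : 0 ≤ M.mu / M.gamma := (div_pos M.mu_pos M.gamma_pos).le
    -- K comes before Cq, which contains it, and n₂ and lamQ come last, so that lamQ dominates lamK
    -- and Cq.
    obtain ⟨K, hK, hscale⟩ := exists_scale
      (x := (1 + 2 * (M.mu / M.gamma)) * (2 + 2 * M.kInf)) hη N₄ (by positivity)
    set Cq := ∑ i, Real.sqrt (A₃ * (slowConst * (n₀ + 1)) / (E.seedLaw.real (W i) / (8 * K))) *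
      (M.b i.succ - M.b i.castSucc)
    obtain ⟨n₂, lamQ, hn₂, hN, hlamQ, hB, hlow, hhigh⟩ := hscale (max lamK Cq)
    refine ⟨lamK, hlamK, lamQ, hlamQ,
      2 * (M.mu / M.gamma * (∑ i, E.c i) * bidConst M lamQ ^ 2), 1, fun cHat hc => ?_⟩
    let L : Learner M :=
      ⟨n₀, π₀, hπ₀, hπ₀_mem, ridge, hridge, cHat, hc, lamK, hlamK, lamQ, hlamQ⟩
    obtain ⟨A, hAm, hA, hG⟩ := hgood L rfl
    refine ⟨A, hAm, hA, fun ω hω N hN3 => ?_⟩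
    have hGω := hG ω hω
    refine regret_le_of_close (L := L) (D := bidConst M lamQ) (fun l τ hτ => ?_) hN3
    refine hGω.abs_bid_sub_pol_le hA₃ hWp hη hhit
      (hGω.reward_close hA₁ hc₂ hlamK1 hlamK2) hn₂ hN hK hlow ((le_max_left _ _).trans hB)
      ((le_max_right _ _).trans hB) (fun n hn => ?_) l τ hτ
    rw [bidConst, ← mul_assoc]
    exact hhigh n hn
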